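/- **Labels.** For $t\ge 0$ let $Z_t=\{1,\dots,t,\bar t,\dots,\bar 1\}$, let $z\mapsto\bar z$ be the obvious involution of $Z_t$ and $T=(1\,\bar 1)\cdots(t\,\bar t)$. Permutations are composed from right to left. For a permutation $\varpi$ of $Z_t$ the *target permutation* is $\tau=\varpi^{-1}T^{-1}\varpi T$. **Class coefficients.** For $N\ge 1$ let $W=UU^{\mathrm T}$ with $U\in U(N)$ Haar distributed (the Circular Orthogonal Ensemble). The COE class coefficients $V^{\mathrm O}_N:S_{2t}\to\mathbb C$ are the coefficients in $$\langle W_{a_1a_{\bar 1}}\cdots W_{a_ta_{\bar t}}\,W^*_{b_1b_{\bar 1}}\cdots W^*_{b_tb_{\bar t}}\rangle=\sum_{\pi\in S_{2t}}V^{\mathrm O}_N(\pi)\prod_{z\in Z_t}\delta(a_z-b_{\pi(z)})\qquad\text{for all } a,b:Z_t\to\{1,\dots,N\}.$$ **Diagrams.** A *locally orientable map* is a finite ribbon graph (possibly disconnected) whose ribbons may be twisted. An *orthogonal diagram* with target permutation $\tau$ is a locally orientable map together with a marking of its boundary such that: (i) it has exactly $2t$ vertices of degree 1 (leaves), labelled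 bijectively by $Z_t$; (ii) all other vertices (the internal ones) have even degree greater than 2; (iii) the whole boundary is made up of segments running from one leaf to the next, each marked solid or dashed; each leaf is incident to one solid and one dashed segment; the solid segments run between the leaves $z$ and $\bar z$, the dashed ones between $\tau(z)$ and $\bar z$ ($z\in Z_t$); each edge is marked solid on one side and dashed on the other. Diagrams are counted up to isomorphisms that respect labels and marking. Let $D^{\mathrm O}_{v,e}(\tau)$ be the number of those with $v$ internal vertices and $e$ edges. **Theorem.** Let $\tau=\varpi^{-1}T^{-1}\varpi T$. 1. Every diagram with target permutation $\tau$ satisfies $e\ge t+2v$, and for every $m$ there are finitely many with $e-v=m$. Let $$\Delta^{\mathrm O}(\tau)=\sum_{v,e}D^{\mathrm O}_{v,e}(\tau)\frac{(-1)^v}{N^{e-v}},$$ where the terms are grouped by the power of $1/N$, both as a formal power series in $1/N$ and as a numerical series. For every integer $N\ge 2t$ the coefficients $V^{\mathrm O}_N$ exist and are unique, the series converges, and $$\Delta^{\mathrm O}(\tau)=V^{\mathrm O}_N(\varpi).$$ 2. Order $Z_t$ by $1<\bar 1<2<\bar 2<\cdots<t<\bar t$. A *palindromic primitive factorization* of $\tau$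 with $v$ pairs of factors is a factorization $$\tau=(s_1\,r_1)\cdots(s_v\,r_v)\,(\bar s_v\,\bar r_v)\cdots(\bar s_1\,\bar r_1),\qquad s_j\in\{1,\dots,t\},\quad r_j\in Z_t,\quad s_j<r_j,\quad s_1\le s_2\le\cdots\le s_v.$$ There is an involution $P$ on the set of (isomorphism classes of) diagrams with target permutation $\tau$ that changes both $v$ and $e$ by the same amount $+1$ or $-1$ on each diagram which it does not fix, and the diagrams fixed by $P$ are in bijection with the palindromic primitive factorizations of $\tau$, where a factorization with $v$ pairs of factors corresponds to a diagram with $v$ internal vertices and $e=t+2v$ edges. Consequently, with $p^{\mathrm O}_v(\tau)$ the number of palindromic primitive factorizations with $v$ pairs, $\Delta^{\mathrm O}(\tau)=\sum_{v\ge 0}(-1)^v p^{\mathrm O}_v(\tau)N^{-t-v}$ as formal power series in $1/N$. 3. The multiset of cycle lengths of $\tau$ (fixed points included) contains each length an even number of times; let $c_1,\dots,c_k$ be the lengths with halved multiplicities. Then $p^{\mathrm O}_v(\tau)$ and $\Delta^{\mathrm O}(\tau)$ depend only on the multiset $\{c_1,\dots,c_k\}$ (and $v$), and as functions of finite multisets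 of positive integers they satisfy $p^{\mathrm O}_0(\emptyset)=1$, $p^{\mathrm O}_v(\emptyset)=0$ for $v\ge1$, $\Delta^{\mathrm O}(\emptyset)=1$, and, for $k\ge 1$ (with $p^{\mathrm O}_{-1}=0$; $q,r\ge 1$; $\hat c_j$ means that $c_j$ is removed), $$p^{\mathrm O}_v(c_1,\dots,c_k)=\delta_{c_1,1}\,p^{\mathrm O}_v(c_2,\dots,c_k)+\sum_{q+r=c_1}p^{\mathrm O}_{v-1}(q,r,c_2,\dots,c_k)+2\sum_{j=2}^k c_j\,p^{\mathrm O}_{v-1}(c_1+c_j,\dots,\hat c_j,\dots,c_k)+c_1\,p^{\mathrm O}_{v-1}(c_1,\dots,c_k),$$ and, equivalently, as formal series in $1/N$, the Brouwer–Beenakker recursion $$(N+c_1)\Delta^{\mathrm O}(c_1,\dots,c_k)+\sum_{q+r=c_1}\Delta^{\mathrm O}(q,r,c_2,\dots,c_k)+2\sum_{j=2}^k c_j\,\Delta^{\mathrm O}(c_1+c_j,\dots,\hat c_j,\dots,c_k)=\delta_{c_1,1}\,\Delta^{\mathrm O}(c_2,\dots,c_k).$$ -/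

import Mathlib

open MeasureTheory

/-! ### Labels of trajectory ends and target permutations -/

/-- The label set `Z_t = {1, …, t, t̄, …, 1̄}`: the label `j` is `(j, false)`, the label `j̄` is
`(j, true)`. -/
abbrev EndLabel (t : ℕ) : Type := Fin t × Bool

/-- The involution `T = (1 1̄) ⋯ (t t̄)` of `Z_t`. -/
def barPerm (t : ℕ) : Equiv.Perm (EndLabel t) :=
  Equiv.prodCongr (Equiv.refl (Fin t)) Equiv.boolNot

/-- The orthogonal target permutation `τ = ϖ⁻¹ T⁻¹ ϖ T`. -/
def orthTarget {t : ℕ} (w : Equiv.Perm (EndLabel t)) : Equiv.Perm (EndLabel t) :=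
  w⁻¹ * (barPerm t)⁻¹ * w * barPerm t

/-! ### Locally orientable maps -/

/-- A (finite, not necessarily connected, locally orientable) map, that is a ribbon graph whose
ribbons may be twisted, without isolated vertices. It is given by its flags: a flag is an end of an
edge together with one of the two sides of the edge there.
* `across f` is the flag at the same end of the same edge, on the other side of the edge;
* `along f` is the flag reached by following that side of the edge to its other end;
* `corner f` is the flag reached by following the boundary around the vertex to the next edge end.
-/
structure RibbonGraph where
  Flag : Type
  finite_flag : Finite Flag
  across : Flag → Flag
  along : Flag → Flag
  corner : Flag → Flag
  across_across : ∀ f, across (across f) = f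
  along_along : ∀ f, along (along f) = f
  corner_corner : ∀ f, corner (corner f) = f
  across_ne : ∀ f, across f ≠ f
  along_ne : ∀ f, along f ≠ f
  corner_ne : ∀ f, corner f ≠ f
  across_along : ∀ f, across (along f) = along (across f)
  across_along_ne : ∀ f, across (along f) ≠ f

namespace RibbonGraph

/-- The vertices are the orbits of `across` and `corner`. -/
def Vertex (G : RibbonGraph) : Type :=
  Quot fun f g : G.Flag => g = G.across f ∨ g = G.corner f

/-- The edges are the orbits of `across` and `along`. -/
def Edge (G : RibbonGraph) : Type :=
  Quot fun f g : G.Flag => g = G.across f ∨ g = G.along f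

/-- The portions of the boundary obtained by cutting it at the vertices of degree 1 (the vertices
whose two flags satisfy `corner f = across f`): one may follow the side of an edge, and one may pass
a corner of any other vertex. -/
def Segment (G : RibbonGraph) : Type :=
  Quot fun f g : G.Flag =>
    g = G.along f ∨ (G.corner f ≠ G.across f ∧ g = G.corner f)

/-- The vertex at which a flag lies. -/
def vertexOf (G : RibbonGraph) (f : G.Flag) : G.Vertex := Quot.mk _ f

/-- The boundary portion on which a flag lies. -/
def segmentOf (G : RibbonGraph) (f : G.Flag) : G.Segment := Quot.mk _ f

/-- The degree of a vertex: the number of edge ends attached to it, each of which has two flags. -/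
noncomputable def degree (G : RibbonGraph) (x : G.Vertex) : ℕ :=
  Nat.card {f : G.Flag // G.vertexOf f = x} / 2

end RibbonGraph

/-! ### Orthogonal diagrams -/

/-- An orthogonal diagram with target permutation `τ`. The marking of the boundary is
`isSolid` (`true` for solid, `false` for dashed); of the two flags at the leaf labelled `z`,
`leaf z` is the one on the solid side and `across (leaf z)` the one on the dashed side. -/
structure OrthogonalDiagram {t : ℕ} (τ : Equiv.Perm (EndLabel t)) extends RibbonGraph where
  leaf : EndLabel t → Flag
  leaf_injective : Function.Injective leaf
  /-- The vertices carrying a label have degree 1. -/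
  corner_leaf : ∀ z, corner (leaf z) = across (leaf z)
  /-- All other vertices have even degree greater than 2. -/
  internal_degree : ∀ x : toRibbonGraph.Vertex, (∀ z, toRibbonGraph.vertexOf (leaf z) ≠ x) →
    Even (toRibbonGraph.degree x) ∧ 2 < toRibbonGraph.degree x
  isSolid : toRibbonGraph.Segment → Bool
  isSolid_leaf : ∀ z, isSolid (toRibbonGraph.segmentOf (leaf z)) = true
  /-- Each edge is marked solid on one side and dashed on the other. -/
  isSolid_across : ∀ f, isSolid (toRibbonGraph.segmentOf (across f)) =
    !isSolid (toRibbonGraph.segmentOf f)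
  /-- The whole boundary consists of segments running from leaf to leaf. -/
  segment_leaf : ∀ s : toRibbonGraph.Segment, ∃ z,
    s = toRibbonGraph.segmentOf (leaf z) ∨ s = toRibbonGraph.segmentOf (across (leaf z))
  /-- The solid segments run between the leaves `z` and `z̄`. -/
  solid_segment : ∀ z,
    toRibbonGraph.segmentOf (leaf z) = toRibbonGraph.segmentOf (leaf (barPerm t z))
  /-- The dashed segments run between the leaves `τ(z)` and `z̄`. -/
  dashed_segment : ∀ z, toRibbonGraph.segmentOf (across (leaf (τ z))) =
    toRibbonGraph.segmentOf (across (leaf (barPerm t z)))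

namespace OrthogonalDiagram

variable {t : ℕ} {τ : Equiv.Perm (EndLabel t)}

/-- The number `e` of edges. -/
noncomputable def numEdges (D : OrthogonalDiagram τ) : ℕ := Nat.card D.toRibbonGraph.Edge

/-- The number `v` of internal vertices, i.e. of vertices that are not leaves. -/
noncomputable def numInternal (D : OrthogonalDiagram τ) : ℕ :=
  Nat.card {x : D.toRibbonGraph.Vertex // ∀ z, D.toRibbonGraph.vertexOf (D.leaf z) ≠ x}

/-- A bijection of the flags that respects the map, the labels of the leaves and the marking. -/
structure IsIso (D D' : OrthogonalDiagram τ) (φ : D.Flag ≃ D'.Flag) : Prop where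
  across : ∀ f, φ (D.across f) = D'.across (φ f)
  along : ∀ f, φ (D.along f) = D'.along (φ f)
  corner : ∀ f, φ (D.corner f) = D'.corner (φ f)
  leaf : ∀ z, φ (D.leaf z) = D'.leaf z
  isSolid : ∀ f, D'.isSolid (D'.toRibbonGraph.segmentOf (φ f)) =
    D.isSolid (D.toRibbonGraph.segmentOf f)

theorem IsIso.symm {D D' : OrthogonalDiagram τ} {φ : D.Flag ≃ D'.Flag} (h : IsIso D D' φ) :
    IsIso D' D φ.symm where
  across f := by rw [Equiv.symm_apply_eq, h.across, Equiv.apply_symm_apply]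
  along f := by rw [Equiv.symm_apply_eq, h.along, Equiv.apply_symm_apply]
  corner f := by rw [Equiv.symm_apply_eq, h.corner, Equiv.apply_symm_apply]
  leaf z := by rw [Equiv.symm_apply_eq, h.leaf]
  isSolid f := by rw [← h.isSolid, Equiv.apply_symm_apply]

instance isoSetoid (τ : Equiv.Perm (EndLabel t)) : Setoid (OrthogonalDiagram τ) where
  r D D' := ∃ φ : D.Flag ≃ D'.Flag, IsIso D D' φ
  iseqv :=
    { refl := fun _ => ⟨Equiv.refl _, ⟨fun _ => rfl, fun _ => rfl, fun _ => rfl, fun _ => rfl,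
        fun _ => rfl⟩⟩
      symm := fun ⟨φ, h⟩ => ⟨φ.symm, h.symm⟩
      trans := fun ⟨φ, h⟩ ⟨ψ, k⟩ => ⟨φ.trans ψ, by
        constructor
        · intro f; simp [h.across, k.across]
        · intro f; simp [h.along, k.along]
        · intro f; simp [h.corner, k.corner]
        · intro f; simp [h.leaf, k.leaf]
        · intro f
          rw [Equiv.trans_apply, k.isSolid, h.isSolid]⟩ }

theorem IsIso.numEdges_eq {D D' : OrthogonalDiagram τ} {φ : D.Flag ≃ D'.Flag}
    (h : IsIso D D' φ) : D.numEdges = D'.numEdges := by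
  refine Nat.card_congr (Quot.congr φ fun f g => ?_)
  rw [← h.across, ← h.along, φ.apply_eq_iff_eq, φ.apply_eq_iff_eq]

theorem IsIso.numInternal_eq {D D' : OrthogonalDiagram τ} {φ : D.Flag ≃ D'.Flag}
    (h : IsIso D D' φ) : D.numInternal = D'.numInternal := by
  let e : D.toRibbonGraph.Vertex ≃ D'.toRibbonGraph.Vertex := Quot.congr φ fun f g => by
    rw [← h.across, ← h.corner, φ.apply_eq_iff_eq, φ.apply_eq_iff_eq]
  refine Nat.card_congr (e.subtypeEquiv fun x => ?_)
  refine forall_congr' fun z => not_congr ?_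
  have hz : D'.toRibbonGraph.vertexOf (D'.leaf z) = e (D.toRibbonGraph.vertexOf (D.leaf z)) := by
    rw [← h.leaf]; rfl
  rw [hz, e.apply_eq_iff_eq]

end OrthogonalDiagram

/-- Orthogonal diagrams with target permutation `τ`, up to isomorphism. -/
def OrthogonalDiagramClass {t : ℕ} (τ : Equiv.Perm (EndLabel t)) : Type 1 :=
  Quotient (OrthogonalDiagram.isoSetoid τ)

namespace OrthogonalDiagramClass

variable {t : ℕ} {τ : Equiv.Perm (EndLabel t)}

/-- The number `e` of edges. -/
noncomputable def numEdges : OrthogonalDiagramClass τ → ℕ :=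
  Quotient.lift OrthogonalDiagram.numEdges fun _ _ ⟨_, h⟩ => h.numEdges_eq

/-- The number `v` of internal vertices. -/
noncomputable def numInternal : OrthogonalDiagramClass τ → ℕ :=
  Quotient.lift OrthogonalDiagram.numInternal fun _ _ ⟨_, h⟩ => h.numInternal_eq

end OrthogonalDiagramClass

/-- `D^O_{v,e}(τ)`: the number of orthogonal diagrams with target permutation `τ`, `v` internal
vertices and `e` edges. -/
noncomputable def orthDiagramCount {t : ℕ} (τ : Equiv.Perm (EndLabel t)) (v e : ℕ) : ℕ :=
  Nat.card {d : OrthogonalDiagramClass τ // d.numInternal = v ∧ d.numEdges = e}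

/-- `Δ^O(τ) = ∑_{v,e} D^O_{v,e}(τ) (-1)^v / N^{e-v}` as a formal power series in `X = 1/N`:
the coefficient of `X^m` collects the terms with `e = v + m`. -/
noncomputable def orthDelta {t : ℕ} (τ : Equiv.Perm (EndLabel t)) : PowerSeries ℤ :=
  PowerSeries.mk fun m => ∑ᶠ v : ℕ, (-1) ^ v * (orthDiagramCount τ v (v + m) : ℤ)

/-! ### Palindromic primitive factorizations -/

/-- Factorizations `τ = (s₁ r₁) ⋯ (s_v r_v) (s̄_v r̄_v) ⋯ (s̄₁ r̄₁)` in which every `s_i` is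
a label without bar, `s₁ ≤ s₂ ≤ ⋯ ≤ s_v` and `s_i < r_i`, in the linear order
`1 < 1̄ < 2 < 2̄ < ⋯ < t < t̄` of the labels. -/
def PalindromicFactorization {t : ℕ} (τ : Equiv.Perm (EndLabel t)) (v : ℕ) : Type :=
  {x : (Fin v → Fin t) × (Fin v → EndLabel t) //
    Monotone x.1 ∧
    (∀ i, toLex (x.1 i, false) < toLex (x.2 i)) ∧
    τ = (List.ofFn fun i => Equiv.swap (x.1 i, false) (x.2 i)).prod *
      (List.ofFn fun i =>
        Equiv.swap (barPerm t (x.1 i, false)) (barPerm t (x.2 i))).reverse.prod}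

/-- `p^O_v(τ)`: the number of palindromic primitive factorizations of `τ` with `v` pairs of
factors. -/
noncomputable def palindromicCount {t : ℕ} (τ : Equiv.Perm (EndLabel t)) (v : ℕ) : ℕ :=
  Nat.card (PalindromicFactorization τ v)

/-! ### Averages over the Circular Orthogonal Ensemble -/

instance compactSpace_unitaryGroup (N : ℕ) : CompactSpace (Matrix.unitaryGroup (Fin N) ℂ) := by
  have hK : IsCompact (Set.univ.pi fun _ : Fin N => Set.univ.pi fun _ : Fin N =>
      Metric.closedBall (0 : ℂ) 1) :=
    isCompact_univ_pi fun _ => isCompact_univ_pi fun _ => isCompact_closedBall 0 1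
  have hc : IsClosed (Matrix.unitaryGroup (Fin N) ℂ : Set (Matrix (Fin N) (Fin N) ℂ)) :=
    isClosed_unitary
  refine isCompact_iff_compactSpace.mp (IsCompact.of_isClosed_subset hK hc ?_)
  intro U hU i _ j _
  simpa using entry_norm_bound_of_unitary hU i j

noncomputable instance measurableSpace_unitaryGroup (N : ℕ) :
    MeasurableSpace (Matrix.unitaryGroup (Fin N) ℂ) := borel _

instance borelSpace_unitaryGroup (N : ℕ) : BorelSpace (Matrix.unitaryGroup (Fin N) ℂ) := ⟨rfl⟩

/-- The Circular Unitary Ensemble: the Haar probability measure on `U(N)`. -/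
noncomputable def cueMeasure (N : ℕ) : Measure (Matrix.unitaryGroup (Fin N) ℂ) :=
  Measure.haarMeasure ⊤

/-- The average `⟨W_{a₁ a₁̄} ⋯ W_{a_t a_t̄} W*_{b₁ b₁̄} ⋯ W*_{b_t b_t̄}⟩` over the Circular
Orthogonal Ensemble, that is over `W = U Uᵀ` with `U` from the Circular Unitary Ensemble; `W*` is
the complex conjugate entry. -/
noncomputable def coeAverage {N t : ℕ} (a b : EndLabel t → Fin N) : ℂ :=
  ∫ U : Matrix.unitaryGroup (Fin N) ℂ,
    (∏ j : Fin t, ((U : Matrix (Fin N) (Fin N) ℂ) * (U : Matrix (Fin N) (Fin N) ℂ).transpose)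
        (a (j, false)) (a (j, true))) *
      ∏ j : Fin t, star (((U : Matrix (Fin N) (Fin N) ℂ) *
        (U : Matrix (Fin N) (Fin N) ℂ).transpose) (b (j, false)) (b (j, true)))
    ∂(cueMeasure N)

/-- `V : S_{2t} → ℂ` is the family `V^O_N` of COE class coefficients of order `t`:
`⟨W_{a₁ a₁̄} ⋯ W_{a_t a_t̄} W*_{b₁ b₁̄} ⋯ W*_{b_t b_t̄}⟩ = ∑_π V(π) ∏_z δ(a_z - b_{π(z)})`
for all choices of the indices. -/
def IsCOEClassCoeff (N t : ℕ) (V : Equiv.Perm (EndLabel t) → ℂ) : Prop :=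
  ∀ a b : EndLabel t → Fin N,
    coeAverage a b = ∑ π : Equiv.Perm (EndLabel t),
      V π * ∏ z : EndLabel t, if a z = b (π z) then 1 else 0

/-!
The class coefficients, the diagrams and the palindromic primitive factorizations are all governed
by what happens next to the label `1`. Write `τ = orthTarget w`, and let `τ_y = (1 y) τ (1̄ ȳ)`, the
target permutation of `w (1 y)`.

*Class coefficients.* Invariance of the Haar measure means that the matrix of the COE averages
commutes with all operators `g ⊗ ⋯ ⊗ g`, `g ∈ U(N)`. A tensor of pairwise different basis vectors,
which exists for `N ≥ 2t`, generates the tensor power under these operators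
(`eq_zero_of_commute_tensorPow`), so that the matrix is a unique combination of permutations of the
tensor factors (`existsUnique_isCOEClassCoeff`). Contracting one index of `W` with the same index of
`W*` and using unitarity gives `N V(w) + ∑_{y ≠ 1} V(w (1 y)) = V(w')`, where `w'` belongs to the
restriction of `τ` to the other labels, and the right-hand side is `0` if `τ` moves the label `1`
(`classCoeff_recursion`).

*Factorizations.* Removing the outermost pair of factors shows that the series
`∑_v (-1)^v p_v(τ) N^{-t-v}` satisfies the same recursion. It converges for `N ≥ 2t`, and since the
sum over `y` has `2t - 1 < N` terms, the recursion has only one solution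
(`classCoeff_eq_factorizationSum`).

*Diagrams.* A diagram is encoded by three matchings of its half-edges (`HalfEdgeDiagram`). The edge
from the leaf `1` leads
* to the leaf `1̄`: the edge can be removed;
* to a vertex of degree four whose opposite edge leads to a leaf `y`: the diagram arises by tying
  the leaves `1` and `y` of a diagram with target permutation `τ_y`;
* to a vertex of degree four whose opposite edge leads to an internal vertex: the diagram arises by
  splitting a larger vertex next to the leaf `1`;
* to a vertex of degree greater than four.

The diagrams of the last two kinds are in bijection, with `v` and `e` both changing by one, and
cancel. The others reproduce the recursion for the factorizations. By induction, the number of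
diagrams with given `v` and `e` is the number of factorizations (for `e = t + 2v`) plus a term `x`
and the same term shifted by one in `v` and `e` (`exists_diagramCount_eq`). Since these numbers are
finite, this amounts to the involution `P` (`exists_involution`), and it yields the coefficients of
the alternating sum (`coeff_orthDelta`) and its value (`hasSum_orthDelta`).

*Cycle lengths.* The cycle of `τ` through `1̄` is the mirror image of the cycle through `1` and is
different from it. If the cycles have length `c₁`, then a label `y` on the cycle of `1` cuts both of
them in the same way, the `c₁` labels on the cycle of `1̄` leave the cycle type unchanged, and a label
on a further pair of cycles joins the pairs (`sum_untied`). Relabelling the leaves moves any label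
to the first place: it conjugates `τ`, which does not change the numbers of diagrams, nor therefore
those of factorizations (`palindromicCount_mul_right`). By induction the numbers depend on the cycle
lengths only (`palindromicCount_eq_of_halfType`), and the recursion next to the label `1` becomes
the recursion in the cycle lengths.
-/

namespace COE

open Equiv

/-! ### Labels and target permutations -/

@[simp] theorem barPerm_apply {t : ℕ} (j : Fin t) (ε : Bool) : barPerm t (j, ε) = (j, !ε) := rfl

@[simp] theorem barPerm_barPerm {t : ℕ} (z : EndLabel t) : barPerm t (barPerm t z) = z := by
  obtain ⟨j, ε⟩ := z; simp

@[simp] theorem barPerm_inv (t : ℕ) : (barPerm t)⁻¹ = barPerm t := by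
  rw [inv_eq_iff_mul_eq_one]; ext1 z; simp

theorem barPerm_ne {t : ℕ} (z : EndLabel t) : barPerm t z ≠ z := by
  obtain ⟨j, ε⟩ := z; simp

/-- The label `1`, the smallest one. -/
def firstLabel (t : ℕ) : EndLabel (t + 1) := (0, false)

/-- The inclusion of `Z_t` in `Z_{t+1}` whose image consists of the labels other than
`1` and `1̄`. -/
def shiftLabel (t : ℕ) : EndLabel t ↪ EndLabel (t + 1) where
  toFun z := (z.1.succ, z.2)
  inj' := by rintro ⟨a, b⟩ ⟨c, d⟩ h; simpa [Fin.succ_inj] using h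

theorem shiftLabel_apply {t : ℕ} (z : EndLabel t) : shiftLabel t z = (z.1.succ, z.2) := rfl

theorem shiftLabel_ne {t : ℕ} (z : EndLabel t) (ε : Bool) : shiftLabel t z ≠ (0, ε) := by
  simp [shiftLabel_apply, Fin.succ_ne_zero]

theorem label_cases {t : ℕ} (z : EndLabel (t + 1)) :
    (∃ ε, z = (0, ε)) ∨ ∃ z', z = shiftLabel t z' := by
  obtain ⟨j, ε⟩ := z
  induction j using Fin.cases with
  | zero => exact Or.inl ⟨ε, rfl⟩
  | succ i => exact Or.inr ⟨(i, ε), rfl⟩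

theorem barPerm_shiftLabel {t : ℕ} (z : EndLabel t) :
    barPerm (t + 1) (shiftLabel t z) = shiftLabel t (barPerm t z) := rfl

/-- A permutation of `Z_t` acting on `Z_{t+1}` with `1` and `1̄` as additional fixed points. -/
noncomputable def extendPerm (t : ℕ) : Perm (EndLabel t) →* Perm (EndLabel (t + 1)) :=
  Perm.viaEmbeddingHom (shiftLabel t)

@[simp] theorem extendPerm_shiftLabel {t : ℕ} (σ : Perm (EndLabel t)) (z : EndLabel t) :
    extendPerm t σ (shiftLabel t z) = shiftLabel t (σ z) :=
  Perm.viaEmbedding_apply σ (shiftLabel t) z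

@[simp] theorem extendPerm_zero {t : ℕ} (σ : Perm (EndLabel t)) (ε : Bool) :
    extendPerm t σ (0, ε) = (0, ε) :=
  Perm.viaEmbedding_apply_of_notMem σ (shiftLabel t) _ fun ⟨z, hz⟩ => shiftLabel_ne z ε hz

theorem extendPerm_injective (t : ℕ) : Function.Injective (extendPerm t) :=
  Perm.viaEmbeddingHom_injective _

theorem exists_extendPerm_eq {t : ℕ} {σ : Perm (EndLabel (t + 1))}
    (h : ∀ ε, σ (0, ε) = (0, ε)) : ∃ σ', extendPerm t σ' = σ := by
  have key : ∀ z, ∃ z', shiftLabel t z' = σ (shiftLabel t z) := by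
    intro z
    rcases label_cases (σ (shiftLabel t z)) with ⟨ε, hε⟩ | ⟨z', hz'⟩
    · rw [← h ε] at hε
      exact absurd (σ.injective hε) (shiftLabel_ne z ε)
    · exact ⟨z', hz'.symm⟩
  choose f hf using key
  have hinj : Function.Injective f := fun x y hxy =>
    (shiftLabel t).injective (σ.injective (by rw [← hf, ← hf, hxy]))
  refine ⟨Equiv.ofBijective f (Finite.injective_iff_bijective.mp hinj), ?_⟩
  ext1 z
  rcases label_cases z with ⟨ε, rfl⟩ | ⟨z', rfl⟩
  · rw [extendPerm_zero, h]
  · rw [extendPerm_shiftLabel, Equiv.ofBijective_apply, hf]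

theorem extendPerm_swap {t : ℕ} (x y : EndLabel t) :
    extendPerm t (swap x y) = swap (shiftLabel t x) (shiftLabel t y) := by
  ext1 z
  rcases label_cases z with ⟨ε, rfl⟩ | ⟨z', rfl⟩
  · rw [extendPerm_zero, swap_apply_of_ne_of_ne (shiftLabel_ne _ _).symm (shiftLabel_ne _ _).symm]
  · rw [extendPerm_shiftLabel, (shiftLabel t).injective.swap_apply]

theorem orthTarget_apply {t : ℕ} (w : Perm (EndLabel t)) (z : EndLabel t) :
    orthTarget w z = w⁻¹ (barPerm t (w (barPerm t z))) := by
  simp [orthTarget]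

theorem orthTarget_extendPerm {t : ℕ} (w : Perm (EndLabel t)) :
    orthTarget (extendPerm t w) = extendPerm t (orthTarget w) := by
  ext1 z
  rw [orthTarget_apply, Perm.inv_eq_iff_eq]
  rcases label_cases z with ⟨ε, rfl⟩ | ⟨z', rfl⟩
  · simp
  · simp [barPerm_shiftLabel, orthTarget_apply]

theorem orthTarget_mul_swap {t : ℕ} (w : Perm (EndLabel t)) (x y : EndLabel t) :
    orthTarget (w * swap x y) =
      swap x y * orthTarget w * swap (barPerm t x) (barPerm t y) := by
  have : swap x y * barPerm t = barPerm t * swap (barPerm t x) (barPerm t y) := by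
    rw [mul_swap_eq_swap_mul]; simp
  simp only [orthTarget, mul_inv_rev, swap_inv, mul_assoc, this]

theorem orthTarget_mul_left {t : ℕ} {h : Perm (EndLabel t)}
    (hh : Commute h (barPerm t)) (w : Perm (EndLabel t)) :
    orthTarget (h * w) = orthTarget w := by
  have : h⁻¹ * barPerm t * h = barPerm t := by rw [mul_assoc, ← hh.eq, inv_mul_cancel_left]
  simp only [orthTarget, mul_inv_rev, barPerm_inv]
  calc w⁻¹ * h⁻¹ * barPerm t * (h * w) * barPerm t
      = w⁻¹ * (h⁻¹ * barPerm t * h) * w * barPerm t := by group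
    _ = _ := by rw [this]

theorem orthTarget_mul_right {t : ℕ} {h : Perm (EndLabel t)}
    (hh : Commute h (barPerm t)) (w : Perm (EndLabel t)) :
    orthTarget (w * h) = h⁻¹ * orthTarget w * h := by
  simp only [orthTarget, mul_inv_rev, barPerm_inv, mul_assoc, hh.eq]

theorem orthTarget_bar_bar {t : ℕ} (w : Perm (EndLabel t)) (z : EndLabel t) :
    orthTarget w (barPerm t (orthTarget w (barPerm t z))) = z := by
  simp [orthTarget_apply]

theorem orthTarget_bar_ne {t : ℕ} (w : Perm (EndLabel t)) (z : EndLabel t) :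
    orthTarget w (barPerm t z) ≠ z := by
  rw [orthTarget_apply, barPerm_barPerm, Ne, Perm.inv_eq_iff_eq]
  exact barPerm_ne _

/-- The relabelling that exchanges the pairs `{1, 1̄}` and `{j, j̄}`, and also exchanges all
labels `k` and `k̄` if `ε` is true. -/
def relabel {t : ℕ} (j : Fin (t + 1)) (ε : Bool) : Perm (EndLabel (t + 1)) :=
  Equiv.prodCongr (swap 0 j) (if ε then Equiv.boolNot else Equiv.refl Bool)

theorem relabel_apply {t : ℕ} (j i : Fin (t + 1)) (ε δ : Bool) :
    relabel j ε (i, δ) = (swap 0 j i, xor ε δ) := by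
  cases ε <;> simp [relabel]

theorem relabel_commute {t : ℕ} (j : Fin (t + 1)) (ε : Bool) :
    Commute (relabel j ε) (barPerm (t + 1)) := by
  ext1 ⟨i, δ⟩
  simp [relabel_apply]

theorem relabel_self {t : ℕ} (j : Fin (t + 1)) (ε : Bool) :
    relabel j ε (j, ε) = firstLabel t := by
  simp [relabel_apply, firstLabel]

theorem orthTarget_zero_true {t : ℕ} {w : Perm (EndLabel (t + 1))}
    (h : orthTarget w (firstLabel t) = firstLabel t) : orthTarget w (0, true) = (0, true) := by
  have := orthTarget_bar_bar w (0, true)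
  rw [show barPerm (t + 1) (0, true) = (0, false) from rfl,
    show orthTarget w (0, false) = (0, false) from h] at this
  exact this

/-- A target permutation that fixes the label `1` comes from a target permutation of the other
labels. -/
theorem exists_orthTarget_eq {t : ℕ} {w : Perm (EndLabel (t + 1))}
    (h : orthTarget w (firstLabel t) = firstLabel t) :
    ∃ w', orthTarget w = extendPerm t (orthTarget w') := by
  set g := relabel (w (firstLabel t)).1 (w (firstLabel t)).2 with hg
  have h1 : (g * w) (firstLabel t) = firstLabel t := relabel_self _ _
  have h2 : orthTarget (g * w) = orthTarget w := orthTarget_mul_left (relabel_commute _ _) w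
  have h3 : (g * w) (0, true) = (0, true) := by
    have h4 := orthTarget_apply (g * w) (0, true)
    rw [h2, orthTarget_zero_true h, eq_comm, Perm.inv_eq_iff_eq] at h4
    rw [← h4]
    have : (g * w) (0, false) = (0, false) := h1
    simp [-Perm.coe_mul, this]
  obtain ⟨w', hw'⟩ := exists_extendPerm_eq (σ := g * w) fun ε => by cases ε <;> assumption
  exact ⟨w', by rw [← h2, ← hw', orthTarget_extendPerm]⟩

theorem orthTarget_of_extendPerm {t : ℕ} {w : Perm (EndLabel (t + 1))} {σ : Perm (EndLabel t)}
    (h : extendPerm t σ = orthTarget w) : ∃ w', σ = orthTarget w' := by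
  obtain ⟨w', hw'⟩ := exists_orthTarget_eq (w := w) (by rw [← h]; exact extendPerm_zero _ _)
  exact ⟨w', extendPerm_injective t (h.trans hw')⟩

/-- The target permutation of a diagram in which the vertex next to the leaf `1` is untied. -/
def untiedTarget {t : ℕ} (τ : Perm (EndLabel (t + 1))) (y : EndLabel (t + 1)) :
    Perm (EndLabel (t + 1)) :=
  swap (firstLabel t) y * τ * swap (barPerm (t + 1) (firstLabel t)) (barPerm (t + 1) y)

theorem untiedTarget_orthTarget {t : ℕ} (w : Perm (EndLabel (t + 1))) (y : EndLabel (t + 1)) :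
    untiedTarget (orthTarget w) y = orthTarget (w * swap (firstLabel t) y) :=
  (orthTarget_mul_swap _ _ _).symm

/-! ### The recursion for palindromic primitive factorizations -/

/-- The palindromic product `(s₁ r₁) ⋯ (s_v r_v) (s̄_v r̄_v) ⋯ (s̄₁ r̄₁)`. -/
def palindromicProd {t v : ℕ} (s : Fin v → Fin t) (r : Fin v → EndLabel t) :
    Perm (EndLabel t) :=
  (List.ofFn fun i => swap (s i, false) (r i)).prod *
    (List.ofFn fun i => swap (barPerm t (s i, false)) (barPerm t (r i))).reverse.prod

theorem palindromicProd_cons {t v : ℕ} (s₀ : Fin t) (r₀ : EndLabel t) (s : Fin v → Fin t)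
    (r : Fin v → EndLabel t) :
    palindromicProd (Fin.cons s₀ s : Fin (v + 1) → Fin t) (Fin.cons r₀ r) =
      swap (s₀, false) r₀ * palindromicProd s r *
        swap (barPerm t (s₀, false)) (barPerm t r₀) := by
  simp [palindromicProd, List.ofFn_succ, mul_assoc]

theorem palindromicProd_shift {t v : ℕ} (s : Fin v → Fin t) (r : Fin v → EndLabel t) :
    palindromicProd (fun i => (s i).succ) (fun i => shiftLabel t (r i)) =
      extendPerm t (palindromicProd s r) := by
  simp only [palindromicProd, map_mul, map_list_prod, List.map_reverse, List.map_ofFn]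
  congr 2
  · congr 2
    funext i
    exact (extendPerm_swap (s i, false) (r i)).symm
  · congr 2
    funext i
    exact (extendPerm_swap (barPerm t (s i, false)) (barPerm t (r i))).symm

theorem palindromicCount_zero {t : ℕ} (τ : Perm (EndLabel t)) :
    palindromicCount τ 0 = if τ = 1 then 1 else 0 := by
  unfold palindromicCount
  split_ifs with h
  · rw [Nat.card_eq_one_iff_unique]
    refine ⟨⟨fun a b => Subtype.ext (Subsingleton.elim _ _)⟩, ⟨⟨(Fin.elim0, Fin.elim0), ?_⟩⟩⟩
    exact ⟨fun i => i.elim0, fun i => i.elim0, by simpa using h⟩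
  · have : IsEmpty (PalindromicFactorization τ 0) := ⟨fun x => h (by simpa using x.2.2.2)⟩
    exact Nat.card_of_isEmpty

theorem palindromicCount_empty (τ : Perm (EndLabel 0)) (v : ℕ) :
    palindromicCount τ (v + 1) = 0 := by
  have : IsEmpty (PalindromicFactorization τ (v + 1)) := ⟨fun x => (x.1.1 0).elim0⟩
  exact Nat.card_of_isEmpty

theorem firstLabel_lt_iff {t : ℕ} (y : EndLabel (t + 1)) :
    toLex ((0 : Fin (t + 1)), false) < toLex y ↔ y ≠ firstLabel t := by
  obtain ⟨j, ε⟩ := y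
  rw [Prod.Lex.toLex_lt_toLex]
  cases ε <;> simp [firstLabel, Fin.pos_iff_ne_zero, eq_comm, em']

theorem untiedTarget_eq_iff {t : ℕ} (τ σ : Perm (EndLabel (t + 1))) (y : EndLabel (t + 1)) :
    untiedTarget τ y = σ ↔ τ = untiedTarget σ y := by
  have key : ∀ τ : Perm (EndLabel (t + 1)), untiedTarget (untiedTarget τ y) y = τ := by
    intro τ
    simp only [untiedTarget, mul_assoc, swap_mul_self, mul_one, swap_mul_self_mul]
  constructor
  · rintro rfl; rw [key]
  · rintro rfl; rw [key]

instance finite_palindromicFactorization {t v : ℕ} (τ : Perm (EndLabel t)) :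
    Finite (PalindromicFactorization τ v) :=
  Subtype.finite

/-- Factorizations whose first factor moves the label `1` arise from those of the untied target
permutations. -/
def firstFactorEquiv {t : ℕ} (τ : Perm (EndLabel (t + 1))) (v : ℕ) :
    {x : PalindromicFactorization τ (v + 1) // x.1.1 0 = 0} ≃
      Σ y : {y : EndLabel (t + 1) // y ≠ firstLabel t},
        PalindromicFactorization (untiedTarget τ y) v where
  toFun x := ⟨⟨x.1.1.2 0, (firstLabel_lt_iff _).mp
      (lt_of_eq_of_lt (by rw [x.2]) (x.1.2.2.1 0))⟩,
    ⟨(Fin.tail x.1.1.1, Fin.tail x.1.1.2),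
      fun i j hij => x.1.2.1 (Fin.succ_le_succ_iff.mpr hij), fun i => x.1.2.2.1 i.succ, by
        rw [untiedTarget_eq_iff]
        refine (x.1.2.2.2.trans ?_)
        change palindromicProd x.1.1.1 x.1.1.2 = _
        conv_lhs => rw [← Fin.cons_self_tail x.1.1.1, ← Fin.cons_self_tail x.1.1.2]
        rw [palindromicProd_cons]
        conv_lhs => rw [x.2]
        rfl⟩⟩
  invFun y := ⟨⟨((Fin.cons 0 y.2.1.1 : Fin (v + 1) → Fin (t + 1)),
      (Fin.cons y.1.1 y.2.1.2 : Fin (v + 1) → EndLabel (t + 1))), by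
        refine ⟨?_, ?_, ?_⟩
        · intro i j hij
          induction i using Fin.cases with
          | zero => simp
          | succ i =>
            induction j using Fin.cases with
            | zero => simp at hij
            | succ j => exact y.2.2.1 (Fin.succ_le_succ_iff.mp hij)
        · intro i
          induction i using Fin.cases with
          | zero => exact (firstLabel_lt_iff _).mpr y.1.2
          | succ i => exact y.2.2.2.1 i
        · have h := y.2.2.2.2
          rw [untiedTarget_eq_iff] at h
          refine h.trans ?_
          exact (palindromicProd_cons (0 : Fin (t + 1)) y.1.1 y.2.1.1 y.2.1.2).symm⟩, rfl⟩
  left_inv x := by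
    apply Subtype.ext
    apply Subtype.ext
    refine Prod.ext ?_ ?_
    · conv_rhs => rw [← Fin.cons_self_tail x.1.1.1, x.2]
    · exact Fin.cons_self_tail x.1.1.2
  right_inv y := rfl

theorem shift_of_ne_zero {t v : ℕ} {s : Fin (v + 1) → Fin (t + 1)}
    {r : Fin (v + 1) → EndLabel (t + 1)} (hs : Monotone s)
    (hr : ∀ i, toLex (s i, false) < toLex (r i)) (h0 : s 0 ≠ 0) :
    ∃ s' : Fin (v + 1) → Fin t, ∃ r' : Fin (v + 1) → EndLabel t,
      s = (fun i => (s' i).succ) ∧ r = fun i => shiftLabel t (r' i) := by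
  have h1 : ∀ i, s i ≠ 0 := fun i h => h0 (Fin.le_zero_iff.mp (h ▸ hs (Fin.zero_le i)))
  have h2 : ∀ i, ∃ z, r i = shiftLabel t z := by
    intro i
    rcases label_cases (r i) with ⟨ε, h⟩ | h
    · have := hr i
      rw [h, Prod.Lex.toLex_lt_toLex] at this
      rcases this with h3 | h3
      · exact absurd h3 (Fin.not_lt_zero _)
      · exact absurd h3.1 (h1 i)
    · exact h
  choose r' hr' using h2
  exact ⟨fun i => (s i).pred (h1 i), r', by simp, funext hr'⟩

theorem toLex_shift_lt_iff {t : ℕ} (s : Fin t) (r : EndLabel t) :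
    toLex (s.succ, false) < toLex (shiftLabel t r) ↔ toLex (s, false) < toLex r := by
  simp [Prod.Lex.toLex_lt_toLex, shiftLabel_apply]

/-- Factorizations in which no factor moves the label `1` are factorizations of the permutation of
the other labels. -/
theorem card_first_ne_zero {t : ℕ} (τ : Perm (EndLabel t)) (v : ℕ) :
    Nat.card {x : PalindromicFactorization (extendPerm t τ) (v + 1) // x.1.1 0 ≠ 0} =
      palindromicCount τ (v + 1) := by
  symm
  refine Nat.card_congr (Equiv.ofBijective (fun x => ⟨⟨(fun i => (x.1.1 i).succ,
    fun i => shiftLabel t (x.1.2 i)), ?_, ?_, ?_⟩, ?_⟩) ⟨?_, ?_⟩)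
  · intro i j hij
    exact Fin.succ_le_succ_iff.mpr (x.2.1 hij)
  · exact fun i => (toLex_shift_lt_iff _ _).mpr (x.2.2.1 i)
  · have := x.2.2.2
    exact (congrArg (extendPerm t) this).trans (palindromicProd_shift _ _).symm
  · exact Fin.succ_ne_zero _
  · intro x y hxy
    have h := congrArg (fun z => z.1.1) hxy
    apply Subtype.ext
    refine Prod.ext (funext fun i => ?_) (funext fun i => ?_)
    · exact Fin.succ_injective _ (congrFun (congrArg Prod.fst h) i)
    · exact (shiftLabel t).injective (congrFun (congrArg Prod.snd h) i)
  · rintro ⟨⟨⟨s, r⟩, hs, hr, hp⟩, h0⟩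
    obtain ⟨s', r', rfl, rfl⟩ := shift_of_ne_zero hs hr h0
    refine ⟨⟨(s', r'), fun i j hij => Fin.succ_le_succ_iff.mp (hs hij),
      fun i => (toLex_shift_lt_iff _ _).mp (hr i), ?_⟩, rfl⟩
    exact extendPerm_injective t (hp.trans (palindromicProd_shift _ _))

theorem card_first_ne_zero_of_notMem {t : ℕ} {τ : Perm (EndLabel (t + 1))}
    (h : ∀ σ, extendPerm t σ ≠ τ) (v : ℕ) :
    Nat.card {x : PalindromicFactorization τ (v + 1) // x.1.1 0 ≠ 0} = 0 := by
  have : IsEmpty {x : PalindromicFactorization τ (v + 1) // x.1.1 0 ≠ 0} := by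
    refine ⟨?_⟩
    rintro ⟨⟨⟨s, r⟩, hs, hr, hp⟩, h0⟩
    obtain ⟨s', r', rfl, rfl⟩ := shift_of_ne_zero hs hr h0
    exact h _ (hp.trans (palindromicProd_shift _ _)).symm
  exact Nat.card_of_isEmpty

/-- Peeling off the outermost pair of factors, which either moves the label `1` or leaves it, together
with all later pairs, fixed. -/
theorem palindromicCount_succ {t : ℕ} (τ : Perm (EndLabel (t + 1))) (v : ℕ) :
    palindromicCount τ (v + 1) =
      Nat.card {x : PalindromicFactorization τ (v + 1) // x.1.1 0 ≠ 0} +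
        ∑ y ∈ Finset.univ.erase (firstLabel t), palindromicCount (untiedTarget τ y) v := by
  classical
  have h1 : palindromicCount τ (v + 1) =
      Nat.card {x : PalindromicFactorization τ (v + 1) // x.1.1 0 = 0} +
        Nat.card {x : PalindromicFactorization τ (v + 1) // x.1.1 0 ≠ 0} := by
    rw [← Nat.card_sum]
    exact Nat.card_congr (Equiv.sumCompl _).symm
  rw [h1, add_comm, Nat.card_congr (firstFactorEquiv τ v), Nat.card_sigma]
  congr 1
  exact (Finset.sum_subtype (Finset.univ.erase (firstLabel t)) (by simp)
    (fun y => palindromicCount (untiedTarget τ y) v)).symm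

theorem palindromicCount_extendPerm_succ {t : ℕ} (τ : Perm (EndLabel t)) (v : ℕ) :
    palindromicCount (extendPerm t τ) (v + 1) = palindromicCount τ (v + 1) +
      ∑ y ∈ Finset.univ.erase (firstLabel t),
        palindromicCount (untiedTarget (extendPerm t τ) y) v := by
  rw [palindromicCount_succ, card_first_ne_zero]

theorem palindromicCount_succ_of_notMem {t : ℕ} {τ : Perm (EndLabel (t + 1))}
    (h : ∀ σ, extendPerm t σ ≠ τ) (v : ℕ) :
    palindromicCount τ (v + 1) =
      ∑ y ∈ Finset.univ.erase (firstLabel t), palindromicCount (untiedTarget τ y) v := by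
  rw [palindromicCount_succ, card_first_ne_zero_of_notMem h, zero_add]

theorem palindromicCount_extendPerm_zero {t : ℕ} (τ : Perm (EndLabel t)) :
    palindromicCount (extendPerm t τ) 0 = palindromicCount τ 0 := by
  simp only [palindromicCount_zero, map_eq_one_iff _ (extendPerm_injective t)]

theorem palindromicCount_zero_of_notMem {t : ℕ} {τ : Perm (EndLabel (t + 1))}
    (h : ∀ σ, extendPerm t σ ≠ τ) : palindromicCount τ 0 = 0 := by
  rw [palindromicCount_zero, if_neg]
  rintro rfl
  exact h 1 (map_one _)

/-- A bound for the number of palindromic primitive factorizations: the coefficients of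
`∏_{k=1}^t 1 / (1 - (2k-1)x)`. -/
def palindromicBound : ℕ → ℕ → ℕ
  | 0, 0 => 1
  | 0, _ + 1 => 0
  | _ + 1, 0 => 1
  | t + 1, v + 1 => palindromicBound t (v + 1) + (2 * t + 1) * palindromicBound (t + 1) v

theorem card_erase_firstLabel (t : ℕ) :
    (Finset.univ.erase (firstLabel t)).card = 2 * t + 1 := by
  rw [Finset.card_erase_of_mem (Finset.mem_univ _)]
  simp only [Finset.card_univ, Fintype.card_prod, Fintype.card_fin, Fintype.card_bool]
  omega

theorem palindromicCount_le {t : ℕ} (τ : Perm (EndLabel t)) (v : ℕ) :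
    palindromicCount τ v ≤ palindromicBound t v := by
  induction t generalizing v with
  | zero =>
    cases v with
    | zero => rw [palindromicCount_zero, palindromicBound]; split_ifs <;> simp
    | succ v => simp [palindromicCount_empty]
  | succ t ih =>
    induction v generalizing τ with
    | zero => rw [palindromicCount_zero, palindromicBound]; split_ifs <;> simp
    | succ v ihv =>
      have h1 : ∑ y ∈ Finset.univ.erase (firstLabel t), palindromicCount (untiedTarget τ y) v ≤
          (2 * t + 1) * palindromicBound (t + 1) v := by
        rw [← card_erase_firstLabel, ← smul_eq_mul]
        exact Finset.sum_le_card_nsmul _ _ _ fun y _ => ihv _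
      rw [palindromicBound]
      by_cases h : ∃ σ, extendPerm t σ = τ
      · obtain ⟨σ, rfl⟩ := h
        rw [palindromicCount_extendPerm_succ]
        exact add_le_add (ih σ _) h1
      · rw [palindromicCount_succ_of_notMem (not_exists.mp h)]
        exact h1.trans (Nat.le_add_left _ _)

/-- The radius of convergence is `1 / (2t - 1)`, so that `x = 1 / N` with `N ≥ 2t` is admissible. -/
theorem summable_palindromicBound {t : ℕ} {x : ℝ} (hx : 0 ≤ x) (ht : (2 * t : ℝ) * x ≤ 1) :
    Summable fun v => (palindromicBound t v : ℝ) * x ^ v := by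
  induction t with
  | zero =>
    refine summable_of_ne_finset_zero (s := {0}) fun v hv => ?_
    obtain ⟨v, rfl⟩ := Nat.exists_eq_succ_of_ne_zero (by simpa using hv)
    simp [palindromicBound]
  | succ t ih =>
    push_cast at ht
    have hs := ih (by nlinarith)
    set c := (2 * t + 1 : ℝ) * x with hc
    have hc1 : c < 1 := by
      rcases hx.eq_or_lt with h | h
      · simp [hc, ← h]
      · nlinarith
    set S := ∑' v, (palindromicBound t v : ℝ) * x ^ v with hS
    have hbound : ∀ n, ∑ v ∈ Finset.range n, (palindromicBound (t + 1) v : ℝ) * x ^ v ≤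
        (1 + S) / (1 - c) := by
      have h0 : 0 ≤ S := tsum_nonneg fun v => by positivity
      intro n
      induction n with
      | zero => simpa using div_nonneg (by linarith) (by linarith)
      | succ n ihn =>
        have h1 : ∑ v ∈ Finset.range n, (palindromicBound t (v + 1) : ℝ) * x ^ (v + 1) ≤ S :=
          ((summable_nat_add_iff 1).mpr hs).sum_le_tsum _ (fun v _ => by positivity) |>.trans (by
            rw [hS, hs.tsum_eq_zero_add]
            exact le_add_of_nonneg_left (by positivity))
        rw [Finset.sum_range_succ']
        have h2 : ∑ v ∈ Finset.range n, (palindromicBound (t + 1) (v + 1) : ℝ) * x ^ (v + 1) =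
            ∑ v ∈ Finset.range n, (palindromicBound t (v + 1) : ℝ) * x ^ (v + 1) +
              c * ∑ v ∈ Finset.range n, (palindromicBound (t + 1) v : ℝ) * x ^ v := by
          rw [Finset.mul_sum, ← Finset.sum_add_distrib]
          refine Finset.sum_congr rfl fun v _ => ?_
          rw [palindromicBound, hc]
          push_cast
          ring
        have hc0 : 0 ≤ c := by positivity
        have h3 := mul_le_mul_of_nonneg_left ihn hc0
        have h4 : c * ((1 + S) / (1 - c)) + (1 + S) = (1 + S) / (1 - c) := by
          field_simp [show (1 - c) ≠ 0 by linarith]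
          ring
        have h5 : (palindromicBound (t + 1) 0 : ℝ) = 1 := by simp [palindromicBound]
        rw [h2, h5]
        linarith
    exact summable_of_sum_range_le (fun v => by positivity) hbound

theorem summable_palindromicCount {t : ℕ} (τ : Perm (EndLabel t)) {x : ℝ} (hx : 0 ≤ x)
    (ht : (2 * t : ℝ) * x ≤ 1) : Summable fun v => (palindromicCount τ v : ℝ) * x ^ v :=
  (summable_palindromicBound hx ht).of_nonneg_of_le (fun v => by positivity) fun v =>
    mul_le_mul_of_nonneg_right (Nat.cast_le.mpr (palindromicCount_le τ v)) (by positivity)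

/-! ### Operators that commute with all tensor powers of unitary matrices -/

section TensorPower

variable {ι : Type*} [Fintype ι] {N : ℕ}

/-- The matrix of `g ⊗ ⋯ ⊗ g`, with one factor for every element of `ι`. -/
def tensorPow (ι : Type*) [Fintype ι] {N : ℕ} (g : Matrix (Fin N) (Fin N) ℂ) :
    Matrix (ι → Fin N) (ι → Fin N) ℂ :=
  Matrix.of fun a c => ∏ z, g (a z) (c z)

theorem tensorPow_one : tensorPow ι (1 : Matrix (Fin N) (Fin N) ℂ) = 1 := by
  ext a b
  simp only [tensorPow, Matrix.of_apply, Matrix.one_apply, Fintype.prod_ite_zero,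
    Finset.prod_const_one, funext_iff]

theorem tensorPow_conjTranspose (g : Matrix (Fin N) (Fin N) ℂ) :
    tensorPow ι g.conjTranspose = (tensorPow ι g).conjTranspose := by
  ext a b
  simp [tensorPow, Matrix.conjTranspose_apply]

theorem tensorPow_diagonal_eq (u : Fin N → ℂ) :
    tensorPow ι (Matrix.diagonal u) = Matrix.diagonal fun a => ∏ z, u (a z) := by
  ext a b
  simp only [tensorPow, Matrix.of_apply, Matrix.diagonal_apply, Fintype.prod_ite_zero, funext_iff]

variable [DecidableEq ι]

theorem tensorPow_mul (g h : Matrix (Fin N) (Fin N) ℂ) :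
    tensorPow ι (g * h) = tensorPow ι g * tensorPow ι h := by
  ext a b
  simp only [tensorPow, Matrix.mul_apply, Matrix.of_apply, Finset.prod_univ_sum,
    Fintype.piFinset_univ, Finset.prod_mul_distrib]

/-- Commutation with diagonal unitary matrices: matrix elements between basis tensors vanish
unless these contain the same basis vectors the same number of times. -/
theorem card_eq_of_commute_tensorPow {R : Matrix (ι → Fin N) (ι → Fin N) ℂ}
    (hR : ∀ g ∈ Matrix.unitaryGroup (Fin N) ℂ, R * tensorPow ι g = tensorPow ι g * R)
    {a b : ι → Fin N} (hab : R a b ≠ 0) (k : Fin N) :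
    (Finset.univ.filter fun z => a z = k).card = (Finset.univ.filter fun z => b z = k).card := by
  set n := Fintype.card ι + 1 with hn
  set ζ : ℂ := Complex.exp (2 * Real.pi * Complex.I / n) with hζ
  have hprim : IsPrimitiveRoot ζ n := Complex.isPrimitiveRoot_exp n (by omega)
  have hnorm : star ζ * ζ = 1 := by
    have h1 : ‖ζ‖ = 1 := hprim.norm'_eq_one (by omega)
    have h2 := Complex.conj_mul' ζ
    rw [h1] at h2
    simpa using h2
  set u : Fin N → ℂ := fun x => if x = k then ζ else 1 with hu
  have hmem : Matrix.diagonal u ∈ Matrix.unitaryGroup (Fin N) ℂ := by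
    rw [Matrix.mem_unitaryGroup_iff', Matrix.star_eq_conjTranspose,
      Matrix.diagonal_conjTranspose, Matrix.diagonal_mul_diagonal, ← Matrix.diagonal_one]
    congr 1
    funext x
    by_cases hx : x = k
    · simpa [hu, hx] using hnorm
    · simp [hu, hx]
  have h := congrFun (congrFun (hR _ hmem) a) b
  rw [tensorPow_diagonal_eq, Matrix.mul_diagonal, Matrix.diagonal_mul, mul_comm] at h
  have h2 := mul_right_cancel₀ hab h
  have h3 : ∀ c : ι → Fin N, ∏ z, u (c z) = ζ ^ (Finset.univ.filter fun z => c z = k).card := by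
    intro c
    rw [hu, Finset.prod_ite, Finset.prod_const_one, mul_one, Finset.prod_const]
  rw [h3, h3] at h2
  have hlt : ∀ c : ι → Fin N, (Finset.univ.filter fun z => c z = k).card < n := fun c =>
    Nat.lt_succ_of_le (Finset.card_le_univ _)
  exact (hprim.pow_inj (hlt b) (hlt a) h2).symm

/-- `R` annihilates the image under `g ⊗ ⋯ ⊗ g` of a basis tensor that it annihilates. -/
theorem column_eq_zero_of_tensorPow {R : Matrix (ι → Fin N) (ι → Fin N) ℂ}
    (hR : ∀ g ∈ Matrix.unitaryGroup (Fin N) ℂ, R * tensorPow ι g = tensorPow ι g * R)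
    {b' : ι → Fin N} (hb' : ∀ a, R a b' = 0) {g : Matrix (Fin N) (Fin N) ℂ}
    (hg : g ∈ Matrix.unitaryGroup (Fin N) ℂ) (a : ι → Fin N) :
    ∑ c, R a c * ∏ z, g (c z) (b' z) = 0 := by
  have h := congrFun (congrFun (hR g hg) a) b'
  simpa [Matrix.mul_apply, hb', tensorPow] using h

/-- The reflection along the unit vector `(3/5) e_i + (4/5) e_j`. -/
noncomputable def planeReflection (i j : Fin N) : Matrix (Fin N) (Fin N) ℂ :=
  let v : Fin N → ℂ := Pi.single i (3 / 5) + Pi.single j (4 / 5)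
  1 - (2 : ℂ) • Matrix.vecMulVec v v

theorem planeReflection_mem {i j : Fin N} (hij : i ≠ j) :
    planeReflection i j ∈ Matrix.unitaryGroup (Fin N) ℂ := by
  set v : Fin N → ℂ := Pi.single i (3 / 5) + Pi.single j (4 / 5) with hv
  have hvv : v ⬝ᵥ v = 1 := by
    simp [hv, dotProduct_add, hij, hij.symm]
    norm_num
  have hstar : star v = v := by
    funext x
    simp only [hv, Pi.star_apply, Pi.add_apply, Pi.single_apply]
    split_ifs <;> simp
  rw [Matrix.mem_unitaryGroup_iff]
  have h1 : star (planeReflection i j) = planeReflection i j := by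
    rw [planeReflection, ← hv, Matrix.star_eq_conjTranspose, Matrix.conjTranspose_sub,
      Matrix.conjTranspose_one, Matrix.conjTranspose_smul, Matrix.conjTranspose_vecMulVec, hstar]
    simp
  rw [h1, planeReflection, ← hv]
  have h2 : Matrix.vecMulVec v v * Matrix.vecMulVec v v = Matrix.vecMulVec v v := by
    rw [Matrix.vecMulVec_mul_vecMulVec, hvv]
    simp
  simp only [sub_mul, mul_sub, one_mul, mul_one, smul_mul_smul_comm, h2]
  ext x y
  simp
  ring

theorem planeReflection_apply_of_ne {i j y : Fin N} (hi : y ≠ i) (hj : y ≠ j) (x : Fin N) :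
    planeReflection i j x y = if x = y then 1 else 0 := by
  simp [planeReflection, Matrix.vecMulVec_apply, Matrix.one_apply, hi, hj]

theorem planeReflection_apply_of_ne' {i j x : Fin N} (hi : x ≠ i) (hj : x ≠ j) (y : Fin N) :
    planeReflection i j x y = if x = y then 1 else 0 := by
  simp [planeReflection, Matrix.vecMulVec_apply, Matrix.one_apply, hi, hj]

theorem planeReflection_same {i j : Fin N} (hij : i ≠ j) : planeReflection i j i i ≠ 0 := by
  simp [planeReflection, Matrix.vecMulVec_apply, hij]
  norm_num

theorem planeReflection_left_right {i j : Fin N} (hij : i ≠ j) :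
    planeReflection i j i j ≠ 0 := by
  simp [planeReflection, Matrix.vecMulVec_apply, hij, hij.symm]

/-- If a basis vector `e_j` occurs exactly once in a basis tensor annihilated by `R`, then `R` also
annihilates the tensor in which it is replaced by any other basis vector. -/
theorem column_eq_zero_of_update {R : Matrix (ι → Fin N) (ι → Fin N) ℂ}
    (hR : ∀ g ∈ Matrix.unitaryGroup (Fin N) ℂ, R * tensorPow ι g = tensorPow ι g * R)
    {b : ι → Fin N} {j : Fin N} (hj : ∀ z, b z ≠ j) (k : ι)
    (hb' : ∀ a, R a (Function.update b k j) = 0) (a : ι → Fin N) : R a b = 0 := by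
  by_contra hab
  set g := planeReflection (b k) j with hg
  set b' := Function.update b k j with hb'_def
  have hgmem : g ∈ Matrix.unitaryGroup (Fin N) ℂ := planeReflection_mem (hj k)
  have hsum := column_eq_zero_of_tensorPow hR hb' hgmem a
  -- the other components of the image of `b'` contain other basis vectors than `b`
  rw [Finset.sum_eq_single b] at hsum
  · rcases mul_eq_zero.mp hsum with h | h
    · exact hab h
    · obtain ⟨z, -, hz⟩ := Finset.prod_eq_zero_iff.mp h
      by_cases hzk : z = k
      · subst hzk
        rw [hb'_def, Function.update_self] at hz
        exact planeReflection_left_right (hj z) hz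
      · rw [hb'_def, Function.update_of_ne hzk] at hz
        by_cases hzi : b z = b k
        · rw [hzi] at hz
          exact planeReflection_same (hj k) hz
        · rw [hg, planeReflection_apply_of_ne hzi (hj z)] at hz
          simp at hz
  · intro c _ hcb
    by_contra hne
    obtain ⟨h1, h2⟩ := mul_ne_zero_iff.mp hne
    apply hcb
    have hc : ∀ z, c z ≠ j := by
      intro z hz
      have h3 := (card_eq_of_commute_tensorPow hR h1 j).symm.trans
        (card_eq_of_commute_tensorPow hR hab j)
      rw [Finset.filter_false_of_mem (s := Finset.univ) (p := fun z => b z = j)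
        (fun z _ => hj z), Finset.card_empty, Finset.card_eq_zero] at h3
      exact Finset.notMem_empty z (h3 ▸ Finset.mem_filter.mpr ⟨Finset.mem_univ z, hz⟩)
    funext z
    have h4 : g (c z) (b' z) ≠ 0 := Finset.prod_ne_zero_iff.mp h2 z (Finset.mem_univ z)
    by_cases hci : c z = b k
    · by_cases hzk : z = k
      · rw [hci, hzk]
      · by_contra hne'
        rw [hb'_def, Function.update_of_ne hzk, hg,
          planeReflection_apply_of_ne (fun h => hne' (hci.trans h.symm)) (hj z),
          if_neg hne'] at h4
        exact h4 rfl
    · rw [hg, planeReflection_apply_of_ne' hci (hc z)] at h4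
      have h5 : c z = b' z := by
        by_contra h
        exact h4 (if_neg h)
      by_cases hzk : z = k
      · rw [hzk, hb'_def, Function.update_self, ← hzk] at h5
        exact absurd h5 (hc z)
      · rwa [hb'_def, Function.update_of_ne hzk] at h5
  · simp

theorem column_eq_zero_of_perm {R : Matrix (ι → Fin N) (ι → Fin N) ℂ}
    (hR : ∀ g ∈ Matrix.unitaryGroup (Fin N) ℂ, R * tensorPow ι g = tensorPow ι g * R)
    {b : ι → Fin N} (hb : ∀ a, R a b = 0) (p : Perm (Fin N)) (a : ι → Fin N) :
    R a (p ∘ b) = 0 := by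
  set g : Matrix (Fin N) (Fin N) ℂ := Matrix.of fun x y => if x = p y then 1 else 0 with hg
  have hmem : g ∈ Matrix.unitaryGroup (Fin N) ℂ := by
    rw [Matrix.mem_unitaryGroup_iff']
    ext x y
    simp [hg, Matrix.mul_apply, Matrix.one_apply, Matrix.star_apply, @eq_comm _ y x]
  have h := column_eq_zero_of_tensorPow hR hb hmem a
  rw [Finset.sum_eq_single (p ∘ b)] at h
  · simpa [hg] using h
  · intro c _ hc
    have : ∃ z, c z ≠ p (b z) := by
      by_contra! h'
      exact hc (funext h')
    obtain ⟨z, hz⟩ := this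
    rw [Finset.prod_eq_zero (Finset.mem_univ z) (by simp [hg, hz]), mul_zero]
  · simp

/-- The tensor `e₁ ⊗ ⋯ ⊗ e_n` of different basis vectors generates the `n`-th tensor power as a
module over the algebra generated by the tensor powers of unitary matrices. -/
theorem eq_zero_of_commute_tensorPow {R : Matrix (ι → Fin N) (ι → Fin N) ℂ}
    (hR : ∀ g ∈ Matrix.unitaryGroup (Fin N) ℂ, R * tensorPow ι g = tensorPow ι g * R)
    {b₀ : ι → Fin N} (hb₀ : Function.Injective b₀) (h₀ : ∀ a, R a b₀ = 0) : R = 0 := by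
  have hle : Fintype.card ι ≤ N := by
    simpa using Fintype.card_le_of_injective b₀ hb₀
  suffices h : ∀ n, ∀ b : ι → Fin N, Fintype.card ι - (Finset.univ.image b).card = n →
      ∀ a, R a b = 0 by
    ext a b
    exact h _ b rfl a
  intro n
  induction n with
  | zero =>
    intro b hb a
    have hcard : (Finset.univ.image b).card = (Finset.univ : Finset ι).card :=
      le_antisymm Finset.card_image_le (by rw [Finset.card_univ]; omega)
    have hinj : Function.Injective b := fun x y hxy =>
      Finset.injOn_of_card_image_eq hcard (Finset.mem_coe.mpr (Finset.mem_univ x))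
        (Finset.mem_coe.mpr (Finset.mem_univ y)) hxy
    obtain ⟨p, hp⟩ := Perm.exists_extending_pair b₀ b hb₀ hinj
    have : b = p ∘ b₀ := by
      funext z; exact (hp z).symm
    rw [this]
    exact column_eq_zero_of_perm hR h₀ p a
  | succ n ih =>
    intro b hb a
    have hninj : ¬ Function.Injective b := by
      intro hinj
      rw [Finset.card_image_of_injective _ hinj, Finset.card_univ, Nat.sub_self] at hb
      omega
    rw [Function.Injective] at hninj
    push Not at hninj
    obtain ⟨k, l, hkl, hne⟩ := hninj
    obtain ⟨j, hj⟩ : ∃ j, j ∉ Finset.univ.image b := by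
      by_contra! h
      have h1 : Finset.univ.image b = Finset.univ := Finset.eq_univ_iff_forall.mpr h
      rw [h1, Finset.card_univ, Fintype.card_fin] at hb
      omega
    have hj' : ∀ z, b z ≠ j := fun z hz =>
      hj (Finset.mem_image.mpr ⟨z, Finset.mem_univ z, hz⟩)
    refine column_eq_zero_of_update hR hj' k (ih _ ?_) a
    have himage : Finset.univ.image (Function.update b k j) =
        insert j (Finset.univ.image b) := by
      ext x
      simp only [Finset.mem_image, Finset.mem_univ, true_and, Finset.mem_insert]
      constructor
      · rintro ⟨z, rfl⟩
        by_cases hz : z = k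
        · left; rw [hz, Function.update_self]
        · right; exact ⟨z, (Function.update_of_ne hz _ _).symm⟩
      · rintro (rfl | ⟨z, rfl⟩)
        · exact ⟨k, Function.update_self _ _ _⟩
        · by_cases hz : z = k
          · exact ⟨l, by rw [Function.update_of_ne hne.symm, hz, hkl]⟩
          · exact ⟨z, Function.update_of_ne hz _ _⟩
    rw [himage, Finset.card_insert_of_notMem hj]
    omega

end TensorPower

/-! ### Class coefficients of the Circular Orthogonal Ensemble -/

section Average

variable {N t : ℕ}

instance isMulLeftInvariant_cueMeasure (N : ℕ) : (cueMeasure N).IsMulLeftInvariant :=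
  inferInstanceAs (Measure.haarMeasure ⊤).IsMulLeftInvariant

instance isProbabilityMeasure_cueMeasure (N : ℕ) : IsProbabilityMeasure (cueMeasure N) :=
  ⟨Measure.haarMeasure_self⟩

/-- The product `W_{a₁ a₁̄} ⋯ W_{a_t a_t̄}` of matrix elements. -/
def entryProd (W : Matrix (Fin N) (Fin N) ℂ) (a : EndLabel t → Fin N) : ℂ :=
  ∏ j : Fin t, W (a (j, false)) (a (j, true))

/-- The symmetric unitary matrix `U Uᵀ`. -/
def coeMatrix (U : Matrix.unitaryGroup (Fin N) ℂ) : Matrix (Fin N) (Fin N) ℂ :=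
  (U : Matrix (Fin N) (Fin N) ℂ) * (U : Matrix (Fin N) (Fin N) ℂ).transpose

theorem coeAverage_eq (a b : EndLabel t → Fin N) :
    coeAverage a b =
      ∫ U, entryProd (coeMatrix U) a * star (entryProd (coeMatrix U) b) ∂(cueMeasure N) := by
  simp only [coeAverage, entryProd, coeMatrix, star_prod]

theorem continuous_coeMatrix_apply (x y : Fin N) :
    Continuous fun U : Matrix.unitaryGroup (Fin N) ℂ => coeMatrix U x y := by
  have h : ∀ i j, Continuous fun U : Matrix.unitaryGroup (Fin N) ℂ =>
      (U : Matrix (Fin N) (Fin N) ℂ) i j := fun i j =>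
    continuous_subtype_val.matrix_elem i j
  simp only [coeMatrix, Matrix.mul_apply, Matrix.transpose_apply]
  exact continuous_finsetSum _ fun i _ => (h _ _).mul (h _ _)

theorem continuous_entryProd (a : EndLabel t → Fin N) :
    Continuous fun U : Matrix.unitaryGroup (Fin N) ℂ => entryProd (coeMatrix U) a :=
  continuous_finsetProd _ fun _ _ => continuous_coeMatrix_apply _ _

theorem integrable_of_continuous {f : Matrix.unitaryGroup (Fin N) ℂ → ℂ} (hf : Continuous f) :
    Integrable f (cueMeasure N) :=
  hf.integrable_of_hasCompactSupport (HasCompactSupport.of_compactSpace f)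

theorem integrable_entryProd (a b : EndLabel t → Fin N) :
    Integrable (fun U => entryProd (coeMatrix U) a * star (entryProd (coeMatrix U) b))
      (cueMeasure N) :=
  integrable_of_continuous ((continuous_entryProd a).mul (continuous_entryProd b).star)

theorem coeMatrix_mul (g U : Matrix.unitaryGroup (Fin N) ℂ) :
    coeMatrix (g * U) = (g : Matrix (Fin N) (Fin N) ℂ) * coeMatrix U *
      (g : Matrix (Fin N) (Fin N) ℂ).transpose := by
  simp [coeMatrix, Matrix.transpose_mul, Matrix.mul_assoc]

theorem coeMatrix_symm (U : Matrix.unitaryGroup (Fin N) ℂ) (x y : Fin N) :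
    coeMatrix U x y = coeMatrix U y x := by
  simp only [coeMatrix, Matrix.mul_apply, Matrix.transpose_apply, mul_comm]

theorem coeMatrix_mem (U : Matrix.unitaryGroup (Fin N) ℂ) :
    coeMatrix U ∈ Matrix.unitaryGroup (Fin N) ℂ := by
  refine mul_mem U.2 ?_
  rw [Matrix.mem_unitaryGroup_iff']
  have h := Matrix.mem_unitaryGroup_iff.mp U.2
  have h2 := congrArg Matrix.transpose h
  rw [Matrix.transpose_mul, Matrix.transpose_one] at h2
  rw [← h2]
  congr 1

/-- The families of indices of `t` pairs of labels, as families of pairs of indices. -/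
def pairIndexEquiv (N t : ℕ) : (EndLabel t → Fin N) ≃ (Fin t → Fin N × Fin N) where
  toFun c j := (c (j, false), c (j, true))
  invFun q z := if z.2 then (q z.1).2 else (q z.1).1
  left_inv c := by
    funext ⟨j, ε⟩
    cases ε <;> rfl
  right_inv q := rfl

theorem entryProd_conj (g W : Matrix (Fin N) (Fin N) ℂ) (a : EndLabel t → Fin N) :
    entryProd (g * W * g.transpose) a =
      ∑ c : EndLabel t → Fin N, tensorPow (EndLabel t) g a c * entryProd W c := by
  have h1 : ∀ x y, (g * W * g.transpose) x y =
      ∑ q : Fin N × Fin N, g x q.1 * g y q.2 * W q.1 q.2 := by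
    intro x y
    rw [Fintype.sum_prod_type_right]
    simp only [Matrix.mul_apply, Matrix.transpose_apply, Finset.sum_mul]
    exact Finset.sum_congr rfl fun i _ => Finset.sum_congr rfl fun j _ => by ring
  simp only [entryProd, h1, Finset.prod_univ_sum, Fintype.piFinset_univ]
  rw [← (pairIndexEquiv N t).sum_comp]
  refine Finset.sum_congr rfl fun c _ => ?_
  rw [tensorPow, Matrix.of_apply, Fintype.prod_prod_type, ← Finset.prod_mul_distrib]
  refine Finset.prod_congr rfl fun j _ => ?_
  simp [pairIndexEquiv, mul_comm]

/-- The matrix of all COE averages of order `t`. -/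
noncomputable def averageMatrix (N t : ℕ) : Matrix (EndLabel t → Fin N) (EndLabel t → Fin N) ℂ :=
  Matrix.of coeAverage

/-- Left invariance of the Haar measure. -/
theorem averageMatrix_eq_conj (g : Matrix.unitaryGroup (Fin N) ℂ) :
    averageMatrix N t = tensorPow (EndLabel t) (g : Matrix (Fin N) (Fin N) ℂ) *
      averageMatrix N t * (tensorPow (EndLabel t) (g : Matrix (Fin N) (Fin N) ℂ)).conjTranspose := by
  ext a b
  rw [averageMatrix, Matrix.of_apply, coeAverage_eq, ← integral_mul_left_eq_self _ g]
  simp only [coeMatrix_mul, entryProd_conj, star_sum, Finset.sum_mul, Finset.mul_sum,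
    Matrix.mul_apply, Matrix.of_apply, Matrix.conjTranspose_apply]
  rw [integral_finsetSum]
  swap
  · intro c _
    refine integrable_finsetSum _ fun c' _ => integrable_of_continuous ?_
    exact (continuous_const.mul (continuous_entryProd _)).mul
      (continuous_const.mul (continuous_entryProd _)).star
  refine Finset.sum_congr rfl fun c _ => ?_
  rw [integral_finsetSum]
  swap
  · intro c' _
    refine integrable_of_continuous ?_
    exact (continuous_const.mul (continuous_entryProd _)).mul
      (continuous_const.mul (continuous_entryProd _)).star
  refine Finset.sum_congr rfl fun c' _ => ?_
  rw [coeAverage_eq, mul_comm, ← mul_assoc, ← integral_const_mul]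
  refine integral_congr_ae (Filter.Eventually.of_forall fun U => ?_)
  simp only [star_mul]
  ring

theorem averageMatrix_commute {g : Matrix (Fin N) (Fin N) ℂ}
    (hg : g ∈ Matrix.unitaryGroup (Fin N) ℂ) :
    averageMatrix N t * tensorPow (EndLabel t) g = tensorPow (EndLabel t) g * averageMatrix N t := by
  have h := averageMatrix_eq_conj (t := t) ⟨g, hg⟩
  conv_lhs => rw [h]
  rw [Matrix.mul_assoc, ← tensorPow_conjTranspose, ← tensorPow_mul]
  have h2 : g.conjTranspose * g = 1 := Matrix.mem_unitaryGroup_iff'.mp hg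
  simp only [h2, tensorPow_one, Matrix.mul_one]

/-- The matrix of the action of a permutation of the tensor factors. -/
def permMatrix (N : ℕ) (π : Perm (EndLabel t)) :
    Matrix (EndLabel t → Fin N) (EndLabel t → Fin N) ℂ :=
  Matrix.of fun a b => ∏ z : EndLabel t, if a z = b (π z) then 1 else 0

theorem permMatrix_apply (π : Perm (EndLabel t)) (a b : EndLabel t → Fin N) :
    permMatrix N π a b = if a = b ∘ π then 1 else 0 := by
  simp [permMatrix, Fintype.prod_ite_zero, funext_iff]

theorem permMatrix_commute (π : Perm (EndLabel t)) (g : Matrix (Fin N) (Fin N) ℂ) :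
    permMatrix N π * tensorPow (EndLabel t) g = tensorPow (EndLabel t) g * permMatrix N π := by
  ext a b
  have h : ∀ c : EndLabel t → Fin N, a = c ∘ π ↔ c = a ∘ π.symm := by
    intro c
    rw [Equiv.eq_comp_symm, eq_comm]
  simp only [Matrix.mul_apply, permMatrix_apply, h, ite_mul, one_mul, zero_mul, mul_ite, mul_one,
    mul_zero, Finset.sum_ite_eq', Finset.mem_univ, if_true]
  simp only [tensorPow, Matrix.of_apply, Function.comp_apply]
  rw [← Equiv.prod_comp π]
  simp

/-- Class coefficients are the coefficients of the averages as a combination of the permutations of the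
tensor factors. -/
theorem isCOEClassCoeff_iff {V : Perm (EndLabel t) → ℂ} :
    IsCOEClassCoeff N t V ↔ averageMatrix N t = ∑ π, V π • permMatrix N π := by
  simp only [IsCOEClassCoeff, ← Matrix.ext_iff, Matrix.sum_apply, Matrix.smul_apply, smul_eq_mul]
  rfl

/-- Pairwise different indices single out one permutation. -/
theorem coeAverage_comp {V : Perm (EndLabel t) → ℂ} (hV : IsCOEClassCoeff N t V)
    {b : EndLabel t → Fin N} (hb : Function.Injective b) (σ : Perm (EndLabel t)) :
    coeAverage (b ∘ σ) b = V σ := by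
  have h := congrFun (congrFun (isCOEClassCoeff_iff.mp hV) (b ∘ σ)) b
  rw [Matrix.sum_apply] at h
  simp only [Matrix.smul_apply, permMatrix_apply, smul_eq_mul, mul_ite, mul_one, mul_zero] at h
  refine h.trans ?_
  rw [Finset.sum_eq_single σ]
  · simp
  · intro π _ hπ
    rw [if_neg]
    intro h
    exact hπ (Equiv.ext fun z => (hb (congrFun h z)).symm)
  · simp

theorem exists_injective_index (h : 2 * t ≤ N) :
    ∃ b : EndLabel t → Fin N, Function.Injective b := by
  have h1 : Fintype.card (EndLabel t) ≤ Fintype.card (Fin N) := by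
    simp only [Fintype.card_prod, Fintype.card_fin, Fintype.card_bool]; omega
  obtain ⟨e⟩ := Function.Embedding.nonempty_of_card_le h1
  exact ⟨e, e.injective⟩

/-- The difference between the averages and the combination of permutations with the coefficients read
off from pairwise different indices annihilates a tensor of different basis vectors, hence vanishes. -/
theorem existsUnique_isCOEClassCoeff (h : 2 * t ≤ N) :
    ∃! V : Perm (EndLabel t) → ℂ, IsCOEClassCoeff N t V := by
  obtain ⟨b, hb⟩ := exists_injective_index h
  refine ⟨fun σ => coeAverage (b ∘ σ) b, ?_, fun V hV =>
    funext fun σ => (coeAverage_comp hV hb σ).symm⟩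
  change IsCOEClassCoeff N t _
  rw [isCOEClassCoeff_iff, ← sub_eq_zero]
  set R := averageMatrix N t - ∑ π : Perm (EndLabel t), coeAverage (b ∘ π) b • permMatrix N π
    with hRdef
  have hR : ∀ g ∈ Matrix.unitaryGroup (Fin N) ℂ,
      R * tensorPow (EndLabel t) g = tensorPow (EndLabel t) g * R := by
    intro g hg
    rw [hRdef, Matrix.sub_mul, Matrix.mul_sub, averageMatrix_commute hg, Matrix.sum_mul,
      Matrix.mul_sum]
    congr 1
    refine Finset.sum_congr rfl fun π _ => ?_
    rw [Matrix.smul_mul, Matrix.mul_smul, permMatrix_commute]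
  refine eq_zero_of_commute_tensorPow hR hb fun a => ?_
  by_contra hne
  -- the two index families contain the same values, so that one is a permutation of the other
  have hcard := card_eq_of_commute_tensorPow hR hne
  have hmem : ∀ z, ∃ y, b y = a z := by
    intro z
    have h1 : 0 < (Finset.univ.filter fun y => a y = a z).card :=
      Finset.card_pos.mpr ⟨z, by simp⟩
    rw [hcard] at h1
    obtain ⟨y, hy⟩ := Finset.card_pos.mp h1
    exact ⟨y, (Finset.mem_filter.mp hy).2⟩
  choose f hf using hmem
  have hsurj : Function.Surjective f := by
    intro y
    have h1 : 0 < (Finset.univ.filter fun z => b z = b y).card :=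
      Finset.card_pos.mpr ⟨y, by simp⟩
    rw [← hcard] at h1
    obtain ⟨z, hz⟩ := Finset.card_pos.mp h1
    exact ⟨z, hb ((hf z).trans (Finset.mem_filter.mp hz).2)⟩
  set σ := Equiv.ofBijective f (Finite.surjective_iff_bijective.mp hsurj) with hσ
  have ha : a = b ∘ σ := funext fun z => (hf z).symm
  apply hne
  rw [hRdef, Matrix.sub_apply, Matrix.sum_apply, sub_eq_zero, ha, Finset.sum_eq_single σ]
  · simp [permMatrix_apply, averageMatrix]
  · intro π _ hπ
    rw [Matrix.smul_apply, permMatrix_apply, if_neg, smul_zero]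
    intro h
    exact hπ (Equiv.ext fun z => (hb (congrFun h z)).symm)
  · simp

end Average

/-! ### The recursion for class coefficients -/

section Recursion

variable {N t : ℕ}

theorem entryProd_comp_relabel (U : Matrix.unitaryGroup (Fin N) ℂ) (j : Fin (t + 1)) (ε : Bool)
    (a : EndLabel (t + 1) → Fin N) :
    entryProd (coeMatrix U) (a ∘ relabel j ε) = entryProd (coeMatrix U) a := by
  simp only [entryProd, Function.comp_apply, relabel_apply]
  rw [← Equiv.prod_comp (swap 0 j) fun i => coeMatrix U (a (i, false)) (a (i, true))]
  refine Finset.prod_congr rfl fun i _ => ?_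
  cases ε
  · simp
  · simpa using coeMatrix_symm U _ _

theorem classCoeff_relabel_mul (h : 2 * (t + 1) ≤ N) {V : Perm (EndLabel (t + 1)) → ℂ}
    (hV : IsCOEClassCoeff N (t + 1) V) (j : Fin (t + 1)) (ε : Bool)
    (w : Perm (EndLabel (t + 1))) : V (relabel j ε * w) = V w := by
  obtain ⟨b, hb⟩ := exists_injective_index h
  have hb' : Function.Injective (b ∘ relabel j ε) := hb.comp (relabel j ε).injective
  rw [← coeAverage_comp hV hb, ← coeAverage_comp hV hb' w, coeAverage_eq, coeAverage_eq]
  simp only [entryProd_comp_relabel, Perm.coe_mul, Function.comp_assoc]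

/-- Unitarity of the symmetric matrix `W`, applied to the factors with indices `1`. -/
theorem sum_coeAverage_update (a b : EndLabel (t + 1) → Fin N) :
    ∑ x, coeAverage (Function.update a (firstLabel t) x) (Function.update b (firstLabel t) x) =
      (if a (0, true) = b (0, true) then 1 else 0) *
        coeAverage (a ∘ shiftLabel t) (b ∘ shiftLabel t) := by
  have h1 : ∀ (U : Matrix.unitaryGroup (Fin N) ℂ) (c : EndLabel (t + 1) → Fin N) (x : Fin N),
      entryProd (coeMatrix U) (Function.update c (firstLabel t) x) =
        coeMatrix U x (c (0, true)) * entryProd (coeMatrix U) (c ∘ shiftLabel t) := by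
    intro U c x
    rw [entryProd, Fin.prod_univ_succ]
    congr 1
  have h2 : ∀ U : Matrix.unitaryGroup (Fin N) ℂ, ∑ x, coeMatrix U x (a (0, true)) *
      star (coeMatrix U x (b (0, true))) = if a (0, true) = b (0, true) then 1 else 0 := by
    intro U
    have h3 := congrFun (congrFun (Matrix.mem_unitaryGroup_iff'.mp (coeMatrix_mem U))
      (b (0, true))) (a (0, true))
    rw [Matrix.mul_apply, Matrix.one_apply] at h3
    simp only [@eq_comm _ (a (0, true))]
    rw [← h3]
    exact Finset.sum_congr rfl fun x _ => mul_comm _ _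
  simp only [coeAverage_eq]
  rw [← integral_finsetSum _ fun x _ => integrable_entryProd _ _, ← integral_const_mul]
  refine integral_congr_ae (Filter.Eventually.of_forall fun U => ?_)
  simp only [h1]
  rw [← h2 U, Finset.sum_mul]
  refine Finset.sum_congr rfl fun x _ => ?_
  rw [star_mul]
  ring

theorem update_comp_eq_iff {b : EndLabel (t + 1) → Fin N} (hb : Function.Injective b) (x : Fin N)
    (κ : Perm (EndLabel (t + 1))) :
    Function.update b (firstLabel t) x = Function.update b (firstLabel t) x ∘ κ ↔
      κ = 1 ∨ ∃ u, u ≠ firstLabel t ∧ x = b u ∧ κ = swap (firstLabel t) u := by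
  set p := firstLabel t with hp
  constructor
  · intro h
    have hz : ∀ z, Function.update b p x z = Function.update b p x (κ z) := fun z => congrFun h z
    -- a label other than `1` that is not fixed is sent to `1`, and its value is `x`
    have key : ∀ z, z ≠ p → κ z ≠ z → κ z = p ∧ b z = x := by
      intro z hzp hzk
      have h1 := hz z
      rw [Function.update_of_ne hzp] at h1
      by_cases h2 : κ z = p
      · rw [h2, Function.update_self] at h1
        exact ⟨h2, h1⟩
      · rw [Function.update_of_ne h2] at h1
        exact absurd (hb h1).symm hzk
    by_cases hone : ∀ z, z ≠ p → κ z = z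
    · left
      ext1 z
      by_cases hzp : z = p
      · by_contra hne
        have h3 : κ z ≠ p := fun h => hne (h.trans hzp.symm)
        exact hne (κ.injective (hone _ h3))
      · exact hone z hzp
    · push Not at hone
      obtain ⟨u, hup, hu⟩ := hone
      obtain ⟨hu1, hu2⟩ := key u hup hu
      refine Or.inr ⟨u, hup, hu2.symm, ?_⟩
      ext1 z
      by_cases hzu : z = u
      · rw [hzu, hu1, swap_apply_right]
      by_cases hzp : z = p
      · rw [hzp, swap_apply_left]
        by_contra hne
        have h4 := hz p
        have h5 : κ p ≠ p := fun h => hup (κ.injective (hu1.trans h.symm))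
        rw [Function.update_self, Function.update_of_ne h5, ← hu2] at h4
        exact hne (hb h4.symm)
      · rw [swap_apply_of_ne_of_ne hzp hzu]
        by_contra hne
        exact hzu (κ.injective ((key z hzp hne).1.trans hu1.symm))
  · rintro (rfl | ⟨u, hup, rfl, rfl⟩)
    · rfl
    · funext z
      rw [Function.comp_apply]
      by_cases hzp : z = p
      · rw [hzp, swap_apply_left, Function.update_self, Function.update_of_ne hup]
      by_cases hzu : z = u
      · rw [hzu, swap_apply_right, Function.update_self, Function.update_of_ne hup]
      · rw [swap_apply_of_ne_of_ne hzp hzu]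

/-- If the index of the label `1` is replaced by `x`, then two labels have the same index if `x` is the
index of another label `u`, and the transposition of `1` and `u` contributes as well. -/
theorem coeAverage_update_comp {V : Perm (EndLabel (t + 1)) → ℂ}
    (hV : IsCOEClassCoeff N (t + 1) V) {b : EndLabel (t + 1) → Fin N}
    (hb : Function.Injective b) (ρ : Perm (EndLabel (t + 1))) (x : Fin N) :
    coeAverage (Function.update b (firstLabel t) x ∘ ρ) (Function.update b (firstLabel t) x) =
      V ρ + ∑ u ∈ Finset.univ.erase (firstLabel t),
        if x = b u then V (swap (firstLabel t) u * ρ) else 0 := by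
  set c := Function.update b (firstLabel t) x with hc
  have h := congrFun (congrFun (isCOEClassCoeff_iff.mp hV) (c ∘ ρ)) c
  rw [Matrix.sum_apply] at h
  simp only [Matrix.smul_apply, permMatrix_apply, smul_eq_mul, mul_ite, mul_one, mul_zero] at h
  refine h.trans ?_
  rw [← Equiv.sum_comp (Equiv.mulRight ρ)]
  have h1 : ∀ κ : Perm (EndLabel (t + 1)), c ∘ ρ = c ∘ (Equiv.mulRight ρ κ) ↔ c = c ∘ κ := by
    intro κ
    rw [Equiv.coe_mulRight, Perm.coe_mul, ← Function.comp_assoc]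
    exact ρ.surjective.injective_comp_right.eq_iff
  simp only [h1]
  simp only [hc, update_comp_eq_iff hb, Equiv.coe_mulRight]
  by_cases hx : ∃ u, u ≠ firstLabel t ∧ x = b u
  · obtain ⟨u, hu, rfl⟩ := hx
    have h2 : ∀ κ : Perm (EndLabel (t + 1)),
        (κ = 1 ∨ ∃ v, v ≠ firstLabel t ∧ b u = b v ∧ κ = swap (firstLabel t) v) ↔
          κ ∈ ({1, swap (firstLabel t) u} : Finset (Perm (EndLabel (t + 1)))) := by
      intro κ
      simp only [Finset.mem_insert, Finset.mem_singleton]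
      refine or_congr_right ⟨?_, fun h => ⟨u, hu, rfl, h⟩⟩
      rintro ⟨v, -, hv, rfl⟩
      rw [hb hv]
    simp only [h2]
    rw [Finset.sum_ite_mem, Finset.univ_inter, Finset.sum_pair, one_mul]
    · congr 1
      rw [Finset.sum_eq_single u]
      · simp
      · intro v _ hv
        rw [if_neg fun h => hv (hb h).symm]
      · intro h
        exact absurd (Finset.mem_erase.mpr ⟨hu, Finset.mem_univ u⟩) h
    · intro h
      exact hu (swap_eq_one_iff.mp h.symm).symm
  · have h2 : ∀ κ : Perm (EndLabel (t + 1)),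
        (κ = 1 ∨ ∃ v, v ≠ firstLabel t ∧ x = b v ∧ κ = swap (firstLabel t) v) ↔ κ = 1 :=
      fun κ => ⟨fun h => h.resolve_right fun ⟨v, h3, h4, _⟩ => hx ⟨v, h3, h4⟩, Or.inl⟩
    simp only [h2]
    rw [Finset.sum_ite_eq', if_pos (Finset.mem_univ _), one_mul, Finset.sum_eq_zero, add_zero]
    intro u hu
    rw [if_neg fun h => hx ⟨u, (Finset.mem_erase.mp hu).1, h⟩]

/-- The sum over the common index `x` of the two labels `1`, evaluated once by unitarity of `W` and once
with the class coefficients. -/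
theorem classCoeff_recursion_of_fix {V : Perm (EndLabel (t + 1)) → ℂ}
    (hV : IsCOEClassCoeff N (t + 1) V) {b : EndLabel (t + 1) → Fin N}
    (hb : Function.Injective b) {ρ : Perm (EndLabel (t + 1))}
    (hρ : ρ (firstLabel t) = firstLabel t) :
    N * V ρ + ∑ u ∈ Finset.univ.erase (firstLabel t), V (swap (firstLabel t) u * ρ) =
      (if ρ (0, true) = (0, true) then 1 else 0) *
        coeAverage (b ∘ ρ ∘ shiftLabel t) (b ∘ shiftLabel t) := by
  have h := sum_coeAverage_update (b ∘ ρ) b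
  have h1 : ∀ x, Function.update (b ∘ ρ) (firstLabel t) x =
      Function.update b (firstLabel t) x ∘ ρ := by
    intro x
    funext z
    by_cases hz : z = firstLabel t
    · rw [hz, Function.update_self, Function.comp_apply, hρ, Function.update_self]
    · rw [Function.update_of_ne hz, Function.comp_apply, Function.comp_apply,
        Function.update_of_ne fun h2 => hz (ρ.injective (h2.trans hρ.symm))]
  simp only [h1, coeAverage_update_comp hV hb, Function.comp_apply, hb.eq_iff] at h
  rw [Function.comp_assoc] at h
  rw [← h, Finset.sum_add_distrib, Finset.sum_const, Finset.card_univ, Fintype.card_fin,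
    nsmul_eq_mul, Finset.sum_comm]
  congr 1
  refine Finset.sum_congr rfl fun u _ => ?_
  rw [Finset.sum_ite_eq', if_pos (Finset.mem_univ _)]

/-- The recursion for the class coefficients, in the form in which the right-hand side only depends on
the target permutation. -/
theorem classCoeff_recursion (h : 2 * (t + 1) ≤ N) {V : Perm (EndLabel (t + 1)) → ℂ}
    (hV : IsCOEClassCoeff N (t + 1) V) (w : Perm (EndLabel (t + 1))) :
    (orthTarget w (firstLabel t) ≠ firstLabel t ∧
      N * V w + ∑ y ∈ Finset.univ.erase (firstLabel t), V (w * swap (firstLabel t) y) = 0) ∨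
    ∃ w' : Perm (EndLabel t), orthTarget w = extendPerm t (orthTarget w') ∧
      ∀ V' : Perm (EndLabel t) → ℂ, IsCOEClassCoeff N t V' →
        N * V w + ∑ y ∈ Finset.univ.erase (firstLabel t), V (w * swap (firstLabel t) y) =
          V' w' := by
  obtain ⟨b, hb⟩ := exists_injective_index h
  set p := firstLabel t with hp
  set g := relabel (w p).1 (w p).2 with hg
  set ρ := g * w with hρ
  have hρp : ρ p = p := relabel_self _ _
  have hT : orthTarget ρ = orthTarget w := orthTarget_mul_left (relabel_commute _ _) w
  have hsum : ∑ u ∈ Finset.univ.erase p, V (swap p u * ρ) =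
      ∑ y ∈ Finset.univ.erase p, V (w * swap p y) := by
    symm
    refine Finset.sum_bij (fun y _ => ρ y) ?_ ?_ ?_ ?_
    · intro y hy
      refine Finset.mem_erase.mpr ⟨fun h => ?_, Finset.mem_univ _⟩
      exact (Finset.mem_erase.mp hy).1 (ρ.injective (h.trans hρp.symm))
    · intro y _ z _ hyz
      exact ρ.injective hyz
    · intro u hu
      refine ⟨ρ.symm u, Finset.mem_erase.mpr ⟨fun h => ?_, Finset.mem_univ _⟩, by simp⟩
      rw [Equiv.symm_apply_eq, hρp] at h
      exact (Finset.mem_erase.mp hu).1 h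
    · intro y _
      rw [← classCoeff_relabel_mul h hV (w p).1 (w p).2, ← mul_assoc, ← hg, ← hρ,
        mul_swap_eq_swap_mul, hρp]
  have hrec := classCoeff_recursion_of_fix hV hb hρp
  rw [hsum, hρ, hg, classCoeff_relabel_mul h hV, ← hg, ← hρ] at hrec
  by_cases hfix : ρ (0, true) = (0, true)
  · right
    obtain ⟨w', hw'⟩ := exists_extendPerm_eq (σ := ρ) fun ε => by cases ε <;> assumption
    refine ⟨w', by rw [← hT, ← hw', orthTarget_extendPerm], fun V' hV' => ?_⟩
    rw [hrec, if_pos hfix, one_mul]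
    have h1 : (b ∘ ρ ∘ shiftLabel t) = (b ∘ shiftLabel t) ∘ w' := by
      funext z
      simp [← hw']
    rw [h1]
    exact coeAverage_comp hV' (hb.comp (shiftLabel t).injective) w'
  · left
    refine ⟨fun h1 => hfix ?_, by rw [hrec, if_neg hfix, zero_mul]⟩
    have h4 := orthTarget_apply ρ (0, true)
    rw [hT, orthTarget_zero_true h1, eq_comm, Perm.inv_eq_iff_eq] at h4
    have h5 : ρ (0, false) = (0, false) := hρp
    rw [← h4, show barPerm (t + 1) (0, true) = (0, false) from rfl, h5]
    rfl

/-! ### Expansion of the class coefficients in palindromic primitive factorizations -/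

/-- The series `∑_v (-1)^v p_v(τ) N^{-t-v}`. -/
noncomputable def factorizationSum (N : ℕ) (τ : Perm (EndLabel t)) : ℂ :=
  ∑' v : ℕ, (-1) ^ v * (palindromicCount τ v : ℂ) / (N : ℂ) ^ (t + v)

theorem summable_factorization (h : 2 * t ≤ N) (τ : Perm (EndLabel t)) :
    Summable fun v : ℕ => (-1) ^ v * (palindromicCount τ v : ℂ) / (N : ℂ) ^ (t + v) := by
  have hx : (0 : ℝ) ≤ 1 / N := by positivity
  have h1 : (2 * t : ℝ) * (1 / N) ≤ 1 := by
    rcases Nat.eq_zero_or_pos N with rfl | hN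
    · simp
    · rw [mul_one_div, div_le_one (by exact_mod_cast hN)]
      exact_mod_cast h
  refine Summable.of_norm ((summable_congr fun v => ?_).mpr
    ((summable_palindromicCount τ hx h1).mul_right ((1 / (N : ℝ)) ^ t)))
  rw [norm_div, norm_mul, norm_pow, norm_neg, norm_one, one_pow, one_mul, norm_pow,
    Complex.norm_natCast, Complex.norm_natCast, pow_add, div_pow, div_pow, one_pow, one_pow]
  ring

/-- The recursion for the numbers of factorizations, summed up. The sequence `s` counts the
factorizations that do not move the label `1`. -/
theorem factorizationSum_recursion (h : 2 * (t + 1) ≤ N) (τ : Perm (EndLabel (t + 1)))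
    (s : ℕ → ℕ) (h0 : palindromicCount τ 0 = s 0)
    (hs : ∀ v, palindromicCount τ (v + 1) = s (v + 1) +
      ∑ y ∈ Finset.univ.erase (firstLabel t), palindromicCount (untiedTarget τ y) v) :
    N * factorizationSum N τ +
        ∑ y ∈ Finset.univ.erase (firstLabel t), factorizationSum N (untiedTarget τ y) =
      ∑' v : ℕ, (-1) ^ v * (s v : ℂ) / (N : ℂ) ^ (t + v) := by
  have hN : (N : ℂ) ≠ 0 := by
    rw [Nat.cast_ne_zero]; omega
  have hsum := summable_factorization h τ
  have hsum' : ∀ y, Summable fun v : ℕ =>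
      (-1) ^ v * (palindromicCount (untiedTarget τ y) v : ℂ) / (N : ℂ) ^ (t + 1 + v) := fun y =>
    summable_factorization h _
  have hterm : ∀ v, (-1) ^ (v + 1) * (s (v + 1) : ℂ) / (N : ℂ) ^ (t + (v + 1)) =
      N * ((-1) ^ (v + 1) * (palindromicCount τ (v + 1) : ℂ) / (N : ℂ) ^ (t + 1 + (v + 1))) +
        ∑ y ∈ Finset.univ.erase (firstLabel t),
          (-1) ^ v * (palindromicCount (untiedTarget τ y) v : ℂ) / (N : ℂ) ^ (t + 1 + v) := by
    intro v
    rw [← Finset.sum_div, ← Finset.mul_sum, hs]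
    push_cast
    rw [show t + 1 + (v + 1) = t + 1 + v + 1 by ring, show t + (v + 1) = t + 1 + v by ring,
      pow_succ (N : ℂ) (t + 1 + v)]
    field_simp
    ring
  have hsS : Summable fun v : ℕ => (-1) ^ v * (s v : ℂ) / (N : ℂ) ^ (t + v) := by
    rw [← summable_nat_add_iff 1]
    simp only [hterm]
    exact (((summable_nat_add_iff 1).mpr hsum).mul_left _).add (summable_sum fun y _ => hsum' y)
  rw [hsS.tsum_eq_zero_add]
  simp only [hterm]
  rw [Summable.tsum_add (((summable_nat_add_iff 1).mpr hsum).mul_left _)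
    (summable_sum fun y _ => hsum' y), tsum_mul_left,
    Summable.tsum_finsetSum fun y _ => hsum' y]
  simp only [factorizationSum]
  rw [hsum.tsum_eq_zero_add, h0, mul_add, add_assoc]
  congr 1
  rw [pow_zero, one_mul, add_zero, add_zero, pow_succ]
  field_simp

/-- The homogeneous recursion has only the trivial solution, because the sum has `2t + 1 < N` terms. -/
theorem eq_zero_of_recursion (h : 2 * (t + 1) ≤ N) {g : Perm (EndLabel (t + 1)) → ℂ}
    (hg : ∀ w, N * g w + ∑ y ∈ Finset.univ.erase (firstLabel t), g (w * swap (firstLabel t) y) = 0)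
    (w : Perm (EndLabel (t + 1))) : g w = 0 := by
  obtain ⟨w₀, hw₀⟩ := Finite.exists_max fun w => ‖g w‖
  have h1 : (N : ℝ) * ‖g w₀‖ ≤ (2 * t + 1 : ℕ) * ‖g w₀‖ := by
    have h2 : (N : ℂ) * g w₀ =
        -∑ y ∈ Finset.univ.erase (firstLabel t), g (w₀ * swap (firstLabel t) y) :=
      eq_neg_of_add_eq_zero_left (hg w₀)
    have h3 := congrArg norm h2
    rw [norm_mul, Complex.norm_natCast, norm_neg] at h3
    rw [h3, ← card_erase_firstLabel, ← nsmul_eq_mul]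
    exact (norm_sum_le _ _).trans (Finset.sum_le_card_nsmul _ _ _ fun y _ => hw₀ _)
  have h4 : (2 * t + 1 : ℕ) + 1 ≤ (N : ℝ) := by exact_mod_cast (by omega : 2 * t + 1 + 1 ≤ N)
  have h5 : ‖g w₀‖ ≤ 0 := by nlinarith [norm_nonneg (g w₀)]
  exact norm_le_zero_iff.mp ((hw₀ w).trans h5)

/-- Both sides satisfy the same recursion, whose solution is unique. -/
theorem classCoeff_eq_factorizationSum (h : 2 * t ≤ N) {V : Perm (EndLabel t) → ℂ}
    (hV : IsCOEClassCoeff N t V) (w : Perm (EndLabel t)) :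
    V w = factorizationSum N (orthTarget w) := by
  induction t with
  | zero =>
    obtain ⟨b, hb⟩ := exists_injective_index h
    have h1 : V w = 1 := by
      rw [← coeAverage_comp hV hb, coeAverage_eq]
      simp [entryProd]
    rw [h1, factorizationSum, tsum_eq_single 0]
    · rw [palindromicCount_zero, if_pos (Subsingleton.elim _ _)]
      simp
    · intro v hv
      obtain ⟨v, rfl⟩ := Nat.exists_eq_succ_of_ne_zero hv
      rw [palindromicCount_empty]
      simp
  | succ t ih =>
    have key : ∀ w, N * (V w - factorizationSum N (orthTarget w)) +
        ∑ y ∈ Finset.univ.erase (firstLabel t), (V (w * swap (firstLabel t) y) -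
          factorizationSum N (orthTarget (w * swap (firstLabel t) y))) = 0 := by
      intro w
      rw [Finset.sum_sub_distrib]
      simp only [← untiedTarget_orthTarget]
      rcases classCoeff_recursion h hV w with ⟨hw, hrec⟩ | ⟨w', hw', hrec⟩
      · have hnot : ∀ σ, extendPerm t σ ≠ orthTarget w := fun σ hσ =>
          hw (by rw [← hσ]; exact extendPerm_zero _ _)
        have h2 := factorizationSum_recursion h (orthTarget w) (fun _ => 0)
          (palindromicCount_zero_of_notMem hnot)
          (fun v => by rw [palindromicCount_succ_of_notMem hnot, zero_add])
        simp only [Nat.cast_zero, mul_zero, zero_div, tsum_zero] at h2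
        linear_combination hrec - h2
      · obtain ⟨V', hV', -⟩ := existsUnique_isCOEClassCoeff (N := N) (t := t) (by omega)
        have h1 := hrec V' hV'
        rw [ih (by omega) hV'] at h1
        have h2 := factorizationSum_recursion h (orthTarget w) (palindromicCount (orthTarget w'))
          (by rw [hw', palindromicCount_extendPerm_zero])
          (fun v => by rw [hw', palindromicCount_extendPerm_succ])
        rw [← factorizationSum] at h2
        linear_combination h1 - h2
    exact sub_eq_zero.mp (eq_zero_of_recursion h key w)

end Recursion

/-! ### Diagrams encoded by three matchings of their half-edges -/

/-- The combinatorial data of an orthogonal diagram: of the two flags at an end of an edge one is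
solid, and it is taken to represent this end, called a half-edge.
* `mate x` is the other end of the edge;
* `solid x` is the half-edge that shares a solid corner with `x`, and `dashed x` the one that shares
  a dashed corner with `x`; both are `x` itself if `x` is attached to a leaf;
* `leaf z` is the half-edge attached to the leaf with label `z`.
The conditions on these data are collected in `Valid`. -/
structure HalfEdgeDiagram (L : Type) where
  Half : Type
  finite_half : Finite Half
  mate : Half → Half
  solid : Half → Half
  dashed : Half → Half
  leaf : L → Half

/-- The permutations `mate` and `corner` of the half-edges cut them into paths, one for each pair
of labels `{z, S z}`, that run from leaf to leaf. This is expressed by the sets which are closed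
under both permutations. -/
def LeafPaths {H L : Type} (S : L → L) (mate corner : H → H) (leaf : L → H) : Prop :=
  ∀ C : Set H, (∀ x ∈ C, mate x ∈ C) → (∀ x ∈ C, corner x ∈ C) →
    (C.Nonempty → ∃ z, leaf z ∈ C) ∧ ∀ z, leaf z ∈ C → leaf (S z) ∈ C

theorem LeafPaths.of_equiv {H H' L : Type} {S : L → L} {b s : H → H} {b' s' : H' → H'}
    {l : L → H} {l' : L → H'} (φ : H ≃ H') (hb : ∀ x, φ (b x) = b' (φ x))
    (hs : ∀ x, φ (s x) = s' (φ x)) (hl : ∀ z, φ (l z) = l' z) (h : LeafPaths S b s l) :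
    LeafPaths S b' s' l' := by
  intro C hbC hsC
  obtain ⟨h1, h2⟩ := h (φ ⁻¹' C) (fun x hx => by
    rw [Set.mem_preimage, hb]; exact hbC _ hx) (fun x hx => by
    rw [Set.mem_preimage, hs]; exact hsC _ hx)
  constructor
  · rintro ⟨y, hy⟩
    obtain ⟨z, hz⟩ := h1 ⟨φ.symm y, by simpa using hy⟩
    exact ⟨z, by rw [← hl]; exact hz⟩
  · intro z hz
    rw [← hl] at hz ⊢
    exact h2 z hz

namespace HalfEdgeDiagram

variable {L : Type}

/-- The conditions on the data of an orthogonal diagram whose solid paths join `z` to `S z` and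
whose dashed paths join `z` to `A z`. The vertices have even degree because the solid and the dashed
corners alternate; the condition `solid_ne_dashed` excludes internal vertices of degree 2. -/
structure Valid (S A : L → L) (D : HalfEdgeDiagram L) : Prop where
  mate_mate : ∀ x, D.mate (D.mate x) = x
  solid_solid : ∀ x, D.solid (D.solid x) = x
  dashed_dashed : ∀ x, D.dashed (D.dashed x) = x
  mate_ne : ∀ x, D.mate x ≠ x
  solid_eq_iff : ∀ x, D.solid x = x ↔ ∃ z, D.leaf z = x
  dashed_eq_iff : ∀ x, D.dashed x = x ↔ ∃ z, D.leaf z = x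
  leaf_injective : Function.Injective D.leaf
  solid_ne_dashed : ∀ x, D.solid x = D.dashed x → D.solid x = x
  solid_paths : LeafPaths S D.mate D.solid D.leaf
  dashed_paths : LeafPaths A D.mate D.dashed D.leaf

/-- A bijection of the half-edges that respects all the data. -/
structure IsIso (D D' : HalfEdgeDiagram L) (φ : D.Half ≃ D'.Half) : Prop where
  mate : ∀ x, φ (D.mate x) = D'.mate (φ x)
  solid : ∀ x, φ (D.solid x) = D'.solid (φ x)
  dashed : ∀ x, φ (D.dashed x) = D'.dashed (φ x)
  leaf : ∀ z, φ (D.leaf z) = D'.leaf z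

theorem IsIso.symm {D D' : HalfEdgeDiagram L} {φ : D.Half ≃ D'.Half} (h : IsIso D D' φ) :
    IsIso D' D φ.symm where
  mate x := by rw [Equiv.symm_apply_eq, h.mate, Equiv.apply_symm_apply]
  solid x := by rw [Equiv.symm_apply_eq, h.solid, Equiv.apply_symm_apply]
  dashed x := by rw [Equiv.symm_apply_eq, h.dashed, Equiv.apply_symm_apply]
  leaf z := by rw [Equiv.symm_apply_eq, h.leaf]

theorem IsIso.trans {D D' D'' : HalfEdgeDiagram L} {φ : D.Half ≃ D'.Half}
    {ψ : D'.Half ≃ D''.Half} (h : IsIso D D' φ) (k : IsIso D' D'' ψ) :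
    IsIso D D'' (φ.trans ψ) where
  mate x := by simp [h.mate, k.mate]
  solid x := by simp [h.solid, k.solid]
  dashed x := by simp [h.dashed, k.dashed]
  leaf z := by simp [h.leaf, k.leaf]

/-- Being isomorphic. -/
def Iso (D D' : HalfEdgeDiagram L) : Prop := ∃ φ : D.Half ≃ D'.Half, IsIso D D' φ

theorem Iso.refl (D : HalfEdgeDiagram L) : Iso D D :=
  ⟨Equiv.refl _, fun _ => rfl, fun _ => rfl, fun _ => rfl, fun _ => rfl⟩

theorem Iso.symm {D D' : HalfEdgeDiagram L} : Iso D D' → Iso D' D := fun ⟨_, h⟩ => ⟨_, h.symm⟩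

theorem Iso.trans {D D' D'' : HalfEdgeDiagram L} : Iso D D' → Iso D' D'' → Iso D D'' :=
  fun ⟨_, h⟩ ⟨_, k⟩ => ⟨_, h.trans k⟩

theorem Valid.of_iso {S A : L → L} {D D' : HalfEdgeDiagram L} (hD : Valid S A D)
    (hiso : Iso D D') : Valid S A D' := by
  obtain ⟨φ, h⟩ := hiso
  have hmem : ∀ x, (∃ z, D'.leaf z = φ x) ↔ ∃ z, D.leaf z = x := by
    intro x
    simp only [← h.leaf, φ.apply_eq_iff_eq]
  refine ⟨?_, ?_, ?_, ?_, ?_, ?_, ?_, ?_, hD.solid_paths.of_equiv φ h.mate h.solid h.leaf,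
    hD.dashed_paths.of_equiv φ h.mate h.dashed h.leaf⟩
  · rw [φ.surjective.forall]; intro x; rw [← h.mate, ← h.mate, hD.mate_mate]
  · rw [φ.surjective.forall]; intro x; rw [← h.solid, ← h.solid, hD.solid_solid]
  · rw [φ.surjective.forall]; intro x; rw [← h.dashed, ← h.dashed, hD.dashed_dashed]
  · rw [φ.surjective.forall]; intro x; rw [← h.mate, Ne, φ.apply_eq_iff_eq]; exact hD.mate_ne x
  · rw [φ.surjective.forall]; intro x
    rw [← h.solid, φ.apply_eq_iff_eq, hmem]; exact hD.solid_eq_iff x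
  · rw [φ.surjective.forall]; intro x
    rw [← h.dashed, φ.apply_eq_iff_eq, hmem]; exact hD.dashed_eq_iff x
  · intro y z hyz
    rw [← h.leaf, ← h.leaf, φ.apply_eq_iff_eq] at hyz
    exact hD.leaf_injective hyz
  · rw [φ.surjective.forall]; intro x
    rw [← h.dashed, ← h.solid, φ.apply_eq_iff_eq, φ.apply_eq_iff_eq]; exact hD.solid_ne_dashed x

/-- The vertices, including the leaves. -/
def Vertex (D : HalfEdgeDiagram L) : Type :=
  Quot fun x y : D.Half => y = D.solid x ∨ y = D.dashed x

/-- The vertex at which a half-edge lies. -/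
def vertexOf (D : HalfEdgeDiagram L) (x : D.Half) : D.Vertex := Quot.mk _ x

theorem vertexOf_solid (D : HalfEdgeDiagram L) (x : D.Half) :
    D.vertexOf (D.solid x) = D.vertexOf x :=
  (Quot.sound (r := fun x y : D.Half => y = D.solid x ∨ y = D.dashed x) (Or.inl rfl)).symm

theorem vertexOf_dashed (D : HalfEdgeDiagram L) (x : D.Half) :
    D.vertexOf (D.dashed x) = D.vertexOf x :=
  (Quot.sound (r := fun x y : D.Half => y = D.solid x ∨ y = D.dashed x) (Or.inr rfl)).symm

instance (D : HalfEdgeDiagram L) : Finite D.Half := D.finite_half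

instance (D : HalfEdgeDiagram L) : Finite D.Vertex :=
  Finite.of_surjective D.vertexOf Quot.mk_surjective

theorem Iso.card_half {D D' : HalfEdgeDiagram L} : Iso D D' →
    Nat.card D.Half = Nat.card D'.Half :=
  fun ⟨φ, _⟩ => Nat.card_congr φ

theorem Iso.card_vertex {D D' : HalfEdgeDiagram L} : Iso D D' →
    Nat.card D.Vertex = Nat.card D'.Vertex :=
  fun ⟨φ, h⟩ => Nat.card_congr (Quot.congr φ fun x y => by
    rw [← h.solid, ← h.dashed, φ.apply_eq_iff_eq, φ.apply_eq_iff_eq])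

namespace Valid

variable {S A : L → L} {D : HalfEdgeDiagram L}

theorem solid_leaf (hD : Valid S A D) (z : L) : D.solid (D.leaf z) = D.leaf z :=
  (hD.solid_eq_iff _).mpr ⟨z, rfl⟩

theorem dashed_leaf (hD : Valid S A D) (z : L) : D.dashed (D.leaf z) = D.leaf z :=
  (hD.dashed_eq_iff _).mpr ⟨z, rfl⟩

theorem mate_injective (hD : Valid S A D) : Function.Injective D.mate :=
  Function.Involutive.injective hD.mate_mate

theorem solid_injective (hD : Valid S A D) : Function.Injective D.solid :=
  Function.Involutive.injective hD.solid_solid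

theorem dashed_injective (hD : Valid S A D) : Function.Injective D.dashed :=
  Function.Involutive.injective hD.dashed_dashed

theorem solid_eq_leaf_iff (hD : Valid S A D) {x : D.Half} {z : L} :
    D.solid x = D.leaf z ↔ x = D.leaf z :=
  ⟨fun h => hD.solid_injective (h.trans (hD.solid_leaf z).symm), fun h => h ▸ hD.solid_leaf z⟩

theorem dashed_eq_leaf_iff (hD : Valid S A D) {x : D.Half} {z : L} :
    D.dashed x = D.leaf z ↔ x = D.leaf z :=
  ⟨fun h => hD.dashed_injective (h.trans (hD.dashed_leaf z).symm), fun h => h ▸ hD.dashed_leaf z⟩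

/-- There are no closed solid boundary components with only one corner. -/
theorem mate_ne_solid (hD : Valid S A D) {x : D.Half} (hx : ∀ z, D.leaf z ≠ x) :
    D.mate x ≠ D.solid x := by
  intro h
  obtain ⟨z, hz⟩ := (hD.solid_paths {x, D.mate x} (by
    rintro y (rfl | rfl)
    · simp
    · simp [hD.mate_mate]) (by
    rintro y (rfl | rfl)
    · simp [h]
    · simp [h, hD.solid_solid])).1 ⟨x, by simp⟩
  rcases hz with hz | hz
  · exact hx z hz
  · exact hx z (hD.solid_eq_leaf_iff.mp (h.symm.trans hz.symm)).symm

theorem mate_ne_dashed (hD : Valid S A D) {x : D.Half} (hx : ∀ z, D.leaf z ≠ x) :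
    D.mate x ≠ D.dashed x := by
  intro h
  obtain ⟨z, hz⟩ := (hD.dashed_paths {x, D.mate x} (by
    rintro y (rfl | rfl)
    · simp
    · simp [hD.mate_mate]) (by
    rintro y (rfl | rfl)
    · simp [h]
    · simp [h, hD.dashed_dashed])).1 ⟨x, by simp⟩
  rcases hz with hz | hz
  · exact hx z hz
  · exact hx z (hD.dashed_eq_leaf_iff.mp (h.symm.trans hz.symm)).symm

end Valid

end HalfEdgeDiagram

theorem exists_equiv_of_sum {α β ν : Type} (φ : α ⊕ ν ≃ β ⊕ ν) (h : ∀ n, φ (Sum.inr n) = Sum.inr n) :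
    ∃ ψ : α ≃ β, ∀ x, φ (Sum.inl x) = Sum.inl (ψ x) := by
  have h1 : ∀ x, ∃ y, φ (Sum.inl x) = Sum.inl y := by
    intro x
    rcases hx : φ (Sum.inl x) with y | n
    · exact ⟨y, rfl⟩
    · rw [← h n] at hx
      exact absurd (φ.injective hx) Sum.inl_ne_inr
  choose f hf using h1
  refine ⟨Equiv.ofBijective f ⟨?_, ?_⟩, hf⟩
  · intro x y hxy
    exact Sum.inl_injective (φ.injective (by rw [hf, hf, hxy]))
  · intro y
    rcases hx : φ.symm (Sum.inl y) with x | n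
    · refine ⟨x, Sum.inl_injective (β := ν) ?_⟩
      rw [← hf, ← hx, Equiv.apply_symm_apply]
    · have := congrArg φ hx
      rw [Equiv.apply_symm_apply, h] at this
      exact absurd this Sum.inl_ne_inr

theorem exists_equiv_sum_of_injective {α ν : Type} (f : ν → α) (hf : Function.Injective f) :
    ∃ e : {x // ∀ n, f n ≠ x} ⊕ ν ≃ α, (∀ x, e (Sum.inl x) = x.1) ∧ ∀ n, e (Sum.inr n) = f n := by
  refine ⟨Equiv.ofBijective (Sum.elim Subtype.val f) ⟨?_, ?_⟩, fun _ => rfl, fun _ => rfl⟩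
  · rintro (x | m) (y | n) hxy
    · exact congrArg _ (Subtype.ext hxy)
    · exact absurd hxy.symm (x.2 n)
    · exact absurd hxy (y.2 m)
    · exact congrArg _ (hf hxy)
  · intro y
    by_cases hy : ∃ n, f n = y
    · obtain ⟨n, rfl⟩ := hy
      exact ⟨Sum.inr n, rfl⟩
    · exact ⟨Sum.inl ⟨y, not_exists.mp hy⟩, rfl⟩

open Classical in
/-- The values of `f` in a subset, with `x` itself substituted where `f x` lies outside. -/
noncomputable def restrictTo {α : Type} {P : α → Prop} (f : α → α) (x : {x // P x}) : {x // P x} :=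
  if h : P (f x) then ⟨f x, h⟩ else x

theorem restrictTo_of {α : Type} {P : α → Prop} {f : α → α} {x : {x // P x}} (h : P (f x)) :
    (restrictTo f x).1 = f x := by
  rw [restrictTo, dif_pos h]

theorem restrictTo_of_not {α : Type} {P : α → Prop} {f : α → α} {x : {x // P x}} (h : ¬ P (f x)) :
    restrictTo f x = x := by
  rw [restrictTo, dif_neg h]

/-! ### Tying two leaves to a vertex of degree four -/

section Corner

open Classical in
/-- The corners of one kind after tying: the half-edges `u` and `v`, which were attached to leaves,
now share a corner with the new half-edges `(false, true)` and `(true, true)`, while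
`(false, false)` and `(true, false)` are attached to the new leaves. -/
noncomputable def tieCorner {H : Type} (f : H → H) (u v : H) : H ⊕ Bool × Bool → H ⊕ Bool × Bool
  | Sum.inl x => if x = u then Sum.inr (false, true) else if x = v then Sum.inr (true, true)
      else Sum.inl (f x)
  | Sum.inr (false, true) => Sum.inl u
  | Sum.inr (true, true) => Sum.inl v
  | Sum.inr (k, false) => Sum.inr (k, false)

/-- The old edges together with two edges `{(k, false), (k, true)}`. -/
def tieMate {H : Type} (b : H → H) : H ⊕ Bool × Bool → H ⊕ Bool × Bool :=
  Sum.map b fun n => (n.1, !n.2)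

open Classical in
/-- The leaves `p` and `q` are attached to new half-edges. -/
noncomputable def tieLeaf {H L : Type} (p q : L) (leaf : L → H) (z : L) : H ⊕ Bool × Bool :=
  if z = p then Sum.inr (false, false) else if z = q then Sum.inr (true, false)
    else Sum.inl (leaf z)

variable {H L : Type} {f : H → H} {u v : H}

@[simp] theorem tieCorner_left : tieCorner f u v (Sum.inl u) = Sum.inr (false, true) := by
  simp [tieCorner]

theorem tieCorner_right (h : u ≠ v) : tieCorner f u v (Sum.inl v) = Sum.inr (true, true) := by
  simp [tieCorner, h.symm]

theorem tieCorner_inl {x : H} (hu : x ≠ u) (hv : x ≠ v) :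
    tieCorner f u v (Sum.inl x) = Sum.inl (f x) := by
  simp [tieCorner, hu, hv]

@[simp] theorem tieCorner_inr_false (k : Bool) :
    tieCorner f u v (Sum.inr (k, false)) = Sum.inr (k, false) := by
  cases k <;> rfl

@[simp] theorem tieCorner_inr_false_true :
    tieCorner f u v (Sum.inr (false, true)) = Sum.inl u := rfl

@[simp] theorem tieCorner_inr_true_true :
    tieCorner f u v (Sum.inr (true, true)) = Sum.inl v := rfl

theorem tieCorner_involutive_iff (huv : u ≠ v) (hu : f u = u) (hv : f v = v) :
    (∀ x, tieCorner f u v (tieCorner f u v x) = x) ↔ ∀ x, f (f x) = x := by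
  constructor
  · intro h x
    by_cases hxu : x = u
    · rw [hxu, hu, hu]
    by_cases hxv : x = v
    · rw [hxv, hv, hv]
    have h1 := h (Sum.inl x)
    rw [tieCorner_inl hxu hxv] at h1
    by_cases h2 : f x = u
    · rw [h2, tieCorner_left] at h1; simp at h1
    by_cases h3 : f x = v
    · rw [h3, tieCorner_right huv] at h1; simp at h1
    rw [tieCorner_inl h2 h3] at h1
    exact Sum.inl_injective h1
  · intro h
    have hinj : Function.Injective f := Function.Involutive.injective h
    rintro (x | ⟨_ | _, _ | _⟩)
    · by_cases hxu : x = u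
      · rw [hxu]; simp
      by_cases hxv : x = v
      · rw [hxv, tieCorner_right huv]; simp
      rw [tieCorner_inl hxu hxv, tieCorner_inl, h]
      · exact fun h1 => hxu (hinj (h1.trans hu.symm))
      · exact fun h1 => hxv (hinj (h1.trans hv.symm))
    · simp
    · simp
    · simp
    · simp [tieCorner_right huv]

theorem tieCorner_inl_eq_iff (x : H) :
    tieCorner f u v (Sum.inl x) = Sum.inl x ↔ x ≠ u ∧ x ≠ v ∧ f x = x := by
  by_cases hxu : x = u
  · simp [hxu]
  by_cases hxv : x = v
  · subst hxv; simp [tieCorner_right (Ne.symm hxu)]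
  simp [tieCorner_inl hxu hxv, hxu, hxv]

theorem exists_tieLeaf_eq_iff {p q : L} (hpq : p ≠ q) {leaf : L → H}
    (hl : Function.Injective leaf) (x : H) :
    (∃ z, tieLeaf p q leaf z = Sum.inl x) ↔ x ≠ leaf p ∧ x ≠ leaf q ∧ ∃ z, leaf z = x := by
  constructor
  · rintro ⟨z, hz⟩
    by_cases h1 : z = p
    · simp [tieLeaf, h1] at hz
    by_cases h2 : z = q
    · simp [tieLeaf, h2, hpq.symm] at hz
    simp only [tieLeaf, h1, h2, if_false] at hz
    obtain rfl := Sum.inl_injective hz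
    exact ⟨fun h => h1 (hl h), fun h => h2 (hl h), z, rfl⟩
  · rintro ⟨h1, h2, z, rfl⟩
    refine ⟨z, ?_⟩
    rw [tieLeaf, if_neg (fun h => h1 (congrArg leaf h)), if_neg (fun h => h2 (congrArg leaf h))]

variable {b : H → H} {leaf : L → H} {p q : L}

theorem leaf_mem_of_tie (hpq : p ≠ q) {σ : L → L} (hu : u = leaf (σ p)) (hv : v = leaf (σ q))
    (hσ : ∀ z, z ≠ p → z ≠ q → σ z = z) {C : Set (H ⊕ Bool × Bool)}
    (hb : ∀ x ∈ C, tieMate b x ∈ C) (hf : ∀ x ∈ C, tieCorner f u v x ∈ C) (huv : u ≠ v) (z : L) :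
    tieLeaf p q leaf z ∈ C ↔ Sum.inl (leaf (σ z)) ∈ C := by
  by_cases h1 : z = p
  · subst h1
    simp only [tieLeaf, if_true]
    rw [← hu]
    exact ⟨fun h => hf _ (hb _ h), fun h => hb (Sum.inr (false, true)) (by simpa using hf _ h)⟩
  by_cases h2 : z = q
  · subst h2
    simp only [tieLeaf, if_neg h1, if_true]
    rw [← hv]
    exact ⟨fun h => hf _ (hb _ h), fun h => hb (Sum.inr (true, true))
      (by simpa [tieCorner_right huv] using hf _ h)⟩
  rw [tieLeaf, if_neg h1, if_neg h2, hσ z h1 h2]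

/-- Tying the leaves `p` and `q` leaves the paths unchanged, up to a permutation `σ` of their
ends. -/
theorem leafPaths_tie_iff (hpq : p ≠ q) {σ S S' : L → L} (hu : u = leaf (σ p))
    (hv : v = leaf (σ q)) (hσ : ∀ z, z ≠ p → z ≠ q → σ z = z) (hσσ : ∀ z, σ (σ z) = z)
    (hS : ∀ z, S' z = σ (S (σ z))) (huv : u ≠ v) (hfu : f u = u) (hfv : f v = v) :
    LeafPaths S' (tieMate b) (tieCorner f u v) (tieLeaf p q leaf) ↔ LeafPaths S b f leaf := by
  constructor
  · intro h C hbC hfC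
    set C' : Set (H ⊕ Bool × Bool) := {x | Sum.elim (· ∈ C)
      (fun n => if n.1 then v ∈ C else u ∈ C) x} with hC'
    have hb' : ∀ x ∈ C', tieMate b x ∈ C' := by
      rintro (x | ⟨_ | _, _ | _⟩) hx
      · exact hbC x hx
      all_goals exact hx
    have hf' : ∀ x ∈ C', tieCorner f u v x ∈ C' := by
      rintro (x | ⟨_ | _, _ | _⟩) hx
      · by_cases hxu : x = u
        · subst hxu; rw [tieCorner_left]; simpa [hC'] using hx
        by_cases hxv : x = v
        · subst hxv; rw [tieCorner_right huv]; simpa [hC'] using hx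
        rw [tieCorner_inl hxu hxv]; exact hfC x hx
      all_goals simpa [hC'] using hx
    obtain ⟨h1, h2⟩ := h C' hb' hf'
    have hl := leaf_mem_of_tie (f := f) hpq hu hv hσ hb' hf' huv
    constructor
    · rintro ⟨x, hx⟩
      obtain ⟨z, hz⟩ := h1 ⟨Sum.inl x, hx⟩
      exact ⟨σ z, (hl z).mp hz⟩
    · intro z hz
      have h3 := h2 (σ z) ((hl _).mpr (by rw [hσσ]; exact hz))
      have h4 := (hl _).mp h3
      rw [hS, hσσ, hσσ] at h4
      exact h4
  · intro h C hbC hfC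
    have hl := leaf_mem_of_tie (f := f) hpq hu hv hσ hbC hfC huv
    obtain ⟨h1, h2⟩ := h (Sum.inl ⁻¹' C) (fun x hx => hbC _ hx) (fun x hx => by
      by_cases hxu : x = u
      · rw [hxu, hfu]; exact hxu ▸ hx
      by_cases hxv : x = v
      · rw [hxv, hfv]; exact hxv ▸ hx
      have := hfC _ hx
      rwa [tieCorner_inl hxu hxv] at this)
    constructor
    · have hne : C.Nonempty → (Sum.inl ⁻¹' C : Set H).Nonempty := by
        rintro ⟨x | ⟨_ | _, _ | _⟩, hx⟩
        · exact ⟨x, hx⟩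
        · exact ⟨u, hfC _ (hbC _ hx)⟩
        · exact ⟨u, hfC _ hx⟩
        · exact ⟨v, hfC _ (hbC _ hx)⟩
        · exact ⟨v, hfC _ hx⟩
      intro hC
      obtain ⟨z, hz⟩ := h1 (hne hC)
      exact ⟨σ z, (hl _).mpr (by rw [hσσ]; exact hz)⟩
    · intro z hz
      rw [hl, hS, hσσ]
      exact h2 _ ((hl z).mp hz)

end Corner

namespace HalfEdgeDiagram

variable {L : Type} {p q : L}

/-- The diagram in which the half-edges at the leaves `p` and `q` become opposite edges of a new
vertex of degree four, whose other two edges lead to the new leaves `p` and `q`. -/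
noncomputable def tie (p q : L) (D : HalfEdgeDiagram L) : HalfEdgeDiagram L where
  Half := D.Half ⊕ Bool × Bool
  finite_half := inferInstance
  mate := tieMate D.mate
  solid := tieCorner D.solid (D.leaf p) (D.leaf q)
  dashed := tieCorner D.dashed (D.leaf q) (D.leaf p)
  leaf := tieLeaf p q D.leaf

open Classical in
/-- The new vertex leaves the ends of the solid paths unchanged and exchanges the ends `p` and `q` of
the dashed paths. -/
theorem tie_valid_iff {S A : L → L} (hpq : p ≠ q) {D : HalfEdgeDiagram L}
    (hs : ∀ z, D.solid (D.leaf z) = D.leaf z) (hd : ∀ z, D.dashed (D.leaf z) = D.leaf z)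
    (hl : D.leaf p ≠ D.leaf q) :
    Valid S (fun z => swap p q (A (swap p q z))) (tie p q D) ↔ Valid S A D := by
  have hsol : LeafPaths S (tie p q D).mate (tie p q D).solid (tie p q D).leaf ↔
      LeafPaths S D.mate D.solid D.leaf :=
    leafPaths_tie_iff hpq (σ := id) rfl rfl (fun _ _ _ => rfl) (fun _ => rfl) (fun _ => rfl) hl
      (hs p) (hs q)
  have hdash : LeafPaths (fun z => swap p q (A (swap p q z))) (tie p q D).mate
      (tie p q D).dashed (tie p q D).leaf ↔ LeafPaths A D.mate D.dashed D.leaf :=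
    leafPaths_tie_iff hpq (σ := swap p q) (by rw [swap_apply_left]) (by rw [swap_apply_right])
      (fun z h1 h2 => swap_apply_of_ne_of_ne h1 h2) (fun z => swap_apply_self _ _ z)
      (fun _ => rfl) hl.symm (hd q) (hd p)
  have hinr : ∀ k, ∃ z, tieLeaf p q D.leaf z = Sum.inr (k, false) := by
    intro k
    cases k
    · exact ⟨p, by simp [tieLeaf]⟩
    · exact ⟨q, by simp [tieLeaf, hpq.symm]⟩
  have hninr : ∀ k z, tieLeaf p q D.leaf z ≠ Sum.inr (k, true) := by
    intro k z
    rw [tieLeaf]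
    split_ifs <;> simp
  constructor
  · intro h
    have hinj : Function.Injective D.leaf := by
      -- if another leaf coincided with `p` or `q`, it would not be a leaf of the tied diagram
      have key : ∀ z, (z ≠ p → D.leaf z ≠ D.leaf p) ∧ (z ≠ q → D.leaf z ≠ D.leaf q) := by
        intro z
        by_cases hzp : z = p
        · subst hzp; exact ⟨fun h => absurd rfl h, fun _ => hl⟩
        by_cases hzq : z = q
        · subst hzq; exact ⟨fun _ => hl.symm, fun h => absurd rfl h⟩
        have h1 := h.solid_leaf z
        have h2 : (tie p q D).leaf z = Sum.inl (D.leaf z) := by simp [tie, tieLeaf, hzp, hzq]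
        rw [h2] at h1
        have h3 := (tieCorner_inl_eq_iff _).mp h1
        exact ⟨fun _ => h3.1, fun _ => h3.2.1⟩
      intro y z hyz
      by_cases hyp : y = p
      · subst hyp
        by_contra hne
        exact (key z).1 (Ne.symm hne) hyz.symm
      by_cases hyq : y = q
      · subst hyq
        by_contra hne
        exact (key z).2 (Ne.symm hne) hyz.symm
      by_cases hzp : z = p
      · subst hzp
        exact absurd hyz ((key y).1 hyp)
      by_cases hzq : z = q
      · subst hzq
        exact absurd hyz ((key y).2 hyq)
      refine h.leaf_injective ?_
      simp [tie, tieLeaf, hyp, hyq, hzp, hzq, hyz]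
    refine ⟨?_, ?_, ?_, ?_, ?_, ?_, hinj, ?_, hsol.mp h.solid_paths, hdash.mp h.dashed_paths⟩
    · intro x; exact Sum.inl_injective (h.mate_mate (Sum.inl x))
    · exact (tieCorner_involutive_iff hl (hs p) (hs q)).mp h.solid_solid
    · exact (tieCorner_involutive_iff hl.symm (hd q) (hd p)).mp h.dashed_dashed
    · intro x hx; exact h.mate_ne (Sum.inl x) (congrArg Sum.inl hx)
    · intro x
      refine ⟨fun hx => ?_, fun ⟨z, hz⟩ => hz ▸ hs z⟩
      by_cases hxp : x = D.leaf p
      · exact ⟨p, hxp.symm⟩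
      by_cases hxq : x = D.leaf q
      · exact ⟨q, hxq.symm⟩
      exact ((exists_tieLeaf_eq_iff hpq hinj x).mp ((h.solid_eq_iff (Sum.inl x)).mp
        ((tieCorner_inl_eq_iff x).mpr ⟨hxp, hxq, hx⟩))).2.2
    · intro x
      refine ⟨fun hx => ?_, fun ⟨z, hz⟩ => hz ▸ hd z⟩
      by_cases hxp : x = D.leaf p
      · exact ⟨p, hxp.symm⟩
      by_cases hxq : x = D.leaf q
      · exact ⟨q, hxq.symm⟩
      exact ((exists_tieLeaf_eq_iff hpq hinj x).mp ((h.dashed_eq_iff (Sum.inl x)).mp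
        ((tieCorner_inl_eq_iff x).mpr ⟨hxq, hxp, hx⟩))).2.2
    · intro x hx
      by_cases hxp : x = D.leaf p
      · rw [hxp]; exact hs p
      by_cases hxq : x = D.leaf q
      · rw [hxq]; exact hs q
      have h1 := h.solid_ne_dashed (Sum.inl x)
      simp only [tie] at h1
      rw [tieCorner_inl hxp hxq, tieCorner_inl hxq hxp] at h1
      exact Sum.inl_injective (h1 (congrArg _ hx))
  · intro h
    have hinj := h.leaf_injective
    refine ⟨?_, ?_, ?_, ?_, ?_, ?_, ?_, ?_, hsol.mpr h.solid_paths, hdash.mpr h.dashed_paths⟩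
    · rintro (x | n)
      · exact congrArg Sum.inl (h.mate_mate x)
      · simp [tie, tieMate]
    · exact (tieCorner_involutive_iff hl (hs p) (hs q)).mpr h.solid_solid
    · exact (tieCorner_involutive_iff hl.symm (hd q) (hd p)).mpr h.dashed_dashed
    · rintro (x | n)
      · exact fun hx => h.mate_ne x (Sum.inl_injective hx)
      · simp [tie, tieMate, Prod.ext_iff]
    · rintro (x | ⟨k, _ | _⟩)
      · exact (tieCorner_inl_eq_iff x).trans
          (((exists_tieLeaf_eq_iff hpq hinj x).trans (by rw [h.solid_eq_iff])).symm)
      · exact iff_of_true (tieCorner_inr_false k) (hinr k)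
      · refine iff_of_false ?_ fun ⟨z, hz⟩ => hninr k z hz
        cases k <;> simp [tie]
    · rintro (x | ⟨k, _ | _⟩)
      · refine (tieCorner_inl_eq_iff x).trans
          (((exists_tieLeaf_eq_iff hpq hinj x).trans ?_).symm)
        rw [h.dashed_eq_iff]
        tauto
      · exact iff_of_true (tieCorner_inr_false k) (hinr k)
      · refine iff_of_false ?_ fun ⟨z, hz⟩ => hninr k z hz
        cases k <;> simp [tie]
    · intro y z hyz
      simp only [tie, tieLeaf] at hyz
      split_ifs at hyz with h1 h2 h3 h4 h5 h6 h7 h8 <;> simp_all [hinj.eq_iff]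
    · rintro (x | ⟨_ | _, _ | _⟩)
      · simp only [tie]
        by_cases hxp : x = D.leaf p
        · subst hxp; simp [tieCorner_right hl.symm]
        by_cases hxq : x = D.leaf q
        · subst hxq; simp [tieCorner_right hl]
        rw [tieCorner_inl hxp hxq, tieCorner_inl hxq hxp]
        exact fun hx => congrArg _ (h.solid_ne_dashed x (Sum.inl_injective hx))
      · intro _; simp [tie]
      · intro hx; exact absurd (Sum.inl_injective hx) hl
      · intro _; simp [tie]
      · intro hx; exact absurd (Sum.inl_injective hx) hl.symm

theorem iso_tie {D D' : HalfEdgeDiagram L} (e : D'.Half ⊕ Bool × Bool ≃ D.Half)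
    (hm : ∀ x, e (tieMate D'.mate x) = D.mate (e x))
    (hs : ∀ x, e (tieCorner D'.solid (D'.leaf p) (D'.leaf q) x) = D.solid (e x))
    (hd : ∀ x, e (tieCorner D'.dashed (D'.leaf q) (D'.leaf p) x) = D.dashed (e x))
    (hl : ∀ z, e (tieLeaf p q D'.leaf z) = D.leaf z) : Iso (tie p q D') D :=
  ⟨e, hm, hs, hd, hl⟩

theorem exists_of_iso_tie {D D' : HalfEdgeDiagram L} : Iso (tie p q D) (tie p q D') →
    ∃ φ : D.Half ⊕ Bool × Bool ≃ D'.Half ⊕ Bool × Bool,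
      (∀ x, φ (tieMate D.mate x) = tieMate D'.mate (φ x)) ∧
      (∀ x, φ (tieCorner D.solid (D.leaf p) (D.leaf q) x) =
        tieCorner D'.solid (D'.leaf p) (D'.leaf q) (φ x)) ∧
      (∀ x, φ (tieCorner D.dashed (D.leaf q) (D.leaf p) x) =
        tieCorner D'.dashed (D'.leaf q) (D'.leaf p) (φ x)) ∧
      ∀ z, φ (tieLeaf p q D.leaf z) = tieLeaf p q D'.leaf z :=
  fun ⟨φ, h⟩ => ⟨φ, h.mate, h.solid, h.dashed, h.leaf⟩

theorem tie_iso_iff {S A : L → L} (hpq : p ≠ q) {D D' : HalfEdgeDiagram L} (hD : Valid S A D)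
    (hD' : Valid S A D') : Iso (tie p q D) (tie p q D') ↔ Iso D D' := by
  constructor
  · intro hiso
    obtain ⟨φ, hm, hs, hd, hl⟩ := exists_of_iso_tie hiso
    have hlp : ∀ E : HalfEdgeDiagram L, tieLeaf p q E.leaf p = Sum.inr (false, false) := fun E => by
      simp [tieLeaf]
    have hlq : ∀ E : HalfEdgeDiagram L, tieLeaf p q E.leaf q = Sum.inr (true, false) := fun E => by
      simp [tieLeaf, hpq.symm]
    have h1 : ∀ k, φ (Sum.inr (k, false)) = Sum.inr (k, false) := by
      intro k
      cases k
      · rw [← hlp D, hl, hlp]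
      · rw [← hlq D, hl, hlq]
    have h2 : ∀ n, φ (Sum.inr n) = Sum.inr n := by
      rintro ⟨k, _ | _⟩
      · exact h1 k
      · have h3 := hm (Sum.inr (k, false))
        rw [h1] at h3
        exact h3
    obtain ⟨ψ, hψ⟩ := exists_equiv_of_sum φ h2
    have hleafp : ψ (D.leaf p) = D'.leaf p := by
      have h3 := hs (Sum.inr (false, true))
      rw [h2, tieCorner_inr_false_true, tieCorner_inr_false_true, hψ] at h3
      exact Sum.inl_injective h3
    have hleafq : ψ (D.leaf q) = D'.leaf q := by
      have h3 := hs (Sum.inr (true, true))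
      rw [h2, tieCorner_inr_true_true, tieCorner_inr_true_true, hψ] at h3
      exact Sum.inl_injective h3
    have hnp : ∀ x, x ≠ D.leaf p → ψ x ≠ D'.leaf p := fun x hx h3 =>
      hx (ψ.injective (h3.trans hleafp.symm))
    have hnq : ∀ x, x ≠ D.leaf q → ψ x ≠ D'.leaf q := fun x hx h3 =>
      hx (ψ.injective (h3.trans hleafq.symm))
    refine ⟨ψ, ?_, ?_, ?_, ?_⟩
    · intro x
      have h3 := hm (Sum.inl x)
      rw [hψ] at h3
      exact Sum.inl_injective ((hψ _).symm.trans h3)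
    · intro x
      by_cases hxp : x = D.leaf p
      · rw [hxp, hD.solid_leaf, hleafp, hD'.solid_leaf]
      by_cases hxq : x = D.leaf q
      · rw [hxq, hD.solid_leaf, hleafq, hD'.solid_leaf]
      have h3 := hs (Sum.inl x)
      rw [tieCorner_inl hxp hxq, hψ, hψ, tieCorner_inl (hnp x hxp) (hnq x hxq)] at h3
      exact Sum.inl_injective h3
    · intro x
      by_cases hxp : x = D.leaf p
      · rw [hxp, hD.dashed_leaf, hleafp, hD'.dashed_leaf]
      by_cases hxq : x = D.leaf q
      · rw [hxq, hD.dashed_leaf, hleafq, hD'.dashed_leaf]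
      have h3 := hd (Sum.inl x)
      rw [tieCorner_inl hxq hxp, hψ, hψ, tieCorner_inl (hnq x hxq) (hnp x hxp)] at h3
      exact Sum.inl_injective h3
    · intro z
      by_cases hzp : z = p
      · rw [hzp, hleafp]
      by_cases hzq : z = q
      · rw [hzq, hleafq]
      have h3 := hl z
      simp only [tieLeaf, if_neg hzp, if_neg hzq, hψ] at h3
      exact Sum.inl_injective h3
  · rintro ⟨ψ, h⟩
    have hcorner : ∀ (f : D.Half → D.Half) (f' : D'.Half → D'.Half) (hf : ∀ x, ψ (f x) = f' (ψ x))
        (u v : D.Half) (x : D.Half ⊕ Bool × Bool), Sum.map ψ id (tieCorner f u v x) =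
          tieCorner f' (ψ u) (ψ v) (Sum.map ψ id x) := by
      rintro f f' hf u v (x | ⟨_ | _, _ | _⟩)
      · by_cases hxu : x = u
        · subst hxu; simp
        by_cases hxv : x = v
        · subst hxv
          rw [tieCorner_right (Ne.symm hxu), Sum.map_inl,
            tieCorner_right (fun h => hxu (ψ.injective h).symm)]
          simp
        rw [tieCorner_inl hxu hxv, Sum.map_inl, Sum.map_inl,
          tieCorner_inl (fun h => hxu (ψ.injective h)) (fun h => hxv (ψ.injective h)), hf]
      all_goals simp
    refine ⟨Equiv.sumCongr ψ (Equiv.refl _), ?_, ?_, ?_, ?_⟩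
    · rintro (x | n)
      · exact congrArg Sum.inl (h.mate x)
      · rfl
    · intro x
      have := hcorner D.solid D'.solid h.solid (D.leaf p) (D.leaf q) x
      rw [h.leaf, h.leaf] at this
      exact this
    · intro x
      have := hcorner D.dashed D'.dashed h.dashed (D.leaf q) (D.leaf p) x
      rw [h.leaf, h.leaf] at this
      exact this
    · intro z
      simp only [tie, tieLeaf]
      split_ifs
      · rfl
      · rfl
      · exact congrArg Sum.inl (h.leaf z)

/-- A diagram in which the edge from the leaf `p` ends at a vertex of degree four whose opposite
edge leads to the leaf `q` arises by tying. -/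
theorem exists_tie_iso {S A : L → L} (hpq : p ≠ q) {D : HalfEdgeDiagram L} (hD : Valid S A D)
    {h : D.Half} (hh : h = D.mate (D.leaf p)) (hnl : ∀ z, D.leaf z ≠ h)
    (hsd : D.solid (D.dashed h) = D.dashed (D.solid h))
    (hq : D.mate (D.solid (D.dashed h)) = D.leaf q) :
    ∃ D' : HalfEdgeDiagram L, (∀ z, D'.solid (D'.leaf z) = D'.leaf z) ∧
      (∀ z, D'.dashed (D'.leaf z) = D'.leaf z) ∧ D'.leaf p ≠ D'.leaf q ∧ Iso (tie p q D') D := by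
  classical
  set n := D.solid (D.dashed h) with hn
  have hsh : D.solid h ≠ h := fun h1 => by
    obtain ⟨z, hz⟩ := (hD.solid_eq_iff h).mp h1
    exact hnl z hz
  have hdh : D.dashed h ≠ h := fun h1 => by
    obtain ⟨z, hz⟩ := (hD.dashed_eq_iff h).mp h1
    exact hnl z hz
  have hne : D.solid h ≠ D.dashed h := fun h1 => hsh (hD.solid_ne_dashed h h1)
  have hmh : D.mate h = D.leaf p := by rw [hh, hD.mate_mate]
  have hmq : D.mate (D.leaf q) = n := by rw [← hq, hD.mate_mate]
  have hsn : D.solid n = D.dashed h := hD.solid_solid _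
  have hdn : D.dashed n = D.solid h := by rw [hsd, hD.dashed_dashed]
  have hnh : n ≠ h := by
    intro h1
    rw [h1] at hsn
    exact hne hsn
  have hnn : ∀ z, D.leaf z ≠ n := by
    rintro z hz
    have h1 := hD.solid_leaf z
    have h2 := hD.dashed_leaf z
    rw [hz, hsn] at h1
    rw [hz, hdn] at h2
    exact hne (h2.trans h1.symm)
  have hlsh : ∀ z, D.leaf z ≠ D.solid h := fun z hz => hnl z (hD.solid_eq_leaf_iff.mp hz.symm).symm
  have hldh : ∀ z, D.leaf z ≠ D.dashed h := fun z hz =>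
    hnl z (hD.dashed_eq_leaf_iff.mp hz.symm).symm
  have hnsh : n ≠ D.solid h := fun h1 => hdh (hD.solid_injective h1)
  have hndh : n ≠ D.dashed h := fun h1 => hsh (hD.dashed_injective (hsd.symm.trans h1))
  set ν : Bool × Bool → D.Half := fun k => if k.1 then (if k.2 then n else D.leaf q) else
    (if k.2 then h else D.leaf p) with hν
  have hνcases : ∀ x, (∀ k, ν k ≠ x) ↔ (x ≠ D.leaf p ∧ x ≠ h ∧ x ≠ D.leaf q ∧ x ≠ n) := by
    intro x
    constructor
    · intro hk
      exact ⟨fun e => hk (false, false) e.symm, fun e => hk (false, true) e.symm,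
        fun e => hk (true, false) e.symm, fun e => hk (true, true) e.symm⟩
    · rintro ⟨h1, h2, h3, h4⟩ ⟨_ | _, _ | _⟩
      · exact h1.symm
      · exact h2.symm
      · exact h3.symm
      · exact h4.symm
  have hlpq : D.leaf p ≠ D.leaf q := fun h1 => hpq (hD.leaf_injective h1)
  have hνinj : Function.Injective ν := by
    rintro ⟨_ | _, _ | _⟩ ⟨_ | _, _ | _⟩ hk <;> simp only [hν, if_true, if_false,
      Bool.false_eq_true] at hk <;> first | rfl | skip
    · exact absurd hk (hnl p)
    · exact absurd hk hlpq
    · exact absurd hk (hnn p)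
    · exact absurd hk.symm (hnl p)
    · exact absurd hk.symm (hnl q)
    · exact absurd hk.symm hnh
    · exact absurd hk.symm hlpq
    · exact absurd hk (hnl q)
    · exact absurd hk (hnn q)
    · exact absurd hk.symm (hnn p)
    · exact absurd hk hnh
    · exact absurd hk.symm (hnn q)
  obtain ⟨e, he1, he2⟩ := exists_equiv_sum_of_injective ν hνinj
  -- the half-edges at the vertex next to `h` become the new leaves
  have hmate : ∀ x, (∀ k, ν k ≠ x) → ∀ k, ν k ≠ D.mate x := by
    intro x hx
    rw [hνcases] at hx ⊢
    obtain ⟨h1, h2, h3, h4⟩ := hx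
    refine ⟨fun h5 => h2 ?_, fun h5 => h1 ?_, fun h5 => h4 ?_, fun h5 => h3 ?_⟩
    · rw [hh, ← h5, hD.mate_mate]
    · rw [← hmh, ← h5, hD.mate_mate]
    · rw [← hmq, ← h5, hD.mate_mate]
    · rw [← hq, ← h5, hD.mate_mate]
  have hsol : ∀ x, (∀ k, ν k ≠ x) → x ≠ D.solid h → x ≠ D.dashed h →
      ∀ k, ν k ≠ D.solid x := by
    intro x hx hx1 hx2
    rw [hνcases] at hx ⊢
    obtain ⟨h1, h2, h3, h4⟩ := hx
    refine ⟨fun h5 => h1 (hD.solid_eq_leaf_iff.mp h5), fun h5 => hx1 ?_,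
      fun h5 => h3 (hD.solid_eq_leaf_iff.mp h5), fun h5 => hx2 (hD.solid_injective h5)⟩
    rw [← h5, hD.solid_solid]
  have hdas : ∀ x, (∀ k, ν k ≠ x) → x ≠ D.solid h → x ≠ D.dashed h →
      ∀ k, ν k ≠ D.dashed x := by
    intro x hx hx1 hx2
    rw [hνcases] at hx ⊢
    obtain ⟨h1, h2, h3, h4⟩ := hx
    refine ⟨fun h5 => h1 (hD.dashed_eq_leaf_iff.mp h5), fun h5 => hx2 ?_,
      fun h5 => h3 (hD.dashed_eq_leaf_iff.mp h5), fun h5 => hx1 ?_⟩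
    · rw [← h5, hD.dashed_dashed]
    · exact hD.dashed_injective (h5.trans hsd)
  have hshν : ∀ k, ν k ≠ D.solid h :=
    (hνcases _).mpr ⟨(hlsh p).symm, hsh, (hlsh q).symm, hnsh.symm⟩
  have hdhν : ∀ k, ν k ≠ D.dashed h :=
    (hνcases _).mpr ⟨(hldh p).symm, hdh, (hldh q).symm, hndh.symm⟩
  have hleafν : ∀ z, z ≠ p → z ≠ q → ∀ k, ν k ≠ D.leaf z := fun z h1 h2 =>
    (hνcases _).mpr ⟨fun h3 => h1 (hD.leaf_injective h3), hnl z,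
      fun h3 => h2 (hD.leaf_injective h3), hnn z⟩
  let D' : HalfEdgeDiagram L :=
    { Half := {x // ∀ k, ν k ≠ x}
      finite_half := inferInstance
      mate := restrictTo D.mate
      solid := restrictTo D.solid
      dashed := restrictTo D.dashed
      leaf := fun z => if hz : z = p then ⟨D.solid h, hshν⟩ else if hz' : z = q then
        ⟨D.dashed h, hdhν⟩ else ⟨D.leaf z, hleafν z hz hz'⟩ }
  have hlp : D'.leaf p = ⟨D.solid h, hshν⟩ := dif_pos rfl
  have hlq : D'.leaf q = ⟨D.dashed h, hdhν⟩ := by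
    simp only [D', dif_neg hpq.symm, dif_pos]
  have hlz : ∀ z, (hz : z ≠ p) → (hz' : z ≠ q) → D'.leaf z = ⟨D.leaf z, hleafν z hz hz'⟩ := by
    intro z hz hz'
    simp only [D', dif_neg hz, dif_neg hz']
  have hν00 : ν (false, false) = D.leaf p := rfl
  have hν01 : ν (false, true) = h := rfl
  have hν10 : ν (true, false) = D.leaf q := rfl
  have hν11 : ν (true, true) = n := rfl
  refine ⟨D', ?_, ?_, ?_, iso_tie e ?_ ?_ ?_ ?_⟩
  · intro z
    by_cases hz : z = p
    · rw [hz, hlp]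
      exact restrictTo_of_not (P := fun x => ∀ k, ν k ≠ x) fun h1 => h1 (false, true) (hD.solid_solid h).symm
    by_cases hz' : z = q
    · rw [hz', hlq]
      exact restrictTo_of_not (P := fun x => ∀ k, ν k ≠ x) fun h1 => h1 (true, true) rfl
    rw [hlz z hz hz']
    apply Subtype.ext
    exact (restrictTo_of (by rw [hD.solid_leaf]; exact hleafν z hz hz')).trans (hD.solid_leaf z)
  · intro z
    by_cases hz : z = p
    · rw [hz, hlp]
      exact restrictTo_of_not (P := fun x => ∀ k, ν k ≠ x) fun h1 => h1 (true, true) (by rw [hν11]; exact hsd)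
    by_cases hz' : z = q
    · rw [hz', hlq]
      exact restrictTo_of_not (P := fun x => ∀ k, ν k ≠ x) fun h1 => h1 (false, true) (hD.dashed_dashed h).symm
    rw [hlz z hz hz']
    apply Subtype.ext
    exact (restrictTo_of (by rw [hD.dashed_leaf]; exact hleafν z hz hz')).trans (hD.dashed_leaf z)
  · rw [hlp, hlq]
    exact fun h1 => hne (congrArg Subtype.val h1)
  · rintro (x | ⟨_ | _, _ | _⟩)
    · rw [he1]
      exact (he1 _).trans (restrictTo_of (hmate x.1 x.2))
    · rw [he2, hν00, ← hh]; exact he2 _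
    · rw [he2, hν01, hmh]; exact he2 _
    · rw [he2, hν10, hmq]; exact he2 _
    · rw [he2, hν11, hq]; exact he2 _
  · rintro (x | ⟨_ | _, _ | _⟩)
    · rw [he1]
      rw [hlp, hlq]
      by_cases hx1 : x.1 = D.solid h
      · obtain rfl : x = ⟨D.solid h, hshν⟩ := Subtype.ext hx1
        rw [tieCorner_left, he2, hν01, hD.solid_solid]
      by_cases hx2 : x.1 = D.dashed h
      · obtain rfl : x = ⟨D.dashed h, hdhν⟩ := Subtype.ext hx2
        rw [tieCorner_right (fun h1 => hne (congrArg Subtype.val h1)), he2, hν11]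
      rw [tieCorner_inl (fun h1 => hx1 (congrArg Subtype.val h1))
        (fun h1 => hx2 (congrArg Subtype.val h1))]
      exact (he1 _).trans (restrictTo_of (hsol x.1 x.2 hx1 hx2))
    · rw [he2, hν00, hD.solid_leaf]; exact he2 _
    · rw [he2, hν01]
      exact (he1 _).trans (congrArg Subtype.val hlp)
    · rw [he2, hν10, hD.solid_leaf]; exact he2 _
    · rw [he2, hν11, hsn]
      exact (he1 _).trans (congrArg Subtype.val hlq)
  · rintro (x | ⟨_ | _, _ | _⟩)
    · rw [he1]
      rw [hlp, hlq]
      by_cases hx2 : x.1 = D.dashed h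
      · obtain rfl : x = ⟨D.dashed h, hdhν⟩ := Subtype.ext hx2
        rw [tieCorner_left, he2, hν01, hD.dashed_dashed]
      by_cases hx1 : x.1 = D.solid h
      · obtain rfl : x = ⟨D.solid h, hshν⟩ := Subtype.ext hx1
        rw [tieCorner_right (fun h1 => hne (congrArg Subtype.val h1).symm), he2, hν11]
        exact hsd
      rw [tieCorner_inl (fun h1 => hx2 (congrArg Subtype.val h1))
        (fun h1 => hx1 (congrArg Subtype.val h1))]
      exact (he1 _).trans (restrictTo_of (hdas x.1 x.2 hx1 hx2))
    · rw [he2, hν00, hD.dashed_leaf]; exact he2 _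
    · rw [he2, hν01]
      exact (he1 _).trans (congrArg Subtype.val hlq)
    · rw [he2, hν10, hD.dashed_leaf]; exact he2 _
    · rw [he2, hν11, hdn]
      exact (he1 _).trans (congrArg Subtype.val hlp)
  · intro z
    by_cases hz : z = p
    · subst hz; simp only [tieLeaf, if_true]; exact he2 _
    by_cases hz' : z = q
    · subst hz'; simp only [tieLeaf, if_neg hz, if_true]; exact he2 _
    simp only [tieLeaf, if_neg hz, if_neg hz']
    exact (he1 _).trans (congrArg Subtype.val (hlz z hz hz'))

end HalfEdgeDiagram

/-! ### Splitting a vertex of degree greater than four -/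

section Corner

open Classical in
/-- The corners of one kind after splitting: the corner between `u` and `v` is replaced by a corner
between `u` and the new half-edge `false` and a corner between the new half-edge `true` and `v`. -/
noncomputable def splitCorner {H : Type} (f : H → H) (u v : H) : H ⊕ Bool → H ⊕ Bool
  | Sum.inl x => if x = u then Sum.inr false else if x = v then Sum.inr true else Sum.inl (f x)
  | Sum.inr false => Sum.inl u
  | Sum.inr true => Sum.inl v

/-- The old edges together with one new edge. -/
def addMate {H : Type} (b : H → H) : H ⊕ Bool → H ⊕ Bool := Sum.map b not

variable {H L : Type} {f : H → H} {u v : H}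

@[simp] theorem splitCorner_left : splitCorner f u v (Sum.inl u) = Sum.inr false := by
  simp [splitCorner]

theorem splitCorner_right (h : u ≠ v) : splitCorner f u v (Sum.inl v) = Sum.inr true := by
  simp [splitCorner, h.symm]

theorem splitCorner_inl {x : H} (hu : x ≠ u) (hv : x ≠ v) :
    splitCorner f u v (Sum.inl x) = Sum.inl (f x) := by
  simp [splitCorner, hu, hv]

@[simp] theorem splitCorner_inr_false : splitCorner f u v (Sum.inr false) = Sum.inl u := rfl

@[simp] theorem splitCorner_inr_true : splitCorner f u v (Sum.inr true) = Sum.inl v := rfl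

theorem splitCorner_involutive_iff (huv : u ≠ v) (hu : f u = v) (hv : f v = u) :
    (∀ x, splitCorner f u v (splitCorner f u v x) = x) ↔ ∀ x, f (f x) = x := by
  constructor
  · intro h x
    by_cases hxu : x = u
    · rw [hxu, hu, hv]
    by_cases hxv : x = v
    · rw [hxv, hv, hu]
    have h1 := h (Sum.inl x)
    rw [splitCorner_inl hxu hxv] at h1
    by_cases h2 : f x = u
    · rw [h2, splitCorner_left] at h1; simp at h1
    by_cases h3 : f x = v
    · rw [h3, splitCorner_right huv] at h1; simp at h1
    rw [splitCorner_inl h2 h3] at h1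
    exact Sum.inl_injective h1
  · intro h
    have hinj : Function.Injective f := Function.Involutive.injective h
    rintro (x | _ | _)
    · by_cases hxu : x = u
      · rw [hxu]; simp
      by_cases hxv : x = v
      · rw [hxv, splitCorner_right huv]; simp
      rw [splitCorner_inl hxu hxv, splitCorner_inl, h]
      · exact fun h1 => hxv (hinj (h1.trans hv.symm))
      · exact fun h1 => hxu (hinj (h1.trans hu.symm))
    · simp
    · simp [splitCorner_right huv]

theorem splitCorner_inl_eq_iff (huv : u ≠ v) (hu : f u = v) (hv : f v = u) (x : H) :
    splitCorner f u v (Sum.inl x) = Sum.inl x ↔ f x = x := by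
  by_cases hxu : x = u
  · simp [hxu, hu, huv.symm]
  by_cases hxv : x = v
  · simp [hxv, splitCorner_right huv, hv, huv]
  simp [splitCorner_inl hxu hxv]

variable {b : H → H} {leaf : L → H}

/-- Splitting a vertex subdivides one solid path and one dashed path. -/
theorem leafPaths_split_iff {S : L → L} (huv : u ≠ v) (hu : f u = v) (hv : f v = u) :
    LeafPaths S (addMate b) (splitCorner f u v) (fun z => Sum.inl (leaf z) : L → H ⊕ Bool) ↔
      LeafPaths S b f leaf := by
  constructor
  · intro h C hbC hfC
    have huvC : v ∈ C ↔ u ∈ C := ⟨fun h1 => hv ▸ hfC _ h1, fun h1 => hu ▸ hfC _ h1⟩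
    obtain ⟨h1, h2⟩ := h {x | Sum.elim (· ∈ C) (fun _ => u ∈ C) x} (by
      rintro (x | _ | _) hx
      · exact hbC x hx
      all_goals exact hx) (by
      rintro (x | _ | _) hx
      · by_cases hxu : x = u
        · subst hxu; rw [splitCorner_left]; simpa using hx
        by_cases hxv : x = v
        · subst hxv; rw [splitCorner_right huv]; simpa using huvC.mp hx
        rw [splitCorner_inl hxu hxv]; exact hfC x hx
      · simpa using hx
      · simpa [huvC] using hx)
    refine ⟨fun ⟨x, hx⟩ => ?_, fun z hz => h2 z hz⟩
    exact h1 ⟨Sum.inl x, hx⟩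
  · intro h C hbC hfC
    obtain ⟨h1, h2⟩ := h (Sum.inl ⁻¹' C) (fun x hx => hbC _ hx) (fun x hx => by
      by_cases hxu : x = u
      · subst hxu
        rw [hu]
        have := hfC _ (hbC _ (hfC _ hx))
        rwa [splitCorner_left] at this
      by_cases hxv : x = v
      · subst hxv
        rw [hv]
        have := hfC _ (hbC _ (hfC _ hx))
        rwa [splitCorner_right huv] at this
      have := hfC _ hx
      rwa [splitCorner_inl hxu hxv] at this)
    refine ⟨?_, fun z hz => h2 z hz⟩
    have hne : C.Nonempty → (Sum.inl ⁻¹' C : Set H).Nonempty := by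
      rintro ⟨x | _ | _, hx⟩
      · exact ⟨x, hx⟩
      · exact ⟨u, hfC _ hx⟩
      · exact ⟨v, hfC _ hx⟩
    exact fun hC => h1 (hne hC)

end Corner

namespace HalfEdgeDiagram

variable {L : Type} {p : L}

/-- The diagram in which the vertex next to the leaf `p` is split: the half-edge `h` next to the
leaf, its two neighbours and a new half-edge form a vertex of degree four, and the other end of the
new edge is attached to the remaining half-edges of the vertex. -/
noncomputable def split (p : L) (D : HalfEdgeDiagram L) : HalfEdgeDiagram L where
  Half := D.Half ⊕ Bool
  finite_half := inferInstance
  mate := addMate D.mate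
  solid := splitCorner D.solid (D.dashed (D.mate (D.leaf p)))
    (D.solid (D.dashed (D.mate (D.leaf p))))
  dashed := splitCorner D.dashed (D.solid (D.mate (D.leaf p)))
    (D.dashed (D.solid (D.mate (D.leaf p))))
  leaf z := Sum.inl (D.leaf z)

/-- The half-edge `h` has four different neighbours, the first two and the last two of which are
exchanged by the solid and dashed corners. -/
structure Splittable (D : HalfEdgeDiagram L) (h : D.Half) : Prop where
  solid_solid : D.solid (D.solid h) = h
  dashed_dashed : D.dashed (D.dashed h) = h
  solid_solid' : D.solid (D.solid (D.dashed h)) = D.dashed h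
  dashed_dashed' : D.dashed (D.dashed (D.solid h)) = D.solid h
  ne : D.solid h ≠ D.dashed h
  ne' : D.solid (D.dashed h) ≠ D.dashed (D.solid h)
  ne_solid : D.dashed h ≠ D.solid (D.dashed h)
  ne_dashed : D.solid h ≠ D.dashed (D.solid h)

theorem Valid.splittable {S A : L → L} {D : HalfEdgeDiagram L} (hD : Valid S A D) {h : D.Half}
    (hnl : ∀ z, D.leaf z ≠ h) (hsd : D.solid (D.dashed h) ≠ D.dashed (D.solid h)) :
    Splittable D h := by
  refine ⟨hD.solid_solid _, hD.dashed_dashed _, hD.solid_solid _, hD.dashed_dashed _, ?_, hsd,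
    ?_, ?_⟩
  · intro h1
    obtain ⟨z, hz⟩ := (hD.solid_eq_iff h).mp (hD.solid_ne_dashed h h1)
    exact hnl z hz
  · intro h1
    obtain ⟨z, hz⟩ := (hD.solid_eq_iff _).mp h1.symm
    exact hnl z (hD.dashed_eq_leaf_iff.mp hz.symm).symm
  · intro h1
    obtain ⟨z, hz⟩ := (hD.dashed_eq_iff _).mp h1.symm
    exact hnl z (hD.solid_eq_leaf_iff.mp hz.symm).symm

theorem Splittable.not_leaf {S A : L → L} {D : HalfEdgeDiagram L} (hD : Valid S A D) {h : D.Half}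
    (hs : Splittable D h) (z : L) : D.leaf z ≠ h := by
  rintro rfl
  exact hs.ne (by rw [hD.solid_leaf, hD.dashed_leaf])

theorem split_valid_iff {S A : L → L} {D : HalfEdgeDiagram L}
    (hs : Splittable D (D.mate (D.leaf p))) : Valid S A (split p D) ↔ Valid S A D := by
  have hsol : LeafPaths S (split p D).mate (split p D).solid (split p D).leaf ↔
      LeafPaths S D.mate D.solid D.leaf :=
    leafPaths_split_iff hs.ne_solid rfl hs.solid_solid'
  have hdash : LeafPaths A (split p D).mate (split p D).dashed (split p D).leaf ↔
      LeafPaths A D.mate D.dashed D.leaf :=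
    leafPaths_split_iff hs.ne_dashed rfl hs.dashed_dashed'
  have hsi := splitCorner_involutive_iff hs.ne_solid rfl hs.solid_solid'
  have hdi := splitCorner_involutive_iff hs.ne_dashed rfl hs.dashed_dashed'
  have hse := splitCorner_inl_eq_iff hs.ne_solid rfl hs.solid_solid'
  have hde := splitCorner_inl_eq_iff hs.ne_dashed rfl hs.dashed_dashed'
  have hex : ∀ x : D.Half, (∃ z, (Sum.inl (D.leaf z) : D.Half ⊕ Bool) = Sum.inl x) ↔
      ∃ z, D.leaf z = x := by
    intro x; simp only [Sum.inl.injEq]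
  have hnex : ∀ n : Bool, ¬ ∃ z, (Sum.inl (D.leaf z) : D.Half ⊕ Bool) = Sum.inr n := by
    intro n; simp
  set h := D.mate (D.leaf p) with hh
  have hdh : D.solid (D.dashed h) ≠ h := fun h1 => by
    have h2 := hs.solid_solid'
    rw [h1] at h2
    exact hs.ne h2
  have hsh : D.dashed (D.solid h) ≠ h := fun h1 => by
    have h2 := hs.dashed_dashed'
    rw [h1] at h2
    exact hs.ne h2.symm
  constructor
  · intro hv
    have hss := hsi.mp hv.solid_solid
    have hdd := hdi.mp hv.dashed_dashed
    refine ⟨?_, hss, hdd, ?_, ?_, ?_, ?_, ?_, hsol.mp hv.solid_paths, hdash.mp hv.dashed_paths⟩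
    · intro x; exact Sum.inl_injective (hv.mate_mate (Sum.inl x))
    · intro x hx; exact hv.mate_ne (Sum.inl x) (congrArg Sum.inl hx)
    · intro x
      rw [← hse, ← hex]
      exact hv.solid_eq_iff (Sum.inl x)
    · intro x
      rw [← hde, ← hex]
      exact hv.dashed_eq_iff (Sum.inl x)
    · intro y z hyz
      exact hv.leaf_injective (congrArg Sum.inl hyz)
    · intro x hx
      by_cases h1 : x = D.dashed h
      · rw [h1, hs.dashed_dashed] at hx
        exact absurd hx hdh
      by_cases h2 : x = D.solid (D.dashed h)
      · rw [h2, hs.solid_solid'] at hx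
        refine absurd ?_ hdh
        rw [← hdd (D.solid (D.dashed h)), ← hx, hdd]
      by_cases h3 : x = D.solid h
      · rw [h3, hs.solid_solid] at hx
        exact absurd hx.symm hsh
      by_cases h4 : x = D.dashed (D.solid h)
      · rw [h4, hs.dashed_dashed'] at hx
        refine absurd ?_ hsh
        rw [← hss (D.dashed (D.solid h)), hx, hss]
      have h5 := hv.solid_ne_dashed (Sum.inl x)
      simp only [split] at h5
      rw [splitCorner_inl h1 h2, splitCorner_inl h3 h4] at h5
      exact Sum.inl_injective (h5 (congrArg _ hx))
  · intro hv
    refine ⟨?_, hsi.mpr hv.solid_solid, hdi.mpr hv.dashed_dashed, ?_, ?_, ?_, ?_, ?_,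
      hsol.mpr hv.solid_paths, hdash.mpr hv.dashed_paths⟩
    · rintro (x | n)
      · exact congrArg Sum.inl (hv.mate_mate x)
      · simp [split, addMate]
    · rintro (x | n)
      · exact fun hx => hv.mate_ne x (Sum.inl_injective hx)
      · cases n <;> simp [split, addMate]
    · rintro (x | n)
      · exact (hse x).trans ((hv.solid_eq_iff x).trans (hex x).symm)
      · refine iff_of_false ?_ (hnex n)
        cases n <;> simp [split]
    · rintro (x | n)
      · exact (hde x).trans ((hv.dashed_eq_iff x).trans (hex x).symm)
      · refine iff_of_false ?_ (hnex n)
        cases n <;> simp [split]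
    · intro y z hyz
      exact hv.leaf_injective (Sum.inl_injective hyz)
    · rintro (x | _ | _)
      · simp only [split]
        rw [← hh]
        by_cases h1 : x = D.dashed h
        · subst h1
          rw [splitCorner_left]
          by_cases h2 : D.dashed h = D.dashed (D.solid h)
          · rw [h2, splitCorner_right hs.ne_dashed]; simp
          · rw [splitCorner_inl hs.ne.symm h2]; simp
        by_cases h2 : x = D.solid (D.dashed h)
        · subst h2
          rw [splitCorner_right hs.ne_solid]
          by_cases h3 : D.solid (D.dashed h) = D.solid h
          · rw [h3, splitCorner_left]; simp
          · rw [splitCorner_inl h3 hs.ne']; simp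
        rw [splitCorner_inl h1 h2]
        by_cases h3 : x = D.solid h
        · rw [h3, splitCorner_left]; simp
        by_cases h4 : x = D.dashed (D.solid h)
        · rw [h4, splitCorner_right hs.ne_dashed]; simp
        rw [splitCorner_inl h3 h4]
        exact fun hx => congrArg _ (hv.solid_ne_dashed x (Sum.inl_injective hx))
      · exact fun hx => absurd (Sum.inl_injective hx).symm hs.ne
      · exact fun hx => absurd (Sum.inl_injective hx) hs.ne'

theorem iso_split {D D' : HalfEdgeDiagram L} (e : D'.Half ⊕ Bool ≃ D.Half)
    (hm : ∀ x, e (addMate D'.mate x) = D.mate (e x))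
    (hs : ∀ x, e (splitCorner D'.solid (D'.dashed (D'.mate (D'.leaf p)))
      (D'.solid (D'.dashed (D'.mate (D'.leaf p)))) x) = D.solid (e x))
    (hd : ∀ x, e (splitCorner D'.dashed (D'.solid (D'.mate (D'.leaf p)))
      (D'.dashed (D'.solid (D'.mate (D'.leaf p)))) x) = D.dashed (e x))
    (hl : ∀ z, e (Sum.inl (D'.leaf z)) = D.leaf z) : Iso (split p D') D :=
  ⟨e, hm, hs, hd, hl⟩

theorem exists_of_iso_split {D D' : HalfEdgeDiagram L} : Iso (split p D) (split p D') →
    ∃ φ : D.Half ⊕ Bool ≃ D'.Half ⊕ Bool,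
      (∀ x, φ (addMate D.mate x) = addMate D'.mate (φ x)) ∧
      (∀ x, φ (splitCorner D.solid (D.dashed (D.mate (D.leaf p)))
          (D.solid (D.dashed (D.mate (D.leaf p)))) x) =
        splitCorner D'.solid (D'.dashed (D'.mate (D'.leaf p)))
          (D'.solid (D'.dashed (D'.mate (D'.leaf p)))) (φ x)) ∧
      (∀ x, φ (splitCorner D.dashed (D.solid (D.mate (D.leaf p)))
          (D.dashed (D.solid (D.mate (D.leaf p)))) x) =
        splitCorner D'.dashed (D'.solid (D'.mate (D'.leaf p)))
          (D'.dashed (D'.solid (D'.mate (D'.leaf p)))) (φ x)) ∧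
      ∀ z, φ (Sum.inl (D.leaf z)) = Sum.inl (D'.leaf z) :=
  fun ⟨φ, h⟩ => ⟨φ, h.mate, h.solid, h.dashed, h.leaf⟩

/-- The vertex of degree four next to the leaf `p` in a split diagram. -/
theorem split_dashed_solid {S A : L → L} {D : HalfEdgeDiagram L} (hD : Valid S A D)
    (hs : Splittable D (D.mate (D.leaf p))) :
    splitCorner D.solid (D.dashed (D.mate (D.leaf p))) (D.solid (D.dashed (D.mate (D.leaf p))))
        (Sum.inl (D.mate (D.leaf p))) = Sum.inl (D.solid (D.mate (D.leaf p))) ∧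
      splitCorner D.dashed (D.solid (D.mate (D.leaf p))) (D.dashed (D.solid (D.mate (D.leaf p))))
        (Sum.inl (D.mate (D.leaf p))) = Sum.inl (D.dashed (D.mate (D.leaf p))) := by
  have hnl := hs.not_leaf hD
  constructor
  · refine splitCorner_inl (fun h1 => ?_) fun h1 => hs.ne ?_
    · obtain ⟨z, hz⟩ := (hD.dashed_eq_iff _).mp h1.symm
      exact hnl z hz
    · conv_lhs => rw [h1]
      exact hs.solid_solid'
  · refine splitCorner_inl (fun h1 => ?_) fun h1 => hs.ne ?_
    · obtain ⟨z, hz⟩ := (hD.solid_eq_iff _).mp h1.symm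
      exact hnl z hz
    · conv_rhs => rw [h1]
      exact hs.dashed_dashed'.symm

theorem split_iso_iff {S A : L → L} {D D' : HalfEdgeDiagram L} (hD : Valid S A D)
    (hD' : Valid S A D') (hs : Splittable D (D.mate (D.leaf p)))
    (hs' : Splittable D' (D'.mate (D'.leaf p))) : Iso (split p D) (split p D') ↔ Iso D D' := by
  constructor
  · intro hiso
    obtain ⟨φ, hm, hso, hda, hl⟩ := exists_of_iso_split hiso
    have hh : φ (Sum.inl (D.mate (D.leaf p))) = Sum.inl (D'.mate (D'.leaf p)) := by
      have h1 := hm (Sum.inl (D.leaf p))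
      rw [hl] at h1
      exact h1
    have hf : φ (Sum.inr false) = Sum.inr false := by
      have h1 := hso (Sum.inl (D.dashed (D.mate (D.leaf p))))
      have h2 := hda (Sum.inl (D.mate (D.leaf p)))
      rw [hh, (split_dashed_solid hD hs).2, (split_dashed_solid hD' hs').2] at h2
      rwa [h2, splitCorner_left, splitCorner_left] at h1
    have ht : φ (Sum.inr true) = Sum.inr true := by
      have h1 := hm (Sum.inr false)
      rw [hf] at h1
      exact h1
    obtain ⟨ψ, hψ⟩ := exists_equiv_of_sum φ (by rintro (_ | _) <;> assumption)
    have hcorner : ∀ {f : D.Half → D.Half} {f' : D'.Half → D'.Half} {u v : D.Half}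
        {u' v' : D'.Half} (_ : u ≠ v) (_ : f u = v) (_ : f v = u) (_ : f' u' = v')
        (_ : f' v' = u')
        (_ : ∀ x, φ (splitCorner f u v x) = splitCorner f' u' v' (φ x)) (x : D.Half),
        ψ (f x) = f' (ψ x) := by
      intro f f' u v u' v' huv hu hv hu' hv' h1 x
      have h2 : ψ u = u' := by
        have h3 := h1 (Sum.inr false)
        rw [hf, splitCorner_inr_false, splitCorner_inr_false, hψ] at h3
        exact Sum.inl_injective h3
      have h3 : ψ v = v' := by
        have h3 := h1 (Sum.inr true)
        rw [ht, splitCorner_inr_true, splitCorner_inr_true, hψ] at h3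
        exact Sum.inl_injective h3
      by_cases hxu : x = u
      · rw [hxu, hu, h3, h2, hu']
      by_cases hxv : x = v
      · rw [hxv, hv, h3, h2, hv']
      have h4 := h1 (Sum.inl x)
      rw [splitCorner_inl hxu hxv, hψ, hψ, splitCorner_inl (fun h5 => hxu (ψ.injective
        (h5.trans h2.symm))) (fun h5 => hxv (ψ.injective (h5.trans h3.symm)))] at h4
      exact Sum.inl_injective h4
    refine ⟨ψ, ?_, ?_, ?_, ?_⟩
    · intro x
      have h3 := hm (Sum.inl x)
      rw [hψ] at h3
      exact Sum.inl_injective ((hψ _).symm.trans h3)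
    · exact hcorner hs.ne_solid rfl hs.solid_solid' rfl hs'.solid_solid' hso
    · exact hcorner hs.ne_dashed rfl hs.dashed_dashed' rfl hs'.dashed_dashed' hda
    · intro z
      have h3 := hl z
      rw [hψ] at h3
      exact Sum.inl_injective h3
  · rintro ⟨ψ, h⟩
    have hcorner : ∀ (f : D.Half → D.Half) (f' : D'.Half → D'.Half) (_ : ∀ x, ψ (f x) = f' (ψ x))
        (u v : D.Half) (x : D.Half ⊕ Bool), Sum.map ψ id (splitCorner f u v x) =
          splitCorner f' (ψ u) (ψ v) (Sum.map ψ id x) := by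
      rintro f f' hf u v (x | _ | _)
      · by_cases hxu : x = u
        · subst hxu; simp
        by_cases hxv : x = v
        · subst hxv
          rw [splitCorner_right (Ne.symm hxu), Sum.map_inl,
            splitCorner_right (fun h => hxu (ψ.injective h).symm)]
          simp
        rw [splitCorner_inl hxu hxv, Sum.map_inl, Sum.map_inl,
          splitCorner_inl (fun h => hxu (ψ.injective h)) (fun h => hxv (ψ.injective h)), hf]
      all_goals simp
    refine ⟨Equiv.sumCongr ψ (Equiv.refl _), ?_, ?_, ?_, ?_⟩
    · rintro (x | n)
      · exact congrArg Sum.inl (h.mate x)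
      · rfl
    · intro x
      have := hcorner D.solid D'.solid h.solid (D.dashed (D.mate (D.leaf p)))
        (D.solid (D.dashed (D.mate (D.leaf p)))) x
      rw [h.solid, h.dashed, h.mate, h.leaf] at this
      exact this
    · intro x
      have := hcorner D.dashed D'.dashed h.dashed (D.solid (D.mate (D.leaf p)))
        (D.dashed (D.solid (D.mate (D.leaf p)))) x
      rw [h.dashed, h.solid, h.mate, h.leaf] at this
      exact this
    · intro z
      exact congrArg Sum.inl (h.leaf z)

open Classical in
/-- A diagram in which the edge from the leaf `p` ends at a vertex of degree four whose opposite
edge leads to another internal vertex arises by splitting a vertex. -/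
theorem exists_split_iso {S A : L → L} {D : HalfEdgeDiagram L} (hD : Valid S A D)
    {h : D.Half} (hh : h = D.mate (D.leaf p)) (hnl : ∀ z, D.leaf z ≠ h)
    (hsd : D.solid (D.dashed h) = D.dashed (D.solid h))
    (hq : ∀ z, D.leaf z ≠ D.mate (D.solid (D.dashed h))) :
    ∃ D' : HalfEdgeDiagram L, Splittable D' (D'.mate (D'.leaf p)) ∧ Iso (split p D') D := by
  set n := D.solid (D.dashed h) with hn
  set m := D.mate n with hm
  have hsh : D.solid h ≠ h := fun h1 => by
    obtain ⟨z, hz⟩ := (hD.solid_eq_iff h).mp h1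
    exact hnl z hz
  have hdh : D.dashed h ≠ h := fun h1 => by
    obtain ⟨z, hz⟩ := (hD.dashed_eq_iff h).mp h1
    exact hnl z hz
  have hne : D.solid h ≠ D.dashed h := fun h1 => hsh (hD.solid_ne_dashed h h1)
  have hsn : D.solid n = D.dashed h := hD.solid_solid _
  have hdn : D.dashed n = D.solid h := by rw [hsd, hD.dashed_dashed]
  have hnn : ∀ z, D.leaf z ≠ n := by
    rintro z hz
    have h1 := hD.solid_leaf z
    have h2 := hD.dashed_leaf z
    rw [hz, hsn] at h1
    rw [hz, hdn] at h2
    exact hne (h2.trans h1.symm)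
  have hnh : n ≠ h := by
    intro h1
    rw [h1] at hsn
    exact hne hsn
  have hmh : D.mate h = D.leaf p := by rw [hh, hD.mate_mate]
  have hmn : D.mate m = n := hD.mate_mate n
  have hmn' : m ≠ n := hD.mate_ne n
  have hmne_h : m ≠ h := fun h1 => hnn p (by rw [← hmh, ← h1, hmn])
  -- the edge opposite to the leaf does not return to the vertex, since no boundary component is
  -- closed
  have hm_dh : m ≠ D.dashed h := by
    rw [← hsn]; exact hD.mate_ne_solid hnn
  have hm_sh : m ≠ D.solid h := by
    rw [← hdn]; exact hD.mate_ne_dashed hnn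
  have hsm : D.solid m ≠ m := fun h1 => by
    obtain ⟨z, hz⟩ := (hD.solid_eq_iff m).mp h1
    exact hq z hz
  have hdm : D.dashed m ≠ m := fun h1 => by
    obtain ⟨z, hz⟩ := (hD.dashed_eq_iff m).mp h1
    exact hq z hz
  have hsm_n : D.solid m ≠ n := fun h1 => hm_dh (by rw [← hsn, ← h1, hD.solid_solid])
  have hdm_n : D.dashed m ≠ n := fun h1 => hm_sh (by rw [← hdn, ← h1, hD.dashed_dashed])
  have hsdm : D.solid m ≠ D.dashed m := fun h1 => hsm (hD.solid_ne_dashed m h1)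
  set ν : Bool → D.Half := fun k => if k then m else n with hν
  have hνcases : ∀ x, (∀ k, ν k ≠ x) ↔ (x ≠ n ∧ x ≠ m) := by
    intro x
    constructor
    · intro hk
      exact ⟨fun e => hk false e.symm, fun e => hk true e.symm⟩
    · rintro ⟨h1, h2⟩ (_ | _)
      · exact h1.symm
      · exact h2.symm
  have hνinj : Function.Injective ν := by
    rintro (_ | _) (_ | _) hk
    · rfl
    · exact absurd hk.symm hmn'
    · exact absurd hk hmn'
    · rfl
  obtain ⟨e, he1, he2⟩ := exists_equiv_sum_of_injective ν hνinj
  have hν0 : ν false = n := rfl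
  have hν1 : ν true = m := rfl
  set cs : D.Half → D.Half := fun x => if x = D.dashed h then D.solid m else
    if x = D.solid m then D.dashed h else D.solid x with hcs
  set cd : D.Half → D.Half := fun x => if x = D.solid h then D.dashed m else
    if x = D.dashed m then D.solid h else D.dashed x with hcd
  have hleafν : ∀ z k, ν k ≠ D.leaf z := fun z => (hνcases _).mpr ⟨hnn z, hq z⟩
  have hmateν : ∀ x, (∀ k, ν k ≠ x) → ∀ k, ν k ≠ D.mate x := by
    intro x hx
    rw [hνcases] at hx ⊢
    refine ⟨fun h1 => hx.2 ?_, fun h1 => hx.1 (hD.mate_injective h1)⟩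
    rw [hm, ← h1, hD.mate_mate]
  have hsmν : ∀ k, ν k ≠ D.solid m := (hνcases _).mpr ⟨hsm_n, hsm⟩
  have hdmν : ∀ k, ν k ≠ D.dashed m := (hνcases _).mpr ⟨hdm_n, hdm⟩
  have hndh : n ≠ D.dashed h := fun h1 => hnn _ (((hD.solid_eq_iff n).mp
    (hsn.trans h1.symm)).choose_spec)
  have hnsh : n ≠ D.solid h := fun h1 => hnn _ (((hD.dashed_eq_iff n).mp
    (hdn.trans h1.symm)).choose_spec)
  have hdhν : ∀ k, ν k ≠ D.dashed h := (hνcases _).mpr ⟨hndh.symm, hm_dh.symm⟩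
  have hshν : ∀ k, ν k ≠ D.solid h := (hνcases _).mpr ⟨hnsh.symm, hm_sh.symm⟩
  have hcsν : ∀ x, (∀ k, ν k ≠ x) → ∀ k, ν k ≠ cs x := by
    intro x hx
    simp only [hcs]
    split_ifs with h1 h2
    · exact hsmν
    · exact hdhν
    · rw [hνcases] at hx ⊢
      refine ⟨fun h3 => h1 (hD.solid_injective h3), fun h3 => h2 ?_⟩
      rw [← h3, hD.solid_solid]
  have hcdν : ∀ x, (∀ k, ν k ≠ x) → ∀ k, ν k ≠ cd x := by
    intro x hx
    simp only [hcd]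
    split_ifs with h1 h2
    · exact hdmν
    · exact hshν
    · rw [hνcases] at hx ⊢
      refine ⟨fun h3 => h1 (hD.dashed_injective (h3.trans hsd)), fun h3 => h2 ?_⟩
      rw [← h3, hD.dashed_dashed]
  let D' : HalfEdgeDiagram L :=
    { Half := {x // ∀ k, ν k ≠ x}
      finite_half := inferInstance
      mate := fun x => ⟨D.mate x.1, hmateν x.1 x.2⟩
      solid := fun x => ⟨cs x.1, hcsν x.1 x.2⟩
      dashed := fun x => ⟨cd x.1, hcdν x.1 x.2⟩
      leaf := fun z => ⟨D.leaf z, hleafν z⟩ }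
  have hcs1 : cs (D.dashed h) = D.solid m := if_pos rfl
  have hcs2 : cs (D.solid m) = D.dashed h := by
    simp only [hcs]
    split_ifs with h1
    · exact h1
    · rfl
  have hcd1 : cd (D.solid h) = D.dashed m := if_pos rfl
  have hcd2 : cd (D.dashed m) = D.solid h := by
    simp only [hcd]
    split_ifs with h1
    · exact h1
    · rfl
  have hsm_h : h ≠ D.solid m := fun h1 => hm_sh (by rw [h1, hD.solid_solid])
  have hdm_h : h ≠ D.dashed m := fun h1 => hm_dh (by rw [h1, hD.dashed_dashed])
  have hcsh : cs h = D.solid h := by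
    simp only [hcs]; rw [if_neg hdh.symm, if_neg hsm_h]
  have hcdh : cd h = D.dashed h := by
    simp only [hcd]; rw [if_neg hsh.symm, if_neg hdm_h]
  have hsm_dh : D.dashed h ≠ D.solid m := fun h1 => hmn' (hD.solid_injective
    (h1.symm.trans hsn.symm))
  have hdm_sh : D.solid h ≠ D.dashed m := fun h1 => hmn' (hD.dashed_injective
    (h1.symm.trans hdn.symm))
  have hcssh : cs (D.solid h) = h := by
    simp only [hcs]
    rw [if_neg hne, if_neg fun h1 => hmne_h (hD.solid_injective h1).symm, hD.solid_solid]
  have hcddh : cd (D.dashed h) = h := by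
    simp only [hcd]
    rw [if_neg hne.symm, if_neg fun h1 => hmne_h (hD.dashed_injective h1).symm, hD.dashed_dashed]
  have hh1 : (D'.mate (D'.leaf p)).1 = h := hh.symm
  have e1 : (D'.solid (D'.mate (D'.leaf p))).1 = D.solid h := (congrArg cs hh1).trans hcsh
  have e2 : (D'.dashed (D'.mate (D'.leaf p))).1 = D.dashed h := (congrArg cd hh1).trans hcdh
  have e3 : (D'.solid (D'.dashed (D'.mate (D'.leaf p)))).1 = D.solid m :=
    (congrArg cs e2).trans hcs1
  have e4 : (D'.dashed (D'.solid (D'.mate (D'.leaf p)))).1 = D.dashed m :=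
    (congrArg cd e1).trans hcd1
  refine ⟨D', ⟨?_, ?_, ?_, ?_, ?_, ?_, ?_, ?_⟩, iso_split e ?_ ?_ ?_ ?_⟩
  · exact Subtype.ext (((congrArg cs e1).trans hcssh).trans hh1.symm)
  · exact Subtype.ext (((congrArg cd e2).trans hcddh).trans hh1.symm)
  · exact Subtype.ext (((congrArg cs e3).trans hcs2).trans e2.symm)
  · exact Subtype.ext (((congrArg cd e4).trans hcd2).trans e1.symm)
  · intro h1
    have h2 := congrArg Subtype.val h1
    rw [e1, e2] at h2
    exact hne h2
  · intro h1
    have h2 := congrArg Subtype.val h1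
    rw [e3, e4] at h2
    exact hsdm h2
  · intro h1
    have h2 := congrArg Subtype.val h1
    rw [e2, e3] at h2
    exact hsm_dh h2
  · intro h1
    have h2 := congrArg Subtype.val h1
    rw [e1, e4] at h2
    exact hdm_sh h2
  · rintro (x | _ | _)
    · rw [he1]; exact he1 _
    · rw [he2, hν0]; exact he2 true
    · rw [he2, hν1, hmn]; exact he2 false
  · rintro (x | _ | _)
    · by_cases h1 : x = D'.dashed (D'.mate (D'.leaf p))
      · rw [h1, splitCorner_left, he2, he1, e2]
        rfl
      by_cases h2 : x = D'.solid (D'.dashed (D'.mate (D'.leaf p)))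
      · rw [h2, splitCorner_right (fun h3 => hsm_dh (by rw [← e2, ← e3, ← h3])), he2, he1, e3,
          hν1, hD.solid_solid]
      rw [splitCorner_inl h1 h2, he1, he1]
      change cs x.1 = D.solid x.1
      simp only [hcs]
      rw [if_neg fun h3 => h1 (Subtype.ext (h3.trans e2.symm)),
        if_neg fun h3 => h2 (Subtype.ext (h3.trans e3.symm))]
    · rw [splitCorner_inr_false, he1, he2, hν0, hsn, e2]
    · rw [splitCorner_inr_true, he1, he2, hν1, e3]
  · rintro (x | _ | _)
    · by_cases h1 : x = D'.solid (D'.mate (D'.leaf p))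
      · rw [h1, splitCorner_left, he2, he1, e1]
        exact hsd
      by_cases h2 : x = D'.dashed (D'.solid (D'.mate (D'.leaf p)))
      · rw [h2, splitCorner_right (fun h3 => hdm_sh (by rw [← e1, ← e4, ← h3])), he2, he1, e4,
          hν1, hD.dashed_dashed]
      rw [splitCorner_inl h1 h2, he1, he1]
      change cd x.1 = D.dashed x.1
      simp only [hcd]
      rw [if_neg fun h3 => h1 (Subtype.ext (h3.trans e1.symm)),
        if_neg fun h3 => h2 (Subtype.ext (h3.trans e4.symm))]
    · rw [splitCorner_inr_false, he1, he2, hν0, hdn, e1]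
    · rw [splitCorner_inr_true, he1, he2, hν1, e4]
  · intro z
    exact he1 _

end HalfEdgeDiagram

namespace HalfEdgeDiagram

/-! ### Adding an edge between two leaves -/

section AddEdge

variable {t : ℕ}

/-- The diagram with an additional component, an edge between the leaves `1` and `1̄`. -/
def addEdge (D : HalfEdgeDiagram (EndLabel t)) : HalfEdgeDiagram (EndLabel (t + 1)) where
  Half := D.Half ⊕ Bool
  finite_half := inferInstance
  mate := addMate D.mate
  solid := Sum.map D.solid id
  dashed := Sum.map D.dashed id
  leaf z := Fin.cases (Sum.inr z.2) (fun i => Sum.inl (D.leaf (i, z.2))) z.1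

theorem leafPaths_addEdge_iff {H : Type} {b f : H → H} {leaf : EndLabel t → H}
    {leaf' : EndLabel (t + 1) → H ⊕ Bool} (h0 : ∀ ε, leaf' (0, ε) = Sum.inr ε)
    (h1 : ∀ z, leaf' (shiftLabel t z) = Sum.inl (leaf z)) {S : EndLabel t → EndLabel t}
    {S' : EndLabel (t + 1) → EndLabel (t + 1)} (hS0 : ∀ ε, S' (0, ε) = (0, !ε))
    (hS1 : ∀ z, S' (shiftLabel t z) = shiftLabel t (S z)) :
    LeafPaths S' (addMate b) (Sum.map f id) leaf' ↔ LeafPaths S b f leaf := by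
  constructor
  · intro h C hbC hfC
    obtain ⟨h2, h3⟩ := h (Sum.inl '' C) (by
      rintro _ ⟨x, hx, rfl⟩
      exact ⟨_, hbC x hx, rfl⟩) (by
      rintro _ ⟨x, hx, rfl⟩
      exact ⟨_, hfC x hx, rfl⟩)
    constructor
    · rintro ⟨x, hx⟩
      obtain ⟨z, y, hy, hz⟩ := h2 ⟨_, x, hx, rfl⟩
      rcases label_cases z with ⟨ε, rfl⟩ | ⟨z, rfl⟩
      · rw [h0] at hz; exact absurd hz Sum.inl_ne_inr
      · rw [h1] at hz
        exact ⟨z, Sum.inl_injective hz ▸ hy⟩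
    · intro z hz
      obtain ⟨y, hy, hz'⟩ := h3 (shiftLabel t z) ⟨_, hz, (h1 z).symm⟩
      rw [hS1, h1] at hz'
      exact Sum.inl_injective hz' ▸ hy
  · intro h C hbC hfC
    obtain ⟨h2, h3⟩ := h (Sum.inl ⁻¹' C) (fun x hx => hbC _ hx) (fun x hx => hfC _ hx)
    constructor
    · rintro ⟨x | ε, hx⟩
      · obtain ⟨z, hz⟩ := h2 ⟨x, hx⟩
        exact ⟨shiftLabel t z, by rw [h1]; exact hz⟩
      · exact ⟨(0, ε), by rw [h0]; exact hx⟩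
    · intro z hz
      rcases label_cases z with ⟨ε, rfl⟩ | ⟨z, rfl⟩
      · rw [h0] at hz
        rw [hS0, h0]
        exact hbC _ hz
      · rw [h1] at hz
        rw [hS1, h1]
        exact h3 z hz

theorem addEdge_valid_iff {S A : EndLabel t → EndLabel t}
    {S' A' : EndLabel (t + 1) → EndLabel (t + 1)} (hS0 : ∀ ε, S' (0, ε) = (0, !ε))
    (hS1 : ∀ z, S' (shiftLabel t z) = shiftLabel t (S z)) (hA0 : ∀ ε, A' (0, ε) = (0, !ε))
    (hA1 : ∀ z, A' (shiftLabel t z) = shiftLabel t (A z)) {D : HalfEdgeDiagram (EndLabel t)} :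
    Valid S' A' (addEdge D) ↔ Valid S A D := by
  have hsol : LeafPaths S' (addEdge D).mate (addEdge D).solid (addEdge D).leaf ↔
      LeafPaths S D.mate D.solid D.leaf :=
    leafPaths_addEdge_iff (leaf := D.leaf) (leaf' := (addEdge D).leaf) (fun _ => rfl)
      (fun _ => rfl) hS0 hS1
  have hdash : LeafPaths A' (addEdge D).mate (addEdge D).dashed (addEdge D).leaf ↔
      LeafPaths A D.mate D.dashed D.leaf :=
    leafPaths_addEdge_iff (leaf := D.leaf) (leaf' := (addEdge D).leaf) (fun _ => rfl)
      (fun _ => rfl) hA0 hA1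
  have hex : ∀ x, (∃ z, (addEdge D).leaf z = Sum.inl x) ↔ ∃ z, D.leaf z = x := by
    intro x
    constructor
    · rintro ⟨z, hz⟩
      rcases label_cases z with ⟨ε, rfl⟩ | ⟨z, rfl⟩
      · exact absurd hz.symm Sum.inl_ne_inr
      · exact ⟨z, Sum.inl_injective hz⟩
    · rintro ⟨z, rfl⟩
      exact ⟨shiftLabel t z, rfl⟩
  constructor
  · intro h
    refine ⟨fun x => Sum.inl_injective (h.mate_mate (Sum.inl x)),
      fun x => Sum.inl_injective (h.solid_solid (Sum.inl x)),
      fun x => Sum.inl_injective (h.dashed_dashed (Sum.inl x)),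
      fun x hx => h.mate_ne (Sum.inl x) (congrArg Sum.inl hx), fun x => ?_, fun x => ?_,
      fun y z hyz => (shiftLabel t).injective (h.leaf_injective (congrArg Sum.inl hyz)),
      fun x hx => Sum.inl_injective (h.solid_ne_dashed (Sum.inl x) (congrArg Sum.inl hx)),
      hsol.mp h.solid_paths, hdash.mp h.dashed_paths⟩
    · have hx : (Sum.inl (D.solid x) : D.Half ⊕ Bool) = Sum.inl x ↔ _ :=
        h.solid_eq_iff (Sum.inl x)
      exact (Sum.inl_injective.eq_iff.symm.trans hx).trans (hex x)
    · have hx : (Sum.inl (D.dashed x) : D.Half ⊕ Bool) = Sum.inl x ↔ _ :=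
        h.dashed_eq_iff (Sum.inl x)
      exact (Sum.inl_injective.eq_iff.symm.trans hx).trans (hex x)
  · intro h
    refine ⟨?_, ?_, ?_, ?_, ?_, ?_, ?_, ?_, hsol.mpr h.solid_paths, hdash.mpr h.dashed_paths⟩
    · rintro (x | ε)
      · exact congrArg Sum.inl (h.mate_mate x)
      · exact congrArg Sum.inr (Bool.not_not ε)
    · rintro (x | ε)
      · exact congrArg Sum.inl (h.solid_solid x)
      · rfl
    · rintro (x | ε)
      · exact congrArg Sum.inl (h.dashed_dashed x)
      · rfl
    · rintro (x | ε)
      · exact fun hx => h.mate_ne x (Sum.inl_injective hx)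
      · intro hx
        have := Sum.inr_injective hx
        simp at this
    · rintro (x | ε)
      · rw [hex, ← h.solid_eq_iff]
        exact Sum.inl_injective.eq_iff
      · exact iff_of_true rfl ⟨(0, ε), rfl⟩
    · rintro (x | ε)
      · rw [hex, ← h.dashed_eq_iff]
        exact Sum.inl_injective.eq_iff
      · exact iff_of_true rfl ⟨(0, ε), rfl⟩
    · intro y z hyz
      rcases label_cases y with ⟨ε, rfl⟩ | ⟨y, rfl⟩ <;>
        rcases label_cases z with ⟨δ, rfl⟩ | ⟨z, rfl⟩
      · exact congrArg (Prod.mk 0) (Sum.inr_injective hyz)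
      · exact absurd hyz.symm Sum.inl_ne_inr
      · exact absurd hyz Sum.inl_ne_inr
      · exact congrArg _ (h.leaf_injective (Sum.inl_injective hyz))
    · rintro (x | ε)
      · exact fun hx => congrArg Sum.inl (h.solid_ne_dashed x (Sum.inl_injective hx))
      · exact fun _ => rfl

theorem exists_of_iso_addEdge {D D' : HalfEdgeDiagram (EndLabel t)} :
    Iso (addEdge D) (addEdge D') → ∃ φ : D.Half ⊕ Bool ≃ D'.Half ⊕ Bool,
      (∀ x, φ (addMate D.mate x) = addMate D'.mate (φ x)) ∧
      (∀ x, φ (Sum.map D.solid id x) = Sum.map D'.solid id (φ x)) ∧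
      (∀ x, φ (Sum.map D.dashed id x) = Sum.map D'.dashed id (φ x)) ∧
      (∀ ε, φ (Sum.inr ε) = Sum.inr ε) ∧ ∀ z, φ (Sum.inl (D.leaf z)) = Sum.inl (D'.leaf z) :=
  fun ⟨φ, h⟩ => ⟨φ, h.mate, h.solid, h.dashed, fun ε => h.leaf (0, ε),
    fun z => h.leaf (shiftLabel t z)⟩

theorem addEdge_iso_iff {D D' : HalfEdgeDiagram (EndLabel t)} :
    Iso (addEdge D) (addEdge D') ↔ Iso D D' := by
  constructor
  · intro hiso
    obtain ⟨φ, hm, hs, hd, hr, hl⟩ := exists_of_iso_addEdge hiso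
    obtain ⟨ψ, hψ⟩ := exists_equiv_of_sum φ hr
    refine ⟨ψ, ?_, ?_, ?_, ?_⟩
    · intro x
      have h := hm (Sum.inl x)
      rw [hψ] at h
      exact Sum.inl_injective ((hψ _).symm.trans h)
    · intro x
      have h := hs (Sum.inl x)
      rw [hψ] at h
      exact Sum.inl_injective ((hψ _).symm.trans h)
    · intro x
      have h := hd (Sum.inl x)
      rw [hψ] at h
      exact Sum.inl_injective ((hψ _).symm.trans h)
    · intro z
      exact Sum.inl_injective ((hψ _).symm.trans (hl z))
  · rintro ⟨ψ, h⟩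
    refine ⟨Equiv.sumCongr ψ (Equiv.refl _), ?_, ?_, ?_, ?_⟩
    · rintro (x | n)
      · exact congrArg Sum.inl (h.mate x)
      · rfl
    · rintro (x | n)
      · exact congrArg Sum.inl (h.solid x)
      · rfl
    · rintro (x | n)
      · exact congrArg Sum.inl (h.dashed x)
      · rfl
    · intro z
      rcases label_cases z with ⟨ε, rfl⟩ | ⟨z, rfl⟩
      · rfl
      · exact congrArg Sum.inl (h.leaf z)

theorem iso_addEdge {D : HalfEdgeDiagram (EndLabel (t + 1))} {D' : HalfEdgeDiagram (EndLabel t)}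
    (e : D'.Half ⊕ Bool ≃ D.Half)
    (hm : ∀ x, e (addMate D'.mate x) = D.mate (e x))
    (hs : ∀ x, e (Sum.map D'.solid id x) = D.solid (e x))
    (hd : ∀ x, e (Sum.map D'.dashed id x) = D.dashed (e x))
    (hl0 : ∀ ε, e (Sum.inr ε) = D.leaf (0, ε))
    (hl : ∀ z, e (Sum.inl (D'.leaf z)) = D.leaf (shiftLabel t z)) : Iso (addEdge D') D := by
  refine ⟨e, hm, hs, hd, fun z => ?_⟩
  rcases label_cases z with ⟨ε, rfl⟩ | ⟨z, rfl⟩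
  · exact hl0 ε
  · exact hl z

/-- If the edge from the leaf `1` leads to a leaf, this is the leaf `1̄`, and the two leaves are
joined by a solid and by a dashed path. -/
theorem mate_leaf_eq {S A : EndLabel (t + 1) → EndLabel (t + 1)}
    {D : HalfEdgeDiagram (EndLabel (t + 1))} (hD : Valid S A D)
    (hS0 : S (firstLabel t) = (0, true)) (hA : A (firstLabel t) ≠ firstLabel t)
    {z : EndLabel (t + 1)} (hz : D.mate (D.leaf (firstLabel t)) = D.leaf z) :
    z = (0, true) ∧ A (firstLabel t) = (0, true) := by
  have hz' : D.mate (D.leaf z) = D.leaf (firstLabel t) := by rw [← hz, hD.mate_mate]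
  have hm : ∀ x ∈ ({D.leaf (firstLabel t), D.leaf z} : Set D.Half),
      D.mate x ∈ ({D.leaf (firstLabel t), D.leaf z} : Set D.Half) := by
    rintro x (rfl | rfl)
    · simp [hz]
    · simp [hz']
  have h1 := (hD.solid_paths {D.leaf (firstLabel t), D.leaf z} hm (by
    rintro x (rfl | rfl) <;> simp [hD.solid_leaf])).2 (firstLabel t) (by simp)
  have h2 := (hD.dashed_paths {D.leaf (firstLabel t), D.leaf z} hm (by
    rintro x (rfl | rfl) <;> simp [hD.dashed_leaf])).2 (firstLabel t) (by simp)
  rw [Set.mem_insert_iff, Set.mem_singleton_iff, hD.leaf_injective.eq_iff,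
    hD.leaf_injective.eq_iff] at h1 h2
  rw [hS0] at h1
  have h3 : z = (0, true) := by
    rcases h1 with h1 | h1
    · exact absurd h1 (by simp [firstLabel])
    · exact h1.symm
  exact ⟨h3, h3 ▸ h2.resolve_left hA⟩

theorem exists_addEdge_iso {S A : EndLabel (t + 1) → EndLabel (t + 1)}
    {D : HalfEdgeDiagram (EndLabel (t + 1))} (hD : Valid S A D)
    (hz : D.mate (D.leaf (firstLabel t)) = D.leaf (0, true)) :
    ∃ D' : HalfEdgeDiagram (EndLabel t), Iso (addEdge D') D := by
  have hz0 : ∀ ε, D.mate (D.leaf (0, ε)) = D.leaf (0, !ε) := by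
    intro ε
    cases ε
    · exact hz
    · exact (congrArg D.mate hz).symm.trans (hD.mate_mate _)
  set ν : Bool → D.Half := fun ε => D.leaf (0, ε) with hν
  have hνinj : Function.Injective ν := fun ε δ h =>
    congrArg Prod.snd (hD.leaf_injective h)
  obtain ⟨e, he1, he2⟩ := exists_equiv_sum_of_injective ν hνinj
  have hm : ∀ x, (∀ k, ν k ≠ x) → ∀ k, ν k ≠ D.mate x := by
    intro x hx k hk
    refine hx (!k) ?_
    have h1 := congrArg D.mate hk
    rw [hD.mate_mate] at h1
    exact (hz0 k).symm.trans h1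
  have hs : ∀ x, (∀ k, ν k ≠ x) → ∀ k, ν k ≠ D.solid x := fun x hx k hk =>
    hx k (hD.solid_eq_leaf_iff.mp hk.symm).symm
  have hd : ∀ x, (∀ k, ν k ≠ x) → ∀ k, ν k ≠ D.dashed x := fun x hx k hk =>
    hx k (hD.dashed_eq_leaf_iff.mp hk.symm).symm
  have hl : ∀ z, ∀ k, ν k ≠ D.leaf (shiftLabel t z) := fun z k hk =>
    shiftLabel_ne z k (hD.leaf_injective hk).symm
  let D' : HalfEdgeDiagram (EndLabel t) :=
    { Half := {x // ∀ k, ν k ≠ x}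
      finite_half := inferInstance
      mate := fun x => ⟨D.mate x.1, hm x.1 x.2⟩
      solid := fun x => ⟨D.solid x.1, hs x.1 x.2⟩
      dashed := fun x => ⟨D.dashed x.1, hd x.1 x.2⟩
      leaf := fun z => ⟨D.leaf (shiftLabel t z), hl z⟩ }
  refine ⟨D', iso_addEdge e ?_ ?_ ?_ he2 fun z => he1 _⟩
  · rintro (x | ε)
    · rw [he1]; exact he1 _
    · rw [he2]; exact (he2 _).trans (hz0 ε).symm
  · rintro (x | ε)
    · rw [he1]; exact he1 _
    · rw [he2]; exact (he2 _).trans (hD.solid_leaf _).symm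
  · rintro (x | ε)
    · rw [he1]; exact he1 _
    · rw [he2]; exact (he2 _).trans (hD.dashed_leaf _).symm

end AddEdge

/-! ### Numbers of vertices and edges -/

section Count

variable {L : Type} {p q : L}

theorem card_half_tie (D : HalfEdgeDiagram L) :
    Nat.card (tie p q D).Half = Nat.card D.Half + 4 := by
  have : Nat.card (tie p q D).Half = Nat.card (D.Half ⊕ Bool × Bool) := rfl
  rw [this, Nat.card_sum]
  simp

theorem card_half_split (D : HalfEdgeDiagram L) :
    Nat.card (split p D).Half = Nat.card D.Half + 2 := by
  have : Nat.card (split p D).Half = Nat.card (D.Half ⊕ Bool) := rfl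
  rw [this, Nat.card_sum]
  simp

theorem card_half_addEdge {t : ℕ} (D : HalfEdgeDiagram (EndLabel t)) :
    Nat.card (addEdge D).Half = Nat.card D.Half + 2 := by
  have : Nat.card (addEdge D).Half = Nat.card (D.Half ⊕ Bool) := rfl
  rw [this, Nat.card_sum]
  simp

/-- A map of the half-edges that is constant on the vertices, as a map of the vertices. -/
def liftVertex {D : HalfEdgeDiagram L} {α : Type} (F : D.Half → α)
    (hs : ∀ x, F (D.solid x) = F x) (hd : ∀ x, F (D.dashed x) = F x) : D.Vertex → α :=
  Quot.lift F (by rintro x y (rfl | rfl); exacts [(hs x).symm, (hd x).symm])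

open Classical in
theorem card_vertex_tie {S A : L → L} (hpq : p ≠ q) {D : HalfEdgeDiagram L} (hD : Valid S A D) :
    Nat.card (tie p q D).Vertex = Nat.card D.Vertex + 1 := by
  have hcard : Nat.card D.Vertex + 1 = Nat.card (Option D.Vertex) := Finite.card_option.symm
  rw [hcard]
  have hl : D.leaf p ≠ D.leaf q := fun h => hpq (hD.leaf_injective h)
  let F : D.Half ⊕ Bool × Bool → Option D.Vertex := fun y => match y with
    | Sum.inl x => if x = D.leaf p ∨ x = D.leaf q then none else some (D.vertexOf x)
    | Sum.inr (false, false) => some (D.vertexOf (D.leaf p))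
    | Sum.inr (true, false) => some (D.vertexOf (D.leaf q))
    | Sum.inr (_, true) => none
  have hF : ∀ x, x ≠ D.leaf p → x ≠ D.leaf q → F (Sum.inl x) = some (D.vertexOf x) :=
    fun x h1 h2 => if_neg (not_or.mpr ⟨h1, h2⟩)
  have hFp : F (Sum.inl (D.leaf p)) = none := if_pos (Or.inl rfl)
  have hFq : F (Sum.inl (D.leaf q)) = none := if_pos (Or.inr rfl)
  have hcorner : ∀ (f : D.Half → D.Half) (u v : D.Half)
      (_ : (u = D.leaf p ∧ v = D.leaf q) ∨ (u = D.leaf q ∧ v = D.leaf p))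
      (_ : ∀ x, D.vertexOf (f x) = D.vertexOf x)
      (_ : ∀ x z, f x = D.leaf z ↔ x = D.leaf z) (y : D.Half ⊕ Bool × Bool),
      F (tieCorner f u v y) = F y := by
    intro f u v huv hf hfl y
    have huv' : u ≠ v := by
      rcases huv with ⟨rfl, rfl⟩ | ⟨rfl, rfl⟩
      exacts [hl, hl.symm]
    have hu : F (Sum.inl u) = none := by rcases huv with ⟨rfl, rfl⟩ | ⟨rfl, rfl⟩ <;> assumption
    have hv : F (Sum.inl v) = none := by rcases huv with ⟨rfl, rfl⟩ | ⟨rfl, rfl⟩ <;> assumption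
    rcases y with x | ⟨_ | _, _ | _⟩
    · by_cases hxu : x = u
      · rw [hxu, tieCorner_left, hu]
      by_cases hxv : x = v
      · rw [hxv, tieCorner_right huv', hv]
      have hxp : x ≠ D.leaf p := by
        rcases huv with ⟨rfl, rfl⟩ | ⟨rfl, rfl⟩ <;> assumption
      have hxq : x ≠ D.leaf q := by
        rcases huv with ⟨rfl, rfl⟩ | ⟨rfl, rfl⟩ <;> assumption
      rw [tieCorner_inl hxu hxv, hF _ (fun h => hxp ((hfl _ _).mp h))
        (fun h => hxq ((hfl _ _).mp h)), hF x hxp hxq, hf]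
    · rw [tieCorner_inr_false]
    · rw [tieCorner_inr_false_true, hu]
    · rw [tieCorner_inr_false]
    · rw [tieCorner_inr_true_true, hv]
  let fwd : (tie p q D).Vertex → Option D.Vertex := liftVertex (D := tie p q D) F
    (hcorner _ _ _ (Or.inl ⟨rfl, rfl⟩) D.vertexOf_solid fun _ _ => hD.solid_eq_leaf_iff)
    (hcorner _ _ _ (Or.inr ⟨rfl, rfl⟩) D.vertexOf_dashed fun _ _ => hD.dashed_eq_leaf_iff)
  let vt : D.Half ⊕ Bool × Bool → (tie p q D).Vertex := (tie p q D).vertexOf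
  have hvs : ∀ y, vt (tieCorner D.solid (D.leaf p) (D.leaf q) y) = vt y :=
    (tie p q D).vertexOf_solid
  have hvd : ∀ y, vt (tieCorner D.dashed (D.leaf q) (D.leaf p) y) = vt y :=
    (tie p q D).vertexOf_dashed
  let G : D.Half → (tie p q D).Vertex := fun x =>
    if x = D.leaf p then vt (Sum.inr (false, false)) else
      if x = D.leaf q then vt (Sum.inr (true, false)) else vt (Sum.inl x)
  have hGp : G (D.leaf p) = vt (Sum.inr (false, false)) := if_pos rfl
  have hGq : G (D.leaf q) = vt (Sum.inr (true, false)) := by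
    simp only [G, if_neg hl.symm, if_true]
  have hG : ∀ x, x ≠ D.leaf p → x ≠ D.leaf q → G x = vt (Sum.inl x) := by
    intro x h1 h2
    simp only [G, if_neg h1, if_neg h2]
  let inv : Option D.Vertex → (tie p q D).Vertex := fun o => match o with
    | none => vt (Sum.inr (false, true))
    | some v => liftVertex G (by
        intro x
        by_cases h1 : x = D.leaf p
        · rw [h1, hD.solid_leaf]
        by_cases h2 : x = D.leaf q
        · rw [h2, hD.solid_leaf]
        rw [hG x h1 h2, hG _ (fun h => h1 (hD.solid_eq_leaf_iff.mp h))
          (fun h => h2 (hD.solid_eq_leaf_iff.mp h)), ← hvs (Sum.inl x), tieCorner_inl h1 h2]) (by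
        intro x
        by_cases h1 : x = D.leaf p
        · rw [h1, hD.dashed_leaf]
        by_cases h2 : x = D.leaf q
        · rw [h2, hD.dashed_leaf]
        rw [hG x h1 h2, hG _ (fun h => h1 (hD.dashed_eq_leaf_iff.mp h))
          (fun h => h2 (hD.dashed_eq_leaf_iff.mp h)), ← hvd (Sum.inl x),
          tieCorner_inl h2 h1]) v
  refine Nat.card_congr ⟨fwd, inv, ?_, ?_⟩
  · have key : ∀ y : D.Half ⊕ Bool × Bool, inv (F y) = vt y := by
      have h2 : vt (Sum.inl (D.leaf p)) = vt (Sum.inr (false, true)) := by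
        rw [← hvs (Sum.inl (D.leaf p)), tieCorner_left]
      have h3 : vt (Sum.inl (D.leaf q)) = vt (Sum.inr (false, true)) := by
        rw [← hvd (Sum.inl (D.leaf q)), tieCorner_left]
      have h4 : vt (Sum.inr (true, true)) = vt (Sum.inr (false, true)) := by
        rw [← h3, ← hvs (Sum.inl (D.leaf q)), tieCorner_right hl]
      rintro (x | ⟨_ | _, _ | _⟩)
      · by_cases h1 : x = D.leaf p
        · rw [h1, hFp]; exact h2.symm
        by_cases h1' : x = D.leaf q
        · rw [h1', hFq]; exact h3.symm
        rw [hF x h1 h1']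
        exact hG x h1 h1'
      · exact hGp
      · rfl
      · exact hGq
      · exact h4.symm
    rintro ⟨y⟩
    exact key y
  · have key : ∀ x, fwd (G x) = some (D.vertexOf x) := by
      intro x
      by_cases h1 : x = D.leaf p
      · rw [h1, hGp]; rfl
      by_cases h2 : x = D.leaf q
      · rw [h2, hGq]; rfl
      rw [hG x h1 h2]
      exact hF x h1 h2
    rintro (_ | ⟨⟨x⟩⟩)
    · rfl
    · exact key x

open Classical in
theorem card_vertex_split {S A : L → L} {D : HalfEdgeDiagram L} (hD : Valid S A D)
    (hs : Splittable D (D.mate (D.leaf p))) :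
    Nat.card (split p D).Vertex = Nat.card D.Vertex + 1 := by
  have hcard : Nat.card D.Vertex + 1 = Nat.card (Option D.Vertex) := Finite.card_option.symm
  rw [hcard]
  obtain ⟨hsplit1, hsplit2⟩ := split_dashed_solid hD hs
  set h := D.mate (D.leaf p) with hh
  -- the half-edges that are separated from the rest of the vertex
  let P : D.Half → Prop := fun x => x = h ∨ x = D.solid h ∨ x = D.dashed h
  let F : D.Half ⊕ Bool → Option D.Vertex := fun y => match y with
    | Sum.inl x => if P x then none else some (D.vertexOf x)
    | Sum.inr false => none
    | Sum.inr true => some (D.vertexOf h)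
  have hF : ∀ x, ¬ P x → F (Sum.inl x) = some (D.vertexOf x) := fun x hx => if_neg hx
  have hFP : ∀ x, P x → F (Sum.inl x) = none := fun x hx => if_pos hx
  have hne1 : D.solid (D.dashed h) ≠ h := fun h1 => by
    have h2 := hs.solid_solid'
    rw [h1] at h2
    exact hs.ne h2
  have hne2 : D.dashed (D.solid h) ≠ h := fun h1 => by
    have h2 := hs.dashed_dashed'
    rw [h1] at h2
    exact hs.ne h2.symm
  have hdh : D.dashed h ≠ h := fun h1 => by
    obtain ⟨z, hz⟩ := (hD.dashed_eq_iff h).mp h1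
    exact hs.not_leaf hD z hz
  have hsh : D.solid h ≠ h := fun h1 => by
    obtain ⟨z, hz⟩ := (hD.solid_eq_iff h).mp h1
    exact hs.not_leaf hD z hz
  have hnP1 : ¬ P (D.solid (D.dashed h)) := by
    rintro (h1 | h1 | h1)
    · exact hne1 h1
    · exact hdh (hD.solid_injective h1)
    · exact hs.ne_solid h1.symm
  have hnP2 : ¬ P (D.dashed (D.solid h)) := by
    rintro (h1 | h1 | h1)
    · exact hne2 h1
    · exact hs.ne_dashed h1.symm
    · exact hsh (hD.dashed_injective h1)
  have hv1 : D.vertexOf (D.solid (D.dashed h)) = D.vertexOf h := by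
    rw [D.vertexOf_solid, D.vertexOf_dashed]
  have hv2 : D.vertexOf (D.dashed (D.solid h)) = D.vertexOf h := by
    rw [D.vertexOf_dashed, D.vertexOf_solid]
  have hFs : ∀ y, F (splitCorner D.solid (D.dashed h) (D.solid (D.dashed h)) y) = F y := by
    rintro (x | _ | _)
    · by_cases h1 : x = D.dashed h
      · rw [h1, splitCorner_left, hFP _ (Or.inr (Or.inr rfl))]
      by_cases h2 : x = D.solid (D.dashed h)
      · rw [h2, splitCorner_right hs.ne_solid, hF _ hnP1, hv1]
      rw [splitCorner_inl h1 h2]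
      by_cases h3 : P x
      · rw [hFP x h3]
        rcases h3 with rfl | rfl | rfl
        · exact hFP _ (Or.inr (Or.inl rfl))
        · exact hFP _ (Or.inl (hD.solid_solid _))
        · exact absurd rfl h1
      · rw [hF x h3, hF, D.vertexOf_solid]
        rintro (h4 | h4 | h4)
        · exact h3 (Or.inr (Or.inl (by rw [← h4, hD.solid_solid])))
        · exact h3 (Or.inl (hD.solid_injective h4))
        · exact h2 (by rw [← h4, hD.solid_solid])
    · rw [splitCorner_inr_false, hFP _ (Or.inr (Or.inr rfl))]
    · rw [splitCorner_inr_true, hF _ hnP1, hv1]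
  have hFd : ∀ y, F (splitCorner D.dashed (D.solid h) (D.dashed (D.solid h)) y) = F y := by
    rintro (x | _ | _)
    · by_cases h1 : x = D.solid h
      · rw [h1, splitCorner_left, hFP _ (Or.inr (Or.inl rfl))]
      by_cases h2 : x = D.dashed (D.solid h)
      · rw [h2, splitCorner_right hs.ne_dashed, hF _ hnP2, hv2]
      rw [splitCorner_inl h1 h2]
      by_cases h3 : P x
      · rw [hFP x h3]
        rcases h3 with rfl | rfl | rfl
        · exact hFP _ (Or.inr (Or.inr rfl))
        · exact absurd rfl h1
        · exact hFP _ (Or.inl (hD.dashed_dashed _))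
      · rw [hF x h3, hF, D.vertexOf_dashed]
        rintro (h4 | h4 | h4)
        · exact h3 (Or.inr (Or.inr (by rw [← h4, hD.dashed_dashed])))
        · exact h2 (by rw [← h4, hD.dashed_dashed])
        · exact h3 (Or.inl (hD.dashed_injective h4))
    · rw [splitCorner_inr_false, hFP _ (Or.inr (Or.inl rfl))]
    · rw [splitCorner_inr_true, hF _ hnP2, hv2]
  let fwd : (split p D).Vertex → Option D.Vertex := liftVertex (D := split p D) F hFs hFd
  let vt : D.Half ⊕ Bool → (split p D).Vertex := (split p D).vertexOf
  have hvs : ∀ y, vt (splitCorner D.solid (D.dashed h) (D.solid (D.dashed h)) y) = vt y :=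
    (split p D).vertexOf_solid
  have hvd : ∀ y, vt (splitCorner D.dashed (D.solid h) (D.dashed (D.solid h)) y) = vt y :=
    (split p D).vertexOf_dashed
  have hvt1 : vt (Sum.inl (D.solid (D.dashed h))) = vt (Sum.inr true) := by
    rw [← hvs, splitCorner_right hs.ne_solid]
  have hvt2 : vt (Sum.inl (D.dashed (D.solid h))) = vt (Sum.inr true) := by
    rw [← hvd, splitCorner_right hs.ne_dashed]
  let G : D.Half → (split p D).Vertex := fun x => if P x then vt (Sum.inr true) else vt (Sum.inl x)
  have hG : ∀ x, ¬ P x → G x = vt (Sum.inl x) := fun x hx => if_neg hx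
  have hGP : ∀ x, P x → G x = vt (Sum.inr true) := fun x hx => if_pos hx
  have hGs : ∀ x, G (D.solid x) = G x := by
    intro x
    by_cases h1 : x = D.dashed h
    · rw [h1, hG _ hnP1, hGP _ (Or.inr (Or.inr rfl)), hvt1]
    by_cases h2 : x = D.solid (D.dashed h)
    · rw [h2, hG _ hnP1, hs.solid_solid', hGP _ (Or.inr (Or.inr rfl)), hvt1]
    by_cases h3 : P x
    · rw [hGP x h3]
      rcases h3 with rfl | rfl | rfl
      · exact hGP _ (Or.inr (Or.inl rfl))
      · exact hGP _ (Or.inl (hD.solid_solid _))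
      · exact absurd rfl h1
    · rw [hG x h3, hG, ← hvs (Sum.inl x), splitCorner_inl h1 h2]
      rintro (h4 | h4 | h4)
      · exact h3 (Or.inr (Or.inl (by rw [← h4, hD.solid_solid])))
      · exact h3 (Or.inl (hD.solid_injective h4))
      · exact h2 (by rw [← h4, hD.solid_solid])
  have hGd : ∀ x, G (D.dashed x) = G x := by
    intro x
    by_cases h1 : x = D.solid h
    · rw [h1, hG _ hnP2, hGP _ (Or.inr (Or.inl rfl)), hvt2]
    by_cases h2 : x = D.dashed (D.solid h)
    · rw [h2, hG _ hnP2, hs.dashed_dashed', hGP _ (Or.inr (Or.inl rfl)), hvt2]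
    by_cases h3 : P x
    · rw [hGP x h3]
      rcases h3 with rfl | rfl | rfl
      · exact hGP _ (Or.inr (Or.inr rfl))
      · exact absurd rfl h1
      · exact hGP _ (Or.inl (hD.dashed_dashed _))
    · rw [hG x h3, hG, ← hvd (Sum.inl x), splitCorner_inl h1 h2]
      rintro (h4 | h4 | h4)
      · exact h3 (Or.inr (Or.inr (by rw [← h4, hD.dashed_dashed])))
      · exact h2 (by rw [← h4, hD.dashed_dashed])
      · exact h3 (Or.inl (hD.dashed_injective h4))
  let inv : Option D.Vertex → (split p D).Vertex := fun o => match o with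
    | none => vt (Sum.inr false)
    | some v => liftVertex G hGs hGd v
  refine Nat.card_congr ⟨fwd, inv, ?_, ?_⟩
  · have key : ∀ y : D.Half ⊕ Bool, inv (F y) = vt y := by
      have h2 : vt (Sum.inl (D.dashed h)) = vt (Sum.inr false) := by
        rw [← hvs, splitCorner_left]
      have h3 : vt (Sum.inl (D.solid h)) = vt (Sum.inr false) := by
        rw [← hvd, splitCorner_left]
      have h4 : vt (Sum.inl h) = vt (Sum.inr false) := by
        rw [← h3, ← hvs (Sum.inl h), hsplit1]
      rintro (x | _ | _)
      · by_cases h1 : P x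
        · rw [hFP x h1]
          rcases h1 with rfl | rfl | rfl
          exacts [h4.symm, h3.symm, h2.symm]
        · rw [hF x h1]
          exact hG x h1
      · rfl
      · exact hGP h (Or.inl rfl)
    rintro ⟨y⟩
    exact key y
  · have key : ∀ x, fwd (G x) = some (D.vertexOf x) := by
      intro x
      by_cases h1 : P x
      · rw [hGP x h1]
        refine congrArg some ?_
        rcases h1 with rfl | rfl | rfl
        · rfl
        · exact (D.vertexOf_solid _).symm
        · exact (D.vertexOf_dashed _).symm
      · rw [hG x h1]
        exact hF x h1
    rintro (_ | ⟨⟨x⟩⟩)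
    · rfl
    · exact key x

theorem card_vertex_addEdge {t : ℕ} (D : HalfEdgeDiagram (EndLabel t)) :
    Nat.card (addEdge D).Vertex = Nat.card D.Vertex + 2 := by
  have h2 : Nat.card D.Vertex + 2 = Nat.card (D.Vertex ⊕ Bool) := by rw [Nat.card_sum]; simp
  rw [h2]
  let fwd : (addEdge D).Vertex → D.Vertex ⊕ Bool :=
    liftVertex (D := addEdge D) (Sum.map D.vertexOf id : D.Half ⊕ Bool → D.Vertex ⊕ Bool)
      (by rintro (x | ε); exacts [congrArg Sum.inl (D.vertexOf_solid x), rfl])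
      (by rintro (x | ε); exacts [congrArg Sum.inl (D.vertexOf_dashed x), rfl])
  let inv : D.Vertex ⊕ Bool → (addEdge D).Vertex := Sum.elim
    (liftVertex (fun x => (addEdge D).vertexOf (Sum.inl x))
      (fun x => (addEdge D).vertexOf_solid (Sum.inl x))
      (fun x => (addEdge D).vertexOf_dashed (Sum.inl x)))
    (fun ε => (addEdge D).vertexOf (Sum.inr ε))
  refine Nat.card_congr ⟨fwd, inv, ?_, ?_⟩
  · rintro ⟨x | ε⟩ <;> rfl
  · rintro (⟨⟨x⟩⟩ | ε) <;> rfl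

end Count

end HalfEdgeDiagram

namespace HalfEdgeDiagram

/-! ### Counting isomorphism classes -/

section IsoCount

variable {L L' : Type}

instance isoSetoid (L : Type) : Setoid (HalfEdgeDiagram L) where
  r := Iso
  iseqv := ⟨Iso.refl, Iso.symm, Iso.trans⟩

/-- The isomorphism class of a diagram. -/
def isoClass (D : HalfEdgeDiagram L) : Quotient (isoSetoid L) := Quotient.mk _ D

theorem isoClass_eq_iff {D D' : HalfEdgeDiagram L} : isoClass D = isoClass D' ↔ Iso D D' :=
  Quotient.eq

/-- The isomorphism classes of the diagrams with property `Q`. -/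
def classSet (Q : HalfEdgeDiagram L → Prop) : Set (Quotient (isoSetoid L)) := isoClass '' {D | Q D}

/-- The number of isomorphism classes of diagrams with property `Q`. -/
noncomputable def isoCount (Q : HalfEdgeDiagram L → Prop) : ℕ := (classSet Q).ncard

theorem finite_classSet [Finite L] {Q : HalfEdgeDiagram L → Prop} {m : ℕ}
    (hQ : ∀ D, Q D → Nat.card D.Half = m) : (classSet Q).Finite := by
  let f : ((Fin m → Fin m) × (Fin m → Fin m) × (Fin m → Fin m) × (L → Fin m)) →
      Quotient (isoSetoid L) := fun x => isoClass
        { Half := Fin m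
          finite_half := inferInstance
          mate := x.1
          solid := x.2.1
          dashed := x.2.2.1
          leaf := x.2.2.2 }
  refine (Set.finite_range f).subset ?_
  rintro _ ⟨D, hD, rfl⟩
  have e : D.Half ≃ Fin m := Finite.equivFinOfCardEq (hQ D hD)
  refine ⟨(fun i => e (D.mate (e.symm i)), fun i => e (D.solid (e.symm i)),
    fun i => e (D.dashed (e.symm i)), fun z => e (D.leaf z)), ?_⟩
  refine isoClass_eq_iff.mpr (Iso.symm ⟨e, ?_, ?_, ?_, fun z => rfl⟩)
  · intro x; exact congrArg (fun y => e (D.mate y)) (e.symm_apply_apply x).symm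
  · intro x; exact congrArg (fun y => e (D.solid y)) (e.symm_apply_apply x).symm
  · intro x; exact congrArg (fun y => e (D.dashed y)) (e.symm_apply_apply x).symm

theorem isoCount_congr {Q Q' : HalfEdgeDiagram L → Prop} (h : ∀ D, Q D ↔ Q' D) :
    isoCount Q = isoCount Q' := by
  rw [show Q = Q' from funext fun D => propext (h D)]

theorem isoCount_eq_zero {Q : HalfEdgeDiagram L → Prop} (h : ∀ D, ¬ Q D) : isoCount Q = 0 := by
  have : classSet Q = ∅ := by
    rw [classSet, Set.image_eq_empty]
    exact Set.eq_empty_iff_forall_notMem.mpr h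
  rw [isoCount, this, Set.ncard_empty]

/-- A construction that respects and reflects isomorphy does not change the number of classes. -/
theorem isoCount_eq_of_map {Q : HalfEdgeDiagram L → Prop} {Q' : HalfEdgeDiagram L' → Prop}
    (f : HalfEdgeDiagram L → HalfEdgeDiagram L') (hf : ∀ D, Q D → Q' (f D))
    (hiso : ∀ D D', Q D → Q D' → (Iso (f D) (f D') ↔ Iso D D'))
    (hsurj : ∀ D', Q' D' → ∃ D, Q D ∧ Iso (f D) D') : isoCount Q = isoCount Q' := by
  have hrep : ∀ c : classSet Q, ∃ D, Q D ∧ isoClass D = c.1 := fun c => c.2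
  choose rep hQ hrep using hrep
  refine Nat.card_congr (Equiv.ofBijective
    (fun c => (⟨isoClass (f (rep c)), _, hf _ (hQ c), rfl⟩ : classSet Q')) ⟨?_, ?_⟩)
  · intro c c' h
    have h1 := (hiso _ _ (hQ c) (hQ c')).mp (isoClass_eq_iff.mp (congrArg Subtype.val h))
    exact Subtype.ext (by rw [← hrep, ← hrep, isoClass_eq_iff]; exact h1)
  · rintro ⟨_, D', hD', rfl⟩
    obtain ⟨D, hD, h⟩ := hsurj D' hD'
    let c : classSet Q := ⟨isoClass D, D, hD, rfl⟩
    refine ⟨c, Subtype.ext (isoClass_eq_iff.mpr (Iso.trans ?_ h))⟩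
    exact (hiso _ _ (hQ c) hD).mpr (isoClass_eq_iff.mp (hrep c))

theorem isoCount_eq_sum [Finite L] {ι : Type} [Fintype ι] {Q : HalfEdgeDiagram L → Prop} {m : ℕ}
    (hQ : ∀ D, Q D → Nat.card D.Half = m) (R : ι → HalfEdgeDiagram L → Prop)
    (hcover : ∀ D, Q D → ∃ i, R i D)
    (hexcl : ∀ D D' i j, Iso D D' → Q D → Q D' → R i D → R j D' → i = j) :
    isoCount Q = ∑ i, isoCount fun D => Q D ∧ R i D := by
  classical
  have h1 : classSet Q = ⋃ i, classSet fun D => Q D ∧ R i D := by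
    ext c
    simp only [Set.mem_iUnion]
    constructor
    · rintro ⟨D, hD, rfl⟩
      obtain ⟨i, hi⟩ := hcover D hD
      exact ⟨i, D, ⟨hD, hi⟩, rfl⟩
    · rintro ⟨i, D, hD, rfl⟩
      exact ⟨D, hD.1, rfl⟩
  rw [isoCount, h1, Set.ncard_iUnion_of_finite]
  · exact finsum_eq_sum_of_fintype _
  · exact fun i => finite_classSet fun D hD => hQ D hD.1
  · rintro i j hij
    rw [Function.onFun, Set.disjoint_left]
    rintro _ ⟨D, hD, rfl⟩ ⟨D', hD', h⟩
    exact hij (hexcl D D' i j (isoClass_eq_iff.mp h).symm hD.1 hD'.1 hD.2 hD'.2)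

theorem isoCount_eq_add [Finite L] {Q : HalfEdgeDiagram L → Prop} {m : ℕ}
    (hQ : ∀ D, Q D → Nat.card D.Half = m) (R : HalfEdgeDiagram L → Prop)
    (hR : ∀ D D', Iso D D' → R D → R D') :
    isoCount Q = isoCount (fun D => Q D ∧ R D) + isoCount fun D => Q D ∧ ¬ R D := by
  rw [isoCount_eq_sum hQ (fun (b : Bool) D => R D ↔ b = true), Fintype.sum_bool]
  · simp
  · intro D _
    by_cases h : R D
    · exact ⟨true, by simpa⟩
    · exact ⟨false, by simpa⟩
  · intro D D' i j hiso _ _ hi hj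
    have h : R D ↔ R D' := ⟨hR _ _ hiso, hR _ _ hiso.symm⟩
    rw [hi, hj] at h
    cases i <;> cases j <;> simp_all

end IsoCount

/-! ### Leaves and internal vertices -/

section Leaves

variable {L : Type} {S A : L → L} {D : HalfEdgeDiagram L}

theorem Valid.vertexOf_eq_leaf_iff (hD : Valid S A D) {x : D.Half} {z : L} :
    D.vertexOf x = D.vertexOf (D.leaf z) ↔ x = D.leaf z := by
  refine ⟨fun h => ?_, fun h => congrArg _ h⟩
  have h1 := congrArg (liftVertex (D := D) (fun x => x = D.leaf z)
    (fun x => propext hD.solid_eq_leaf_iff) fun x => propext hD.dashed_eq_leaf_iff) h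
  exact (iff_of_eq h1).mpr rfl

theorem Valid.vertexOf_leaf_injective (hD : Valid S A D) :
    Function.Injective fun z => D.vertexOf (D.leaf z) :=
  fun _ _ h => hD.leaf_injective (hD.vertexOf_eq_leaf_iff.mp h)

/-- If there are no vertices besides the leaves, every half-edge is at a leaf. -/
theorem Valid.exists_leaf_eq [Finite L] (hD : Valid S A D)
    (h : Nat.card D.Vertex = Nat.card L) (x : D.Half) : ∃ z, D.leaf z = x := by
  have hb := (Nat.bijective_iff_injective_and_card
    (fun z => D.vertexOf (D.leaf z))).mpr ⟨hD.vertexOf_leaf_injective, h.symm⟩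
  obtain ⟨z, hz⟩ := hb.2 (D.vertexOf x)
  exact ⟨z, (hD.vertexOf_eq_leaf_iff.mp hz.symm).symm⟩

/-- Every internal vertex has degree at least four. -/
theorem Valid.card_vertex_le [Finite L] (hD : Valid S A D) :
    4 * Nat.card D.Vertex ≤ Nat.card D.Half + 3 * Nat.card L := by
  classical
  have := Fintype.ofFinite D.Half
  have := Fintype.ofFinite D.Vertex
  have := Fintype.ofFinite L
  have h1 : ∀ c : D.Vertex, 4 ≤ Fintype.card {x // D.vertexOf x = c} +
      3 * Fintype.card {z // D.vertexOf (D.leaf z) = c} := by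
    rintro ⟨x⟩
    change 4 ≤ Fintype.card {y // D.vertexOf y = D.vertexOf x} +
      3 * Fintype.card {z // D.vertexOf (D.leaf z) = D.vertexOf x}
    by_cases hx : ∃ z, D.leaf z = x
    · obtain ⟨z, rfl⟩ := hx
      have h2 : 0 < Fintype.card {y // D.vertexOf y = D.vertexOf (D.leaf z)} :=
        Fintype.card_pos_iff.mpr ⟨⟨_, rfl⟩⟩
      have h3 : 0 < Fintype.card {y // D.vertexOf (D.leaf y) = D.vertexOf (D.leaf z)} :=
        Fintype.card_pos_iff.mpr ⟨⟨z, rfl⟩⟩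
      omega
    · have hsx : D.solid x ≠ x := fun h => hx ((hD.solid_eq_iff x).mp h)
      have hdx : D.dashed x ≠ x := fun h => hx ((hD.dashed_eq_iff x).mp h)
      have hsd : D.solid x ≠ D.dashed x := fun h => hsx (hD.solid_ne_dashed x h)
      have h2 : ({x, D.solid x, D.dashed x, D.solid (D.dashed x)} : Finset D.Half).card ≤
          Fintype.card {y // D.vertexOf y = D.vertexOf x} := by
        rw [Fintype.card_subtype]
        refine Finset.card_le_card fun y hy => ?_
        simp only [Finset.mem_insert, Finset.mem_singleton] at hy
        rw [Finset.mem_filter]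
        refine ⟨Finset.mem_univ _, ?_⟩
        rcases hy with rfl | rfl | rfl | rfl <;> simp [vertexOf_solid, vertexOf_dashed]
      have h3 : x ≠ D.solid (D.dashed x) := fun h => hsd (by
        conv_lhs => rw [h]
        exact hD.solid_solid _)
      have h4 : D.solid x ≠ D.solid (D.dashed x) := fun h => hdx (hD.solid_injective h).symm
      have h5 : D.dashed x ≠ D.solid (D.dashed x) := fun h => by
        obtain ⟨z, hz⟩ := (hD.solid_eq_iff _).mp h.symm
        exact hx ⟨z, (hD.dashed_eq_leaf_iff.mp hz.symm).symm⟩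
      rw [Finset.card_eq_of_equiv_fin (n := 4)] at h2
      · omega
      · refine Finset.equivFinOfCardEq ?_
        rw [Finset.card_insert_of_notMem, Finset.card_insert_of_notMem,
          Finset.card_insert_of_notMem, Finset.card_singleton]
        · simpa using h5
        · simpa using ⟨hsd, h4⟩
        · simpa using ⟨hsx.symm, hdx.symm, h3⟩
  have h2 := Finset.sum_le_sum fun c (_ : c ∈ Finset.univ) => h1 c
  have h3 : ∑ c, Fintype.card {x // D.vertexOf x = c} = Fintype.card D.Half := by
    rw [← Fintype.card_sigma]
    exact Fintype.card_congr (Equiv.sigmaFiberEquiv _)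
  have h4 : ∑ c, Fintype.card {z // D.vertexOf (D.leaf z) = c} = Fintype.card L := by
    rw [← Fintype.card_sigma]
    exact Fintype.card_congr (Equiv.sigmaFiberEquiv fun z => D.vertexOf (D.leaf z))
  rw [Finset.sum_add_distrib, ← Finset.mul_sum, h3, h4, Finset.sum_const, Finset.card_univ,
    smul_eq_mul] at h2
  simp only [Nat.card_eq_fintype_card]
  omega

end Leaves

/-! ### The recursion for the numbers of diagrams -/

section Recursion

variable {t : ℕ}

/-- The diagrams with target permutation `τ`: the dashed paths run between `τ z` and `z̄`. -/
def ValidFor (τ : Perm (EndLabel t)) (D : HalfEdgeDiagram (EndLabel t)) : Prop :=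
  Valid (barPerm t) (fun z => τ (barPerm t z)) D

/-- The diagrams with target permutation `τ`, with `v` internal vertices and `e` edges. -/
structure HasSize (τ : Perm (EndLabel t)) (v e : ℕ) (D : HalfEdgeDiagram (EndLabel t)) : Prop where
  validFor : ValidFor τ D
  card_vertex : Nat.card D.Vertex = v + 2 * t
  card_half : Nat.card D.Half = 2 * e

/-- The number of isomorphism classes of diagrams with target permutation `τ`, with `v` internal
vertices and `e` edges. -/
noncomputable def diagramCount (τ : Perm (EndLabel t)) (v e : ℕ) : ℕ := isoCount (HasSize τ v e)

theorem card_endLabel (t : ℕ) : Nat.card (EndLabel t) = 2 * t := by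
  simp [mul_comm]

/-- There are `2e` half-edges, at least four at each of the `v` internal vertices and one at each of the
`2t` leaves. -/
theorem HasSize.le {τ : Perm (EndLabel t)} {v e : ℕ} {D : HalfEdgeDiagram (EndLabel t)}
    (h : HasSize τ v e D) : t + 2 * v ≤ e := by
  have h1 := h.validFor.card_vertex_le
  rw [card_endLabel, h.card_vertex, h.card_half] at h1
  omega

/-- The half-edge `h` next to the leaf `1` is at another leaf. -/
def NextIsLeaf (D : HalfEdgeDiagram (EndLabel (t + 1))) : Prop :=
  ∃ z, D.leaf z = D.mate (D.leaf (firstLabel t))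

/-- The vertex next to the leaf `1` has degree four. -/
def NextIsQuartic (D : HalfEdgeDiagram (EndLabel (t + 1))) : Prop :=
  D.solid (D.dashed (D.mate (D.leaf (firstLabel t)))) =
    D.dashed (D.solid (D.mate (D.leaf (firstLabel t))))

/-- The half-edge that is opposite to the leaf `1` at the vertex next to it leads to the
leaf `r`. -/
def OppositeIsLeaf (r : EndLabel (t + 1)) (D : HalfEdgeDiagram (EndLabel (t + 1))) : Prop :=
  D.leaf r = D.mate (D.solid (D.dashed (D.mate (D.leaf (firstLabel t)))))

theorem NextIsLeaf.of_iso {D D' : HalfEdgeDiagram (EndLabel (t + 1))} :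
    Iso D D' → NextIsLeaf D → NextIsLeaf D' := by
  rintro ⟨φ, h⟩ ⟨z, hz⟩
  exact ⟨z, by rw [← h.leaf, hz, h.mate, h.leaf]⟩

theorem NextIsQuartic.of_iso {D D' : HalfEdgeDiagram (EndLabel (t + 1))} :
    Iso D D' → NextIsQuartic D → NextIsQuartic D' := by
  rintro ⟨φ, h⟩ hD
  rw [NextIsQuartic, ← h.leaf, ← h.mate, ← h.dashed, ← h.solid, ← h.solid, ← h.dashed, hD]

theorem OppositeIsLeaf.of_iso {r : EndLabel (t + 1)} {D D' : HalfEdgeDiagram (EndLabel (t + 1))} :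
    Iso D D' → OppositeIsLeaf r D → OppositeIsLeaf r D' := by
  rintro ⟨φ, h⟩ hD
  rw [OppositeIsLeaf, ← h.leaf, hD, h.mate, h.solid, h.dashed, h.mate, h.leaf]

/-- The number of diagrams in which the vertex next to the leaf `1` has degree greater than
four. -/
noncomputable def bigCount (τ : Perm (EndLabel (t + 1))) (v e : ℕ) : ℕ :=
  isoCount fun D => (HasSize τ v e D ∧ ¬ NextIsLeaf D) ∧ ¬ NextIsQuartic D

/-- The diagrams are distinguished by the vertex next to the leaf `1`: it is a leaf, it has degree four
and the opposite edge leads to the leaf `r`, it has degree four and the opposite edge leads to an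
internal vertex, or it has degree greater than four. -/
theorem diagramCount_eq (τ : Perm (EndLabel (t + 1))) (v e : ℕ) :
    diagramCount τ v e = (isoCount fun D => HasSize τ v e D ∧ NextIsLeaf D) +
      ((∑ r ∈ Finset.univ.erase (firstLabel t),
          isoCount fun D => ((HasSize τ v e D ∧ ¬ NextIsLeaf D) ∧ NextIsQuartic D) ∧
            OppositeIsLeaf r D) +
        isoCount (fun D => ((HasSize τ v e D ∧ ¬ NextIsLeaf D) ∧ NextIsQuartic D) ∧
          ¬ ∃ r, OppositeIsLeaf r D) + bigCount τ v e) := by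
  have hQ : ∀ D, HasSize τ v e D → Nat.card D.Half = 2 * e := fun D hD => hD.card_half
  rw [diagramCount, isoCount_eq_add hQ NextIsLeaf fun _ _ => NextIsLeaf.of_iso]
  congr 1
  rw [isoCount_eq_add (fun D hD => hQ D hD.1) NextIsQuartic fun _ _ => NextIsQuartic.of_iso]
  congr 1
  rw [isoCount_eq_add (fun D hD => hQ D hD.1.1) (fun D => ∃ r, OppositeIsLeaf r D)
    fun _ _ h ⟨r, hr⟩ => ⟨r, hr.of_iso h⟩]
  congr 1
  rw [isoCount_eq_sum (fun D hD => hQ D hD.1.1.1) OppositeIsLeaf fun D hD => hD.2]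
  · rw [← Finset.add_sum_erase _ _ (Finset.mem_univ (firstLabel t)), isoCount_eq_zero, zero_add]
    · refine Finset.sum_congr rfl fun r _ => isoCount_congr fun D => ?_
      exact ⟨fun h => ⟨h.1.1, h.2⟩, fun h => ⟨⟨h.1, r, h.2⟩, h.2⟩⟩
    · rintro D ⟨⟨⟨⟨hD, hnl⟩, _⟩, _⟩, h⟩
      have hv := hD.validFor
      rw [OppositeIsLeaf, ← hv.mate_injective.eq_iff, hv.mate_mate] at h
      set x := D.mate (D.leaf (firstLabel t)) with hx
      have h2 : D.solid x = D.dashed x := by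
        conv_lhs => rw [h]
        exact hv.solid_solid _
      obtain ⟨z, hz⟩ := (hv.solid_eq_iff x).mp (hv.solid_ne_dashed x h2)
      exact hnl ⟨z, hz⟩
  · intro D D' i j hiso hD hD' hi hj
    have h1 := hi.of_iso hiso
    rw [OppositeIsLeaf] at h1 hj
    exact hD'.1.1.1.validFor.leaf_injective (h1.trans hj.symm)

theorem diagramCount_right_zero (τ : Perm (EndLabel (t + 1))) (v : ℕ) :
    diagramCount τ v 0 = 0 :=
  isoCount_eq_zero fun D hD => by have := hD.le; omega

theorem HasSize.nextIsLeaf {τ : Perm (EndLabel (t + 1))} {e : ℕ}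
    {D : HalfEdgeDiagram (EndLabel (t + 1))} (hD : HasSize τ 0 e D) : NextIsLeaf D :=
  hD.validFor.exists_leaf_eq (by rw [hD.card_vertex, card_endLabel, zero_add]) _

theorem bigCount_left_zero (τ : Perm (EndLabel (t + 1))) (e : ℕ) : bigCount τ 0 e = 0 :=
  isoCount_eq_zero fun _ hD => hD.1.2 hD.1.1.nextIsLeaf

theorem bigCount_right_zero (τ : Perm (EndLabel (t + 1))) (v : ℕ) : bigCount τ v 0 = 0 :=
  isoCount_eq_zero fun _ hD => by have := hD.1.1.le; omega

theorem validFor_addEdge_iff (τ : Perm (EndLabel t)) (D : HalfEdgeDiagram (EndLabel t)) :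
    ValidFor (extendPerm t τ) (addEdge D) ↔ ValidFor τ D :=
  addEdge_valid_iff (fun ε => rfl) (fun z => rfl) (fun ε => extendPerm_zero _ _)
    (fun z => by rw [barPerm_shiftLabel, extendPerm_shiftLabel])

theorem hasSize_addEdge_iff (τ : Perm (EndLabel t)) (v e : ℕ) (D : HalfEdgeDiagram (EndLabel t)) :
    HasSize (extendPerm t τ) v (e + 1) (addEdge D) ↔ HasSize τ v e D := by
  constructor
  · intro h
    refine ⟨(validFor_addEdge_iff τ D).mp h.validFor, ?_, ?_⟩
    · have := h.card_vertex; rw [card_vertex_addEdge] at this; omega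
    · have := h.card_half; rw [card_half_addEdge] at this; omega
  · intro h
    refine ⟨(validFor_addEdge_iff τ D).mpr h.validFor, ?_, ?_⟩
    · have := h.card_vertex; rw [card_vertex_addEdge]; omega
    · have := h.card_half; rw [card_half_addEdge]; omega

/-- These diagrams arise by adding an edge between the leaves `1` and `1̄`. -/
theorem isoCount_nextIsLeaf (w : Perm (EndLabel (t + 1))) {τ : Perm (EndLabel t)}
    (hτ : extendPerm t τ = orthTarget w) (v e : ℕ) :
    (isoCount fun D => HasSize (orthTarget w) v (e + 1) D ∧ NextIsLeaf D) =
      diagramCount τ v e := by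
  symm
  rw [← hτ]
  refine isoCount_eq_of_map addEdge (fun D hD => ⟨(hasSize_addEdge_iff _ _ _ _).mpr hD,
    (0, true), rfl⟩) (fun D D' _ _ => addEdge_iso_iff) ?_
  rintro D ⟨hD, z, hz⟩
  have h1 := mate_leaf_eq hD.validFor rfl (by
    rw [show barPerm (t + 1) (firstLabel t) = (0, true) from rfl, extendPerm_zero]
    simp [firstLabel]) hz.symm
  rw [h1.1] at hz
  obtain ⟨D', hD'⟩ := exists_addEdge_iso hD.validFor hz.symm
  refine ⟨D', (hasSize_addEdge_iff τ v e D').mp ⟨Valid.of_iso hD.validFor hD'.symm, ?_, ?_⟩, hD'⟩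
  · rw [hD'.card_vertex, hD.card_vertex]
  · rw [hD'.card_half, hD.card_half]

theorem isoCount_nextIsLeaf_of_notMem {w : Perm (EndLabel (t + 1))}
    (hτ : ∀ τ, extendPerm t τ ≠ orthTarget w) (v e : ℕ) :
    (isoCount fun D => HasSize (orthTarget w) v e D ∧ NextIsLeaf D) = 0 := by
  refine isoCount_eq_zero ?_
  rintro D ⟨hD, z, hz⟩
  have hne : orthTarget w (barPerm (t + 1) (firstLabel t)) ≠ firstLabel t := orthTarget_bar_ne w _
  have h1 := (mate_leaf_eq hD.validFor rfl hne hz.symm).2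
  have h2 := orthTarget_bar_bar w (firstLabel t)
  rw [h1] at h2
  have h3 : orthTarget w (0, true) = (0, true) := orthTarget_zero_true h2
  obtain ⟨τ, h4⟩ := exists_extendPerm_eq (σ := orthTarget w) fun ε => by cases ε <;> assumption
  exact hτ τ h4

theorem swap_bar {r s z : EndLabel t} :
    swap (barPerm t r) (barPerm t s) (barPerm t z) = barPerm t (swap r s z) :=
  (barPerm t).injective.swap_apply r s z

section Moves

variable {r : EndLabel (t + 1)} (D : HalfEdgeDiagram (EndLabel (t + 1)))

theorem tie_mate_leaf_first :
    (tie (firstLabel t) r D).mate ((tie (firstLabel t) r D).leaf (firstLabel t)) =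
      (Sum.inr (false, true) : D.Half ⊕ Bool × Bool) := by
  have h1 : tieLeaf (firstLabel t) r D.leaf (firstLabel t) = Sum.inr (false, false) := by
    simp [tieLeaf]
  exact congrArg (tieMate D.mate) h1

theorem not_nextIsLeaf_tie (r : EndLabel (t + 1)) : ¬ NextIsLeaf (tie (firstLabel t) r D) := by
  rintro ⟨z, hz⟩
  rw [tie_mate_leaf_first] at hz
  have hz' : tieLeaf (firstLabel t) r D.leaf z = Sum.inr (false, true) := hz
  unfold tieLeaf at hz'
  split_ifs at hz' <;> simp at hz'

theorem nextIsQuartic_tie (hl : D.leaf (firstLabel t) ≠ D.leaf r) :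
    NextIsQuartic (tie (firstLabel t) r D) := by
  rw [NextIsQuartic, tie_mate_leaf_first]
  exact (tieCorner_right (f := D.solid) hl).trans (tieCorner_right (f := D.dashed) hl.symm).symm

theorem oppositeIsLeaf_tie (hr : firstLabel t ≠ r) (hl : D.leaf (firstLabel t) ≠ D.leaf r) :
    OppositeIsLeaf r (tie (firstLabel t) r D) := by
  rw [OppositeIsLeaf, tie_mate_leaf_first]
  have h1 : tieLeaf (firstLabel t) r D.leaf r = Sum.inr (true, false) := by
    simp [tieLeaf, hr.symm]
  exact h1.trans (congrArg (tieMate D.mate) (tieCorner_right (f := D.solid) hl)).symm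

theorem nextIsLeaf_of_split : NextIsLeaf (split (firstLabel t) D) → NextIsLeaf D :=
  fun ⟨z, hz⟩ => ⟨z, Sum.inl_injective hz⟩

variable {D} {S A : EndLabel (t + 1) → EndLabel (t + 1)}

theorem nextIsQuartic_split (hD : Valid S A D)
    (hs : Splittable D (D.mate (D.leaf (firstLabel t)))) :
    NextIsQuartic (split (firstLabel t) D) := by
  obtain ⟨h1, h2⟩ := split_dashed_solid hD hs
  exact (congrArg (splitCorner D.solid _ _) h2).trans (splitCorner_left.trans
    ((congrArg (splitCorner D.dashed _ _) h1).trans splitCorner_left).symm)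

theorem not_oppositeIsLeaf_split (hD : Valid S A D)
    (hs : Splittable D (D.mate (D.leaf (firstLabel t)))) :
    ¬ ∃ r, OppositeIsLeaf r (split (firstLabel t) D) := by
  rintro ⟨r, hr⟩
  obtain ⟨h1, h2⟩ := split_dashed_solid hD hs
  have h3 : (Sum.inl (D.leaf r) : D.Half ⊕ Bool) = addMate D.mate (splitCorner D.solid
      (D.dashed (D.mate (D.leaf (firstLabel t))))
      (D.solid (D.dashed (D.mate (D.leaf (firstLabel t)))))
      (splitCorner D.dashed (D.solid (D.mate (D.leaf (firstLabel t))))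
        (D.dashed (D.solid (D.mate (D.leaf (firstLabel t)))))
        (Sum.inl (D.mate (D.leaf (firstLabel t)))))) := hr
  rw [h2, splitCorner_left] at h3
  exact Sum.inl_ne_inr h3

end Moves

/-- These diagrams arise by tying the leaves `1` and `r`. -/
theorem isoCount_oppositeIsLeaf (τ : Perm (EndLabel (t + 1))) {r : EndLabel (t + 1)}
    (hr : firstLabel t ≠ r) (v e : ℕ) :
    (isoCount fun D => ((HasSize τ (v + 1) (e + 2) D ∧ ¬ NextIsLeaf D) ∧ NextIsQuartic D) ∧
      OppositeIsLeaf r D) = diagramCount (untiedTarget τ r) v e := by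
  classical
  symm
  have key : ∀ D : HalfEdgeDiagram (EndLabel (t + 1)),
      (∀ z, D.solid (D.leaf z) = D.leaf z) → (∀ z, D.dashed (D.leaf z) = D.leaf z) →
      D.leaf (firstLabel t) ≠ D.leaf r →
      (ValidFor τ (tie (firstLabel t) r D) ↔ ValidFor (untiedTarget τ r) D) := by
    intro D hs hd hl
    have h1 := tie_valid_iff (S := barPerm (t + 1))
      (A := fun z => untiedTarget τ r (barPerm (t + 1) z)) hr hs hd hl
    rw [← ValidFor] at h1
    rw [← h1, ValidFor]
    refine iff_of_eq (congrArg (fun A => Valid _ A _) (funext fun z => ?_))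
    simp only [untiedTarget, Perm.mul_apply, swap_bar]
    have h2 : ∀ y, (@swap _ (fun a b => Classical.propDecidable (a = b)) (firstLabel t) r) y =
        swap (firstLabel t) r y := fun y => by
      congr 2; exact Subsingleton.elim _ _
    simp [h2]
  refine isoCount_eq_of_map (tie (firstLabel t) r) ?_ ?_ ?_
  · intro D hD
    have hv := hD.validFor
    have hl : D.leaf (firstLabel t) ≠ D.leaf r := fun h => hr (hv.leaf_injective h)
    have hvt := (key D hv.solid_leaf hv.dashed_leaf hl).mpr hv
    refine ⟨⟨⟨⟨hvt, ?_, ?_⟩, ?_⟩, ?_⟩, ?_⟩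
    · rw [card_vertex_tie hr hv, hD.card_vertex]; omega
    · rw [card_half_tie, hD.card_half]; omega
    · exact not_nextIsLeaf_tie D r
    · exact nextIsQuartic_tie D hl
    · exact oppositeIsLeaf_tie D hr hl
  · exact fun D D' hD hD' => tie_iso_iff hr hD.validFor hD'.validFor
  · rintro D ⟨⟨⟨hD, hnl⟩, h4⟩, ho⟩
    obtain ⟨D', hs, hd, hl, hiso⟩ := exists_tie_iso hr hD.validFor rfl
      (fun z hz => hnl ⟨z, hz⟩) h4 ho.symm
    have hv := (key D' hs hd hl).mp (Valid.of_iso hD.validFor hiso.symm)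
    have h1 := hiso.card_vertex
    have h2 := hiso.card_half
    rw [card_vertex_tie hr hv, hD.card_vertex] at h1
    rw [card_half_tie, hD.card_half] at h2
    exact ⟨D', ⟨hv, by omega, by omega⟩, hiso⟩

theorem isoCount_oppositeIsLeaf_one (τ : Perm (EndLabel (t + 1))) (r : EndLabel (t + 1)) (v : ℕ) :
    (isoCount fun D => ((HasSize τ (v + 1) 1 D ∧ ¬ NextIsLeaf D) ∧ NextIsQuartic D) ∧
      OppositeIsLeaf r D) = 0 :=
  isoCount_eq_zero fun _ hD => by have := hD.1.1.1.le; omega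

/-- These diagrams arise by splitting the vertex next to the leaf `1`. -/
theorem isoCount_opposite_not_leaf (τ : Perm (EndLabel (t + 1))) (v e : ℕ) :
    (isoCount fun D => ((HasSize τ (v + 1) (e + 1) D ∧ ¬ NextIsLeaf D) ∧ NextIsQuartic D) ∧
      ¬ ∃ r, OppositeIsLeaf r D) = bigCount τ v e := by
  symm
  refine isoCount_eq_of_map (split (firstLabel t)) ?_ ?_ ?_
  · rintro D ⟨⟨hD, hnl⟩, h4⟩
    have hs := hD.validFor.splittable (fun z hz => hnl ⟨z, hz⟩) h4
    refine ⟨⟨⟨⟨(split_valid_iff hs).mpr hD.validFor, ?_, ?_⟩, ?_⟩, ?_⟩, ?_⟩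
    · rw [card_vertex_split hD.validFor hs, hD.card_vertex]; omega
    · rw [card_half_split, hD.card_half]; omega
    · exact fun h => hnl (nextIsLeaf_of_split D h)
    · exact nextIsQuartic_split hD.validFor hs
    · exact not_oppositeIsLeaf_split hD.validFor hs
  · rintro D D' ⟨⟨hD, hnl⟩, h4⟩ ⟨⟨hD', hnl'⟩, h4'⟩
    exact split_iso_iff hD.validFor hD'.validFor
      (hD.validFor.splittable (fun z hz => hnl ⟨z, hz⟩) h4)
      (hD'.validFor.splittable (fun z hz => hnl' ⟨z, hz⟩) h4')
  · rintro D ⟨⟨⟨hD, hnl⟩, h4⟩, ho⟩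
    obtain ⟨D', hs, hiso⟩ := exists_split_iso hD.validFor rfl
      (fun z hz => hnl ⟨z, hz⟩) h4 (fun z hz => ho ⟨z, hz⟩)
    have hv : ValidFor τ D' := (split_valid_iff hs).mp (Valid.of_iso hD.validFor hiso.symm)
    have h1 := hiso.card_vertex
    have h2 := hiso.card_half
    rw [card_vertex_split hv hs, hD.card_vertex] at h1
    rw [card_half_split, hD.card_half] at h2
    exact ⟨D', ⟨⟨⟨hv, by omega, by omega⟩, fun ⟨z, hz⟩ => hs.not_leaf hv z hz⟩, hs.ne'⟩, hiso⟩

end Recursion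

end HalfEdgeDiagram

namespace HalfEdgeDiagram

/-! ### Diagrams that do not cancel -/

section Cancel

theorem isEmpty_half_of_validFor {τ : Perm (EndLabel 0)} {D : HalfEdgeDiagram (EndLabel 0)}
    (hD : ValidFor τ D) : IsEmpty D.Half := by
  by_contra h
  rw [not_isEmpty_iff] at h
  obtain ⟨x⟩ := h
  obtain ⟨z, -⟩ := (hD.solid_paths Set.univ (fun _ _ => trivial) fun _ _ => trivial).1 ⟨x, trivial⟩
  exact z.1.elim0

theorem diagramCount_empty (τ : Perm (EndLabel 0)) (v e : ℕ) :
    diagramCount τ v e = if v = 0 ∧ e = 0 then 1 else 0 := by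
  split_ifs with h
  · obtain ⟨rfl, rfl⟩ := h
    let D : HalfEdgeDiagram (EndLabel 0) := ⟨Empty, inferInstance, id, id, id, fun z => z.1.elim0⟩
    have hE : IsEmpty D.Half := inferInstanceAs (IsEmpty Empty)
    have hv : IsEmpty D.Vertex := ⟨fun c => Quot.ind (β := fun _ => False) (fun x => hE.elim x) c⟩
    have hpath : ∀ (S : EndLabel 0 → EndLabel 0) (f : D.Half → D.Half),
        LeafPaths S D.mate f D.leaf := fun S f C _ _ =>
      ⟨fun ⟨x, _⟩ => hE.elim x, fun z => z.1.elim0⟩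
    have hD : HasSize τ 0 0 D := by
      refine ⟨⟨fun x => hE.elim x, fun x => hE.elim x, fun x => hE.elim x, fun x => hE.elim x,
        fun x => hE.elim x, fun x => hE.elim x, fun z => z.1.elim0, fun x => hE.elim x,
        hpath _ _, hpath _ _⟩, ?_, ?_⟩ <;> simp
    have : classSet (HasSize τ 0 0) = {isoClass D} := by
      refine Set.eq_singleton_iff_unique_mem.mpr ⟨⟨D, hD, rfl⟩, ?_⟩
      rintro _ ⟨D', hD', rfl⟩
      have hE' := isEmpty_half_of_validFor hD'.validFor
      exact isoClass_eq_iff.mpr ⟨Equiv.equivOfIsEmpty _ _, fun x => hE'.elim x,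
        fun x => hE'.elim x, fun x => hE'.elim x, fun z => z.1.elim0⟩
    rw [diagramCount, isoCount, this, Set.ncard_singleton]
  · refine isoCount_eq_zero fun D hD => h ?_
    have hE := isEmpty_half_of_validFor hD.validFor
    have hv : IsEmpty D.Vertex := ⟨fun c => Quot.ind (β := fun _ => False) (fun x => hE.elim x) c⟩
    have h1 := hD.card_half
    have h2 := hD.card_vertex
    rw [Nat.card_of_isEmpty] at h1 h2
    omega

/-- The array `x` shifted by one in both indices. -/
def diagShift (x : ℕ → ℕ → ℕ) : ℕ → ℕ → ℕ
  | v + 1, e + 1 => x v e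
  | _, _ => 0

@[simp] theorem diagShift_succ_succ (x : ℕ → ℕ → ℕ) (v e : ℕ) :
    diagShift x (v + 1) (e + 1) = x v e := rfl

@[simp] theorem diagShift_left_zero (x : ℕ → ℕ → ℕ) (e : ℕ) : diagShift x 0 e = 0 := rfl

@[simp] theorem diagShift_right_zero (x : ℕ → ℕ → ℕ) (v : ℕ) : diagShift x v 0 = 0 := by
  cases v <;> rfl

variable {t : ℕ}

theorem diagramCount_zero_succ (τ : Perm (EndLabel (t + 1))) (e : ℕ) :
    diagramCount τ 0 (e + 1) = isoCount fun D => HasSize τ 0 (e + 1) D ∧ NextIsLeaf D :=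
  isoCount_congr fun _ => ⟨fun h => ⟨h, h.nextIsLeaf⟩, fun h => h.1⟩

theorem diagramCount_succ_one (τ : Perm (EndLabel (t + 1))) (v : ℕ) :
    diagramCount τ (v + 1) 1 = (isoCount fun D => HasSize τ (v + 1) 1 D ∧ NextIsLeaf D) +
      bigCount τ (v + 1) 1 := by
  rw [diagramCount_eq, isoCount_opposite_not_leaf τ v 0, bigCount_right_zero,
    Finset.sum_eq_zero fun r _ => isoCount_oppositeIsLeaf_one τ r v, zero_add, zero_add]

/-- The recursion for the numbers of diagrams. The diagrams in which the vertex next to the leaf `1`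
is big occur twice, the second time after splitting this vertex. -/
theorem diagramCount_succ_succ (τ : Perm (EndLabel (t + 1))) (v e : ℕ) :
    diagramCount τ (v + 1) (e + 2) =
      (isoCount fun D => HasSize τ (v + 1) (e + 2) D ∧ NextIsLeaf D) +
      ((∑ r ∈ Finset.univ.erase (firstLabel t), diagramCount (untiedTarget τ r) v e +
        bigCount τ v (e + 1)) + bigCount τ (v + 1) (e + 2)) := by
  rw [diagramCount_eq, isoCount_opposite_not_leaf τ v (e + 1)]
  congr 3
  exact Finset.sum_congr rfl fun r hr =>
    isoCount_oppositeIsLeaf τ (Finset.ne_of_mem_erase hr).symm v e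

/-- The number of diagrams is the number of palindromic primitive factorizations up to a term that
cancels in the alternating sum over the diagrams with the same number `e - v`. -/
theorem exists_diagramCount_eq (t : ℕ) (w : Perm (EndLabel t)) : ∃ x : ℕ → ℕ → ℕ, ∀ v e,
    diagramCount (orthTarget w) v e =
      (if e = t + 2 * v then palindromicCount (orthTarget w) v else 0) + x v e +
        diagShift x v e := by
  induction t with
  | zero =>
    refine ⟨fun _ _ => 0, fun v e => ?_⟩
    rw [diagramCount_empty]
    have h1 : orthTarget w = 1 := Subsingleton.elim _ _
    cases v with
    | zero => simp [palindromicCount_zero, h1]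
    | succ v => cases e <;> simp [palindromicCount_empty]
  | succ t ih =>
    have hq : ∀ w : Perm (EndLabel (t + 1)), ∃ (x : ℕ → ℕ → ℕ) (c : ℕ → ℕ),
        (∀ v e, (isoCount fun D => HasSize (orthTarget w) v (e + 1) D ∧ NextIsLeaf D) =
          (if e = t + 2 * v then c v else 0) + x v e + diagShift x v e) ∧
        palindromicCount (orthTarget w) 0 = c 0 ∧
        ∀ v, palindromicCount (orthTarget w) (v + 1) = c (v + 1) +
          ∑ r ∈ Finset.univ.erase (firstLabel t),
            palindromicCount (orthTarget (w * swap (firstLabel t) r)) v := by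
      intro w
      simp only [← untiedTarget_orthTarget]
      by_cases h : ∃ τ, extendPerm t τ = orthTarget w
      · obtain ⟨τ, hτ⟩ := h
        obtain ⟨w', rfl⟩ := orthTarget_of_extendPerm hτ
        obtain ⟨x, hx⟩ := ih w'
        refine ⟨x, palindromicCount (orthTarget w'), fun v e => ?_, ?_, fun v => ?_⟩
        · rw [isoCount_nextIsLeaf w hτ, hx]
        · rw [← hτ, palindromicCount_extendPerm_zero]
        · rw [← hτ, palindromicCount_extendPerm_succ]
      · rw [not_exists] at h
        refine ⟨fun _ _ => 0, fun _ => 0, fun v e => ?_, palindromicCount_zero_of_notMem h,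
          fun v => by rw [palindromicCount_succ_of_notMem h, zero_add]⟩
        rw [isoCount_nextIsLeaf_of_notMem h]
        cases v <;> cases e <;> simp
    choose xq c hleaf hc0 hc using hq
    let pre : (ℕ → ℕ) → ℕ → ℕ := fun f e => e.casesOn 0 f
    let x : ℕ → Perm (EndLabel (t + 1)) → ℕ → ℕ := fun v => v.rec (fun w => pre (xq w 0))
      fun v x w e => pre (xq w (v + 1)) e +
        ∑ r ∈ Finset.univ.erase (firstLabel t), pre (pre (x (w * swap (firstLabel t) r))) e +
          bigCount (orthTarget w) (v + 1) e
    have hx : ∀ w v e, x v w (e + 1) = xq w v e + ∑ r ∈ Finset.univ.erase (firstLabel t),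
        diagShift (fun v => x v (w * swap (firstLabel t) r)) v e +
          bigCount (orthTarget w) v (e + 1) := by
      intro w v e
      cases v with
      | zero => simp [x, pre, bigCount_left_zero]
      | succ v => cases e <;> simp [x, pre]
    have hx0 : ∀ w v, x v w 0 = 0 := by
      intro w v
      cases v <;> simp [x, pre, bigCount_right_zero]
    clear_value x
    refine ⟨fun v => x v w, fun v => ?_⟩
    induction v generalizing w with
    | zero =>
      intro e
      beta_reduce
      cases e with
      | zero => rw [diagramCount_right_zero, hx0]; simp
      | succ e =>
        rw [diagramCount_zero_succ, hleaf, hx, hc0, bigCount_left_zero]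
        simp
    | succ v ihv =>
      intro e
      beta_reduce
      rcases e with _ | _ | e
      · rw [diagramCount_right_zero, hx0, diagShift_right_zero, if_neg (by omega)]
      · have h1 : diagramCount (orthTarget w) (v + 1) (0 + 1) = _ := diagramCount_succ_one _ v
        rw [h1, hleaf w (v + 1) 0, hx w (v + 1) 0, diagShift_succ_succ, hx0, if_neg (by omega), if_neg (by omega)]
        simp
      · rw [diagramCount_succ_succ, hleaf w (v + 1) (e + 1), hx w (v + 1) (e + 1),
          diagShift_succ_succ, diagShift_succ_succ, hx w v e, hc]
        simp only [untiedTarget_orthTarget, ihv, Finset.sum_add_distrib, diagShift_succ_succ]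
        by_cases h : e = t + 1 + 2 * v
        · rw [if_pos (by omega), if_pos (by omega), Finset.sum_congr rfl fun r _ => if_pos h]
          ring
        · rw [if_neg (by omega), if_neg (by omega), Finset.sum_congr rfl fun r _ => if_neg h]
          simp only [Finset.sum_const_zero]
          ring

end Cancel

end HalfEdgeDiagram

/-! ### Orthogonal diagrams in terms of half-edges -/

/-- A fixed-point free involution pairs up the elements. -/
theorem even_card_of_involution {α : Type} [Finite α] (f : α → α) (hf : ∀ x, f (f x) = x)
    (hne : ∀ x, f x ≠ x) : Even (Nat.card α) := by
  classical
  have := Fintype.ofFinite α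
  rw [Nat.card_eq_fintype_card, ← Finset.card_univ, ← ZMod.natCast_eq_zero_iff_even,
    Finset.cast_card]
  exact Finset.sum_involution (fun x _ => f x) (fun x _ => by decide) (fun x _ _ => hne x)
    (fun x _ => Finset.mem_univ _) fun x _ => hf x

theorem segmentOf_along (G : RibbonGraph) (f : G.Flag) :
    G.segmentOf (G.along f) = G.segmentOf f :=
  (Quot.sound (r := fun f g : G.Flag => g = G.along f ∨ (G.corner f ≠ G.across f ∧ g = G.corner f))
    (Or.inl rfl)).symm

theorem segmentOf_corner (G : RibbonGraph) {f : G.Flag} (hf : G.corner f ≠ G.across f) :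
    G.segmentOf (G.corner f) = G.segmentOf f :=
  (Quot.sound (r := fun f g : G.Flag => g = G.along f ∨ (G.corner f ≠ G.across f ∧ g = G.corner f))
    (Or.inr ⟨hf, rfl⟩)).symm

namespace HalfEdgeDiagram

variable {t : ℕ} {τ : Perm (EndLabel t)}

open Classical in
/-- The corner structure on the two flags `(x, true)` (solid) and `(x, false)` (dashed) of each
half-edge `x`. -/
noncomputable def flagCorner (E : HalfEdgeDiagram (EndLabel t)) (f : E.Half × Bool) :
    E.Half × Bool :=
  if E.solid f.1 = f.1 then (f.1, !f.2) else (if f.2 then E.solid f.1 else E.dashed f.1, f.2)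

theorem flagCorner_of_eq {E : HalfEdgeDiagram (EndLabel t)} {x : E.Half} (h : E.solid x = x)
    (b : Bool) : E.flagCorner (x, b) = (x, !b) := if_pos h

theorem flagCorner_true {E : HalfEdgeDiagram (EndLabel t)} {x : E.Half} (h : E.solid x ≠ x) :
    E.flagCorner (x, true) = (E.solid x, true) := if_neg h

theorem flagCorner_false {E : HalfEdgeDiagram (EndLabel t)} {x : E.Half} (h : E.solid x ≠ x) :
    E.flagCorner (x, false) = (E.dashed x, false) := if_neg h

theorem Valid.solid_eq_iff_dashed_eq {L : Type} {S A : L → L} {E : HalfEdgeDiagram L}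
    (hE : Valid S A E) (x : E.Half) : E.solid x = x ↔ E.dashed x = x := by
  rw [hE.solid_eq_iff, hE.dashed_eq_iff]

theorem Valid.solid_solid_ne {L : Type} {S A : L → L} {E : HalfEdgeDiagram L}
    (hE : Valid S A E) {x : E.Half} (h : E.solid x ≠ x) : E.solid (E.solid x) ≠ E.solid x :=
  fun h1 => h (hE.solid_injective h1)

theorem Valid.solid_dashed_ne {L : Type} {S A : L → L} {E : HalfEdgeDiagram L}
    (hE : Valid S A E) {x : E.Half} (h : E.solid x ≠ x) : E.solid (E.dashed x) ≠ E.dashed x := by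
  rw [Ne, hE.solid_eq_iff_dashed_eq] at h ⊢
  exact fun h1 => h (hE.dashed_injective h1)

/-- The map with two flags for each half-edge. -/
noncomputable def toRibbonGraph (E : HalfEdgeDiagram (EndLabel t)) (hE : ValidFor τ E) :
    RibbonGraph where
  Flag := E.Half × Bool
  finite_flag := inferInstance
  across f := (f.1, !f.2)
  along f := (E.mate f.1, f.2)
  corner := E.flagCorner
  across_across f := by simp
  along_along f := by simp [hE.mate_mate]
  corner_corner := by
    rintro ⟨x, b⟩
    by_cases h : E.solid x = x
    · rw [flagCorner_of_eq h, flagCorner_of_eq h, Bool.not_not]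
    · cases b
      · rw [flagCorner_false h, flagCorner_false (hE.solid_dashed_ne h), hE.dashed_dashed]
      · rw [flagCorner_true h, flagCorner_true (hE.solid_solid_ne h), hE.solid_solid]
  across_ne f h := by simpa using congrArg Prod.snd h
  along_ne f h := hE.mate_ne _ (congrArg Prod.fst h)
  corner_ne := by
    rintro ⟨x, b⟩ hx
    by_cases h : E.solid x = x
    · rw [flagCorner_of_eq h] at hx
      simpa using congrArg Prod.snd hx
    · cases b
      · rw [flagCorner_false h] at hx
        exact h ((hE.solid_eq_iff_dashed_eq x).mpr (congrArg Prod.fst hx))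
      · rw [flagCorner_true h] at hx
        exact h (congrArg Prod.fst hx)
  across_along f := rfl
  across_along_ne f h := hE.mate_ne _ (congrArg Prod.fst h)

section ToRibbonGraph

variable {E : HalfEdgeDiagram (EndLabel t)} (hE : ValidFor τ E)

/-- The vertices of the map are the vertices of the diagram. -/
noncomputable def vertexEquiv : (toRibbonGraph E hE).Vertex ≃ E.Vertex where
  toFun := Quot.lift (fun f : E.Half × Bool => E.vertexOf f.1) (by
    rintro ⟨x, b⟩ _ (rfl | rfl)
    · rfl
    · change _ = E.vertexOf (E.flagCorner (x, b)).1
      by_cases h : E.solid x = x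
      · rw [flagCorner_of_eq h]
      · cases b
        · rw [flagCorner_false h, vertexOf_dashed]
        · rw [flagCorner_true h, vertexOf_solid])
  invFun := Quot.lift (fun x => (toRibbonGraph E hE).vertexOf (x, true)) (by
    have hacross : ∀ (x : E.Half) b, (toRibbonGraph E hE).vertexOf (x, b) =
        (toRibbonGraph E hE).vertexOf (x, !b) := fun x b => Quot.sound (Or.inl rfl)
    have hcorner : ∀ (x : E.Half) b, (toRibbonGraph E hE).vertexOf (x, b) =
        (toRibbonGraph E hE).vertexOf (E.flagCorner (x, b)) := fun x b => Quot.sound (Or.inr rfl)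
    rintro x _ (rfl | rfl)
    · by_cases h : E.solid x = x
      · rw [h]
      · rw [hcorner, flagCorner_true h]
    · by_cases h : E.solid x = x
      · rw [(hE.solid_eq_iff_dashed_eq x).mp h]
      · rw [hacross, Bool.not_true, hcorner, flagCorner_false h, hacross, Bool.not_false])
  left_inv := by
    rintro ⟨x, b⟩
    cases b
    · exact Quot.sound (Or.inl rfl)
    · rfl
  right_inv := by
    rintro ⟨x⟩
    rfl

theorem vertexEquiv_vertexOf (f : E.Half × Bool) :
    vertexEquiv hE ((toRibbonGraph E hE).vertexOf f) = E.vertexOf f.1 := rfl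

theorem degree_toRibbonGraph (c : (toRibbonGraph E hE).Vertex) :
    (toRibbonGraph E hE).degree c = Nat.card {x // E.vertexOf x = vertexEquiv hE c} := by
  have h1 : Nat.card {f : E.Half × Bool // (toRibbonGraph E hE).vertexOf f = c} =
      Nat.card ({x // E.vertexOf x = vertexEquiv hE c} × Bool) := by
    have h2 : ∀ f : E.Half × Bool, (toRibbonGraph E hE).vertexOf f = c ↔
        E.vertexOf f.1 = vertexEquiv hE c := fun f => by
      rw [← vertexEquiv_vertexOf hE f, (vertexEquiv hE).apply_eq_iff_eq]
    exact Nat.card_congr ⟨fun f => (⟨f.1.1, (h2 f.1).mp f.2⟩, f.1.2),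
      fun x => ⟨(x.1.1, x.2), (h2 _).mpr x.1.2⟩, fun _ => rfl, fun _ => rfl⟩
  rw [RibbonGraph.degree]
  refine (congrArg (· / 2) h1).trans ?_
  rw [Nat.card_prod]
  simp

theorem segmentOf_mate (x : E.Half) (b : Bool) : (toRibbonGraph E hE).segmentOf (E.mate x, b) =
    (toRibbonGraph E hE).segmentOf (x, b) :=
  segmentOf_along (toRibbonGraph E hE) (x, b)

theorem segmentOf_solid (x : E.Half) : (toRibbonGraph E hE).segmentOf (E.solid x, true) =
    (toRibbonGraph E hE).segmentOf (x, true) := by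
  by_cases h : E.solid x = x
  · rw [h]
  · rw [← segmentOf_corner (toRibbonGraph E hE) (f := (x, true))]
    · exact congrArg (toRibbonGraph E hE).segmentOf (flagCorner_true h).symm
    · exact fun h1 => h (congrArg Prod.fst ((flagCorner_true h).symm.trans h1))

theorem segmentOf_dashed (x : E.Half) : (toRibbonGraph E hE).segmentOf (E.dashed x, false) =
    (toRibbonGraph E hE).segmentOf (x, false) := by
  by_cases h : E.solid x = x
  · rw [(hE.solid_eq_iff_dashed_eq x).mp h]
  · rw [← segmentOf_corner (toRibbonGraph E hE) (f := (x, false))]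
    · exact congrArg (toRibbonGraph E hE).segmentOf (flagCorner_false h).symm
    · exact fun h1 => h ((hE.solid_eq_iff_dashed_eq x).mpr
        (congrArg Prod.fst ((flagCorner_false h).symm.trans h1)))

/-- The boundary segments through flags `(x, true)` are marked solid. -/
noncomputable def segmentMark : (toRibbonGraph E hE).Segment → Bool :=
  Quot.lift (fun f : E.Half × Bool => f.2) (by
    rintro ⟨x, b⟩ _ (rfl | ⟨h, rfl⟩)
    · rfl
    · have h' : E.flagCorner (x, b) ≠ (x, !b) := h
      change b = (E.flagCorner (x, b)).2
      by_cases hx : E.solid x = x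
      · exact absurd (flagCorner_of_eq hx b) h'
      · cases b
        · rw [flagCorner_false hx]
        · rw [flagCorner_true hx])

theorem solid_path (c : (toRibbonGraph E hE).Segment) :
    ((∃ x, (toRibbonGraph E hE).segmentOf (x, true) = c) →
      ∃ z, (toRibbonGraph E hE).segmentOf (E.leaf z, true) = c) ∧
    ∀ z, (toRibbonGraph E hE).segmentOf (E.leaf z, true) = c →
      (toRibbonGraph E hE).segmentOf (E.leaf (barPerm t z), true) = c :=
  hE.solid_paths {x | (toRibbonGraph E hE).segmentOf (x, true) = c}
    (fun x hx => (segmentOf_mate hE x true).trans hx) fun x hx => (segmentOf_solid hE x).trans hx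

theorem dashed_path (c : (toRibbonGraph E hE).Segment) :
    ((∃ x, (toRibbonGraph E hE).segmentOf (x, false) = c) →
      ∃ z, (toRibbonGraph E hE).segmentOf (E.leaf z, false) = c) ∧
    ∀ z, (toRibbonGraph E hE).segmentOf (E.leaf z, false) = c →
      (toRibbonGraph E hE).segmentOf (E.leaf (τ (barPerm t z)), false) = c :=
  hE.dashed_paths {x | (toRibbonGraph E hE).segmentOf (x, false) = c}
    (fun x hx => (segmentOf_mate hE x false).trans hx) fun x hx => (segmentOf_dashed hE x).trans hx

/-- The orthogonal diagram with two flags for each half-edge. -/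
noncomputable def toOrthogonal : OrthogonalDiagram τ where
  toRibbonGraph := toRibbonGraph E hE
  leaf z := (E.leaf z, true)
  leaf_injective y z h := hE.leaf_injective (congrArg Prod.fst h)
  corner_leaf z := flagCorner_of_eq (hE.solid_leaf z) true
  internal_degree := by
    rintro ⟨x, b⟩ hx
    have hx' : ∀ y, E.vertexOf y = E.vertexOf x → E.solid y ≠ y := by
      intro y hy h
      obtain ⟨z, rfl⟩ := (hE.solid_eq_iff y).mp h
      exact hx z ((vertexEquiv hE).injective hy)
    have h0 := hx' x rfl
    have h1 : E.dashed x ≠ x := fun h => h0 ((hE.solid_eq_iff_dashed_eq x).mpr h)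
    have hdeg : (toRibbonGraph E hE).degree ((toRibbonGraph E hE).vertexOf (x, b)) =
        Nat.card {y // E.vertexOf y = E.vertexOf x} := degree_toRibbonGraph hE _
    change Even ((toRibbonGraph E hE).degree ((toRibbonGraph E hE).vertexOf (x, b))) ∧
      2 < (toRibbonGraph E hE).degree ((toRibbonGraph E hE).vertexOf (x, b))
    rw [hdeg]
    constructor
    · exact even_card_of_involution
        (fun y => ⟨E.solid y.1, (E.vertexOf_solid _).trans y.2⟩)
        (fun y => Subtype.ext (hE.solid_solid _))
        fun y h => hx' y.1 y.2 (congrArg Subtype.val h)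
    · classical
      have h2 : ({x, E.solid x, E.dashed x} : Finset E.Half).card ≤
          Nat.card {y // E.vertexOf y = E.vertexOf x} := by
        have := Fintype.ofFinite E.Half
        rw [Nat.card_eq_fintype_card, Fintype.card_subtype]
        refine Finset.card_le_card fun y hy => ?_
        simp only [Finset.mem_insert, Finset.mem_singleton] at hy
        rw [Finset.mem_filter]
        refine ⟨Finset.mem_univ _, ?_⟩
        rcases hy with rfl | rfl | rfl <;> simp [vertexOf_solid, vertexOf_dashed]
      rw [Finset.card_eq_three.mpr ⟨x, E.solid x, E.dashed x, Ne.symm h0, Ne.symm h1,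
        fun h => h0 (hE.solid_ne_dashed x h), rfl⟩] at h2
      exact h2
  isSolid := segmentMark hE
  isSolid_leaf z := rfl
  isSolid_across f := rfl
  segment_leaf := by
    rintro ⟨x, b⟩
    cases b
    · obtain ⟨z, hz⟩ := (dashed_path hE _).1 ⟨x, rfl⟩
      exact ⟨z, Or.inr hz.symm⟩
    · obtain ⟨z, hz⟩ := (solid_path hE _).1 ⟨x, rfl⟩
      exact ⟨z, Or.inl hz.symm⟩
  solid_segment z := ((solid_path hE _).2 z rfl).symm
  dashed_segment z := by
    have h := (dashed_path hE _).2 (barPerm t z) rfl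
    rw [barPerm_barPerm] at h
    exact h

theorem numInternal_toOrthogonal :
    Nat.card E.Vertex = (toOrthogonal hE).numInternal + 2 * t := by
  classical
  have h1 : (toOrthogonal hE).numInternal =
      Nat.card {c : E.Vertex // ¬ ∃ z, E.vertexOf (E.leaf z) = c} := by
    refine Nat.card_congr ((vertexEquiv hE).subtypeEquiv fun c => ?_)
    rw [not_exists]
    exact forall_congr' fun z => not_congr ((vertexEquiv hE).apply_eq_iff_eq.symm)
  have h2 : Nat.card {c : E.Vertex // ∃ z, E.vertexOf (E.leaf z) = c} = 2 * t := by
    rw [← card_endLabel t]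
    exact (Nat.card_congr (Equiv.ofInjective _ hE.vertexOf_leaf_injective)).symm
  rw [h1, ← h2, ← Nat.card_sum]
  exact Nat.card_congr ((Equiv.sumComm _ _).trans
    (Equiv.sumCompl fun c : E.Vertex => ∃ z, E.vertexOf (E.leaf z) = c)).symm

theorem numEdges_toOrthogonal : Nat.card E.Half = 2 * (toOrthogonal hE).numEdges := by
  classical
  let edge : E.Half × Bool → (toRibbonGraph E hE).Edge := Quot.mk _
  have hacross : ∀ x b, edge (x, b) = edge (x, !b) := fun x b => Quot.sound (Or.inl rfl)
  have halong : ∀ x b, edge (x, b) = edge (E.mate x, b) := fun x b => Quot.sound (Or.inr rfl)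
  have hfin : Finite (toRibbonGraph E hE).Edge :=
    Finite.of_surjective edge Quot.mk_surjective
  have h1 : ∀ c : (toRibbonGraph E hE).Edge, Nat.card {x // edge (x, true) = c} = 2 := by
    rintro ⟨x, b⟩
    change Nat.card {y // edge (y, true) = edge (x, b)} = 2
    have hb : edge (x, b) = edge (x, true) := by cases b; exacts [hacross x false, rfl]
    have hiff : ∀ y, edge (y, true) = edge (x, b) ↔ y ∈ ({x, E.mate x} : Set E.Half) := by
      intro y
      rw [hb]
      constructor
      · intro h
        let F : (toRibbonGraph E hE).Edge → Prop :=
          Quot.lift (fun f : E.Half × Bool => f.1 ∈ ({x, E.mate x} : Set E.Half)) (by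
            rintro ⟨y, b⟩ _ (rfl | rfl)
            · rfl
            · have hy : ∀ y, y ∈ ({x, E.mate x} : Set E.Half) →
                  E.mate y ∈ ({x, E.mate x} : Set E.Half) := by
                rintro y (rfl | rfl)
                · simp
                · simp [hE.mate_mate]
              refine propext ⟨hy y, fun h => ?_⟩
              have h2 := hy (E.mate y) h
              rwa [hE.mate_mate] at h2)
        have h2 : F (edge (y, true)) = F (edge (x, true)) := congrArg F h
        exact (iff_of_eq h2).mpr (Or.inl rfl)
      · rintro (rfl | rfl)
        · rfl
        · exact (halong x true).symm
    rw [Nat.card_congr (Equiv.subtypeEquivRight hiff)]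
    exact Set.ncard_pair (hE.mate_ne x).symm
  have := Fintype.ofFinite (toRibbonGraph E hE).Edge
  rw [Nat.card_congr (Equiv.sigmaFiberEquiv fun x => edge (x, true)).symm, Nat.card_sigma,
    Finset.sum_congr rfl fun c _ => h1 c, Finset.sum_const, Finset.card_univ, smul_eq_mul,
    ← Nat.card_eq_fintype_card, mul_comm]
  rfl

end ToRibbonGraph

theorem toOrthogonal_equiv {E E' : HalfEdgeDiagram (EndLabel t)} (hE : ValidFor τ E)
    (hE' : ValidFor τ E') : Iso E E' → toOrthogonal hE ≈ toOrthogonal hE' := by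
  rintro ⟨φ, h⟩
  refine ⟨φ.prodCongr (Equiv.refl Bool), fun f => rfl, fun f => ?_, ?_, fun z => ?_, fun f => rfl⟩
  · exact Prod.ext (h.mate f.1) rfl
  · rintro ⟨x, b⟩
    change (φ (E.flagCorner (x, b)).1, (E.flagCorner (x, b)).2) = E'.flagCorner (φ x, b)
    by_cases hx : E.solid x = x
    · have hx' : E'.solid (φ x) = φ x := by rw [← h.solid, hx]
      rw [flagCorner_of_eq hx, flagCorner_of_eq hx']
    · have hx' : E'.solid (φ x) ≠ φ x := by rw [← h.solid, Ne, φ.apply_eq_iff_eq]; exact hx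
      cases b
      · rw [flagCorner_false hx, flagCorner_false hx', h.dashed]
      · rw [flagCorner_true hx, flagCorner_true hx', h.solid]
  · exact Prod.ext (h.leaf z) rfl

end HalfEdgeDiagram

namespace HalfEdgeDiagram

variable {t : ℕ} {τ : Perm (EndLabel t)}

/-! ### The half-edges of an orthogonal diagram -/

section OfOrthogonal

variable (D : OrthogonalDiagram τ)

/-- The flag `f` lies on the solid side of its edge. -/
def SolidFlag (f : D.Flag) : Prop := D.isSolid (D.toRibbonGraph.segmentOf f) = true

variable {D}

theorem solidFlag_across {f : D.Flag} : SolidFlag D (D.across f) ↔ ¬ SolidFlag D f := by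
  rw [SolidFlag, SolidFlag, D.isSolid_across]
  simp

theorem solidFlag_along {f : D.Flag} : SolidFlag D (D.along f) ↔ SolidFlag D f := by
  rw [SolidFlag, SolidFlag, segmentOf_along]

theorem solidFlag_corner {f : D.Flag} (hf : D.corner f ≠ D.across f) :
    SolidFlag D (D.corner f) ↔ SolidFlag D f := by
  rw [SolidFlag, SolidFlag, segmentOf_corner _ hf]

theorem corner_ne_across_of_across {f : D.Flag} (hf : D.corner f ≠ D.across f) :
    D.corner (D.across f) ≠ D.across (D.across f) := by
  rw [D.across_across]
  intro h
  apply hf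
  rw [← D.corner_corner (D.across f), h]

theorem corner_ne_across_of_corner {f : D.Flag} (hf : D.corner f ≠ D.across f) :
    D.corner (D.corner f) ≠ D.across (D.corner f) := by
  rw [D.corner_corner]
  intro h
  apply hf
  conv_rhs => rw [h]
  rw [D.across_across]

/-- A vertex of degree 1 has only two flags. -/
theorem eq_or_eq_of_vertexOf_eq {f g : D.Flag} (hf : D.corner f = D.across f)
    (h : D.toRibbonGraph.vertexOf g = D.toRibbonGraph.vertexOf f) : g = f ∨ g = D.across f := by
  have h1 : D.corner (D.across f) = f := by rw [← hf, D.corner_corner]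
  let P : D.Flag → Prop := fun g => g = f ∨ g = D.across f
  have ha : ∀ g, P g → P (D.across g) := by
    rintro g (rfl | rfl)
    · exact Or.inr rfl
    · exact Or.inl (D.across_across f)
  have hc : ∀ g, P g → P (D.corner g) := by
    rintro g (rfl | rfl)
    · exact Or.inr hf
    · exact Or.inl h1
  let F : D.toRibbonGraph.Vertex → Prop := Quot.lift P (by
    rintro g _ (rfl | rfl)
    · exact propext ⟨ha g, fun h => by simpa only [D.across_across] using ha _ h⟩
    · exact propext ⟨hc g, fun h => by simpa only [D.corner_corner] using hc _ h⟩)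
  exact (iff_of_eq (congrArg F h)).mpr (Or.inl rfl)

theorem vertexOf_leaf_ne {f : D.Flag} (hf : D.corner f ≠ D.across f) (z : EndLabel t) :
    D.toRibbonGraph.vertexOf (D.leaf z) ≠ D.toRibbonGraph.vertexOf f := by
  intro h
  rcases eq_or_eq_of_vertexOf_eq (D.corner_leaf z) h.symm with rfl | rfl
  · exact hf (D.corner_leaf z)
  · apply corner_ne_across_of_across hf
    rw [D.across_across, D.corner_leaf]

/-- The vertices with the labels are the only ones of degree 1. -/
theorem exists_leaf_of_corner_eq {f : D.Flag} (hs : SolidFlag D f)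
    (hf : D.corner f = D.across f) : ∃ z, D.leaf z = f := by
  by_contra hne
  rw [not_exists] at hne
  have h1 : ∀ z, D.toRibbonGraph.vertexOf (D.leaf z) ≠ D.toRibbonGraph.vertexOf f := by
    intro z h
    rcases eq_or_eq_of_vertexOf_eq hf h with h1 | h1
    · exact hne z h1
    · have h2 : SolidFlag D (D.leaf z) := D.isSolid_leaf z
      rw [h1, solidFlag_across] at h2
      exact h2 hs
  have h2 := (D.internal_degree _ h1).2
  have h3 : Nat.card {g // D.toRibbonGraph.vertexOf g = D.toRibbonGraph.vertexOf f} ≤ 2 := by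
    refine (Nat.card_mono (Set.toFinite {f, D.across f})
      fun g hg => eq_or_eq_of_vertexOf_eq hf hg).trans ?_
    exact Set.ncard_insert_le _ _ |>.trans (by simp)
  rw [RibbonGraph.degree] at h2
  omega

/-- Internal vertices do not have degree 2. -/
theorem corner_ne_across_corner_across {f : D.Flag} (hf : D.corner f ≠ D.across f) :
    D.corner f ≠ D.across (D.corner (D.across f)) := by
  intro h0
  have h1 : D.corner (D.across f) = D.across (D.corner f) := by rw [h0, D.across_across]
  have h2 := (D.internal_degree _ (vertexOf_leaf_ne hf)).2
  let s : Set D.Flag := {f, D.across f, D.corner f, D.across (D.corner f)}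
  have ha : ∀ g, g ∈ s → D.across g ∈ s := by
    rintro g (rfl | rfl | rfl | rfl) <;> simp [s, D.across_across]
  have hc : ∀ g, g ∈ s → D.corner g ∈ s := by
    rintro g (rfl | rfl | rfl | rfl)
    · simp [s]
    · simp [s, h1]
    · simp [s, D.corner_corner]
    · simp [s, ← h1, D.corner_corner]
  let F : D.toRibbonGraph.Vertex → Prop := Quot.lift (fun g => g ∈ s) (by
    rintro g _ (rfl | rfl)
    · exact propext ⟨ha g, fun h => by simpa only [D.across_across] using ha _ h⟩
    · exact propext ⟨hc g, fun h => by simpa only [D.corner_corner] using hc _ h⟩)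
  have h3 : Nat.card {g // D.toRibbonGraph.vertexOf g = D.toRibbonGraph.vertexOf f} ≤ 4 := by
    refine (Nat.card_mono (Set.toFinite s)
      fun g hg => (iff_of_eq (congrArg F hg)).mpr (Or.inl rfl)).trans ?_
    have h4 : ∀ a b c d : D.Flag, ({a, b, c, d} : Set D.Flag).ncard ≤ 4 := fun a b c d => by
      have e1 := Set.ncard_insert_le a {b, c, d}
      have e2 := Set.ncard_insert_le b {c, d}
      have e3 := Set.ncard_insert_le c {d}
      rw [Set.ncard_singleton] at e3
      omega
    exact h4 _ _ _ _
  rw [RibbonGraph.degree] at h2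
  omega

open Classical in
/-- The half-edge next to `f` in the map, or `f` itself at a leaf. -/
noncomputable def solidCorner (D : OrthogonalDiagram τ) (f : D.Flag) : D.Flag :=
  if D.corner f = D.across f then f else D.corner f

open Classical in
/-- The half-edge next to `f` on the side of the flag `across f`, or `f` itself at a leaf. -/
noncomputable def dashedCorner (D : OrthogonalDiagram τ) (f : D.Flag) : D.Flag :=
  if D.corner f = D.across f then f else D.across (D.corner (D.across f))

theorem solidCorner_of_eq {f : D.Flag} (hf : D.corner f = D.across f) : solidCorner D f = f :=
  if_pos hf

theorem dashedCorner_of_eq {f : D.Flag} (hf : D.corner f = D.across f) : dashedCorner D f = f :=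
  if_pos hf

theorem solidCorner_of_ne {f : D.Flag} (hf : D.corner f ≠ D.across f) :
    solidCorner D f = D.corner f := if_neg hf

theorem dashedCorner_of_ne {f : D.Flag} (hf : D.corner f ≠ D.across f) :
    dashedCorner D f = D.across (D.corner (D.across f)) := if_neg hf

theorem solidFlag_solidCorner {f : D.Flag} : SolidFlag D (solidCorner D f) ↔ SolidFlag D f := by
  by_cases hf : D.corner f = D.across f
  · rw [solidCorner_of_eq hf]
  · rw [solidCorner_of_ne hf, solidFlag_corner hf]

theorem solidFlag_dashedCorner {f : D.Flag} : SolidFlag D (dashedCorner D f) ↔ SolidFlag D f := by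
  by_cases hf : D.corner f = D.across f
  · rw [dashedCorner_of_eq hf]
  · rw [dashedCorner_of_ne hf, solidFlag_across, solidFlag_corner (corner_ne_across_of_across hf),
      solidFlag_across, not_not]

/-- The half-edge diagram of an orthogonal diagram. -/
noncomputable def ofOrthogonal (D : OrthogonalDiagram τ) : HalfEdgeDiagram (EndLabel t) where
  Half := {f : D.Flag // SolidFlag D f}
  finite_half := @Subtype.finite _ D.finite_flag _
  mate f := ⟨D.along f.1, solidFlag_along.mpr f.2⟩
  solid f := ⟨solidCorner D f.1, solidFlag_solidCorner.mpr f.2⟩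
  dashed f := ⟨dashedCorner D f.1, solidFlag_dashedCorner.mpr f.2⟩
  leaf z := ⟨D.leaf z, D.isSolid_leaf z⟩

/-- A set of half-edges that is closed under `mate` and `corner` is a union of boundary segments.
The map `rep` sends a flag on the relevant side of an edge to its half-edge. -/
theorem leafPaths_of_segment {H : Type} {mate corner : H → H} {leaf : EndLabel t → H}
    {S : EndLabel t → EndLabel t} (g : H → D.Flag) (rep : D.Flag → Option H)
    (hrep : ∀ x, rep (g x) = some x)
    (halong : ∀ f, rep (D.along f) = (rep f).map mate)
    (hcorner : ∀ f, D.corner f ≠ D.across f → rep (D.corner f) = (rep f).map corner)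
    (hmate : ∀ x, mate (mate x) = x) (hcor : ∀ x, corner (corner x) = x)
    (hleaf : ∀ x, ∃ z, D.toRibbonGraph.segmentOf (g x) = D.toRibbonGraph.segmentOf (g (leaf z)))
    (hS : ∀ z, D.toRibbonGraph.segmentOf (g (leaf z)) =
      D.toRibbonGraph.segmentOf (g (leaf (S z)))) : LeafPaths S mate corner leaf := by
  intro C hm hc
  let P : D.Flag → Prop := fun f => ∃ x ∈ rep f, x ∈ C
  have hPm : ∀ (q : H → H), (∀ x, q (q x) = x) → (∀ x ∈ C, q x ∈ C) → ∀ o : Option H,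
      (∃ x ∈ o, x ∈ C) = ∃ x ∈ o.map q, x ∈ C := by
    intro q hq hqC o
    cases o with
    | none => simp
    | some x =>
      simp only [Option.map_some, Option.mem_def, Option.some.injEq, exists_eq_left']
      exact propext ⟨hqC x, fun h => by simpa only [hq] using hqC _ h⟩
  let F : D.toRibbonGraph.Segment → Prop := Quot.lift P (by
    rintro f _ (rfl | ⟨hf, rfl⟩)
    · simp only [P, halong]
      exact hPm mate hmate hm _
    · simp only [P, hcorner f hf]
      exact hPm corner hcor hc _)
  have hF : ∀ x, F (D.toRibbonGraph.segmentOf (g x)) ↔ x ∈ C := by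
    intro x
    change P (g x) ↔ _
    simp [P, hrep]
  constructor
  · rintro ⟨x, hx⟩
    obtain ⟨z, hz⟩ := hleaf x
    exact ⟨z, by rw [← hF, ← hz, hF]; exact hx⟩
  · intro z hz
    rw [← hF, ← hS, hF]
    exact hz

theorem validFor_ofOrthogonal (D : OrthogonalDiagram τ) : ValidFor τ (ofOrthogonal D) := by
  classical
  have hsol : ∀ f : D.Flag, solidCorner D (solidCorner D f) = f := by
    intro f
    by_cases hf : D.corner f = D.across f
    · rw [solidCorner_of_eq hf, solidCorner_of_eq hf]
    · rw [solidCorner_of_ne hf, solidCorner_of_ne (corner_ne_across_of_corner hf), D.corner_corner]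
  have hdash : ∀ f : D.Flag, dashedCorner D (dashedCorner D f) = f := by
    intro f
    by_cases hf : D.corner f = D.across f
    · rw [dashedCorner_of_eq hf, dashedCorner_of_eq hf]
    · rw [dashedCorner_of_ne hf, dashedCorner_of_ne (corner_ne_across_of_across
        (corner_ne_across_of_corner (corner_ne_across_of_across hf))), D.across_across,
        D.corner_corner, D.across_across]
  have hleaf : ∀ f : D.Flag, SolidFlag D f → (D.corner f = D.across f ↔ ∃ z, D.leaf z = f) :=
    fun f hs => ⟨exists_leaf_of_corner_eq hs, by rintro ⟨z, rfl⟩; exact D.corner_leaf z⟩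
  have hleaf' : ∀ x : (ofOrthogonal D).Half,
      D.corner x.1 = D.across x.1 ↔ ∃ z, (ofOrthogonal D).leaf z = x := fun x => by
    rw [hleaf x.1 x.2]
    exact exists_congr fun z => ⟨fun h => Subtype.ext h, fun h => congrArg Subtype.val h⟩
  have hdc : ∀ f : D.Flag, D.corner f ≠ D.across f → dashedCorner D f ≠ f := by
    intro f hf h
    rw [dashedCorner_of_ne hf] at h
    apply D.corner_ne (D.across f)
    conv_rhs => rw [← h]
    rw [D.across_across]
  refine ⟨fun x => Subtype.ext (D.along_along _), fun x => Subtype.ext (hsol _),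
    fun x => Subtype.ext (hdash _), fun x h => D.along_ne _ (congrArg Subtype.val h), fun x => ?_,
    fun x => ?_, fun y z h => D.leaf_injective (congrArg Subtype.val h), fun x h => ?_, ?_, ?_⟩
  · rw [← hleaf']
    refine ⟨fun h => ?_, fun h => Subtype.ext (solidCorner_of_eq h)⟩
    by_contra hf
    have h1 : solidCorner D x.1 = x.1 := congrArg Subtype.val h
    rw [solidCorner_of_ne hf] at h1
    exact D.corner_ne _ h1
  · rw [← hleaf']
    refine ⟨fun h => ?_, fun h => Subtype.ext (dashedCorner_of_eq h)⟩
    by_contra hf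
    exact hdc x.1 hf (congrArg Subtype.val h)
  · by_contra hx
    have hf : D.corner x.1 ≠ D.across x.1 := fun h1 => hx (Subtype.ext (solidCorner_of_eq h1))
    have h1 : solidCorner D x.1 = dashedCorner D x.1 := congrArg Subtype.val h
    rw [solidCorner_of_ne hf, dashedCorner_of_ne hf] at h1
    exact corner_ne_across_corner_across hf h1
  · refine leafPaths_of_segment (D := D) (H := {f : D.Flag // SolidFlag D f}) (fun x => x.1)
      (fun f => if h : SolidFlag D f then some ⟨f, h⟩ else none) (fun x => dif_pos x.2) ?_ ?_
      (fun x => Subtype.ext (D.along_along _)) (fun x => Subtype.ext (hsol _)) ?_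
      fun z => D.solid_segment z
    · intro f
      by_cases h : SolidFlag D f
      · rw [dif_pos h, dif_pos (solidFlag_along.mpr h)]; rfl
      · rw [dif_neg h, dif_neg (fun h1 => h (solidFlag_along.mp h1))]; rfl
    · intro f hf
      by_cases h : SolidFlag D f
      · rw [dif_pos h, dif_pos ((solidFlag_corner hf).mpr h)]
        exact congrArg some (Subtype.ext (solidCorner_of_ne hf).symm)
      · rw [dif_neg h, dif_neg (fun h1 => h ((solidFlag_corner hf).mp h1))]; rfl
    · intro x
      obtain ⟨z, hz | hz⟩ := D.segment_leaf (D.toRibbonGraph.segmentOf x.1)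
      · exact ⟨z, hz⟩
      · have h1 := x.2
        rw [SolidFlag, hz, D.isSolid_across, D.isSolid_leaf] at h1
        simp at h1
  · refine leafPaths_of_segment (D := D) (H := {f : D.Flag // SolidFlag D f})
      (fun x => D.across x.1)
      (fun f => if h : SolidFlag D (D.across f) then some ⟨D.across f, h⟩ else none)
      (fun x => ?_) ?_ ?_
      (fun x => Subtype.ext (D.along_along _)) (fun x => Subtype.ext (hdash _)) ?_ fun z => ?_
    · have h : D.across (D.across x.1) = x.1 := D.across_across _
      rw [dif_pos (by rw [h]; exact x.2)]
      exact congrArg some (Subtype.ext h)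
    · intro f
      have h0 := D.across_along f
      by_cases h : SolidFlag D (D.across f)
      · rw [dif_pos h, dif_pos (by rw [h0]; exact solidFlag_along.mpr h)]
        exact congrArg some (Subtype.ext h0)
      · rw [dif_neg h, dif_neg (fun h1 => h (by rw [h0] at h1; exact solidFlag_along.mp h1))]; rfl
    · intro f hf
      have h0 : D.across (D.corner f) = dashedCorner D (D.across f) := by
        rw [dashedCorner_of_ne (corner_ne_across_of_across hf), D.across_across]
      by_cases h : SolidFlag D (D.across f)
      · rw [dif_pos h, dif_pos (by rw [h0]; exact solidFlag_dashedCorner.mpr h)]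
        exact congrArg some (Subtype.ext h0)
      · rw [dif_neg h, dif_neg (fun h1 => h (by
          rw [h0] at h1; exact solidFlag_dashedCorner.mp h1))]; rfl
    · intro x
      obtain ⟨z, hz | hz⟩ := D.segment_leaf (D.toRibbonGraph.segmentOf (D.across x.1))
      · have h1 : SolidFlag D x.1 := x.2
        rw [← D.across_across x.1, solidFlag_across, SolidFlag, hz, D.isSolid_leaf] at h1
        simp at h1
      · exact ⟨z, hz⟩
    · have h := D.dashed_segment (barPerm t z)
      rw [barPerm_barPerm] at h
      exact h.symm

theorem ofOrthogonal_iso {D D' : OrthogonalDiagram τ} :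
    D ≈ D' → Iso (ofOrthogonal D) (ofOrthogonal D') := by
  rintro ⟨φ, h⟩
  have hsol : ∀ f, SolidFlag D f ↔ SolidFlag D' (φ f) := fun f => by
    rw [SolidFlag, SolidFlag, h.isSolid]
  have hl : ∀ f, D.corner f = D.across f ↔ D'.corner (φ f) = D'.across (φ f) := fun f => by
    rw [← h.corner, ← h.across, φ.apply_eq_iff_eq]
  refine ⟨φ.subtypeEquiv hsol, fun x => Subtype.ext (h.along _), fun x => Subtype.ext ?_,
    fun x => Subtype.ext ?_, fun z => Subtype.ext (h.leaf z)⟩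
  · change φ (solidCorner D x.1) = solidCorner D' (φ x.1)
    by_cases hx : D.corner x.1 = D.across x.1
    · rw [solidCorner_of_eq hx, solidCorner_of_eq ((hl _).mp hx)]
    · rw [solidCorner_of_ne hx, solidCorner_of_ne (fun h1 => hx ((hl _).mpr h1)), h.corner]
  · change φ (dashedCorner D x.1) = dashedCorner D' (φ x.1)
    by_cases hx : D.corner x.1 = D.across x.1
    · rw [dashedCorner_of_eq hx, dashedCorner_of_eq ((hl _).mp hx)]
    · rw [dashedCorner_of_ne hx, dashedCorner_of_ne (fun h1 => hx ((hl _).mpr h1)), h.across,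
        h.corner, h.across]

theorem ofOrthogonal_toOrthogonal {E : HalfEdgeDiagram (EndLabel t)} (hE : ValidFor τ E) :
    Iso (ofOrthogonal (toOrthogonal hE)) E := by
  have hl : ∀ x : E.Half, (toOrthogonal hE).corner (x, true) = (toOrthogonal hE).across (x, true) ↔
      E.solid x = x := by
    intro x
    change E.flagCorner (x, true) = (x, false) ↔ _
    by_cases h : E.solid x = x
    · rw [flagCorner_of_eq h]
      exact iff_of_true rfl h
    · rw [flagCorner_true h]
      exact iff_of_false (by simp) h
  apply Iso.symm
  let e : E.Half ≃ {f : E.Half × Bool // SolidFlag (toOrthogonal hE) f} :=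
    { toFun := fun x => ⟨(x, true), rfl⟩
      invFun := fun f => f.1.1
      left_inv := fun x => rfl
      right_inv := by
        rintro ⟨⟨x, b⟩, hb⟩
        have hb' : b = true := hb
        subst hb'
        rfl }
  refine ⟨e, fun x => Subtype.ext rfl, fun x => Subtype.ext ?_, fun x => Subtype.ext ?_,
    fun z => Subtype.ext rfl⟩
  · change (E.solid x, true) = solidCorner (toOrthogonal hE) (x, true)
    by_cases h : E.solid x = x
    · rw [solidCorner_of_eq ((hl x).mpr h), h]
    · rw [solidCorner_of_ne (fun h1 => h ((hl x).mp h1))]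
      exact (flagCorner_true h).symm
  · change (E.dashed x, true) = dashedCorner (toOrthogonal hE) (x, true)
    by_cases h : E.solid x = x
    · rw [dashedCorner_of_eq ((hl x).mpr h), (hE.solid_eq_iff_dashed_eq x).mp h]
    · rw [dashedCorner_of_ne (fun h1 => h ((hl x).mp h1))]
      change _ = (fun f : E.Half × Bool => (f.1, !f.2)) (E.flagCorner (x, false))
      rw [flagCorner_false h]
      rfl

open Classical in
theorem toOrthogonal_ofOrthogonal (D : OrthogonalDiagram τ) :
    toOrthogonal (validFor_ofOrthogonal D) ≈ D := by
  have hnot : ∀ x : {f : D.Flag // SolidFlag D f}, ¬ SolidFlag D (D.across x.1) := fun x h =>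
    solidFlag_across.mp h x.2
  let ψ : {f : D.Flag // SolidFlag D f} × Bool → D.Flag := fun x =>
    if x.2 then x.1.1 else D.across x.1.1
  have hψt : ∀ x, ψ (x, true) = x.1 := fun x => rfl
  have hψf : ∀ x, ψ (x, false) = D.across x.1 := fun x => rfl
  have hψ : Function.Bijective ψ := by
    constructor
    · rintro ⟨x, _ | _⟩ ⟨y, _ | _⟩ h
      · rw [hψf, hψf] at h
        have h1 := congrArg D.across h
        rw [D.across_across, D.across_across] at h1
        rw [Subtype.ext h1]
      · rw [hψf, hψt] at h
        exact absurd (h ▸ y.2) (hnot x)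
      · rw [hψf, hψt] at h
        exact absurd (h ▸ x.2) (hnot y)
      · rw [hψt, hψt] at h
        rw [Subtype.ext h]
    · intro f
      by_cases hf : SolidFlag D f
      · exact ⟨(⟨f, hf⟩, true), rfl⟩
      · exact ⟨(⟨D.across f, solidFlag_across.mpr hf⟩, false), D.across_across f⟩
  refine ⟨Equiv.ofBijective ψ hψ, ?_, ?_, ?_, fun z => rfl, ?_⟩
  · rintro ⟨x, _ | _⟩
    · exact (D.across_across x.1).symm
    · rfl
  · rintro ⟨x, _ | _⟩
    · exact D.across_along x.1
    · rfl
  · rintro ⟨x, b⟩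
    have hx : (ofOrthogonal D).solid x = x ↔ D.corner x.1 = D.across x.1 := by
      constructor
      · intro h
        by_contra h1
        have h2 : solidCorner D x.1 = x.1 := congrArg Subtype.val h
        rw [solidCorner_of_ne h1] at h2
        exact D.corner_ne _ h2
      · exact fun h => Subtype.ext (solidCorner_of_eq h)
    change ψ ((ofOrthogonal D).flagCorner (x, b)) = D.corner (ψ (x, b))
    by_cases h : (ofOrthogonal D).solid x = x
    · have h1 := hx.mp h
      rw [flagCorner_of_eq h]
      cases b
      · change x.1 = D.corner (D.across x.1)
        rw [← h1, D.corner_corner]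
      · exact h1.symm
    · have h1 := fun h2 => h (hx.mpr h2)
      cases b
      · rw [flagCorner_false h]
        change D.across (dashedCorner D x.1) = D.corner (D.across x.1)
        rw [dashedCorner_of_ne h1, D.across_across]
      · rw [flagCorner_true h]
        exact solidCorner_of_ne h1
  · rintro ⟨x, _ | _⟩
    · have h1 := hnot x
      rw [SolidFlag, Bool.not_eq_true] at h1
      exact h1
    · exact x.2

theorem ofOrthogonal_iso_iff {D D' : OrthogonalDiagram τ} :
    Iso (ofOrthogonal D) (ofOrthogonal D') ↔ D ≈ D' := by
  refine ⟨fun h => ?_, ofOrthogonal_iso⟩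
  exact Setoid.trans (Setoid.symm (toOrthogonal_ofOrthogonal D))
    (Setoid.trans (toOrthogonal_equiv _ _ h) (toOrthogonal_ofOrthogonal D'))

theorem hasSize_ofOrthogonal (D : OrthogonalDiagram τ) :
    HasSize τ D.numInternal D.numEdges (ofOrthogonal D) := by
  obtain ⟨φ, h⟩ := toOrthogonal_ofOrthogonal D
  refine ⟨validFor_ofOrthogonal D, ?_, ?_⟩
  · rw [numInternal_toOrthogonal (validFor_ofOrthogonal D), h.numInternal_eq]
  · rw [numEdges_toOrthogonal (validFor_ofOrthogonal D), h.numEdges_eq]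

end OfOrthogonal

theorem HasSize.unique {v e v' e' : ℕ} {D D' : HalfEdgeDiagram (EndLabel t)} (h : HasSize τ v e D)
    (h' : HasSize τ v' e' D') (hiso : Iso D D') : v = v' ∧ e = e' := by
  have h1 := hiso.card_vertex
  have h2 := hiso.card_half
  rw [h.card_vertex, h'.card_vertex] at h1
  rw [h.card_half, h'.card_half] at h2
  omega

/-- The classes of orthogonal diagrams of a given size and of half-edge diagrams correspond to each
other. -/
theorem exists_classEquiv (τ : Perm (EndLabel t)) (v e : ℕ) :
    Nonempty ({d : OrthogonalDiagramClass τ // d.numInternal = v ∧ d.numEdges = e} ≃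
      classSet (HasSize τ v e)) := by
  have hrep : ∀ d : {d : OrthogonalDiagramClass τ // d.numInternal = v ∧ d.numEdges = e},
      ∃ D : OrthogonalDiagram τ, Quotient.mk _ D = d.1 ∧ HasSize τ v e (ofOrthogonal D) := by
    rintro ⟨⟨D⟩, rfl, rfl⟩
    exact ⟨D, rfl, hasSize_ofOrthogonal D⟩
  choose rep hrep hsize using hrep
  refine ⟨Equiv.ofBijective (fun d => ⟨isoClass (ofOrthogonal (rep d)), _, hsize d, rfl⟩) ⟨?_, ?_⟩⟩
  · intro d d' h
    have h1 := ofOrthogonal_iso_iff.mp (isoClass_eq_iff.mp (congrArg Subtype.val h))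
    exact Subtype.ext (by rw [← hrep, ← hrep]; exact Quotient.sound h1)
  · rintro ⟨_, E, hE, rfl⟩
    have h1 := ofOrthogonal_toOrthogonal hE.validFor
    have h2 := (hasSize_ofOrthogonal (toOrthogonal hE.validFor)).unique hE h1
    let d : {d : OrthogonalDiagramClass τ // d.numInternal = v ∧ d.numEdges = e} :=
      ⟨Quotient.mk _ (toOrthogonal hE.validFor), h2⟩
    refine ⟨d, Subtype.ext (isoClass_eq_iff.mpr (Iso.trans (ofOrthogonal_iso ?_) h1))⟩
    exact Quotient.exact (hrep d)

theorem orthDiagramCount_eq (τ : Perm (EndLabel t)) (v e : ℕ) :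
    orthDiagramCount τ v e = diagramCount τ v e :=
  Nat.card_congr (exists_classEquiv τ v e).some

theorem finite_orthogonalDiagramClass (τ : Perm (EndLabel t)) (v e : ℕ) :
    Finite {d : OrthogonalDiagramClass τ // d.numInternal = v ∧ d.numEdges = e} := by
  have := (finite_classSet (Q := HasSize τ v e) fun D hD => hD.card_half).to_subtype
  exact Finite.of_equiv _ (exists_classEquiv τ v e).some.symm

theorem numInternal_le (d : OrthogonalDiagramClass τ) : t + 2 * d.numInternal ≤ d.numEdges := by
  obtain ⟨D⟩ := d
  exact (hasSize_ofOrthogonal D).le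

end HalfEdgeDiagram

namespace HalfEdgeDiagram

variable {t : ℕ}

/-! ### The cancelling involution -/

/-- A family of types, one for each size `(v, e)`, in which the elements of the second kind are
matched with the elements of the third kind of the next size. -/
abbrev PairedFamily (F : ℕ → ℕ → Type) (x : ℕ → ℕ → ℕ) : Type :=
  Σ i : ℕ × ℕ, F i.1 i.2 ⊕ (Fin (x i.1 i.2) ⊕ Fin (diagShift x i.1 i.2))

/-- The matching of the elements of the second and of the third kind. -/
def pairUp {F : ℕ → ℕ → Type} {x : ℕ → ℕ → ℕ} : PairedFamily F x → PairedFamily F x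
  | ⟨i, Sum.inl a⟩ => ⟨i, Sum.inl a⟩
  | ⟨(v, e), Sum.inr (Sum.inl k)⟩ => ⟨(v + 1, e + 1), Sum.inr (Sum.inr k)⟩
  | ⟨(v + 1, e + 1), Sum.inr (Sum.inr k)⟩ => ⟨(v, e), Sum.inr (Sum.inl k)⟩
  | ⟨(0, _), Sum.inr (Sum.inr k)⟩ => Fin.elim0 k
  | ⟨(_ + 1, 0), Sum.inr (Sum.inr k)⟩ => Fin.elim0 k

theorem pairUp_pairUp {F : ℕ → ℕ → Type} {x : ℕ → ℕ → ℕ} (m : PairedFamily F x) :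
    pairUp (pairUp m) = m := by
  obtain ⟨⟨v, e⟩, a | k | k⟩ := m
  · rfl
  · rfl
  · cases v with
    | zero => exact Fin.elim0 k
    | succ v =>
      cases e with
      | zero => exact Fin.elim0 k
      | succ e => rfl

theorem pairUp_size {F : ℕ → ℕ → Type} {x : ℕ → ℕ → ℕ} (m : PairedFamily F x) :
    (∃ i a, m = ⟨i, Sum.inl a⟩) ∨
      ((pairUp m).1.1 = m.1.1 + 1 ∧ (pairUp m).1.2 = m.1.2 + 1) ∨
      (m.1.1 = (pairUp m).1.1 + 1 ∧ m.1.2 = (pairUp m).1.2 + 1) := by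
  obtain ⟨⟨v, e⟩, a | k | k⟩ := m
  · exact Or.inl ⟨_, _, rfl⟩
  · exact Or.inr (Or.inl ⟨rfl, rfl⟩)
  · cases v with
    | zero => exact Fin.elim0 k
    | succ v =>
      cases e with
      | zero => exact Fin.elim0 k
      | succ e => exact Or.inr (Or.inr ⟨rfl, rfl⟩)

theorem pairUp_eq_self_iff {F : ℕ → ℕ → Type} {x : ℕ → ℕ → ℕ} (m : PairedFamily F x) :
    pairUp m = m ↔ ∃ i a, m = ⟨i, Sum.inl a⟩ := by
  constructor
  · intro h
    have h1 := pairUp_size m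
    rw [h] at h1
    rcases h1 with h1 | h1 | h1
    · exact h1
    · omega
    · omega
  · rintro ⟨i, a, rfl⟩
    rfl

theorem card_factorization_of_size (τ : Perm (EndLabel t)) (v e : ℕ) :
    Nat.card {_a : PalindromicFactorization τ v // e = t + 2 * v} =
      if e = t + 2 * v then palindromicCount τ v else 0 := by
  split_ifs with h
  · exact Nat.card_congr (Equiv.subtypeUnivEquiv fun _ => h)
  · have : IsEmpty {_a : PalindromicFactorization τ v // e = t + 2 * v} := ⟨fun a => h a.2⟩
    exact Nat.card_of_isEmpty

/-- The classes of each size are finite in number, so that the numerical identity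
`exists_diagramCount_eq` is the cardinality of a bijection. -/
theorem exists_equiv_pairedFamily (w : Perm (EndLabel t)) : ∃ (x : ℕ → ℕ → ℕ)
    (E : OrthogonalDiagramClass (orthTarget w) ≃ PairedFamily
      (fun v e => {_a : PalindromicFactorization (orthTarget w) v // e = t + 2 * v}) x),
    ∀ d, (E d).1 = (d.numInternal, d.numEdges) := by
  obtain ⟨x, hx⟩ := exists_diagramCount_eq t w
  let size : OrthogonalDiagramClass (orthTarget w) → ℕ × ℕ := fun d => (d.numInternal, d.numEdges)
  let G : ℕ × ℕ → Type := fun i =>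
    {_a : PalindromicFactorization (orthTarget w) i.1 // i.2 = t + 2 * i.1} ⊕
      (Fin (x i.1 i.2) ⊕ Fin (diagShift x i.1 i.2))
  have hfib : ∀ i : ℕ × ℕ, Nonempty ({d // size d = i} ≃ G i) := by
    rintro ⟨v, e⟩
    have h1 : ∀ d, size d = (v, e) ↔ d.numInternal = v ∧ d.numEdges = e := fun d => Prod.ext_iff
    have hfin := finite_orthogonalDiagramClass (orthTarget w) v e
    have hfin' : Finite (PalindromicFactorization (orthTarget w) v) :=
      finite_palindromicFactorization _
    have hfin'' : Finite {d // size d = (v, e)} :=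
      Finite.of_equiv _ (Equiv.subtypeEquivRight h1).symm
    have h2 : Nat.card {d // size d = (v, e)} = Nat.card (G (v, e)) := by
      rw [Nat.card_congr (Equiv.subtypeEquivRight h1), ← orthDiagramCount, orthDiagramCount_eq, hx,
        Nat.card_sum, Nat.card_sum, card_factorization_of_size]
      simp [add_assoc]
    exact Finite.card_eq.mp h2
  let E : OrthogonalDiagramClass (orthTarget w) ≃ Σ i, G i :=
    (Equiv.sigmaFiberEquiv size).symm.trans (Equiv.sigmaCongrRight fun i => (hfib i).some)
  exact ⟨x, E, fun d => rfl⟩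

theorem exists_involution (w : Perm (EndLabel t)) :
    ∃ P : OrthogonalDiagramClass (orthTarget w) → OrthogonalDiagramClass (orthTarget w),
      Function.Involutive P ∧
      (∀ d, P d ≠ d →
        ((P d).numInternal = d.numInternal + 1 ∧ (P d).numEdges = d.numEdges + 1) ∨
        (d.numInternal = (P d).numInternal + 1 ∧ d.numEdges = (P d).numEdges + 1)) ∧
      ∃ F : {d : OrthogonalDiagramClass (orthTarget w) // P d = d} ≃
          Σ v : ℕ, PalindromicFactorization (orthTarget w) v,
        ∀ d, d.1.numInternal = (F d).1 ∧ d.1.numEdges = t + 2 * (F d).1 := by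
  obtain ⟨x, E, hE⟩ := exists_equiv_pairedFamily w
  let P := fun d => E.symm (pairUp (E d))
  have hP : ∀ d, E (P d) = pairUp (E d) := fun d => E.apply_symm_apply _
  have hfix : ∀ d, P d = d ↔ pairUp (E d) = E d := fun d => E.symm_apply_eq
  have hi : ∀ d, d.numInternal = (E d).1.1 := fun d => by rw [hE]
  have he : ∀ d, d.numEdges = (E d).1.2 := fun d => by rw [hE]
  refine ⟨P, fun d => ?_, fun d hd => ?_, ?_⟩
  · rw [← E.apply_eq_iff_eq, hP, hP, pairUp_pairUp]
  · rw [hi, hi, he, he, hP]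
    refine (pairUp_size (E d)).resolve_left fun h => hd ?_
    rw [hfix, pairUp_eq_self_iff]
    exact h
  · let G : (Σ v : ℕ, PalindromicFactorization (orthTarget w) v) →
        {d : OrthogonalDiagramClass (orthTarget w) // P d = d} := fun a =>
      ⟨E.symm ⟨(a.1, t + 2 * a.1), Sum.inl ⟨a.2, rfl⟩⟩, by
        rw [hfix, E.apply_symm_apply]; rfl⟩
    have hG : ∀ a, E (G a).1 = ⟨(a.1, t + 2 * a.1), Sum.inl ⟨a.2, rfl⟩⟩ := fun a =>
      E.apply_symm_apply _
    have hbij : Function.Bijective G := by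
      constructor
      · rintro ⟨v, a⟩ ⟨v', a'⟩ h
        have h1 := congrArg (fun d => E d.1) h
        simp only [hG] at h1
        obtain ⟨h2, h3⟩ := Sigma.mk.inj h1
        obtain rfl : v = v' := congrArg Prod.fst h2
        have h4 := congrArg Subtype.val (Sum.inl_injective (eq_of_heq h3))
        rw [show a = a' from h4]
      · rintro ⟨d, hd⟩
        obtain ⟨⟨v, e⟩, ⟨a, ha⟩, h⟩ := (pairUp_eq_self_iff _).mp ((hfix d).mp hd)
        have ha' : e = t + 2 * v := ha
        subst ha'
        refine ⟨⟨v, a⟩, Subtype.ext (E.injective ?_)⟩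
        rw [hG, h]
    refine ⟨(Equiv.ofBijective G hbij).symm, fun d => ?_⟩
    obtain ⟨a, rfl⟩ := hbij.2 d
    rw [Equiv.ofBijective_symm_apply_apply, hi, he, hG]
    exact ⟨rfl, rfl⟩

/-! ### The alternating sum over the diagrams -/

theorem alternating_sum_diagShift (x : ℕ → ℕ → ℕ) (m n : ℕ) :
    ∑ v ∈ Finset.range (n + 1), (-1 : ℤ) ^ v * (x v (v + m) + diagShift x v (v + m) : ℕ) =
      (-1) ^ n * x n (n + m) := by
  induction n with
  | zero => simp
  | succ n ih =>
    rw [Finset.sum_range_succ, ih, show n + 1 + m = (n + m) + 1 by ring, diagShift_succ_succ]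
    push_cast
    ring

/-- The pairs of diagrams that cancel drop out of the alternating sum. There are no diagrams with
`v > m` and `e = v + m`, so that the sum is finite. -/
theorem coeff_orthDelta_eq_sum (w : Perm (EndLabel t)) (m : ℕ) :
    PowerSeries.coeff m (orthDelta (orthTarget w)) = ∑ v ∈ Finset.range (m + 2),
      (-1 : ℤ) ^ v * (if v + m = t + 2 * v then palindromicCount (orthTarget w) v else 0 : ℕ) := by
  obtain ⟨x, hx⟩ := exists_diagramCount_eq t w
  have h0 : ∀ v, m < v → diagramCount (orthTarget w) v (v + m) = 0 := fun v hv =>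
    isoCount_eq_zero fun D hD => by have := hD.le; omega
  have hxm : x (m + 1) (m + 1 + m) = 0 := by
    have h1 := hx (m + 1) (m + 1 + m)
    rw [h0 _ (Nat.lt_succ_self m)] at h1
    omega
  rw [orthDelta, PowerSeries.coeff_mk,
    finsum_eq_sum_of_support_subset (s := Finset.range (m + 2))]
  · have h1 := alternating_sum_diagShift x m (m + 1)
    rw [hxm, Nat.cast_zero, mul_zero] at h1
    refine Eq.trans ?_ ((congrArg (_ + ·) h1).trans (add_zero _))
    rw [← Finset.sum_add_distrib]
    refine Finset.sum_congr rfl fun v _ => ?_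
    rw [orthDiagramCount_eq, hx]
    push_cast
    ring
  · intro v hv
    rw [Finset.coe_range, Set.mem_Iio]
    by_contra hlt
    apply hv
    simp only [orthDiagramCount_eq]
    rw [h0 v (by omega)]
    simp

theorem coeff_orthDelta (w : Perm (EndLabel t)) (v : ℕ) :
    PowerSeries.coeff (t + v) (orthDelta (orthTarget w)) =
      (-1) ^ v * (palindromicCount (orthTarget w) v : ℤ) := by
  rw [coeff_orthDelta_eq_sum, Finset.sum_eq_single v]
  · rw [if_pos (by ring)]
  · intro u _ hu
    rw [if_neg (by omega)]
    simp
  · intro h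
    rw [Finset.mem_range] at h
    omega

theorem coeff_orthDelta_of_lt (w : Perm (EndLabel t)) {m : ℕ} (hm : m < t) :
    PowerSeries.coeff m (orthDelta (orthTarget w)) = 0 := by
  rw [coeff_orthDelta_eq_sum]
  refine Finset.sum_eq_zero fun v _ => ?_
  rw [if_neg (by omega)]
  simp

theorem finite_of_order (τ : Perm (EndLabel t)) (m : ℕ) :
    {d : OrthogonalDiagramClass τ | d.numEdges = d.numInternal + m}.Finite := by
  have h : (⋃ v ∈ Finset.range (m + 1),
      {d : OrthogonalDiagramClass τ | d.numInternal = v ∧ d.numEdges = v + m}).Finite :=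
    Set.Finite.biUnion (Finset.finite_toSet _) fun v _ =>
      @Set.toFinite _ _ (finite_orthogonalDiagramClass τ v (v + m))
  refine h.subset fun d hd => ?_
  have h1 : d.numEdges = d.numInternal + m := hd
  have h2 := numInternal_le d
  simp only [Set.mem_iUnion]
  exact ⟨d.numInternal, Finset.mem_range.mpr (by omega), rfl, h1⟩

theorem hasSum_orthDelta {N : ℕ} (h : 2 * t ≤ N) {V : Perm (EndLabel t) → ℂ}
    (hV : IsCOEClassCoeff N t V) (w : Perm (EndLabel t)) :
    HasSum (fun m : ℕ => ((PowerSeries.coeff m (orthDelta (orthTarget w)) : ℤ) : ℂ) / (N : ℂ) ^ m)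
      (V w) := by
  rw [classCoeff_eq_factorizationSum h hV]
  have h1 : HasSum _ (factorizationSum N (orthTarget w)) :=
    (summable_factorization h (orthTarget w)).hasSum
  refine (Function.Injective.hasSum_iff (add_right_injective t) ?_).mp ?_
  · intro m hm
    rw [coeff_orthDelta_of_lt, Int.cast_zero, zero_div]
    by_contra hlt
    exact hm ⟨m - t, by simp only; omega⟩
  · convert h1 using 1
    funext v
    rw [Function.comp_apply, coeff_orthDelta]
    push_cast
    rfl

end HalfEdgeDiagram

namespace HalfEdgeDiagram

variable {t : ℕ}

/-! ### Relabelling of the leaves -/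

/-- The diagram with its leaves relabelled. -/
def relabelLeaves (h : Perm (EndLabel t)) (D : HalfEdgeDiagram (EndLabel t)) :
    HalfEdgeDiagram (EndLabel t) where
  Half := D.Half
  finite_half := D.finite_half
  mate := D.mate
  solid := D.solid
  dashed := D.dashed
  leaf z := D.leaf (h z)

theorem LeafPaths.relabel {H : Type} {b f : H → H} {leaf : EndLabel t → H}
    {S S' : EndLabel t → EndLabel t} {h : Perm (EndLabel t)} (hS : ∀ z, h (S' z) = S (h z))
    (hp : LeafPaths S b f leaf) : LeafPaths S' b f fun z => leaf (h z) := by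
  intro C hb hf
  obtain ⟨h1, h2⟩ := hp C hb hf
  constructor
  · intro hC
    obtain ⟨z, hz⟩ := h1 hC
    exact ⟨h.symm z, by beta_reduce; rwa [Equiv.apply_symm_apply]⟩
  · intro z hz
    beta_reduce
    rw [hS]
    exact h2 _ hz

theorem Valid.relabelLeaves {S A S' A' : EndLabel t → EndLabel t} {h : Perm (EndLabel t)}
    (hS : ∀ z, h (S' z) = S (h z)) (hA : ∀ z, h (A' z) = A (h z))
    {D : HalfEdgeDiagram (EndLabel t)} (hD : Valid S A D) : Valid S' A' (D.relabelLeaves h) where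
  mate_mate := hD.mate_mate
  solid_solid := hD.solid_solid
  dashed_dashed := hD.dashed_dashed
  mate_ne := hD.mate_ne
  solid_eq_iff x := (hD.solid_eq_iff x).trans h.surjective.exists
  dashed_eq_iff x := (hD.dashed_eq_iff x).trans h.surjective.exists
  leaf_injective := hD.leaf_injective.comp h.injective
  solid_ne_dashed := hD.solid_ne_dashed
  solid_paths := LeafPaths.relabel hS hD.solid_paths
  dashed_paths := LeafPaths.relabel hA hD.dashed_paths

theorem relabelLeaves_iso {h : Perm (EndLabel t)} {D D' : HalfEdgeDiagram (EndLabel t)} :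
    Iso (D.relabelLeaves h) (D'.relabelLeaves h) ↔ Iso D D' := by
  constructor
  · rintro ⟨φ, hφ⟩
    refine ⟨φ, hφ.mate, hφ.solid, hφ.dashed, fun z => ?_⟩
    have h1 := hφ.leaf (h.symm z)
    have h2 : φ (D.leaf (h (h.symm z))) = D'.leaf (h (h.symm z)) := h1
    rwa [Equiv.apply_symm_apply] at h2
  · rintro ⟨φ, hφ⟩
    exact ⟨φ, hφ.mate, hφ.solid, hφ.dashed, fun z => hφ.leaf (h z)⟩

theorem HasSize.relabelLeaves {τ : Perm (EndLabel t)} {h : Perm (EndLabel t)}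
    (hh : Commute h (barPerm t)) {v e : ℕ} {D : HalfEdgeDiagram (EndLabel t)}
    (hD : HasSize τ v e D) : HasSize (h⁻¹ * τ * h) v e (D.relabelLeaves h) := by
  have hbar : ∀ z, h (barPerm t z) = barPerm t (h z) := fun z => congrArg (· z) hh.eq
  refine ⟨hD.validFor.relabelLeaves hbar fun z => ?_, hD.card_vertex, hD.card_half⟩
  simp [hbar]

theorem diagramCount_conj (τ : Perm (EndLabel t)) {h : Perm (EndLabel t)}
    (hh : Commute h (barPerm t)) (v e : ℕ) :
    diagramCount (h⁻¹ * τ * h) v e = diagramCount τ v e := by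
  symm
  refine isoCount_eq_of_map (HalfEdgeDiagram.relabelLeaves h) (fun D hD => hD.relabelLeaves hh)
    (fun D D' _ _ => relabelLeaves_iso) fun D hD => ?_
  have h1 := hD.relabelLeaves (h := h⁻¹) hh.inv_left
  rw [show h⁻¹⁻¹ * (h⁻¹ * τ * h) * h⁻¹ = τ by group] at h1
  refine ⟨D.relabelLeaves h⁻¹, h1, Equiv.refl _, fun x => rfl, fun x => rfl, fun x => rfl,
    fun z => ?_⟩
  exact congrArg D.leaf (h.symm_apply_apply z)

/-- The number of palindromic primitive factorizations does not change under relabelling, although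
the order of the labels enters its definition. -/
theorem palindromicCount_mul_right (w : Perm (EndLabel t)) {h : Perm (EndLabel t)}
    (hh : Commute h (barPerm t)) (v : ℕ) :
    palindromicCount (orthTarget (w * h)) v = palindromicCount (orthTarget w) v := by
  have h1 : orthDelta (orthTarget (w * h)) = orthDelta (orthTarget w) := by
    simp only [orthDelta, orthTarget_mul_right hh, orthDiagramCount_eq, diagramCount_conj _ hh]
  have h2 := coeff_orthDelta (w * h) v
  rw [h1, coeff_orthDelta] at h2
  have h3 : ((-1 : ℤ)) ^ v ≠ 0 := by simp
  exact_mod_cast (mul_left_cancel₀ h3 h2).symm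

end HalfEdgeDiagram

/-! ### Cycle lengths of permutations -/

section CycleLength

set_option linter.unusedSectionVars false

variable {α : Type} [Fintype α] [DecidableEq α] {σ : Perm α} {a b x y : α}

/-- The length of the cycle of `σ` through `x`. -/
noncomputable def cycleLength (σ : Perm α) (x : α) : ℕ := Function.minimalPeriod σ x

theorem cycleLength_pos (σ : Perm α) (x : α) : 0 < cycleLength σ x :=
  Function.minimalPeriod_pos_of_mem_periodicPts (σ.injective.mem_periodicPts x)

theorem pow_eq_self_iff {n : ℕ} : (σ ^ n) x = x ↔ cycleLength σ x ∣ n := by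
  rw [cycleLength, ← Function.isPeriodicPt_iff_minimalPeriod_dvd, Function.IsPeriodicPt,
    Function.IsFixedPt, Perm.iterate_eq_pow]

theorem pow_cycleLength (σ : Perm α) (x : α) : (σ ^ cycleLength σ x) x = x :=
  pow_eq_self_iff.mpr dvd_rfl

theorem pow_ne_self {n : ℕ} (h0 : 0 < n) (h : n < cycleLength σ x) : (σ ^ n) x ≠ x := fun h1 =>
  absurd (Nat.le_of_dvd h0 (pow_eq_self_iff.mp h1)) (not_le.mpr h)

theorem cycleLength_pow (σ : Perm α) (x : α) (n : ℕ) :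
    cycleLength σ ((σ ^ n) x) = cycleLength σ x := by
  rw [← Perm.iterate_eq_pow]
  exact Function.minimalPeriod_apply_iterate (σ.injective.mem_periodicPts x) n

theorem cycleLength_eq {n : ℕ} (hn : 0 < n) (h : (σ ^ n) x = x)
    (hne : ∀ i, 0 < i → i < n → (σ ^ i) x ≠ x) : cycleLength σ x = n := by
  refine le_antisymm (Nat.le_of_dvd hn (pow_eq_self_iff.mp h)) ?_
  by_contra hlt
  exact hne _ (cycleLength_pos σ x) (not_le.mp hlt) (pow_cycleLength σ x)

theorem cycleLength_congr {σ σ' : Perm α} {x x' : α}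
    (h : ∀ n, (σ ^ n) x = x ↔ (σ' ^ n) x' = x') : cycleLength σ x = cycleLength σ' x' :=
  Nat.dvd_antisymm (pow_eq_self_iff.mp ((h _).mpr (pow_cycleLength σ' x')))
    (pow_eq_self_iff.mp ((h _).mp (pow_cycleLength σ x)))

theorem exists_pow_eq (h : σ.SameCycle a x) : ∃ i < cycleLength σ a, (σ ^ i) a = x := by
  obtain ⟨n, hn⟩ := h.exists_nat_pow_eq
  refine ⟨n % cycleLength σ a, Nat.mod_lt _ (cycleLength_pos σ a), ?_⟩
  rw [← hn, ← Perm.iterate_eq_pow, ← Perm.iterate_eq_pow]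
  exact Function.iterate_mod_minimalPeriod_eq

theorem sameCycle_pow (σ : Perm α) (a : α) (n : ℕ) : σ.SameCycle a ((σ ^ n) a) :=
  ⟨n, by simp⟩

theorem cycleLength_eq_of_sameCycle (h : σ.SameCycle a x) : cycleLength σ x = cycleLength σ a := by
  obtain ⟨i, -, rfl⟩ := exists_pow_eq h
  exact cycleLength_pow σ a i

theorem pow_injOn : Set.InjOn (fun i : ℕ => (σ ^ i) a) (Set.Iio (cycleLength σ a)) := by
  simp only [← Perm.iterate_eq_pow]
  exact Function.iterate_injOn_Iio_minimalPeriod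

open Classical in
theorem sum_sameCycle {M : Type} [AddCommMonoid M] (σ : Perm α) (a : α) (f : α → M) :
    ∑ x ∈ Finset.univ.filter (fun x => σ.SameCycle a x), f x =
      ∑ i ∈ Finset.range (cycleLength σ a), f ((σ ^ i) a) := by
  symm
  refine Finset.sum_bij (fun i _ => (σ ^ i) a) ?_ ?_ ?_ fun _ _ => rfl
  · intro i _
    exact Finset.mem_filter.mpr ⟨Finset.mem_univ _, sameCycle_pow σ a i⟩
  · intro i hi j hj h
    exact pow_injOn (Finset.mem_range.mp hi) (Finset.mem_range.mp hj) h
  · intro x hx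
    obtain ⟨i, hi, h⟩ := exists_pow_eq (Finset.mem_filter.mp hx).2
    exact ⟨i, Finset.mem_range.mpr hi, h⟩

open Classical in
theorem card_sameCycle (σ : Perm α) (a : α) :
    (Finset.univ.filter fun x => σ.SameCycle a x).card = cycleLength σ a := by
  rw [Finset.card_eq_sum_ones, sum_sameCycle, Finset.sum_const, Finset.card_range, smul_eq_mul,
    mul_one]

theorem cycleLength_eq_card (hx : σ x ≠ x) : cycleLength σ x = (σ.cycleOf x).support.card := by
  have hc := Perm.isCycle_cycleOf σ hx
  rw [← hc.orderOf]
  have h : ∀ n, cycleLength σ x ∣ n ↔ orderOf (σ.cycleOf x) ∣ n := by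
    intro n
    rw [← pow_eq_self_iff, orderOf_dvd_iff_pow_eq_one, hc.pow_eq_one_iff' (x := x) (by simpa),
      Perm.cycleOf_pow_apply_self]
  exact Nat.dvd_antisymm ((h _).mpr dvd_rfl) ((h _).mp dvd_rfl)

/-- The cycle type is determined by the numbers of elements on the cycles of each length. -/
theorem card_cycleLength_eq (σ : Perm α) (k : ℕ) :
    (Finset.univ.filter fun x => cycleLength σ x = k).card = k * σ.partition.parts.count k := by
  rcases Nat.lt_trichotomy k 1 with hk | rfl | hk
  · obtain rfl : k = 0 := by omega
    rw [zero_mul, Finset.card_eq_zero, Finset.filter_eq_empty_iff]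
    exact fun x _ => (cycleLength_pos σ x).ne'
  · have h1 : ∀ x, cycleLength σ x = 1 ↔ x ∈ σ.supportᶜ := by
      intro x
      rw [Finset.mem_compl, Perm.mem_support, not_not, ← Nat.dvd_one, ← pow_eq_self_iff, pow_one]
    have h2 : σ.cycleType.count 1 = 0 := Multiset.count_eq_zero.mpr fun h =>
      absurd (Perm.two_le_of_mem_cycleType h) (by norm_num)
    rw [Finset.filter_congr fun x _ => h1 x, Finset.filter_mem_eq_inter, Finset.univ_inter,
      Finset.card_compl, Perm.parts_partition, Multiset.count_add, h2,
      Multiset.count_replicate_self, one_mul, zero_add]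
  · rw [Perm.parts_partition, Multiset.count_add, Multiset.count_replicate, if_neg hk.ne, add_zero,
      Perm.cycleType_def, Multiset.count_map]
    have hne : ∀ x, cycleLength σ x = k → σ x ≠ x := by
      rintro x rfl h
      exact absurd (Nat.le_of_dvd one_pos (pow_eq_self_iff.mp (by rwa [pow_one]))) (not_le.mpr hk)
    have hmap : ∀ x ∈ Finset.univ.filter fun x => cycleLength σ x = k,
        σ.cycleOf x ∈ σ.cycleFactorsFinset.filter fun c => k = (Finset.card ∘ Perm.support) c := by
      intro x hx
      have hx' := (Finset.mem_filter.mp hx).2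
      rw [Finset.mem_filter, Perm.cycleOf_mem_cycleFactorsFinset_iff, Perm.mem_support]
      refine ⟨hne x hx', ?_⟩
      rw [Function.comp_apply, ← cycleLength_eq_card (hne x hx'), hx']
    rw [Finset.card_eq_sum_card_fiberwise hmap, Finset.sum_congr rfl (g := fun _ => k)]
    · rw [Finset.sum_const, smul_eq_mul, mul_comm]
      rfl
    · intro c hc
      obtain ⟨hc1, hc2⟩ := Finset.mem_filter.mp hc
      rw [hc2, Function.comp_apply]
      congr 1
      ext x
      simp only [Finset.mem_filter, Finset.mem_univ, true_and]
      constructor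
      · rintro ⟨h1, rfl⟩
        rw [Perm.mem_support_cycleOf_iff, Perm.mem_support]
        exact ⟨Perm.SameCycle.refl _ _, hne x (h1.trans hc2.symm)⟩
      · intro hx
        have h1 := Perm.cycle_is_cycleOf hx hc1
        refine ⟨?_, h1.symm⟩
        rw [cycleLength_eq_card, ← h1]
        have h2 := (Perm.mem_cycleFactorsFinset_iff.mp hc1).2 x hx
        rw [← h2]
        exact Perm.mem_support.mp hx

theorem zero_notMem_parts (σ : Perm α) : 0 ∉ σ.partition.parts := fun h =>
  absurd (σ.partition.parts_pos h) (lt_irrefl 0)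

theorem cycleLength_mem_parts (σ : Perm α) (x : α) : cycleLength σ x ∈ σ.partition.parts := by
  rw [← Multiset.count_pos]
  have h1 : 0 < (Finset.univ.filter fun y => cycleLength σ y = cycleLength σ x).card :=
    Finset.card_pos.mpr ⟨x, by simp⟩
  rw [card_cycleLength_eq] at h1
  exact Nat.pos_of_mul_pos_left h1

theorem exists_cycleLength_eq {k : ℕ} (hk : k ∈ σ.partition.parts) : ∃ x, cycleLength σ x = k := by
  have h1 : 0 < (Finset.univ.filter fun y => cycleLength σ y = k).card := by
    rw [card_cycleLength_eq]
    exact Nat.mul_pos (σ.partition.parts_pos hk) (Multiset.count_pos.mpr hk)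
  obtain ⟨x, hx⟩ := Finset.card_pos.mp h1
  exact ⟨x, (Finset.mem_filter.mp hx).2⟩

theorem pow_swap_mul {n : ℕ} (h : ∀ i, 0 < i → i ≤ n → (σ ^ i) x ≠ a ∧ (σ ^ i) x ≠ b) :
    ((swap a b * σ) ^ n) x = (σ ^ n) x := by
  induction n with
  | zero => simp
  | succ n ih =>
    rw [pow_succ', Perm.mul_apply, ih fun i h0 h1 => h i h0 (h1.trans n.le_succ), Perm.mul_apply,
      ← Perm.mul_apply σ, ← pow_succ']
    obtain ⟨h1, h2⟩ := h (n + 1) n.succ_pos le_rfl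
    exact swap_apply_of_ne_of_ne h1 h2

theorem swap_mul_pow_of_not_sameCycle (hab : ¬ σ.SameCycle a b) {n : ℕ}
    (hn : n < cycleLength σ a) : ((swap a b * σ) ^ n) a = (σ ^ n) a :=
  pow_swap_mul fun i h0 h1 => ⟨pow_ne_self h0 (h1.trans_lt hn), fun h =>
    hab (h ▸ sameCycle_pow σ a i)⟩

theorem swap_mul_pow_cycleLength (hab : ¬ σ.SameCycle a b) :
    ((swap a b * σ) ^ cycleLength σ a) a = b := by
  obtain ⟨n, hn⟩ := Nat.exists_eq_succ_of_ne_zero (cycleLength_pos σ a).ne'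
  have h := pow_cycleLength σ a
  rw [hn] at h ⊢
  rw [pow_succ', Perm.mul_apply, swap_mul_pow_of_not_sameCycle hab (hn ▸ n.lt_succ_self),
    Perm.mul_apply, ← Perm.mul_apply σ, ← pow_succ', h, swap_apply_left]

/-- A transposition of elements on different cycles joins these cycles. -/
theorem cycleLength_swap_mul (hab : ¬ σ.SameCycle a b) :
    cycleLength (swap a b * σ) a = cycleLength σ a + cycleLength σ b := by
  have hba : ¬ σ.SameCycle b a := fun h => hab h.symm
  have h2 := swap_mul_pow_cycleLength hba
  rw [swap_comm] at h2
  refine cycleLength_eq (Nat.add_pos_left (cycleLength_pos σ a) _) ?_ fun i h0 h1 h => ?_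
  · rw [add_comm, pow_add, Perm.mul_apply, swap_mul_pow_cycleLength hab, h2]
  · rcases lt_trichotomy i (cycleLength σ a) with hi | rfl | hi
    · rw [swap_mul_pow_of_not_sameCycle hab hi] at h
      exact pow_ne_self h0 hi h
    · rw [swap_mul_pow_cycleLength hab] at h
      exact hab (h ▸ Perm.SameCycle.refl _ _)
    · obtain ⟨j, rfl⟩ := Nat.exists_eq_add_of_lt hi
      rw [show cycleLength σ a + j + 1 = (j + 1) + cycleLength σ a by ring, pow_add,
        Perm.mul_apply, swap_mul_pow_cycleLength hab, swap_comm,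
        swap_mul_pow_of_not_sameCycle hba (by omega)] at h
      exact hba (h ▸ sameCycle_pow σ b (j + 1))

theorem cycleLength_swap_mul_of_sameCycle (hab : ¬ σ.SameCycle a b)
    (hx : σ.SameCycle a x ∨ σ.SameCycle b x) :
    cycleLength (swap a b * σ) x = cycleLength σ a + cycleLength σ b := by
  have hba : ¬ σ.SameCycle b a := fun h => hab h.symm
  rcases hx with hx | hx
  · obtain ⟨i, hi, rfl⟩ := exists_pow_eq hx
    rw [← swap_mul_pow_of_not_sameCycle hab hi, cycleLength_pow, cycleLength_swap_mul hab]
  · obtain ⟨i, hi, rfl⟩ := exists_pow_eq hx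
    rw [← swap_mul_pow_of_not_sameCycle hba hi, swap_comm a b, cycleLength_pow,
      cycleLength_swap_mul hba, add_comm]

theorem pow_swap_mul_of_not_sameCycle (ha : ¬ σ.SameCycle a x) (hb : ¬ σ.SameCycle b x) (n : ℕ) :
    ((swap a b * σ) ^ n) x = (σ ^ n) x :=
  pow_swap_mul fun i _ _ => ⟨fun h => ha (h ▸ sameCycle_pow σ x i).symm,
    fun h => hb (h ▸ sameCycle_pow σ x i).symm⟩

theorem cycleLength_swap_mul_of_not_sameCycle (ha : ¬ σ.SameCycle a x) (hb : ¬ σ.SameCycle b x) :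
    cycleLength (swap a b * σ) x = cycleLength σ x :=
  cycleLength_congr fun n => by rw [pow_swap_mul_of_not_sameCycle ha hb]

theorem sameCycle_swap_mul_iff (ha : ¬ σ.SameCycle a x) (hb : ¬ σ.SameCycle b x) :
    (swap a b * σ).SameCycle x y ↔ σ.SameCycle x y := by
  constructor
  · intro h
    obtain ⟨i, -, rfl⟩ := exists_pow_eq h
    rw [pow_swap_mul_of_not_sameCycle ha hb]
    exact sameCycle_pow σ x i
  · intro h
    obtain ⟨i, -, rfl⟩ := exists_pow_eq h
    rw [← pow_swap_mul_of_not_sameCycle ha hb]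
    exact sameCycle_pow _ x i

theorem parts_swap_mul (hab : ¬ σ.SameCycle a b) :
    (swap a b * σ).partition.parts + {cycleLength σ a, cycleLength σ b} =
      σ.partition.parts + {cycleLength σ a + cycleLength σ b} := by
  classical
  set p := cycleLength σ a with hp
  set q := cycleLength σ b with hq
  have hp0 : 0 < p := cycleLength_pos σ a
  have hq0 : 0 < q := cycleLength_pos σ b
  ext k
  rcases Nat.eq_zero_or_pos k with rfl | hk
  · rw [Multiset.count_eq_zero_of_notMem, Multiset.count_eq_zero_of_notMem]
    · rw [Multiset.mem_add]
      exact not_or.mpr ⟨zero_notMem_parts _, by simp; omega⟩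
    · rw [Multiset.mem_add]
      exact not_or.mpr ⟨zero_notMem_parts _, by simp; omega⟩
  · apply Nat.eq_of_mul_eq_mul_left hk
    have hterm : ∀ x, (if cycleLength (swap a b * σ) x = k then 1 else 0) +
        ((if σ.SameCycle a x then if p = k then 1 else 0 else 0) +
          if σ.SameCycle b x then if q = k then 1 else 0 else 0) =
        (if cycleLength σ x = k then 1 else 0) +
          ((if σ.SameCycle a x then if p + q = k then 1 else 0 else 0) +
          if σ.SameCycle b x then if p + q = k then 1 else 0 else 0) := by
      intro x
      by_cases hx : σ.SameCycle a x
      · have hx' : ¬ σ.SameCycle b x := fun h => hab (hx.trans h.symm)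
        rw [cycleLength_swap_mul_of_sameCycle hab (Or.inl hx), cycleLength_eq_of_sameCycle hx]
        simp only [if_pos hx, if_neg hx', ← hp, ← hq]
        omega
      · by_cases hx' : σ.SameCycle b x
        · rw [cycleLength_swap_mul_of_sameCycle hab (Or.inr hx'), cycleLength_eq_of_sameCycle hx']
          simp only [if_neg hx, if_pos hx', ← hp, ← hq]
          omega
        · rw [cycleLength_swap_mul_of_not_sameCycle hx hx']
          simp only [if_neg hx, if_neg hx']
    have hsum := Finset.sum_congr (rfl : (Finset.univ : Finset α) = _) fun x _ => hterm x
    have hc : ∀ (c : α) (m : ℕ), ∑ x, (if σ.SameCycle c x then m else 0) = cycleLength σ c * m := by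
      intro c m
      rw [← Finset.sum_filter, Finset.sum_const, card_sameCycle, smul_eq_mul]
    simp only [Finset.sum_add_distrib, hc, ← Finset.card_filter, card_cycleLength_eq] at hsum
    rw [← hp, ← hq] at hsum
    rw [Multiset.count_add, Multiset.count_add, Multiset.insert_eq_cons, Multiset.count_cons,
      Multiset.count_singleton, Multiset.count_singleton]
    have e1 : ∀ m : ℕ, k * (if k = m then 1 else 0) = m * if m = k then 1 else 0 := by
      intro m
      by_cases h : k = m
      · rw [if_pos h, if_pos h.symm, h]
      · rw [if_neg h, if_neg (Ne.symm h), mul_zero, mul_zero]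
    rw [mul_add, mul_add, mul_add, e1, e1, e1, add_mul]
    rw [← hsum]
    ring

theorem parts_swap_mul_comm (σ : Perm α) (a b : α) :
    (σ * swap a b).partition.parts = (swap a b * σ).partition.parts := by
  have h : IsConj (σ * swap a b) (swap a b * σ) := isConj_iff.mpr ⟨swap a b, by
    rw [swap_inv, ← mul_assoc, mul_assoc (swap a b * σ), swap_mul_self, mul_one]⟩
  rw [Perm.partition_eq_of_isConj.mp h]

section Split

variable {j : ℕ}

theorem split_pow_left (hj : j < cycleLength σ a) {i : ℕ} (hi : i < j) :
    ((swap a ((σ ^ j) a) * σ) ^ i) a = (σ ^ i) a :=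
  pow_swap_mul fun k h0 h1 => ⟨pow_ne_self h0 (by omega), fun h =>
    absurd (pow_injOn (Set.mem_Iio.mpr (by omega)) (Set.mem_Iio.mpr hj) h) (by omega)⟩

theorem split_pow_left_self (h0 : 0 < j) (hj : j < cycleLength σ a) :
    ((swap a ((σ ^ j) a) * σ) ^ j) a = a := by
  obtain ⟨n, rfl⟩ := Nat.exists_eq_succ_of_ne_zero h0.ne'
  rw [pow_succ', Perm.mul_apply, split_pow_left hj n.lt_succ_self, Perm.mul_apply,
    ← Perm.mul_apply σ, ← pow_succ', swap_apply_right]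

theorem split_pow_right (h0 : 0 < j) (hj : j < cycleLength σ a) {i : ℕ}
    (hi : i < cycleLength σ a - j) :
    ((swap a ((σ ^ j) a) * σ) ^ i) ((σ ^ j) a) = (σ ^ i) ((σ ^ j) a) :=
  pow_swap_mul fun k hk0 hk1 => ⟨fun h => by
    rw [← Perm.mul_apply, ← pow_add] at h
    exact pow_ne_self (by omega) (by omega) h, fun h =>
    pow_ne_self hk0 (by rw [cycleLength_pow]; omega) h⟩

theorem split_pow_right_self (h0 : 0 < j) (hj : j < cycleLength σ a) :
    ((swap a ((σ ^ j) a) * σ) ^ (cycleLength σ a - j)) ((σ ^ j) a) = (σ ^ j) a := by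
  obtain ⟨n, hn⟩ := Nat.exists_eq_succ_of_ne_zero (Nat.sub_pos_of_lt hj).ne'
  rw [hn, pow_succ', Perm.mul_apply, split_pow_right h0 hj (by omega), Perm.mul_apply,
    ← Perm.mul_apply σ, ← pow_succ', ← Perm.mul_apply (σ ^ _), ← pow_add,
    show n.succ + j = cycleLength σ a by omega, pow_cycleLength, swap_apply_left]

/-- A transposition of elements on the same cycle cuts this cycle. -/
theorem parts_split (h0 : 0 < j) (hj : j < cycleLength σ a) :
    (swap a ((σ ^ j) a) * σ).partition.parts + {cycleLength σ a} =
      σ.partition.parts + {j, cycleLength σ a - j} := by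
  set σ' := swap a ((σ ^ j) a) * σ with hσ'
  have h1 : cycleLength σ' a = j := cycleLength_eq h0 (split_pow_left_self h0 hj) fun i hi0 hi => by
    rw [split_pow_left hj hi]
    exact pow_ne_self hi0 (hi.trans hj)
  have h2 : cycleLength σ' ((σ ^ j) a) = cycleLength σ a - j :=
    cycleLength_eq (by omega) (split_pow_right_self h0 hj) fun i hi0 hi => by
      rw [split_pow_right h0 hj hi]
      exact pow_ne_self hi0 (by rw [cycleLength_pow]; omega)
  have h3 : ¬ σ'.SameCycle a ((σ ^ j) a) := by
    intro h
    obtain ⟨i, hi, h4⟩ := exists_pow_eq h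
    rw [h1] at hi
    rw [split_pow_left hj hi] at h4
    exact absurd (pow_injOn (Set.mem_Iio.mpr (hi.trans hj)) (Set.mem_Iio.mpr hj) h4) hi.ne
  have h4 := parts_swap_mul h3
  rw [h1, h2, Nat.add_sub_cancel' hj.le, hσ', ← mul_assoc, swap_mul_self, one_mul] at h4
  exact h4.symm

end Split

end CycleLength

/-! ### Cycle lengths of target permutations -/

section Target

variable {t : ℕ} (w : Perm (EndLabel t))

theorem orthTarget_pow_bar (n : ℕ) (z : EndLabel t) :
    (orthTarget w ^ n) (barPerm t ((orthTarget w ^ n) z)) = barPerm t z := by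
  induction n generalizing z with
  | zero => simp
  | succ n ih =>
    have h := orthTarget_bar_bar w (barPerm t z)
    rw [barPerm_barPerm] at h
    conv_lhs => enter [2, 2]; rw [pow_succ, Perm.mul_apply]
    rw [pow_succ', Perm.mul_apply, ih, h]

/-- No cycle of a target permutation contains two labels `z` and `z̄`. -/
theorem not_sameCycle_bar (z : EndLabel t) : ¬ (orthTarget w).SameCycle z (barPerm t z) := by
  intro h
  obtain ⟨n, -, hn⟩ := exists_pow_eq h
  have key : ∀ m, (orthTarget w ^ m) (barPerm t ((orthTarget w ^ m) z)) = barPerm t z := fun m =>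
    orthTarget_pow_bar w m z
  rcases Nat.even_or_odd' n with ⟨m, rfl | rfl⟩
  · rw [two_mul, pow_add, Perm.mul_apply, ← key m] at hn
    exact barPerm_ne _ ((orthTarget w ^ m).injective hn).symm
  · rw [show 2 * m + 1 = m + (1 + m) by ring, pow_add, pow_add, pow_one, Perm.mul_apply,
      Perm.mul_apply, ← key m] at hn
    have h1 := (orthTarget w ^ m).injective hn
    refine orthTarget_bar_ne w (barPerm t ((orthTarget w ^ m) z)) ?_
    rw [barPerm_barPerm, h1]

theorem cycleLength_bar (z : EndLabel t) :
    cycleLength (orthTarget w) (barPerm t z) = cycleLength (orthTarget w) z := by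
  refine cycleLength_congr fun n => ⟨fun h => ?_, fun h => ?_⟩
  · have h1 := orthTarget_pow_bar w n (barPerm t z)
    rwa [h, barPerm_barPerm] at h1
  · have h1 := orthTarget_pow_bar w n z
    rwa [h] at h1

variable {w}

theorem sameCycle_bar {x y : EndLabel t} (h : (orthTarget w).SameCycle x y) :
    (orthTarget w).SameCycle (barPerm t x) (barPerm t y) := by
  obtain ⟨i, -, rfl⟩ := exists_pow_eq h
  have h1 := sameCycle_pow (orthTarget w) (barPerm t ((orthTarget w ^ i) x)) i
  rw [orthTarget_pow_bar] at h1
  exact h1.symm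

theorem sameCycle_bar_iff {x y : EndLabel t} :
    (orthTarget w).SameCycle (barPerm t x) (barPerm t y) ↔ (orthTarget w).SameCycle x y := by
  refine ⟨fun h => ?_, sameCycle_bar⟩
  have h1 := sameCycle_bar h
  rwa [barPerm_barPerm, barPerm_barPerm] at h1

theorem sameCycle_bar_left_iff {x y : EndLabel t} :
    (orthTarget w).SameCycle (barPerm t x) y ↔ (orthTarget w).SameCycle x (barPerm t y) := by
  rw [← sameCycle_bar_iff, barPerm_barPerm]

theorem parts_retie (τ : Perm (EndLabel t)) (x y : EndLabel t) :
    (swap x y * τ * swap (barPerm t x) (barPerm t y)).partition.parts =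
      (swap (barPerm t x) (barPerm t y) * (swap x y * τ)).partition.parts :=
  parts_swap_mul_comm _ _ _

/-- Untying with a label `y` on a third cycle joins the cycles of `x` and `y`, and those of `x̄` and `ȳ`. -/
theorem parts_retie_join {x y : EndLabel t} (h1 : ¬ (orthTarget w).SameCycle x y)
    (h2 : ¬ (orthTarget w).SameCycle (barPerm t x) y) :
    (swap x y * orthTarget w * swap (barPerm t x) (barPerm t y)).partition.parts +
      {cycleLength (orthTarget w) x, cycleLength (orthTarget w) y} +
      {cycleLength (orthTarget w) x, cycleLength (orthTarget w) y} =
    (orthTarget w).partition.parts +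
      {cycleLength (orthTarget w) x + cycleLength (orthTarget w) y} +
      {cycleLength (orthTarget w) x + cycleLength (orthTarget w) y} := by
  have hx := not_sameCycle_bar w x
  have hy := not_sameCycle_bar w y
  have hyx : ¬ (orthTarget w).SameCycle y (barPerm t x) := fun h => h2 h.symm
  have hxy : ¬ (orthTarget w).SameCycle x (barPerm t y) := fun h =>
    h2 (sameCycle_bar_left_iff.mpr h)
  have h3 : ¬ (swap x y * orthTarget w).SameCycle (barPerm t x) (barPerm t y) := by
    rw [sameCycle_swap_mul_iff hx hyx, sameCycle_bar_iff]
    exact h1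
  have h4 := parts_swap_mul h3
  rw [cycleLength_swap_mul_of_not_sameCycle hx hyx, cycleLength_bar,
    cycleLength_swap_mul_of_not_sameCycle hxy hy, cycleLength_bar] at h4
  rw [parts_retie, h4, add_right_comm, parts_swap_mul h1]

/-- Untying with a label on the cycle of `x` cuts this cycle and that of `x̄`. -/
theorem parts_retie_split {x : EndLabel t} {j : ℕ} (h0 : 0 < j)
    (hj : j < cycleLength (orthTarget w) x) :
    (swap x ((orthTarget w ^ j) x) * orthTarget w *
        swap (barPerm t x) (barPerm t ((orthTarget w ^ j) x))).partition.parts +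
      {cycleLength (orthTarget w) x} + {cycleLength (orthTarget w) x} =
    (orthTarget w).partition.parts + {j, cycleLength (orthTarget w) x - j} +
      {j, cycleLength (orthTarget w) x - j} := by
  set y := (orthTarget w ^ j) x with hy
  have hxy : (orthTarget w).SameCycle x y := sameCycle_pow _ _ _
  have hyy := not_sameCycle_bar w y
  have hxy' : ¬ (orthTarget w).SameCycle x (barPerm t y) := fun h => hyy (hxy.symm.trans h)
  have hlen : cycleLength (swap x y * orthTarget w) (barPerm t y) =
      cycleLength (orthTarget w) x := by
    rw [cycleLength_swap_mul_of_not_sameCycle hxy' hyy, cycleLength_bar, hy, cycleLength_pow]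
  have hpow : ((swap x y * orthTarget w) ^ j) (barPerm t y) = barPerm t x := by
    rw [pow_swap_mul_of_not_sameCycle hxy' hyy, hy, orthTarget_pow_bar]
  have h1 := parts_split h0 (hlen.symm ▸ hj : j < cycleLength (swap x y * orthTarget w) (barPerm t y))
  rw [hpow, hlen] at h1
  rw [parts_retie, swap_comm (barPerm t x), h1, add_right_comm, parts_split h0 hj]

/-- Untying with a label `y` on the cycle of `x̄` first joins the cycles of `x` and `x̄`, and then cuts the
joined cycle into two halves of equal length. -/
theorem parts_retie_bar {x y : EndLabel t} (h : (orthTarget w).SameCycle (barPerm t x) y) :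
    (swap x y * orthTarget w * swap (barPerm t x) (barPerm t y)).partition.parts =
      (orthTarget w).partition.parts := by
  have hxy : ¬ (orthTarget w).SameCycle x y := fun h1 => not_sameCycle_bar w x (h1.trans h.symm)
  have hyx : ¬ (orthTarget w).SameCycle y x := fun h1 => hxy h1.symm
  set n := cycleLength (orthTarget w) x with hn
  have hny : cycleLength (orthTarget w) y = n := by
    rw [cycleLength_eq_of_sameCycle h, cycleLength_bar]
  have hn0 : 0 < n := cycleLength_pos _ _
  set X := swap x y * orthTarget w with hX
  have hlen : cycleLength X x = n + n := by rw [hX, cycleLength_swap_mul hxy, hny]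
  -- in the joined cycle, `τ ^ i x` and `τ ^ i y` are opposite to each other
  have hopp : ∀ i < n, (X ^ n) ((orthTarget w ^ i) x) = (orthTarget w ^ i) y := by
    intro i hi
    rw [← swap_mul_pow_of_not_sameCycle hxy hi, ← hX, ← Perm.mul_apply, ← pow_add, add_comm,
      pow_add, Perm.mul_apply, hX, hn, swap_mul_pow_cycleLength hxy, swap_comm,
      swap_mul_pow_of_not_sameCycle hyx (hny.symm ▸ hi)]
  obtain ⟨j, hj, hjy⟩ := exists_pow_eq h
  rw [cycleLength_bar, ← hn] at hj
  have hpair : (X ^ n) (barPerm t y) = barPerm t x ∧ cycleLength X (barPerm t y) = n + n := by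
    have h1 : ∃ i < n, (orthTarget w ^ i) x = barPerm t y ∧
        (orthTarget w ^ i) y = barPerm t x := by
      have h2 := orthTarget_pow_bar w j (barPerm t x)
      rw [hjy, barPerm_barPerm] at h2
      rcases Nat.eq_zero_or_pos j with rfl | hj0
      · refine ⟨0, hn0, ?_, ?_⟩
        · simpa using h2.symm
        · simpa using hjy.symm
      · refine ⟨n - j, by omega, ?_, ?_⟩
        · rw [← h2, ← Perm.mul_apply, ← pow_add, Nat.sub_add_cancel hj.le, pow_eq_self_iff,
            cycleLength_bar, hny]
        · rw [← hjy, ← Perm.mul_apply, ← pow_add, Nat.sub_add_cancel hj.le, pow_eq_self_iff,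
            cycleLength_bar]
    obtain ⟨i, hi, h1, h2⟩ := h1
    refine ⟨by rw [← h1, hopp i hi, h2], ?_⟩
    rw [← h1, ← swap_mul_pow_of_not_sameCycle hxy hi, ← hX, cycleLength_pow, hlen]
  have h1 := parts_split hn0 (by rw [hpair.2]; omega : n < cycleLength X (barPerm t y))
  rw [hpair.1, hpair.2, Nat.add_sub_cancel] at h1
  have h2 := parts_swap_mul hxy
  rw [hny, ← hn, ← hX] at h2
  rw [parts_retie, swap_comm (barPerm t x), ← hX]
  exact add_right_cancel (h1.trans h2)

/-- The half type of a permutation whose cycle lengths all occur an even number of times. -/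
def HasHalfType (τ : Perm (EndLabel t)) (c : Multiset ℕ) : Prop := τ.partition.parts = c + c

theorem HasHalfType.mem {τ : Perm (EndLabel t)} {c : Multiset ℕ} (h : HasHalfType τ c)
    (x : EndLabel t) : cycleLength τ x ∈ c := by
  have h1 := cycleLength_mem_parts τ x
  rw [h, Multiset.mem_add, or_self] at h1
  exact h1

theorem HasHalfType.sum {τ : Perm (EndLabel t)} {c : Multiset ℕ} (h : HasHalfType τ c) :
    c.sum = t := by
  have h1 := τ.partition.parts_sum
  rw [h, Multiset.sum_add, Fintype.card_prod, Fintype.card_fin, Fintype.card_bool] at h1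
  omega

variable {x y : EndLabel t} {c : Multiset ℕ}

theorem HasHalfType.split (h : HasHalfType (orthTarget w) (cycleLength (orthTarget w) x ::ₘ c))
    {j : ℕ} (h0 : 0 < j) (hj : j < cycleLength (orthTarget w) x) :
    HasHalfType (orthTarget (w * swap x ((orthTarget w ^ j) x)))
      (j ::ₘ (cycleLength (orthTarget w) x - j) ::ₘ c) := by
  have h1 := parts_retie_split h0 hj
  rw [h, add_assoc] at h1
  rw [HasHalfType, orthTarget_mul_swap]
  refine add_right_cancel (h1.trans ?_)
  ext k
  simp only [Multiset.count_add, Multiset.count_cons, Multiset.insert_eq_cons,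
    Multiset.count_singleton]
  ring

theorem HasHalfType.keep (h : HasHalfType (orthTarget w) c)
    (hy : (orthTarget w).SameCycle (barPerm t x) y) :
    HasHalfType (orthTarget (w * swap x y)) c := by
  rw [HasHalfType, orthTarget_mul_swap, parts_retie_bar hy]
  exact h

theorem HasHalfType.join (h : HasHalfType (orthTarget w) (cycleLength (orthTarget w) x ::ₘ c))
    (h1 : ¬ (orthTarget w).SameCycle x y) (h2 : ¬ (orthTarget w).SameCycle (barPerm t x) y) :
    cycleLength (orthTarget w) y ∈ c ∧ HasHalfType (orthTarget (w * swap x y))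
      ((cycleLength (orthTarget w) x + cycleLength (orthTarget w) y) ::ₘ
        c.erase (cycleLength (orthTarget w) y)) := by
  have h3 := parts_retie_join h1 h2
  rw [h] at h3
  have hx0 := cycleLength_pos (orthTarget w) x
  set p := cycleLength (orthTarget w) x
  set q := cycleLength (orthTarget w) y
  have hq : q ∈ c := by
    rw [← Multiset.count_pos]
    have h4 := congrArg (Multiset.count q) h3
    simp only [Multiset.count_add, Multiset.count_cons, Multiset.insert_eq_cons,
      Multiset.count_singleton, if_true] at h4
    rw [if_neg (by omega : ¬ q = p + q)] at h4
    omega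
  refine ⟨hq, ?_⟩
  rw [HasHalfType, orthTarget_mul_swap]
  rw [add_assoc] at h3
  refine add_right_cancel (h3.trans ?_)
  conv_lhs => rw [← Multiset.cons_erase hq]
  ext k
  simp only [Multiset.count_add, Multiset.count_cons, Multiset.insert_eq_cons,
    Multiset.count_singleton]
  ring

theorem orthTarget_one (t : ℕ) : orthTarget (1 : Perm (EndLabel t)) = 1 := by
  ext1 z
  rw [orthTarget_apply]
  simp

/-- Every target permutation is obtained from the trivial one by transpositions, and each of these
preserves the property. -/
theorem exists_hasHalfType (w : Perm (EndLabel t)) : ∃ c, HasHalfType (orthTarget w) c := by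
  induction w using Perm.swap_induction_on' with
  | one =>
    refine ⟨Multiset.replicate t 1, ?_⟩
    rw [HasHalfType, orthTarget_one, Perm.parts_partition, Perm.cycleType_one, Perm.support_one,
      Finset.card_empty, Fintype.card_prod, Fintype.card_fin, Fintype.card_bool, zero_add,
      tsub_zero, mul_two, Multiset.replicate_add]
  | mul_swap w x y hxy ih =>
    obtain ⟨c, hc⟩ := ih
    obtain ⟨d, hd⟩ := Multiset.exists_cons_of_mem (hc.mem x)
    rw [hd] at hc
    by_cases h1 : (orthTarget w).SameCycle x y
    · obtain ⟨j, hj, rfl⟩ := exists_pow_eq h1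
      refine ⟨_, hc.split (Nat.pos_of_ne_zero ?_) hj⟩
      rintro rfl
      exact hxy rfl
    · by_cases h2 : (orthTarget w).SameCycle (barPerm t x) y
      · exact ⟨_, hc.keep h2⟩
      · exact ⟨_, (hc.join h1 h2).2⟩

theorem parts_extendPerm (σ : Perm (EndLabel t)) :
    (extendPerm t σ).partition.parts = σ.partition.parts + {1, 1} := by
  classical
  have h1 : (extendPerm t σ).cycleType = σ.cycleType :=
    @Perm.cycleType_extendDomain (EndLabel t) _ _ (EndLabel (t + 1)) _ _
      (· ∈ Set.range (shiftLabel t)) (fun _ => Classical.propDecidable _)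
      (Equiv.ofInjective _ (shiftLabel t).injective) σ
  have h2 : (extendPerm t σ).support.card = σ.support.card := by
    rw [← Perm.sum_cycleType, h1, Perm.sum_cycleType]
  have h3 := σ.support.card_le_univ
  rw [Perm.parts_partition, Perm.parts_partition, h1, h2, add_assoc,
    show ({1, 1} : Multiset ℕ) = Multiset.replicate 2 1 from rfl, ← Multiset.replicate_add]
  congr 2
  simp only [Fintype.card_prod, Fintype.card_fin, Fintype.card_bool] at h3 ⊢
  omega

/-- An edge between two leaves contributes a cycle length `1`. -/
theorem hasHalfType_extendPerm_iff {σ : Perm (EndLabel t)} {c : Multiset ℕ} :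
    HasHalfType (extendPerm t σ) (1 ::ₘ c) ↔ HasHalfType σ c := by
  have h : (1 ::ₘ c) + (1 ::ₘ c) = (c + c) + {1, 1} := by
    ext k
    simp only [Multiset.count_add, Multiset.count_cons, Multiset.insert_eq_cons,
      Multiset.count_singleton]
    ring
  rw [HasHalfType, HasHalfType, parts_extendPerm, h, add_left_inj]

end Target

/-! ### The recursion in terms of the cycle lengths -/

section Recursion

variable {t : ℕ} {w : Perm (EndLabel (t + 1))} {c : Multiset ℕ}

open Classical in
/-- The labels on other cycles than `x` and `x̄` are counted by the half type. -/
theorem card_filter_cycleLength {t : ℕ} {w : Perm (EndLabel t)} {x : EndLabel t}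
    (h : HasHalfType (orthTarget w) (cycleLength (orthTarget w) x ::ₘ c)) (k : ℕ) :
    ((Finset.univ.filter fun y => ¬ (orthTarget w).SameCycle x y ∧
        ¬ (orthTarget w).SameCycle (barPerm t x) y).filter
      fun y => cycleLength (orthTarget w) y = k).card = c.count k * (2 * k) := by
  set τ := orthTarget w with hτ
  set p := cycleLength τ x with hp
  have hterm : ∀ y, (if cycleLength τ y = k then 1 else 0) =
      (if τ.SameCycle x y then if p = k then 1 else 0 else 0) +
        ((if τ.SameCycle (barPerm t x) y then if p = k then 1 else 0 else 0) +
        if (¬ τ.SameCycle x y ∧ ¬ τ.SameCycle (barPerm t x) y) ∧ cycleLength τ y = k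
          then 1 else 0) := by
    intro y
    by_cases h1 : τ.SameCycle x y
    · have h2 : ¬ τ.SameCycle (barPerm t x) y := fun h2 => not_sameCycle_bar w x (h1.trans h2.symm)
      rw [cycleLength_eq_of_sameCycle h1]
      simp [h1, h2, ← hp]
    · by_cases h2 : τ.SameCycle (barPerm t x) y
      · rw [cycleLength_eq_of_sameCycle h2, hτ, cycleLength_bar, ← hτ, ← hp]
        simp [h1, h2]
      · simp [h1, h2]
  have hsum := Finset.sum_congr (rfl : (Finset.univ : Finset (EndLabel t)) = _) fun y _ => hterm y
  have hc : ∀ (z : EndLabel t) (m : ℕ),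
      ∑ y, (if τ.SameCycle z y then m else 0) = cycleLength τ z * m := by
    intro z m
    rw [← Finset.sum_filter, Finset.sum_const, card_sameCycle, smul_eq_mul]
  have hbar : cycleLength τ (barPerm t x) = p := cycleLength_bar w x
  simp only [Finset.sum_add_distrib, hc, ← Finset.card_filter, card_cycleLength_eq] at hsum
  rw [hbar, ← hp, h, Multiset.count_add, Multiset.count_cons] at hsum
  rw [Finset.filter_filter]
  by_cases hk : k = p
  · rw [if_pos hk, if_pos hk.symm] at hsum
    subst hk
    linarith
  · rw [if_neg hk, if_neg (Ne.symm hk)] at hsum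
    linarith

/-- The sum over all ways to untie a vertex next to the leaf `1`, in terms of the cycle lengths. -/
theorem sum_untied {p : ℕ} (hp : cycleLength (orthTarget w) (firstLabel t) = p)
    (h : HasHalfType (orthTarget w) (p ::ₘ c)) (g : Perm (EndLabel (t + 1)) → ℕ)
    (F : Multiset ℕ → ℕ) (hg : ∀ w d, HasHalfType (orthTarget w) d → g (orthTarget w) = F d) :
    ∑ y ∈ Finset.univ.erase (firstLabel t), g (untiedTarget (orthTarget w) y) =
      ∑ q ∈ Finset.Ioo 0 p, F (q ::ₘ (p - q) ::ₘ c) +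
        (c.map fun k => 2 * k * F ((p + k) ::ₘ c.erase k)).sum + p * F (p ::ₘ c) := by
  classical
  subst hp
  simp only [untiedTarget_orthTarget]
  set x := firstLabel t with hx
  set τ := orthTarget w with hτ
  set p := cycleLength τ x with hp
  let f : EndLabel (t + 1) → ℕ := fun y => if y = x then 0 else g (orthTarget (w * swap x y))
  have hf : ∀ y, y ≠ x → f y = g (orthTarget (w * swap x y)) := fun y hy => if_neg hy
  have h1 : ∑ y ∈ Finset.univ.erase x, g (orthTarget (w * swap x y)) = ∑ y, f y := by
    rw [← Finset.add_sum_erase Finset.univ f (Finset.mem_univ x), show f x = 0 from if_pos rfl,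
      zero_add]
    exact Finset.sum_congr rfl fun y hy => (hf y (Finset.ne_of_mem_erase hy)).symm
  have h2 : ∑ y ∈ Finset.univ.filter (fun y => τ.SameCycle x y), f y =
      ∑ q ∈ Finset.Ioo 0 p, F (q ::ₘ (p - q) ::ₘ c) := by
    rw [sum_sameCycle]
    symm
    have hsub : Finset.Ioo 0 p ⊆ Finset.range p := fun j hj =>
      Finset.mem_range.mpr (Finset.mem_Ioo.mp hj).2
    rw [← Finset.sum_subset hsub]
    · refine Finset.sum_congr rfl fun j hj => ?_
      obtain ⟨hj0, hj⟩ := Finset.mem_Ioo.mp hj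
      rw [hf _ (pow_ne_self hj0 hj), hg _ _ (h.split hj0 hj)]
    · intro j hj hj'
      have hj0 : j = 0 := by
        rw [Finset.mem_Ioo] at hj'
        rw [Finset.mem_range] at hj
        omega
      subst hj0
      exact if_pos rfl
  have h3 : ∑ y ∈ Finset.univ.filter (fun y => τ.SameCycle (barPerm (t + 1) x) y), f y =
      p * F (p ::ₘ c) := by
    have hcard : (Finset.univ.filter fun y => τ.SameCycle (barPerm (t + 1) x) y).card = p := by
      rw [card_sameCycle, hτ, cycleLength_bar]
    rw [Finset.sum_congr rfl (g := fun _ => F (p ::ₘ c)), Finset.sum_const, hcard, smul_eq_mul]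
    intro y hy
    have hy' := (Finset.mem_filter.mp hy).2
    rw [hf, hg _ _ (h.keep hy')]
    rintro rfl
    exact not_sameCycle_bar w _ hy'.symm
  have h4 : ∑ y ∈ Finset.univ.filter (fun y => ¬ τ.SameCycle x y ∧
      ¬ τ.SameCycle (barPerm (t + 1) x) y), f y =
      (c.map fun k => 2 * k * F ((p + k) ::ₘ c.erase k)).sum := by
    rw [Finset.sum_multiset_map_count,
      ← Finset.sum_fiberwise_of_maps_to (g := fun y => cycleLength τ y) (t := c.toFinset)]
    · refine Finset.sum_congr rfl fun k _ => ?_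
      rw [Finset.sum_congr rfl (g := fun _ => F ((p + k) ::ₘ c.erase k)), Finset.sum_const,
        card_filter_cycleLength h, smul_eq_mul, smul_eq_mul]
      · ring
      · intro y hy
        obtain ⟨hy1, rfl⟩ := Finset.mem_filter.mp hy
        obtain ⟨hy2, hy3⟩ := (Finset.mem_filter.mp hy1).2
        rw [hf, hg _ _ (h.join hy2 hy3).2]
        rintro rfl
        exact hy2 (Perm.SameCycle.refl _ _)
    · intro y hy
      obtain ⟨hy2, hy3⟩ := (Finset.mem_filter.mp hy).2
      exact Multiset.mem_toFinset.mpr (h.join hy2 hy3).1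
  rw [h1, ← Finset.sum_filter_add_sum_filter_not Finset.univ (fun y => τ.SameCycle x y), h2,
    ← Finset.sum_filter_add_sum_filter_not (Finset.univ.filter fun y => ¬ τ.SameCycle x y)
      (fun y => τ.SameCycle (barPerm (t + 1) x) y), Finset.filter_filter, Finset.filter_filter, h4,
    ← h3, add_comm (∑ y ∈ _, f y), ← add_assoc]
  congr 2
  refine Finset.filter_congr fun y _ => ⟨fun h => h.2, fun h => ⟨fun h' => ?_, h⟩⟩
  exact not_sameCycle_bar w _ (h'.trans h.symm)

/-- The recursion for the numbers of palindromic primitive factorizations of a permutation for which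
the label `1` is on a cycle of length `p`. -/
theorem palindromicCount_recursion {p : ℕ} (hp : cycleLength (orthTarget w) (firstLabel t) = p)
    (h : HasHalfType (orthTarget w) (p ::ₘ c)) :
    ∃ q : ℕ → ℕ, (p ≠ 1 → ∀ v, q v = 0) ∧
      (p = 1 → ∃ w' : Perm (EndLabel t), HasHalfType (orthTarget w') c ∧
        ∀ v, q v = palindromicCount (orthTarget w') v) ∧
      palindromicCount (orthTarget w) 0 = q 0 ∧
      ∀ (v : ℕ) (F : Multiset ℕ → ℕ), (∀ (w : Perm (EndLabel (t + 1))) (d : Multiset ℕ),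
          HasHalfType (orthTarget w) d → palindromicCount (orthTarget w) v = F d) →
        palindromicCount (orthTarget w) (v + 1) = q (v + 1) +
          (∑ q ∈ Finset.Ioo 0 p, F (q ::ₘ (p - q) ::ₘ c) +
            (c.map fun k => 2 * k * F ((p + k) ::ₘ c.erase k)).sum + p * F (p ::ₘ c)) := by
  by_cases h1 : ∃ σ, extendPerm t σ = orthTarget w
  · obtain ⟨σ, hσ⟩ := h1
    have hp1 : p = 1 := by
      rw [← hp, ← Nat.dvd_one, ← pow_eq_self_iff, pow_one, ← hσ]
      exact extendPerm_zero _ _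
    obtain ⟨w', rfl⟩ := orthTarget_of_extendPerm hσ
    refine ⟨palindromicCount (orthTarget w'), fun h => absurd hp1 h,
      fun _ => ⟨w', ?_, fun _ => rfl⟩, ?_, fun v F hF => ?_⟩
    · rw [hp1, ← hσ] at h
      exact hasHalfType_extendPerm_iff.mp h
    · rw [← hσ, palindromicCount_extendPerm_zero]
    · rw [← sum_untied hp h (fun τ => palindromicCount τ v) F hF, ← hσ,
        palindromicCount_extendPerm_succ]
  · have hp1 : p ≠ 1 := by
      intro hp1
      rw [hp1, ← Nat.dvd_one, ← pow_eq_self_iff, pow_one] at hp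
      obtain ⟨σ, hσ⟩ := exists_extendPerm_eq (σ := orthTarget w) fun ε => by
        cases ε
        · exact hp
        · exact orthTarget_zero_true hp
      exact h1 ⟨σ, hσ⟩
    rw [not_exists] at h1
    refine ⟨fun _ => 0, fun _ _ => rfl, fun h => absurd h hp1, palindromicCount_zero_of_notMem h1,
      fun v F hF => ?_⟩
    rw [← sum_untied hp h (fun τ => palindromicCount τ v) F hF,
      palindromicCount_succ_of_notMem h1, zero_add]

/-- Any label can be moved to the first place. -/
theorem exists_cycleLength_first (w : Perm (EndLabel (t + 1))) (x : EndLabel (t + 1)) :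
    ∃ w' : Perm (EndLabel (t + 1)),
      cycleLength (orthTarget w') (firstLabel t) = cycleLength (orthTarget w) x ∧
      (∀ c, HasHalfType (orthTarget w) c → HasHalfType (orthTarget w') c) ∧
      ∀ v, palindromicCount (orthTarget w') v = palindromicCount (orthTarget w) v := by
  set h := (relabel x.1 x.2)⁻¹ with hh
  have hcomm : Commute h (barPerm (t + 1)) := (relabel_commute x.1 x.2).inv_left
  have hx : h (firstLabel t) = x := by
    rw [hh, Perm.inv_eq_iff_eq]
    exact (relabel_self x.1 x.2).symm
  refine ⟨w * h, ?_, fun c hc => ?_, fun v => HalfEdgeDiagram.palindromicCount_mul_right w hcomm v⟩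
  · rw [orthTarget_mul_right hcomm]
    refine cycleLength_congr fun n => ?_
    have h1 : (h⁻¹ * orthTarget w * h) ^ n = h⁻¹ * orthTarget w ^ n * h := by
      simpa using conj_pow (i := n) (a := h⁻¹) (b := orthTarget w)
    rw [h1, Perm.mul_apply, Perm.mul_apply, hx, Perm.inv_eq_iff_eq, hx, eq_comm]
  · have h1 : IsConj (orthTarget w) (orthTarget (w * h)) := by
      rw [orthTarget_mul_right hcomm, isConj_iff]
      exact ⟨h⁻¹, by rw [inv_inv]⟩
    rw [HasHalfType, ← Perm.partition_eq_of_isConj.mp h1]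
    exact hc

/-- The recursion can start with any of the cycle lengths. -/
theorem exists_first (h : HasHalfType (orthTarget w) c) {p : ℕ} (hp : p ∈ c) :
    ∃ w' : Perm (EndLabel (t + 1)), cycleLength (orthTarget w') (firstLabel t) = p ∧
      HasHalfType (orthTarget w') c ∧
      ∀ v, palindromicCount (orthTarget w') v = palindromicCount (orthTarget w) v := by
  obtain ⟨x, rfl⟩ := exists_cycleLength_eq (σ := orthTarget w) (k := p) (by
    rw [h]; exact Multiset.mem_add.mpr (Or.inl hp))
  obtain ⟨w', h1, h2, h3⟩ := exists_cycleLength_first w x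
  exact ⟨w', h1, h2 c h, h3⟩

/-- The number of palindromic primitive factorizations depends on the half type only, by induction
on `v` and, for the factorizations in which the label `1` is fixed, on `t`. -/
theorem palindromicCount_eq_of_halfType (v t : ℕ) (w w' : Perm (EndLabel t)) (c : Multiset ℕ)
    (h : HasHalfType (orthTarget w) c) (h' : HasHalfType (orthTarget w') c) :
    palindromicCount (orthTarget w) v = palindromicCount (orthTarget w') v := by
  classical
  induction v generalizing t c with
  | zero =>
    induction t generalizing c with
    | zero => rw [Subsingleton.elim w w']
    | succ t iht =>
      have hp := h.mem (firstLabel t)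
      obtain ⟨w₁, h1, h2, h3⟩ := exists_first h hp
      obtain ⟨w₂, h1', h2', h3'⟩ := exists_first h' hp
      obtain ⟨d, rfl⟩ := Multiset.exists_cons_of_mem hp
      obtain ⟨q, hq, hq1, h4, -⟩ := palindromicCount_recursion h1 h2
      obtain ⟨q', hq', hq1', h4', -⟩ := palindromicCount_recursion h1' h2'
      rw [← h3, ← h3', h4, h4']
      by_cases hp1 : cycleLength (orthTarget w) (firstLabel t) = 1
      · obtain ⟨u, hu, hqu⟩ := hq1 hp1
        obtain ⟨u', hu', hqu'⟩ := hq1' hp1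
        rw [hqu, hqu', iht u u' d hu hu']
      · rw [hq hp1, hq' hp1]
  | succ v ihv =>
    induction t generalizing c with
    | zero => rw [Subsingleton.elim w w']
    | succ t iht =>
      have hp := h.mem (firstLabel t)
      obtain ⟨w₁, h1, h2, h3⟩ := exists_first h hp
      obtain ⟨w₂, h1', h2', h3'⟩ := exists_first h' hp
      obtain ⟨d, rfl⟩ := Multiset.exists_cons_of_mem hp
      obtain ⟨q, hq, hq1, -, h4⟩ := palindromicCount_recursion h1 h2
      obtain ⟨q', hq', hq1', -, h4'⟩ := palindromicCount_recursion h1' h2'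
      let F : Multiset ℕ → ℕ := fun d =>
        if hd : ∃ u : Perm (EndLabel (t + 1)), HasHalfType (orthTarget u) d then
          palindromicCount (orthTarget hd.choose) v else 0
      have hF : ∀ (u : Perm (EndLabel (t + 1))) (d : Multiset ℕ),
          HasHalfType (orthTarget u) d → palindromicCount (orthTarget u) v = F d := by
        intro u d hu
        have hd : ∃ u : Perm (EndLabel (t + 1)), HasHalfType (orthTarget u) d := ⟨u, hu⟩
        simp only [F, dif_pos hd]
        exact ihv (t + 1) u _ d hu hd.choose_spec
      rw [← h3, ← h3', h4 v F hF, h4' v F hF]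
      congr 1
      by_cases hp1 : cycleLength (orthTarget w) (firstLabel t) = 1
      · obtain ⟨u, hu, hqu⟩ := hq1 hp1
        obtain ⟨u', hu', hqu'⟩ := hq1' hp1
        rw [hqu, hqu', iht u u' d hu hu']
      · rw [hq hp1, hq' hp1]

/-- Every multiset of positive integers is the half type of a target permutation. -/
theorem exists_halfType_eq (c : Multiset ℕ) (hc : 0 ∉ c) :
    ∃ (t : ℕ) (w : Perm (EndLabel t)), HasHalfType (orthTarget w) c := by
  induction c using Multiset.induction_on with
  | empty =>
    obtain ⟨c, h⟩ := exists_hasHalfType (1 : Perm (EndLabel 0))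
    have h1 : c = 0 := by
      have h2 := h.sum
      by_contra hne
      obtain ⟨k, hk⟩ := Multiset.exists_mem_of_ne_zero hne
      have h3 := Multiset.le_sum_of_mem hk
      have h4 : k ∈ (orthTarget (1 : Perm (EndLabel 0))).partition.parts := by
        rw [h]; exact Multiset.mem_add.mpr (Or.inl hk)
      have h5 := Nat.Partition.parts_pos _ h4
      omega
    exact ⟨0, 1, h1 ▸ h⟩
  | cons k c ih =>
    rw [Multiset.mem_cons, not_or] at hc
    have hk : 1 ≤ k := Nat.one_le_iff_ne_zero.mpr (Ne.symm hc.1)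
    have hone : ∀ d : Multiset ℕ, (∃ (t : ℕ) (w : Perm (EndLabel t)),
        HasHalfType (orthTarget w) d) →
        ∃ (t : ℕ) (w : Perm (EndLabel (t + 1))), HasHalfType (orthTarget w) (1 ::ₘ d) := by
      rintro d ⟨t, w, h⟩
      refine ⟨t, extendPerm t w, ?_⟩
      rw [orthTarget_extendPerm]
      exact hasHalfType_extendPerm_iff.mpr h
    induction k, hk using Nat.le_induction with
    | base =>
      obtain ⟨t, w, h⟩ := hone c (ih hc.2)
      exact ⟨t + 1, w, h⟩
    | succ k hk ihk =>
      obtain ⟨t, w, h⟩ := hone _ (ihk ⟨by omega, hc.2⟩)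
      obtain ⟨w₁, h1, h2, -⟩ := exists_first h (Multiset.mem_cons_self 1 _)
      have h2' : HasHalfType (orthTarget w₁)
          (cycleLength (orthTarget w₁) (firstLabel t) ::ₘ k ::ₘ c) := by rw [h1]; exact h2
      have h3 := card_filter_cycleLength h2' k
      have h4 : 0 < (k ::ₘ c).count k * (2 * k) := by
        rw [Multiset.count_cons_self]
        positivity
      rw [← h3, Finset.card_pos] at h4
      obtain ⟨y, hy⟩ := h4
      obtain ⟨hy1, hy2⟩ := Finset.mem_filter.mp hy
      obtain ⟨hy3, hy4⟩ := (Finset.mem_filter.mp hy1).2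
      have h5 := (h2'.join hy3 hy4).2
      rw [hy2, h1, Multiset.erase_cons_head, add_comm 1 k] at h5
      exact ⟨_, _, h5⟩

end Recursion

/-! ### Counts and series as functions of the half type -/

section HalfType

open Classical in
/-- The number of palindromic primitive factorizations with `v` pairs of any target permutation
with half type `c`; it is `0` if there is none, that is if `0 ∈ c`. -/
noncomputable def halfTypeCount (v : ℕ) (c : Multiset ℕ) : ℕ :=
  if h : ∃ a : Σ t : ℕ, Perm (EndLabel t), HasHalfType (orthTarget a.2) c then
    palindromicCount (orthTarget h.choose.2) v else 0

/-- The number of pairs of labels is the sum of the half type, and for a fixed number of labels the half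
type determines the count. -/
theorem palindromicCount_eq_halfTypeCount {t : ℕ} {w : Perm (EndLabel t)} {c : Multiset ℕ}
    (h : HasHalfType (orthTarget w) c) (v : ℕ) :
    palindromicCount (orthTarget w) v = halfTypeCount v c := by
  have he : ∃ a : Σ t : ℕ, Perm (EndLabel t), HasHalfType (orthTarget a.2) c := ⟨⟨t, w⟩, h⟩
  rw [halfTypeCount, dif_pos he]
  obtain ⟨⟨t', w'⟩, h', ha⟩ : ∃ a : Σ t : ℕ, Perm (EndLabel t),
      HasHalfType (orthTarget a.2) c ∧ he.choose = a := ⟨_, he.choose_spec, rfl⟩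
  rw [ha]
  obtain rfl : t = t' := h.sum.symm.trans h'.sum
  exact palindromicCount_eq_of_halfType v t w w' c h h'

/-- The power series with the alternating coefficients `(-1) ^ v * f v`. -/
noncomputable def alternatingSeries (f : ℕ → ℕ) : PowerSeries ℤ :=
  PowerSeries.mk fun v => (-1) ^ v * (f v : ℤ)

/-- The sum over the diagrams as a function of the half type `c`. The exponent `c.sum` is the
number `t` of pairs of labels. -/
noncomputable def halfTypeDelta (c : Multiset ℕ) : PowerSeries ℤ :=
  PowerSeries.X ^ c.sum * alternatingSeries fun v => halfTypeCount v c

theorem orthDelta_eq_halfTypeDelta {t : ℕ} {w : Perm (EndLabel t)} {c : Multiset ℕ}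
    (h : HasHalfType (orthTarget w) c) : orthDelta (orthTarget w) = halfTypeDelta c := by
  ext m
  rw [halfTypeDelta, PowerSeries.coeff_X_pow_mul', h.sum, alternatingSeries]
  split_ifs with hm
  · obtain ⟨v, rfl⟩ := Nat.exists_eq_add_of_le hm
    rw [HalfEdgeDiagram.coeff_orthDelta, Nat.add_sub_cancel_left, PowerSeries.coeff_mk,
      palindromicCount_eq_halfTypeCount h]
  · exact HalfEdgeDiagram.coeff_orthDelta_of_lt w (by omega)

theorem hasHalfType_zero : HasHalfType (orthTarget (1 : Perm (EndLabel 0))) 0 := by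
  obtain ⟨c, h⟩ := exists_hasHalfType (1 : Perm (EndLabel 0))
  suffices c = 0 by rwa [this] at h
  refine Multiset.eq_zero_of_forall_notMem fun k hk => ?_
  have h1 := Multiset.le_sum_of_mem hk
  rw [h.sum] at h1
  have h2 : k ∈ (orthTarget (1 : Perm (EndLabel 0))).partition.parts := by
    rw [show (orthTarget (1 : Perm (EndLabel 0))).partition.parts = c + c from h]
    exact Multiset.mem_add.mpr (Or.inl hk)
  have h3 := Nat.Partition.parts_pos _ h2
  omega

theorem halfTypeCount_zero_zero : halfTypeCount 0 0 = 1 := by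
  rw [← palindromicCount_eq_halfTypeCount hasHalfType_zero, palindromicCount_zero,
    if_pos (Subsingleton.elim _ _)]

theorem halfTypeCount_succ_zero (v : ℕ) : halfTypeCount (v + 1) 0 = 0 := by
  rw [← palindromicCount_eq_halfTypeCount hasHalfType_zero, palindromicCount_empty]

theorem halfTypeDelta_zero : halfTypeDelta 0 = 1 := by
  ext m
  rw [halfTypeDelta, alternatingSeries, Multiset.sum_zero, pow_zero, one_mul,
    PowerSeries.coeff_mk, PowerSeries.coeff_one]
  cases m with
  | zero => rw [halfTypeCount_zero_zero]; simp
  | succ v => rw [halfTypeCount_succ_zero]; simp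

theorem halfTypeCount_recursion {p : ℕ} {c : Multiset ℕ} (hp : 0 < p) (hc : 0 ∉ c) :
    halfTypeCount 0 (p ::ₘ c) = (if p = 1 then halfTypeCount 0 c else 0) ∧
    ∀ v : ℕ, halfTypeCount (v + 1) (p ::ₘ c) =
      (if p = 1 then halfTypeCount (v + 1) c else 0)
      + (∑ q ∈ Finset.Ioo 0 p, halfTypeCount v (q ::ₘ (p - q) ::ₘ c))
      + (c.map fun k : ℕ => 2 * k * halfTypeCount v ((p + k) ::ₘ c.erase k)).sum
      + p * halfTypeCount v (p ::ₘ c) := by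
  obtain ⟨t, w, h⟩ := exists_halfType_eq (p ::ₘ c)
    (by rw [Multiset.mem_cons, not_or]; exact ⟨hp.ne, hc⟩)
  obtain _ | t := t
  · have h1 := h.sum
    rw [Multiset.sum_cons] at h1
    omega
  obtain ⟨w', h1, h2, -⟩ := exists_first h (Multiset.mem_cons_self p c)
  obtain ⟨q, hq1, hq2, hq3, hq4⟩ := palindromicCount_recursion h1 h2
  have hq : ∀ v, q v = if p = 1 then halfTypeCount v c else 0 := by
    intro v
    split_ifs with h3
    · obtain ⟨w'', h4, h5⟩ := hq2 h3
      rw [h5, palindromicCount_eq_halfTypeCount h4]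
    · exact hq1 h3 v
  refine ⟨?_, fun v => ?_⟩
  · rw [← palindromicCount_eq_halfTypeCount h2, hq3, hq]
  · rw [← palindromicCount_eq_halfTypeCount h2, hq4 v (halfTypeCount v)
      fun w d hd => palindromicCount_eq_halfTypeCount hd v, hq]
    ring

/-- The recursion for the counts, as an identity of power series. -/
theorem alternatingSeries_recursion {p : ℕ} {c : Multiset ℕ} (hp : 0 < p) (hc : 0 ∉ c) :
    (1 + (p : PowerSeries ℤ) * PowerSeries.X) *
        alternatingSeries (fun v => halfTypeCount v (p ::ₘ c))
      + PowerSeries.X * (∑ q ∈ Finset.Ioo 0 p,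
        alternatingSeries fun v => halfTypeCount v (q ::ₘ (p - q) ::ₘ c))
      + 2 * PowerSeries.X * (c.map fun k : ℕ => (k : PowerSeries ℤ) *
        alternatingSeries fun v => halfTypeCount v ((p + k) ::ₘ c.erase k)).sum
      = if p = 1 then alternatingSeries (fun v => halfTypeCount v c) else 0 := by
  obtain ⟨h0, h1⟩ := halfTypeCount_recursion hp hc
  have hk (k : ℕ) (f : PowerSeries ℤ) (v : ℕ) :
      PowerSeries.coeff v ((k : PowerSeries ℤ) * f) = k * PowerSeries.coeff v f := by
    rw [← nsmul_eq_mul, map_nsmul, nsmul_eq_mul]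
  have hif (v : ℕ) : PowerSeries.coeff v
      (if p = 1 then alternatingSeries (fun v => halfTypeCount v c) else 0) =
      (-1) ^ v * ((if p = 1 then halfTypeCount v c else 0 : ℕ) : ℤ) := by
    split_ifs <;> simp [alternatingSeries]
  rw [show ∀ A B C : PowerSeries ℤ, (1 + (p : PowerSeries ℤ) * PowerSeries.X) * A
      + PowerSeries.X * B + 2 * PowerSeries.X * C = A + PowerSeries.X *
        ((p : PowerSeries ℤ) * A + B + ((2 : ℕ) : PowerSeries ℤ) * C) from
    fun A B C => by push_cast; ring]
  ext n
  rw [hif, map_add]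
  cases n with
  | zero =>
    rw [PowerSeries.coeff_zero_X_mul, add_zero, alternatingSeries, PowerSeries.coeff_mk, h0]
  | succ v =>
    rw [PowerSeries.coeff_succ_X_mul, map_add, map_add, hk, hk, map_sum, map_multiset_sum,
      Multiset.map_map]
    simp only [Function.comp_def, hk, alternatingSeries, PowerSeries.coeff_mk, h1]
    push_cast
    rw [← Finset.mul_sum]
    have h2 : (c.map fun k : ℕ => (k : ℤ) *
        ((-1) ^ v * (halfTypeCount v ((p + k) ::ₘ c.erase k) : ℤ))).sum =
        (-1) ^ v * (c.map fun k : ℕ =>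
          (k : ℤ) * (halfTypeCount v ((p + k) ::ₘ c.erase k) : ℤ)).sum := by
      rw [← Multiset.sum_map_mul_left]
      exact congrArg Multiset.sum (Multiset.map_congr rfl fun k _ => by ring)
    have h3 : (c.map fun k : ℕ =>
          2 * (k : ℤ) * (halfTypeCount v ((p + k) ::ₘ c.erase k) : ℤ)).sum =
        2 * (c.map fun k : ℕ =>
          (k : ℤ) * (halfTypeCount v ((p + k) ::ₘ c.erase k) : ℤ)).sum := by
      rw [← Multiset.sum_map_mul_left]
      exact congrArg Multiset.sum (Multiset.map_congr rfl fun k _ => by ring)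
    rw [h2, Multiset.map_map]
    simp only [Function.comp_def]
    push_cast
    rw [h3]
    ring

theorem halfTypeDelta_recursion {p : ℕ} {c : Multiset ℕ} (hp : 0 < p) (hc : 0 ∉ c) :
    (1 + (p : PowerSeries ℤ) * PowerSeries.X) * halfTypeDelta (p ::ₘ c)
      + PowerSeries.X * (∑ q ∈ Finset.Ioo 0 p, halfTypeDelta (q ::ₘ (p - q) ::ₘ c))
      + 2 * PowerSeries.X * (c.map fun k : ℕ => (k : PowerSeries ℤ) *
        halfTypeDelta ((p + k) ::ₘ c.erase k)).sum
      = if p = 1 then PowerSeries.X * halfTypeDelta c else 0 := by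
  have h1 : ∑ q ∈ Finset.Ioo 0 p, halfTypeDelta (q ::ₘ (p - q) ::ₘ c) =
      PowerSeries.X ^ (p + c.sum) * ∑ q ∈ Finset.Ioo 0 p,
        alternatingSeries fun v => halfTypeCount v (q ::ₘ (p - q) ::ₘ c) := by
    rw [Finset.mul_sum]
    refine Finset.sum_congr rfl fun q hq => ?_
    rw [halfTypeDelta, Multiset.sum_cons, Multiset.sum_cons, ← add_assoc,
      Nat.add_sub_cancel' (Finset.mem_Ioo.mp hq).2.le]
  have h2 : (c.map fun k : ℕ => (k : PowerSeries ℤ) *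
        halfTypeDelta ((p + k) ::ₘ c.erase k)).sum =
      PowerSeries.X ^ (p + c.sum) * (c.map fun k : ℕ => (k : PowerSeries ℤ) *
        alternatingSeries fun v => halfTypeCount v ((p + k) ::ₘ c.erase k)).sum := by
    rw [← Multiset.sum_map_mul_left]
    refine congrArg Multiset.sum (Multiset.map_congr rfl fun k hk => ?_)
    rw [halfTypeDelta, Multiset.sum_cons, add_assoc, Multiset.sum_erase hk]
    ring
  have h3 : (if p = 1 then PowerSeries.X * halfTypeDelta c else 0) =
      PowerSeries.X ^ (p + c.sum) *
        if p = 1 then alternatingSeries (fun v => halfTypeCount v c) else 0 := by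
    split_ifs with h
    · rw [h, halfTypeDelta, pow_add, pow_one, mul_assoc]
    · rw [mul_zero]
  rw [h1, h2, h3, ← alternatingSeries_recursion hp hc, halfTypeDelta, Multiset.sum_cons]
  ring

end HalfType

end COE

theorem theorem6p2 :
    -- the total contribution of the diagrams is the COE class coefficient
    (∀ t N : ℕ, 2 * t ≤ N →
      (∃! V : Equiv.Perm (EndLabel t) → ℂ, IsCOEClassCoeff N t V) ∧
      ∀ V : Equiv.Perm (EndLabel t) → ℂ, IsCOEClassCoeff N t V →
        ∀ w : Equiv.Perm (EndLabel t),
          HasSum (fun m : ℕ => ((PowerSeries.coeff m (orthDelta (orthTarget w)) : ℤ) : ℂ)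
            / (N : ℂ) ^ m) (V w)) ∧
    -- finiteness at each order, the cancelling involution and its fixed points
    (∀ (t : ℕ) (w : Equiv.Perm (EndLabel t)),
      (∀ d : OrthogonalDiagramClass (orthTarget w), t + 2 * d.numInternal ≤ d.numEdges) ∧
      (∀ m : ℕ, {d : OrthogonalDiagramClass (orthTarget w) |
        d.numEdges = d.numInternal + m}.Finite) ∧
      (∃ P : OrthogonalDiagramClass (orthTarget w) → OrthogonalDiagramClass (orthTarget w),
        Function.Involutive P ∧
        (∀ d, P d ≠ d →
          ((P d).numInternal = d.numInternal + 1 ∧ (P d).numEdges = d.numEdges + 1) ∨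
          (d.numInternal = (P d).numInternal + 1 ∧ d.numEdges = (P d).numEdges + 1)) ∧
        ∃ F : {d : OrthogonalDiagramClass (orthTarget w) // P d = d} ≃
            Σ v : ℕ, PalindromicFactorization (orthTarget w) v,
          ∀ d, d.1.numInternal = (F d).1 ∧ d.1.numEdges = t + 2 * (F d).1) ∧
      (∀ v : ℕ, PowerSeries.coeff (t + v) (orthDelta (orthTarget w)) =
        (-1) ^ v * (palindromicCount (orthTarget w) v : ℤ)) ∧
      (∀ m : ℕ, m < t → PowerSeries.coeff m (orthDelta (orthTarget w)) = 0)) ∧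
    -- the recursions in terms of the cycle lengths `c₁, …, c_k`
    (∃ (p : ℕ → Multiset ℕ → ℕ) (R : Multiset ℕ → PowerSeries ℤ),
      (∀ (t : ℕ) (w : Equiv.Perm (EndLabel t)), ∃ c : Multiset ℕ,
        (orthTarget w).partition.parts = c + c ∧
        (∀ v : ℕ, palindromicCount (orthTarget w) v = p v c) ∧
        orthDelta (orthTarget w) = R c) ∧
      p 0 0 = 1 ∧ (∀ v : ℕ, p (v + 1) 0 = 0) ∧ R 0 = 1 ∧
      ∀ (c₁ : ℕ) (c : Multiset ℕ), 0 < c₁ → 0 ∉ c →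
        p 0 (c₁ ::ₘ c) = (if c₁ = 1 then p 0 c else 0) ∧
        (∀ v : ℕ, p (v + 1) (c₁ ::ₘ c) =
          (if c₁ = 1 then p (v + 1) c else 0)
          + (∑ q ∈ Finset.Ioo 0 c₁, p v (q ::ₘ (c₁ - q) ::ₘ c))
          + (c.map fun k : ℕ => 2 * k * p v ((c₁ + k) ::ₘ c.erase k)).sum
          + c₁ * p v (c₁ ::ₘ c)) ∧
        -- the Brouwer–Beenakker recursion, multiplied by `X = 1/N`
        (1 + (c₁ : PowerSeries ℤ) * PowerSeries.X) * R (c₁ ::ₘ c)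
          + PowerSeries.X *
            (∑ q ∈ Finset.Ioo 0 c₁, R (q ::ₘ (c₁ - q) ::ₘ c))
          + 2 * PowerSeries.X *
            (c.map fun k : ℕ => (k : PowerSeries ℤ) * R ((c₁ + k) ::ₘ c.erase k)).sum
          = if c₁ = 1 then PowerSeries.X * R c else 0) := by
  refine ⟨fun t N h => ⟨COE.existsUnique_isCOEClassCoeff h, fun V hV w =>
      COE.HalfEdgeDiagram.hasSum_orthDelta h hV w⟩,
    fun t w => ⟨COE.HalfEdgeDiagram.numInternal_le, COE.HalfEdgeDiagram.finite_of_order _,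
      COE.HalfEdgeDiagram.exists_involution w, COE.HalfEdgeDiagram.coeff_orthDelta w,
      fun m hm => COE.HalfEdgeDiagram.coeff_orthDelta_of_lt w hm⟩,
    COE.halfTypeCount, COE.halfTypeDelta, fun t w => ?_, COE.halfTypeCount_zero_zero,
    COE.halfTypeCount_succ_zero, COE.halfTypeDelta_zero, fun c₁ c h1 hc => ?_⟩
  · obtain ⟨c, h⟩ := COE.exists_hasHalfType w
    exact ⟨c, h, COE.palindromicCount_eq_halfTypeCount h, COE.orthDelta_eq_halfTypeDelta h⟩
  · obtain ⟨h2, h3⟩ := COE.halfTypeCount_recursion h1 hc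
    exact ⟨h2, h3, COE.halfTypeDelta_recursion h1 hc⟩
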